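/- Let $b\in\mathbb R$, $\omega>0$, $\mathcal B>0$, $\varepsilon>0$, $t\ge 0$ be fixed. On $\mathbb R^2$ put $y\wedge\eta=y_1\eta_2-y_2\eta_1$, $A(x)=b\,(-x_2,x_1)/|x|^2$ and $h(x,\xi)=\tfrac12|\xi-A(x)|^2+\tfrac{\omega^2}{2}|x|^2$. For $y\ne0$ and $y\wedge\eta\neq b$ let $(x^t,\xi^t)=(x^t,\xi^t)(y,\eta)$ be the solution of $\dot x^t=h_\xi$, $\dot\xi^t=-h_x$, $(x^0,\xi^0)=(y,\eta)$; it never meets $x=0$ and is given by $$x^t=\cos(\omega t)\,y+\tfrac{\sin(\omega t)}{\omega}(\eta-A(y)),\qquad \xi^t=\dot x^t+A(x^t).$$ Let $$S(t,y,\eta)=\int_0^t(h_\xi\cdot\xi^s-h)(x^s,\xi^s)\,ds,\qquad \varphi=S+(x-x^t)\cdot\xi^t+\tfrac{i\mathcal B}{2}|x-x^t|^2,\qquad Z=\xi^t_\eta-i\mathcal B\,x^t_\eta,$$ and let $(\det Z)^{1/2}$ be the branch that is continuous in $t$ and equal to $1$ at $t=0$. Let $\theta\in C^\infty(\mathbb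 R^2;\mathbb R)$ with $\theta=1$ for $|x|>2$, $\theta=0$ for $|x|<1$, and $\theta_\varepsilon(x)=\theta(x/\varepsilon)$. Let $N\ge0$ and $$U_N(t,x,y)=(2\pi\alpha)^{-2}\int_{\mathbb R^2}e^{i\varphi/\alpha}u_N\,d\eta,\qquad u_N=\theta_\varepsilon(x^t)\theta_\varepsilon(y)(\det Z)^{1/2}+\sum_{k=1}^N\alpha^k u_{(k)}(t,y,\eta),$$ where the $u_{(k)}(t,\cdot,\cdot)$, $1\le k\le N$, are any amplitudes: functions that are smooth on $\{y\neq0,\ y\wedge\eta\ne b\}$ and such that for every compact $K\subset\mathbb R^2\setminus\{0\}$ there is an $M$ for which each derivative in $(y,\eta)$, of any order, is $O((1+|\eta|)^M)$ uniformly for $y\in K$, $y\wedge\eta\ne b$. Let $x,y_0,\eta_0\in\mathbb R^2$ with $y_0\ne0$, $y_0\wedge\eta_0\ne b$, $x=x^t(y_0,\eta_0)$, $\det x^t_y(y_0,\eta_0)\neq0$ and $\theta_\varepsilon(x)=\theta_\varepsilon(y_0)=1$. Let $\rho\in C_0^\infty\big(\mathbb R^2\setminus(\{0\}\cup\{y:y\wedge\eta_0=b\})\big)$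 be such that the equation $x=x^t(y,\eta_0)$ has no solution $y\in\operatorname{supp}\rho$ other than, possibly, $y_0$. Then for every $\alpha>0$ the integral $$J(\alpha)=\int_{\mathbb R^2} U_N(t,x,y)\rho(y)e^{iy\cdot\eta_0/\alpha}\,dy$$ exists as an oscillatory integral in $(y,\eta)$ (the limit as $\delta\to0+$ of the integrals with a factor $\chi(\delta\eta)$ inserted, for every $\chi\in C_0^\infty(\mathbb R^2)$ with $\chi(0)=1$), and if $\sin(\omega t)\neq0$ the double integral converges absolutely and $J(\alpha)$ is its ordinary value. Moreover, as $\alpha\to0+$, $$J(\alpha)=\rho(y_0)\,e^{i(y_0\cdot\eta_0+S(t,y_0,\eta_0))/\alpha}\,e^{-i\pi m/2}\,\Big|\cos^2(\omega t)-\frac{b^2}{\omega^2}|y_0|^{-4}\sin^2(\omega t)\Big|^{-1/2}+O(\alpha),$$ where $m$ is the Morse index of the trajectory $\{x^s(y_0,\eta_0):0\le s\le t\}$, i.e. the number of $s\in(0,t)$ at which $x^s_y(y_0,\eta_0)$ is degenerate, each counted with the multiplicity $\dim\ker x^s_y(y_0,\eta_0)$. -/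

import Mathlib

open scoped Topology
open MeasureTheory Filter Asymptotics

noncomputable section

namespace ABOscillator

/-- The Euclidean plane. -/
abbrev Plane : Type := EuclideanSpace ℝ (Fin 2)

/-- `y ∧ η = y₁ η₂ - y₂ η₁`. -/
def wedge (y η : Plane) : ℝ := y 0 * η 1 - y 1 * η 0

/-- The Aharonov-Bohm vector potential `A(x) = b (-x₂, x₁) / |x|²`. -/
def potential (b : ℝ) (x : Plane) : Plane :=
  !₂[-(b * x 1) / ‖x‖ ^ 2, b * x 0 / ‖x‖ ^ 2]

/-- The classical Hamiltonian `h(x,ξ) = |ξ - A(x)|² / 2 + ω² |x|² / 2`. -/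
def hamiltonian (b ω : ℝ) (x ξ : Plane) : ℝ :=
  ‖ξ - potential b x‖ ^ 2 / 2 + ω ^ 2 / 2 * ‖x‖ ^ 2

/-- The set of initial data `(y, η)` with `y ≠ 0` and `y ∧ η ≠ b`, whose trajectories never
meet the origin. -/
def phaseSpace (b : ℝ) : Set (Plane × Plane) :=
  {p | p.1 ≠ 0 ∧ wedge p.1 p.2 ≠ b}

/-- The velocity `ẋᵗ(y,η)` of the trajectory starting at `(y,η)`. -/
def flowV (b ω t : ℝ) (y η : Plane) : Plane :=
  (-(ω * Real.sin (ω * t))) • y + Real.cos (ω * t) • (η - potential b y)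

/-- The position component `xᵗ(y,η)` of the Hamiltonian flow. -/
def flowX (b ω t : ℝ) (y η : Plane) : Plane :=
  Real.cos (ω * t) • y + (Real.sin (ω * t) / ω) • (η - potential b y)

/-- The momentum component `ξᵗ(y,η)` of the Hamiltonian flow. -/
def flowXi (b ω t : ℝ) (y η : Plane) : Plane :=
  flowV b ω t y η + potential b (flowX b ω t y η)

theorem wedge_flow (b ω t : ℝ) (hω : 0 < ω) (y η : Plane) (hy : y ≠ 0) :
    wedge (flowX b ω t y η) (flowV b ω t y η) = wedge y η - b := by
  have hn : y 0 ^ 2 + y 1 ^ 2 ≠ 0 := by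
    have h := EuclideanSpace.real_norm_sq_eq y
    rw [Fin.sum_univ_two] at h
    rw [← h]
    exact pow_ne_zero 2 (norm_ne_zero_iff.mpr hy)
  have hsc := Real.sin_sq_add_cos_sq (ω * t)
  have hsq : Real.sin (ω * t) ^ 2 = 1 - Real.cos (ω * t) ^ 2 := by linarith
  simp only [wedge, flowX, flowV, potential, EuclideanSpace.real_norm_sq_eq, Fin.sum_univ_two,
    PiLp.add_apply, PiLp.smul_apply, PiLp.sub_apply, smul_eq_mul]
  simp
  field_simp
  ring_nf
  rw [hsq]
  ring

/-- The trajectory does not meet the origin. -/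
theorem flowX_ne_zero (b ω t : ℝ) (hω : 0 < ω) (y η : Plane) (h : (y, η) ∈ phaseSpace b) :
    flowX b ω t y η ≠ 0 := by
  intro h0
  have h1 := wedge_flow b ω t hω y η h.1
  rw [h0] at h1
  have h2 : wedge y η ≠ b := h.2
  apply h2
  simp [wedge] at h1 ⊢
  linarith

theorem hasDerivAt_flowX (b ω t : ℝ) (hω : 0 < ω) (y η : Plane) :
    HasDerivAt (fun s => flowX b ω s y η) (flowV b ω t y η) t := by
  have hl : HasDerivAt (fun s : ℝ => ω * s) ω t := by
    simpa using (hasDerivAt_id t).const_mul ω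
  have h1 := (hl.cos.smul_const y).add ((hl.sin.div_const ω).smul_const (η - potential b y))
  refine h1.congr_deriv ?_
  simp only [flowV]
  congr 2
  · ring
  · field_simp

theorem hasDerivAt_flowV (b ω t : ℝ) (hω : 0 < ω) (y η : Plane) :
    HasDerivAt (fun s => flowV b ω s y η) (-(ω ^ 2) • flowX b ω t y η) t := by
  have hl : HasDerivAt (fun s : ℝ => ω * s) ω t := by
    simpa using (hasDerivAt_id t).const_mul ω
  have h1 := ((hl.sin.const_mul ω).neg.smul_const y).add
    (hl.cos.smul_const (η - potential b y))
  refine h1.congr_deriv ?_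
  simp only [flowX, smul_add, smul_smul]
  congr 2
  · ring
  · field_simp

/-- The derivative `A_x` of the vector potential, a symmetric trace-free matrix. -/
def potentialDeriv (b : ℝ) (x : Plane) : Plane →L[ℝ] Plane :=
  LinearMap.toContinuousLinearMap (Matrix.toEuclideanLin
    !![2 * b * x 0 * x 1 / ‖x‖ ^ 4, b * (x 1 ^ 2 - x 0 ^ 2) / ‖x‖ ^ 4;
       b * (x 1 ^ 2 - x 0 ^ 2) / ‖x‖ ^ 4, -(2 * b * x 0 * x 1) / ‖x‖ ^ 4])

theorem potentialDeriv_apply (b : ℝ) (x w : Plane) :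
    potentialDeriv b x w =
      !₂[2 * b * x 0 * x 1 / ‖x‖ ^ 4 * w 0 + b * (x 1 ^ 2 - x 0 ^ 2) / ‖x‖ ^ 4 * w 1,
        b * (x 1 ^ 2 - x 0 ^ 2) / ‖x‖ ^ 4 * w 0 + -(2 * b * x 0 * x 1) / ‖x‖ ^ 4 * w 1] := by
  ext i
  fin_cases i <;>
    simp [potentialDeriv, Matrix.toEuclideanLin, Matrix.mulVec, dotProduct, Fin.sum_univ_two]

theorem hasFDerivAt_potential (b : ℝ) (x : Plane) (hx : x ≠ 0) :
    HasFDerivAt (potential b) (potentialDeriv b x) x := by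
  have hn : ‖x‖ ^ 2 ≠ 0 := pow_ne_zero 2 (norm_ne_zero_iff.mpr hx)
  have hN : HasFDerivAt (fun z : Plane => ‖z‖ ^ 2) (2 • innerSL ℝ x) x :=
    (hasStrictFDerivAt_norm_sq x).hasFDerivAt
  have h0 : HasFDerivAt (fun z : Plane => z 0) (EuclideanSpace.proj 0 : Plane →L[ℝ] ℝ) x :=
    (EuclideanSpace.proj 0 : Plane →L[ℝ] ℝ).hasFDerivAt
  have h1 : HasFDerivAt (fun z : Plane => z 1) (EuclideanSpace.proj 1 : Plane →L[ℝ] ℝ) x :=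
    (EuclideanSpace.proj 1 : Plane →L[ℝ] ℝ).hasFDerivAt
  have hI := (hasDerivAt_inv hn).comp_hasFDerivAt x hN
  have hnsq : ‖x‖ ^ 2 = x 0 ^ 2 + x 1 ^ 2 := by
    rw [EuclideanSpace.real_norm_sq_eq, Fin.sum_univ_two]
  have hn4 : ‖x‖ ^ 4 = (x 0 ^ 2 + x 1 ^ 2) ^ 2 := by rw [← hnsq]; ring
  have hne : x 0 ^ 2 + x 1 ^ 2 ≠ 0 := hnsq ▸ hn
  have hin : ∀ w : Plane, inner ℝ x w = x 0 * w 0 + x 1 * w 1 := fun w => by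
    simp [PiLp.inner_apply, Fin.sum_univ_two, mul_comm]
  rw [← hasFDerivWithinAt_univ, hasFDerivWithinAt_euclidean]
  intro i
  rw [hasFDerivWithinAt_univ]
  fin_cases i
  · have := ((h1.const_mul b).neg).mul hI
    refine (this.congr_fderiv ?_).congr_of_eventuallyEq (Eventually.of_forall fun z => ?_)
    · ext w
      simp [potentialDeriv_apply, hin, hn4, hnsq]
      field_simp
      ring
    · simp [potential, div_eq_mul_inv]
  · have := (h0.const_mul b).mul hI
    refine (this.congr_fderiv ?_).congr_of_eventuallyEq (Eventually.of_forall fun z => ?_)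
    · ext w
      simp [potentialDeriv_apply, hin, hn4, hnsq]
      field_simp
      ring
    · simp [potential, div_eq_mul_inv]

theorem inner_potentialDeriv (b : ℝ) (x v w : Plane) :
    inner ℝ v (potentialDeriv b x w) = inner ℝ (potentialDeriv b x v) w := by
  simp [potentialDeriv_apply, PiLp.inner_apply, Fin.sum_univ_two]
  ring

theorem hasGradientAt_hamiltonian_momentum (b ω : ℝ) (x ξ : Plane) :
    HasGradientAt (fun ζ => hamiltonian b ω x ζ) (ξ - potential b x) ξ := by
  rw [hasGradientAt_iff_hasFDerivAt]
  have h := ((((hasFDerivAt_id (𝕜 := ℝ) ξ).sub_const (potential b x)).norm_sq).mul_const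
    ((2 : ℝ)⁻¹)).add_const (ω ^ 2 / 2 * ‖x‖ ^ 2)
  refine (h.congr_fderiv ?_).congr_of_eventuallyEq (Eventually.of_forall fun z => ?_)
  · ext w
    simp
  · simp [hamiltonian, div_eq_mul_inv]

theorem hasGradientAt_hamiltonian_position (b ω : ℝ) (x ξ : Plane) (hx : x ≠ 0) :
    HasGradientAt (fun z => hamiltonian b ω z ξ)
      (-(potentialDeriv b x (ξ - potential b x)) + ω ^ 2 • x) x := by
  rw [hasGradientAt_iff_hasFDerivAt]
  have h := ((((hasFDerivAt_potential b x hx).const_sub ξ).norm_sq).mul_const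
    ((2 : ℝ)⁻¹)).add (((hasFDerivAt_id (𝕜 := ℝ) x).norm_sq).const_mul (ω ^ 2 / 2))
  refine (h.congr_fderiv ?_).congr_of_eventuallyEq (Eventually.of_forall fun z => ?_)
  · ext w
    simp [← inner_potentialDeriv, -map_sub]
    ring
  · simp [hamiltonian, div_eq_mul_inv]

/-- For `(y, η)` in the phase space, `(xᵗ, ξᵗ)` solves Hamilton's equations `ẋ = h_ξ`, `ξ̇ = -h_x`
with the initial data `(y, η)`. -/
theorem flow_hamilton (b ω : ℝ) (hω : 0 < ω) (y η : Plane) (h : (y, η) ∈ phaseSpace b) :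
    flowX b ω 0 y η = y ∧ flowXi b ω 0 y η = η ∧ ∀ t : ℝ,
      HasDerivAt (fun s => flowX b ω s y η)
        (gradient (fun ζ => hamiltonian b ω (flowX b ω t y η) ζ) (flowXi b ω t y η)) t ∧
      HasDerivAt (fun s => flowXi b ω s y η)
        (-gradient (fun z => hamiltonian b ω z (flowXi b ω t y η)) (flowX b ω t y η)) t := by
  have hV : ∀ t, flowXi b ω t y η - potential b (flowX b ω t y η) = flowV b ω t y η :=
    fun t => by simp [flowXi]
  refine ⟨by simp [flowX], by simp [flowXi, flowV, flowX], fun t => ⟨?_, ?_⟩⟩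
  · rw [(hasGradientAt_hamiltonian_momentum b ω _ _).gradient, hV]
    exact hasDerivAt_flowX b ω t hω y η
  · have hne := flowX_ne_zero b ω t hω y η h
    rw [(hasGradientAt_hamiltonian_position b ω _ _ hne).gradient, hV]
    have h2 := (hasFDerivAt_potential b _ hne).comp_hasDerivAt t (hasDerivAt_flowX b ω t hω y η)
    refine ((hasDerivAt_flowV b ω t hω y η).add h2).congr_deriv ?_
    simp [add_comm]

/-- The action `S(t,y,η) = ∫₀ᵗ (h_ξ · ξˢ - h)(xˢ, ξˢ) ds`, where `h_ξ = ξ - A(x)`. -/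
def action (b ω t : ℝ) (y η : Plane) : ℝ :=
  ∫ s in (0 : ℝ)..t,
    (inner ℝ (flowXi b ω s y η - potential b (flowX b ω s y η)) (flowXi b ω s y η) -
      hamiltonian b ω (flowX b ω s y η) (flowXi b ω s y η))

/-- The complex phase `φ = S + (x - xᵗ) · ξᵗ + i B |x - xᵗ|² / 2`. -/
def phase (b ω B t : ℝ) (x y η : Plane) : ℂ :=
  ((action b ω t y η + inner ℝ (x - flowX b ω t y η) (flowXi b ω t y η) : ℝ) : ℂ) +
    Complex.I * ((B * ‖x - flowX b ω t y η‖ ^ 2 / 2 : ℝ) : ℂ)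

/-- The Jacobian matrix of a map of the plane. -/
def jacobian (F : Plane → Plane) (p : Plane) : Matrix (Fin 2) (Fin 2) ℝ :=
  Matrix.of fun i j => (fderiv ℝ F p (EuclideanSpace.single j 1)) i

/-- The matrix `Z = ξᵗ_η - i B xᵗ_η`. -/
def matrixZ (b ω B t : ℝ) (y η : Plane) : Matrix (Fin 2) (Fin 2) ℂ :=
  (jacobian (flowXi b ω t y) η).map (fun r : ℝ => (r : ℂ)) -
    (Complex.I * (B : ℂ)) • (jacobian (flowX b ω t y) η).map (fun r : ℝ => (r : ℂ))

/-- `r` is a branch on `[0, ∞)` of the square root of `f`, continuous in time, that starts at `1`. -/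
def IsContinuousSqrt (f r : ℝ → ℂ) : Prop :=
  ContinuousOn r (Set.Ici 0) ∧ r 0 = 1 ∧ ∀ s, 0 ≤ s → r s ^ 2 = f s

open Classical in
/-- The square root of `det Z(t,y,η)`, by continuity in `t ≥ 0` from the value `1` at `t = 0`. -/
def sqrtDetZ (b ω B t : ℝ) (y η : Plane) : ℂ :=
  if h : ∃ r, IsContinuousSqrt (fun s => (matrixZ b ω B s y η).det) r then h.choose t else 0

/-- The conditions on the cut-off function `θ`. -/
structure IsCutoff (θ : Plane → ℝ) : Prop where
  smooth : ContDiff ℝ (⊤ : ℕ∞) θ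
  eq_one : ∀ x, 2 < ‖x‖ → θ x = 1
  eq_zero : ∀ x, ‖x‖ < 1 → θ x = 0

/-- `θ_ε(x) = θ(x / ε)`. -/
def scaledCutoff (θ : Plane → ℝ) (ε : ℝ) (x : Plane) : ℝ := θ (ε⁻¹ • x)

/-- The leading amplitude `u₍₀₎ = θ_ε(xᵗ) θ_ε(y) (det Z)^{1/2}`. -/
def leadingAmplitude (b ω B ε : ℝ) (θ : Plane → ℝ) (t : ℝ) (y η : Plane) : ℂ :=
  (scaledCutoff θ ε (flowX b ω t y η) : ℂ) * (scaledCutoff θ ε y : ℂ) * sqrtDetZ b ω B t y η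

/-- Amplitudes: smooth on the phase space, all derivatives being bounded by a constant times
`(1 + |η|)^M`, for `y` in any compact set away from the origin. -/
structure IsAmplitude (b : ℝ) (a : Plane → Plane → ℂ) : Prop where
  smooth : ContDiffOn ℝ (⊤ : ℕ∞) (fun p : Plane × Plane => a p.1 p.2) (phaseSpace b)
  bound : ∀ K : Set Plane, IsCompact K → (0 : Plane) ∉ K → ∃ M : ℕ, ∀ n : ℕ, ∃ C : ℝ,
    ∀ y ∈ K, ∀ η : Plane, wedge y η ≠ b →
      ‖iteratedFDeriv ℝ n (fun p : Plane × Plane => a p.1 p.2) (y, η)‖ ≤ C * (1 + ‖η‖) ^ M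

/-- The full amplitude `u_N = u₍₀₎ + ∑_{k=1}^N αᵏ u₍ₖ₎`. -/
def amplitude (b ω B ε : ℝ) (θ : Plane → ℝ) (N : ℕ) (u : ℕ → ℝ → Plane → Plane → ℂ)
    (α t : ℝ) (y η : Plane) : ℂ :=
  leadingAmplitude b ω B ε θ t y η + ∑ k ∈ Finset.Icc 1 N, (α : ℂ) ^ k * u k t y η

/-- The integrand `(2πα)⁻² e^{iφ/α} u_N` of the kernel `U_N(t,x,y)`. -/
def kernelIntegrand (b ω B ε : ℝ) (θ : Plane → ℝ) (N : ℕ) (u : ℕ → ℝ → Plane → Plane → ℂ)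
    (α t : ℝ) (x y η : Plane) : ℂ :=
  (((2 * Real.pi * α) ^ 2)⁻¹ : ℝ) * Complex.exp (Complex.I * phase b ω B t x y η / (α : ℂ)) *
    amplitude b ω B ε θ N u α t y η

/-- The kernel `U_N(t,x,y)`; the integral converges absolutely when `sin (ω t) ≠ 0`. -/
def kernel (b ω B ε : ℝ) (θ : Plane → ℝ) (N : ℕ) (u : ℕ → ℝ → Plane → Plane → ℂ)
    (α t : ℝ) (x y : Plane) : ℂ :=
  ∫ η, kernelIntegrand b ω B ε θ N u α t x y η

/-- The oscillating function `ρ(y) e^{i y·η₀/α}`. -/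
def oscillatingData (ρ : Plane → ℂ) (η₀ : Plane) (α : ℝ) (y : Plane) : ℂ :=
  ρ y * Complex.exp (Complex.I * ((inner ℝ y η₀ / α : ℝ) : ℂ))

/-- `J` is the value of the oscillatory integral `∬ F(y,η) dη dy`: the limit, as `δ → 0+`, of the
integrals with the integrand multiplied by `χ(δη)`, for every test function `χ` with `χ(0) = 1`. -/
def IsOscillatoryIntegral (F : Plane → Plane → ℂ) (J : ℂ) : Prop :=
  ∀ χ : Plane → ℂ, ContDiff ℝ (⊤ : ℕ∞) χ → HasCompactSupport χ → χ 0 = 1 →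
    Tendsto (fun δ : ℝ => ∫ y, ∫ η, χ (δ • η) * F y η) (𝓝[>] 0) (𝓝 J)

/-- The derivative `xᵗ_y(y,η)`. -/
def flowXy (b ω t : ℝ) (y η : Plane) : Plane →L[ℝ] Plane :=
  fderiv ℝ (fun z => flowX b ω t z η) y

/-- The Morse index of the trajectory `xˢ(y,η)`, `0 ≤ s ≤ t`, when `xᵗ_y(y,η)` is invertible: the
number of times `0 < s < t` at which `xˢ_y(y,η)` is degenerate, counted with the multiplicity
`dim ker xˢ_y(y,η)`. -/
def morseIndex (b ω t : ℝ) (y η : Plane) : ℕ :=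
  ∑ᶠ s ∈ Set.Ioo 0 t, Module.finrank ℝ (LinearMap.ker (flowXy b ω s y η).toLinearMap)

theorem flowXy_eq (b ω t : ℝ) (y η : Plane) (hy : y ≠ 0) :
    flowXy b ω t y η = Real.cos (ω * t) • ContinuousLinearMap.id ℝ Plane +
      (Real.sin (ω * t) / ω) • (-potentialDeriv b y) := by
  have h := ((hasFDerivAt_id (𝕜 := ℝ) y).const_smul (Real.cos (ω * t))).add
    (((hasFDerivAt_potential b y hy).const_sub η).const_smul (Real.sin (ω * t) / ω))
  exact h.fderiv

theorem potentialDeriv_sq (b : ℝ) (y w : Plane) (hy : y ≠ 0) :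
    potentialDeriv b y (potentialDeriv b y w) = (b ^ 2 / ‖y‖ ^ 4) • w := by
  have hn : ‖y‖ ^ 2 ≠ 0 := pow_ne_zero 2 (norm_ne_zero_iff.mpr hy)
  have hnsq : ‖y‖ ^ 2 = y 0 ^ 2 + y 1 ^ 2 := by
    rw [EuclideanSpace.real_norm_sq_eq, Fin.sum_univ_two]
  have hn4 : ‖y‖ ^ 4 = (y 0 ^ 2 + y 1 ^ 2) ^ 2 := by rw [← hnsq]; ring
  have hne : y 0 ^ 2 + y 1 ^ 2 ≠ 0 := hnsq ▸ hn
  ext i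
  fin_cases i <;>
  · simp [potentialDeriv_apply, hn4]
    field_simp
    ring

/-- The sum that defines the Morse index has finitely many nonzero terms. -/
theorem finite_focal (b ω t : ℝ) (y η : Plane) (hy : y ≠ 0) :
    {s ∈ Set.Ioo 0 t |
      Module.finrank ℝ (LinearMap.ker (flowXy b ω s y η).toLinearMap) ≠ 0}.Finite := by
  set g : ℝ → ℝ := fun s => Real.cos (ω * s) ^ 2 -
    (Real.sin (ω * s) / ω) ^ 2 * (b ^ 2 / ‖y‖ ^ 4) with hg
  have key : ∀ s, Module.finrank ℝ (LinearMap.ker (flowXy b ω s y η).toLinearMap) ≠ 0 →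
      g s = 0 := by
    intro s hs
    have hbot : LinearMap.ker (flowXy b ω s y η).toLinearMap ≠ ⊥ := by
      intro h0
      rw [h0] at hs
      simp at hs
    obtain ⟨w, hw, hw0⟩ := Submodule.exists_mem_ne_zero_of_ne_bot hbot
    have h1 : Real.cos (ω * s) • w = (Real.sin (ω * s) / ω) • potentialDeriv b y w := by
      have h2 : flowXy b ω s y η w = 0 := hw
      rw [flowXy_eq b ω s y η hy] at h2
      simpa [add_neg_eq_zero] using h2
    have h3 : (g s) • w = 0 := by
      have h4 := congrArg (potentialDeriv b y) h1
      rw [map_smul, map_smul, potentialDeriv_sq b y w hy] at h4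
      have h5 : Real.cos (ω * s) • (Real.cos (ω * s) • w) =
          (Real.sin (ω * s) / ω) • ((Real.sin (ω * s) / ω) • (b ^ 2 / ‖y‖ ^ 4) • w) := by
        rw [← h4, h1, smul_comm]
      rw [hg]
      simp only [sub_smul, pow_two, ← smul_smul] at h5 ⊢
      rw [h5, sub_self]
    exact (smul_eq_zero.mp h3).resolve_right hw0
  by_contra hinf
  have hinf' : {s ∈ Set.Ioo 0 t |
      Module.finrank ℝ (LinearMap.ker (flowXy b ω s y η).toLinearMap) ≠ 0}.Infinite := hinf
  obtain ⟨a, -, ha⟩ := hinf'.exists_accPt_of_subset_isCompact (isCompact_Icc (a := 0) (b := t))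
    (fun s hs => ⟨hs.1.1.le, hs.1.2.le⟩)
  have hfr : ∃ᶠ s in 𝓝[≠] a, g s = 0 :=
    (accPt_iff_frequently_nhdsNE.mp ha).mono fun s hs => key s hs.2
  have han : AnalyticOnNhd ℝ g Set.univ := by
    intro s _
    rw [hg]
    fun_prop
  have h0 := han.eqOn_zero_of_preconnected_of_frequently_eq_zero isPreconnected_univ
    (Set.mem_univ a) hfr (Set.mem_univ 0)
  simp [hg] at h0

end ABOscillator

end

/-! Put ψ = φ + y·η₀. Then J is (2πα)⁻² times an oscillatory integral over (y, η) ∈ ℝ⁴ with the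
exponential e^{iψ/α}. The identity dS = ξᵗ·dxᵗ − η·dy (`hasFDerivAt_action`) gives dψ = (x − xᵗ)·dξᵗ
− (η − η₀)·dy − iB (x − xᵗ)·dxᵗ, and Im ψ = B|x − xᵗ|²/2. So only points with x = xᵗ and η = η₀ can
contribute, and over supp ρ the only candidate is (y₀, η₀).

`exists_amplitude_expansion` splits the integrand into three pieces. Where xᵗ is away from x the
exponential is exponentially small (`IsModerate.norm_integral_wave_le`). Where η is away from η₀ one
integrates by parts along the field V = `tangentField`, whose y-component is η − η₀, so that Vψ =
−|η − η₀|² up to a controlled error. The amplitudes may jump across y ∧ η = b. Since V is tangent to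
the level sets of y ∧ η, cut-offs that depend on y ∧ η commute with the transposed field, and no
boundary terms appear (`integral_wave_mul`). The same argument gives the existence of the
oscillatory integral (`exists_oscillatory`). This is essential when sin ωt = 0, because xᵗ then does
not depend on η and the imaginary part of the phase gives no decay in η.

Near (y₀, η₀) the Hessian is nondegenerate, because det Z ≠ 0 and det xᵗ_y ≠ 0
(`exists_coords_phaseHessian`), and `stationary_phase` applies with h = √α in dimension d = 4. An
amplitude of weight (h + |p|)^r has an integral O(h^{d+r}) (`norm_integral_le_of_isSymbol`);
vanishing to an odd order gains one more power of h (`IsPhaseOn.norm_integral_le_of_odd`). Hence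
replacing the amplitude by its value and the phase by its quadratic part costs O(h^{d+2}) = O(α³),
which is O(α) after the normalization. The Hessian has only a nonnegative imaginary part, so the
quadratic exponential is damped by a fixed factor e^{−ν}; this changes the normalized value by O(α).

The damped Gaussian is computed exactly. If sin ωt ≠ 0, the variables z and q = xᵗ_y z + xᵗ_η ζ
separate the Hessian, and eigenbases of A_x(y₀) and A_x(x) reduce it to four one-dimensional
Gaussians. The two factors in q cancel against (det Z)^{1/2}. The two factors in z give |det
xᵗ_y|^{−1/2} and one factor −i for each negative coefficient. As xˢ_y = cos ωs − (sin ωs/ω) A_x(y₀),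
the same coefficients tell how many focal times lie before t, and together with the sign of sin ωt
the factors −i add up to e^{−iπm/2} (`gaussian_value_of_sin_ne_zero`). The case sin ωt = 0 is a
separate, simpler Gaussian. -/

namespace SymbolCalculus

/-! ### Algebra of parameter-dependent symbols. -/

variable {E : Type*} [NormedAddCommGroup E] [NormedSpace ℝ E] {P : Type*}

/-- The family `f i` is bounded on `U` by a constant times the weight `w`, each of its first `k`
derivatives costing a factor `1 / lam`, uniformly in the parameter `i`. -/
def SymbolBound (U : Set E) (lam : P → E → ℝ) :
    ℕ → (P → E → ℝ) → (P → E → ℂ) → Prop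
  | 0, w, f => ∃ C, ∀ i, ∀ p ∈ U, ‖f i p‖ ≤ C * w i p
  | k + 1, w, f => (∃ C, ∀ i, ∀ p ∈ U, ‖f i p‖ ≤ C * w i p) ∧
      (∀ i, ∀ p ∈ U, DifferentiableAt ℝ (f i) p) ∧
      ∀ v : E, SymbolBound U lam k (fun i p => w i p / lam i p) (fun i p => fderiv ℝ (f i) p v)

/-- Symbols: the bounds hold for derivatives of all orders. -/
def IsSymbol (U : Set E) (lam : P → E → ℝ) (w : P → E → ℝ) (f : P → E → ℂ) : Prop :=
  ∀ k, SymbolBound U lam k w f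

variable {U : Set E} {lam : P → E → ℝ} {w w' : P → E → ℝ} {f g : P → E → ℂ} {k : ℕ}

theorem SymbolBound.of_succ (h : SymbolBound U lam (k + 1) w f) : SymbolBound U lam k w f := by
  induction k generalizing w f with
  | zero => exact h.1
  | succ k ih => exact ⟨h.1, h.2.1, fun v => ih (h.2.2 v)⟩

theorem SymbolBound.comp_param {P' : Type*} (σ : P' → P) (h : SymbolBound U lam k w f) :
    SymbolBound U (fun i => lam (σ i)) k (fun i => w (σ i)) (fun i => f (σ i)) := by
  induction k generalizing w f with
  | zero =>
    obtain ⟨C, hC⟩ := h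
    exact ⟨C, fun i p hp => hC _ p hp⟩
  | succ k ih =>
    obtain ⟨C, hC⟩ := h.1
    exact ⟨⟨C, fun i p hp => hC _ p hp⟩, fun i p hp => h.2.1 _ p hp, fun v => ih (h.2.2 v)⟩

theorem SymbolBound.congr (hU : IsOpen U) (h : SymbolBound U lam k w f)
    (hfg : ∀ i, ∀ p ∈ U, g i p = f i p) : SymbolBound U lam k w g := by
  induction k generalizing w f g with
  | zero =>
    obtain ⟨C, hC⟩ := h
    exact ⟨C, fun i p hp => by rw [hfg i p hp]; exact hC i p hp⟩
  | succ k ih =>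
    obtain ⟨C, hC⟩ := h.1
    have hev : ∀ i, ∀ p ∈ U, g i =ᶠ[𝓝 p] f i := fun i p hp => by
      filter_upwards [hU.mem_nhds hp] with q hq using hfg i q hq
    refine ⟨⟨C, fun i p hp => by rw [hfg i p hp]; exact hC i p hp⟩,
      fun i p hp => (h.2.1 i p hp).congr_of_eventuallyEq (hev i p hp), fun v => ih (h.2.2 v) ?_⟩
    intro i p hp
    rw [(hev i p hp).fderiv_eq]

theorem SymbolBound.mono_weight (hlam : ∀ i, ∀ p ∈ U, 0 < lam i p)
    (hw : ∀ i, ∀ p ∈ U, 0 ≤ w i p)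
    (h : SymbolBound U lam k w f) (hww : ∃ A, ∀ i, ∀ p ∈ U, w i p ≤ A * w' i p) :
    SymbolBound U lam k w' f := by
  have key : ∀ {w w' : P → E → ℝ} {f : P → E → ℂ}, (∀ i, ∀ p ∈ U, 0 ≤ w i p) →
      (∃ A, ∀ i, ∀ p ∈ U, w i p ≤ A * w' i p) → (∃ C, ∀ i, ∀ p ∈ U, ‖f i p‖ ≤ C * w i p) →
      ∃ C, ∀ i, ∀ p ∈ U, ‖f i p‖ ≤ C * w' i p := by
    rintro w w' f hw ⟨A, hA⟩ ⟨C, hC⟩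
    refine ⟨max C 0 * A, fun i p hp => ?_⟩
    calc ‖f i p‖ ≤ C * w i p := hC i p hp
      _ ≤ max C 0 * w i p := mul_le_mul_of_nonneg_right (le_max_left _ _) (hw i p hp)
      _ ≤ max C 0 * (A * w' i p) := mul_le_mul_of_nonneg_left (hA i p hp) (le_max_right _ _)
      _ = _ := by ring
  induction k generalizing w w' f with
  | zero => exact key hw hww h
  | succ k ih =>
    refine ⟨key hw hww h.1, h.2.1, fun v => ih (fun i p hp => ?_) (h.2.2 v) ?_⟩
    · exact div_nonneg (hw i p hp) (hlam i p hp).le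
    · obtain ⟨A, hA⟩ := hww
      refine ⟨A, fun i p hp => ?_⟩
      rw [← mul_div_assoc]
      exact div_le_div_of_nonneg_right (hA i p hp) (hlam i p hp).le

theorem SymbolBound.congr_weight (h : SymbolBound U lam k w f)
    (hww : ∀ i, ∀ p ∈ U, w i p = w' i p) : SymbolBound U lam k w' f := by
  induction k generalizing w w' f with
  | zero =>
    obtain ⟨C, hC⟩ := h
    exact ⟨C, fun i p hp => by rw [← hww i p hp]; exact hC i p hp⟩
  | succ k ih =>
    obtain ⟨C, hC⟩ := h.1
    exact ⟨⟨C, fun i p hp => by rw [← hww i p hp]; exact hC i p hp⟩, h.2.1,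
      fun v => ih (h.2.2 v) fun i p hp => by simp only [hww i p hp]⟩

theorem SymbolBound.zero (hlam : ∀ i, ∀ p ∈ U, 0 < lam i p)
    (hw : ∀ i, ∀ p ∈ U, 0 ≤ w i p) : SymbolBound U lam k w (fun _ _ => 0) := by
  induction k generalizing w with
  | zero => exact ⟨1, fun i p hp => by simpa using hw i p hp⟩
  | succ k ih =>
    refine ⟨⟨1, fun i p hp => by simpa using hw i p hp⟩, fun i p hp => by fun_prop, fun v => ?_⟩
    simpa using ih fun i p hp => div_nonneg (hw i p hp) (hlam i p hp).le

theorem SymbolBound.const (hlam : ∀ i, ∀ p ∈ U, 0 < lam i p) (c : P → ℂ)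
    (hc : ∃ C, ∀ i, ‖c i‖ ≤ C) : SymbolBound U lam k (fun _ _ => 1) (fun i _ => c i) := by
  cases k with
  | zero =>
    obtain ⟨C, hC⟩ := hc
    exact ⟨C, fun i p _ => by simpa using hC i⟩
  | succ k =>
    refine ⟨?_, fun i p hp => by fun_prop, fun v => ?_⟩
    · obtain ⟨C, hC⟩ := hc
      exact ⟨C, fun i p _ => by simpa using hC i⟩
    · simpa using SymbolBound.zero hlam fun i p hp => div_nonneg zero_le_one (hlam i p hp).le

theorem SymbolBound.add (hU : IsOpen U) (hf : SymbolBound U lam k w f)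
    (hg : SymbolBound U lam k w g) : SymbolBound U lam k w (fun i p => f i p + g i p) := by
  have key : ∀ {w : P → E → ℝ} {f g : P → E → ℂ},
      (∃ C, ∀ i, ∀ p ∈ U, ‖f i p‖ ≤ C * w i p) → (∃ C, ∀ i, ∀ p ∈ U, ‖g i p‖ ≤ C * w i p) →
      ∃ C, ∀ i, ∀ p ∈ U, ‖f i p + g i p‖ ≤ C * w i p := by
    rintro w f g ⟨C, hC⟩ ⟨D, hD⟩
    refine ⟨C + D, fun i p hp => (norm_add_le _ _).trans ?_⟩
    rw [add_mul]
    exact add_le_add (hC i p hp) (hD i p hp)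
  induction k generalizing w f g with
  | zero => exact key hf hg
  | succ k ih =>
    refine ⟨key hf.1 hg.1, fun i p hp => (hf.2.1 i p hp).add (hg.2.1 i p hp), fun v => ?_⟩
    refine (ih (hf.2.2 v) (hg.2.2 v)).congr hU fun i p hp => ?_
    rw [fderiv_fun_add (hf.2.1 i p hp) (hg.2.1 i p hp)]
    rfl

theorem SymbolBound.mul (hU : IsOpen U) (hlam : ∀ i, ∀ p ∈ U, 0 < lam i p)
    (hw : ∀ i, ∀ p ∈ U, 0 ≤ w i p) (hw' : ∀ i, ∀ p ∈ U, 0 ≤ w' i p)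
    (hf : SymbolBound U lam k w f) (hg : SymbolBound U lam k w' g) :
    SymbolBound U lam k (fun i p => w i p * w' i p) (fun i p => f i p * g i p) := by
  have key : ∀ {w w' : P → E → ℝ} {f g : P → E → ℂ},
      (∀ i, ∀ p ∈ U, 0 ≤ w i p) → (∀ i, ∀ p ∈ U, 0 ≤ w' i p) →
      (∃ C, ∀ i, ∀ p ∈ U, ‖f i p‖ ≤ C * w i p) → (∃ C, ∀ i, ∀ p ∈ U, ‖g i p‖ ≤ C * w' i p) →
      ∃ C, ∀ i, ∀ p ∈ U, ‖f i p * g i p‖ ≤ C * (w i p * w' i p) := by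
    rintro w w' f g hw hw' ⟨C, hC⟩ ⟨D, hD⟩
    refine ⟨max C 0 * D, fun i p hp => ?_⟩
    rw [norm_mul]
    calc ‖f i p‖ * ‖g i p‖ ≤ (max C 0 * w i p) * (D * w' i p) := by
          refine mul_le_mul ((hC i p hp).trans
            (mul_le_mul_of_nonneg_right (le_max_left _ _) (hw i p hp))) (hD i p hp)
            (norm_nonneg _) (mul_nonneg (le_max_right _ _) (hw i p hp))
      _ = _ := by ring
  induction k generalizing w w' f g with
  | zero => exact key hw hw' hf hg
  | succ k ih =>
    refine ⟨key hw hw' hf.1 hg.1, fun i p hp => (hf.2.1 i p hp).mul (hg.2.1 i p hp),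
      fun v => ?_⟩
    have hd : ∀ {w : P → E → ℝ}, (∀ i, ∀ p ∈ U, 0 ≤ w i p) →
        ∀ i, ∀ p ∈ U, 0 ≤ w i p / lam i p :=
      fun h i p hp => div_nonneg (h i p hp) (hlam i p hp).le
    have h1 := (ih hw (hd hw') hf.of_succ (hg.2.2 v)).congr_weight
      (w' := fun i p => w i p * w' i p / lam i p) fun i p hp => by ring
    have h2 := (ih hw' (hd hw) hg.of_succ (hf.2.2 v)).congr_weight
      (w' := fun i p => w i p * w' i p / lam i p) fun i p hp => by ring
    refine (h1.add hU h2).congr hU fun i p hp => ?_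
    rw [fderiv_fun_mul (hf.2.1 i p hp) (hg.2.1 i p hp)]
    rfl

/-- Induction through (1/f)' = −f' f⁻²: the bounds of one order less for 1/f are used twice, and the
weights combine to w⁻¹/lam. -/
theorem SymbolBound.inv (hU : IsOpen U) (hlam : ∀ i, ∀ p ∈ U, 0 < lam i p)
    (hw : ∀ i, ∀ p ∈ U, 0 < w i p) (hf : SymbolBound U lam k w f)
    (hc : ∃ c > 0, ∀ i, ∀ p ∈ U, c * w i p ≤ ‖f i p‖) :
    SymbolBound U lam k (fun i p => (w i p)⁻¹) (fun i p => (f i p)⁻¹) := by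
  obtain ⟨c, hc0, hc⟩ := hc
  have h0 : ∃ C, ∀ i, ∀ p ∈ U, ‖(f i p)⁻¹‖ ≤ C * (w i p)⁻¹ := by
    refine ⟨c⁻¹, fun i p hp => ?_⟩
    rw [norm_inv, ← mul_inv]
    exact inv_anti₀ (mul_pos hc0 (hw i p hp)) (hc i p hp)
  have hne : ∀ i, ∀ p ∈ U, f i p ≠ 0 := fun i p hp =>
    norm_pos_iff.mp ((mul_pos hc0 (hw i p hp)).trans_le (hc i p hp))
  induction k with
  | zero => exact h0
  | succ k ih =>
    have hI := ih hf.of_succ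
    refine ⟨h0, fun i p hp => (hf.2.1 i p hp).inv (hne i p hp), fun v => ?_⟩
    have hi : ∀ i, ∀ p ∈ U, 0 ≤ (w i p)⁻¹ := fun i p hp => (inv_pos.mpr (hw i p hp)).le
    have h1 := SymbolBound.mul hU hlam hi hi hI hI
    have h2 := SymbolBound.mul hU hlam
      (fun i p hp => div_nonneg (hw i p hp).le (hlam i p hp).le)
      (fun i p hp => mul_nonneg (hi i p hp) (hi i p hp)) (hf.2.2 v) h1
    have h3 := SymbolBound.mul (w := fun _ _ => 1) hU hlam (fun _ _ _ => zero_le_one)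
      (fun i p hp => mul_nonneg (div_nonneg (hw i p hp).le (hlam i p hp).le)
        (mul_nonneg (hi i p hp) (hi i p hp)))
      (SymbolBound.const hlam (fun _ => (-1 : ℂ)) ⟨1, fun i => by simp⟩) h2
    refine (h3.congr_weight fun i p hp => ?_).congr hU fun i p hp => ?_
    · have := (hw i p hp).ne'
      have := (hlam i p hp).ne'
      field_simp
    · have := ((hasDerivAt_inv (hne i p hp)).hasFDerivAt.restrictScalars ℝ).comp p
        (hf.2.1 i p hp).hasFDerivAt
      change fderiv ℝ (Inv.inv ∘ f i) p v = _
      rw [this.fderiv]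
      have hne' := hne i p hp
      have h5 : -(f i p ^ 2)⁻¹ = -1 * ((f i p)⁻¹ * (f i p)⁻¹) := by field_simp
      simp only [ContinuousLinearMap.comp_apply, ContinuousLinearMap.coe_restrictScalars',
        ContinuousLinearMap.toSpanSingleton_apply, smul_eq_mul, h5]
      ring

namespace IsSymbol

theorem bound (h : IsSymbol U lam w f) : ∃ C, ∀ i, ∀ p ∈ U, ‖f i p‖ ≤ C * w i p := h 0

theorem bound_pos (h : IsSymbol U lam w f) (hw : ∀ i, ∀ p ∈ U, 0 ≤ w i p) :
    ∃ C > 0, ∀ i, ∀ p ∈ U, ‖f i p‖ ≤ C * w i p := by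
  obtain ⟨C, hC⟩ := h.bound
  exact ⟨max C 1, by positivity, fun i p hp => (hC i p hp).trans
    (mul_le_mul_of_nonneg_right (le_max_left _ _) (hw i p hp))⟩

theorem differentiableAt (h : IsSymbol U lam w f) (i : P) {p : E} (hp : p ∈ U) :
    DifferentiableAt ℝ (f i) p := (h 1).2.1 i p hp

theorem deriv (h : IsSymbol U lam w f) (v : E) :
    IsSymbol U lam (fun i p => w i p / lam i p) (fun i p => fderiv ℝ (f i) p v) :=
  fun k => (h (k + 1)).2.2 v

theorem of_deriv (h0 : ∃ C, ∀ i, ∀ p ∈ U, ‖f i p‖ ≤ C * w i p)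
    (hd : ∀ i, ∀ p ∈ U, DifferentiableAt ℝ (f i) p)
    (h : ∀ v, IsSymbol U lam (fun i p => w i p / lam i p) (fun i p => fderiv ℝ (f i) p v)) :
    IsSymbol U lam w f
  | 0 => h0
  | k + 1 => ⟨h0, hd, fun v => h v k⟩

theorem comp_param {P' : Type*} (σ : P' → P) (h : IsSymbol U lam w f) :
    IsSymbol U (fun i => lam (σ i)) (fun i => w (σ i)) (fun i => f (σ i)) :=
  fun k => (h k).comp_param σ

theorem congr (hU : IsOpen U) (h : IsSymbol U lam w f)
    (hfg : ∀ i, ∀ p ∈ U, g i p = f i p) : IsSymbol U lam w g :=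
  fun k => (h k).congr hU hfg

theorem mono_weight (hlam : ∀ i, ∀ p ∈ U, 0 < lam i p) (hw : ∀ i, ∀ p ∈ U, 0 ≤ w i p)
    (h : IsSymbol U lam w f) (hww : ∃ A, ∀ i, ∀ p ∈ U, w i p ≤ A * w' i p) :
    IsSymbol U lam w' f :=
  fun k => (h k).mono_weight hlam hw hww

theorem congr_weight (h : IsSymbol U lam w f) (hww : ∀ i, ∀ p ∈ U, w i p = w' i p) :
    IsSymbol U lam w' f :=
  fun k => (h k).congr_weight hww

theorem zero (hlam : ∀ i, ∀ p ∈ U, 0 < lam i p) (hw : ∀ i, ∀ p ∈ U, 0 ≤ w i p) :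
    IsSymbol U lam w (fun _ _ => 0) := fun _ => SymbolBound.zero hlam hw

theorem const (hlam : ∀ i, ∀ p ∈ U, 0 < lam i p) (c : P → ℂ) (hc : ∃ C, ∀ i, ‖c i‖ ≤ C) :
    IsSymbol U lam (fun _ _ => 1) (fun i _ => c i) := fun _ => SymbolBound.const hlam c hc

/-- Parameter-dependent constants, with a weight. -/
theorem const_weight (hlam : ∀ i, ∀ p ∈ U, 0 < lam i p) (c : P → ℂ) (r : P → ℝ)
    (hc : ∃ C, ∀ i, ‖c i‖ ≤ C * r i) : IsSymbol U lam (fun i _ => r i) (fun i _ => c i) := by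
  refine of_deriv ?_ (fun _ _ _ => by fun_prop) fun v => ?_
  · obtain ⟨C, hC⟩ := hc
    exact ⟨C, fun i _ _ => hC i⟩
  · refine fun k => ?_
    obtain ⟨C, hC⟩ := hc
    have hz : IsSymbol U lam (fun i p => ‖c i‖ / lam i p) (fun _ _ => 0) :=
      zero hlam fun i p hp => div_nonneg (norm_nonneg _) (hlam i p hp).le
    have := hz.mono_weight (w' := fun i p => r i / lam i p) hlam
      (fun i p hp => div_nonneg (norm_nonneg _) (hlam i p hp).le)
      ⟨C, fun i p hp => by
        rw [← mul_div_assoc]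
        exact div_le_div_of_nonneg_right (hC i) (hlam i p hp).le⟩
    simpa using this k

theorem add (hU : IsOpen U) (hf : IsSymbol U lam w f) (hg : IsSymbol U lam w g) :
    IsSymbol U lam w (fun i p => f i p + g i p) := fun k => (hf k).add hU (hg k)

theorem mul (hU : IsOpen U) (hlam : ∀ i, ∀ p ∈ U, 0 < lam i p)
    (hw : ∀ i, ∀ p ∈ U, 0 ≤ w i p) (hw' : ∀ i, ∀ p ∈ U, 0 ≤ w' i p)
    (hf : IsSymbol U lam w f) (hg : IsSymbol U lam w' g) :
    IsSymbol U lam (fun i p => w i p * w' i p) (fun i p => f i p * g i p) :=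
  fun k => (hf k).mul hU hlam hw hw' (hg k)

theorem inv (hU : IsOpen U) (hlam : ∀ i, ∀ p ∈ U, 0 < lam i p)
    (hw : ∀ i, ∀ p ∈ U, 0 < w i p) (hf : IsSymbol U lam w f)
    (hc : ∃ c > 0, ∀ i, ∀ p ∈ U, c * w i p ≤ ‖f i p‖) :
    IsSymbol U lam (fun i p => (w i p)⁻¹) (fun i p => (f i p)⁻¹) :=
  fun k => (hf k).inv hU hlam hw hc

theorem const_mul (hU : IsOpen U) (hlam : ∀ i, ∀ p ∈ U, 0 < lam i p)
    (hw : ∀ i, ∀ p ∈ U, 0 ≤ w i p) (c : P → ℂ) (hc : ∃ C, ∀ i, ‖c i‖ ≤ C)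
    (hf : IsSymbol U lam w f) : IsSymbol U lam w (fun i p => c i * f i p) :=
  ((const hlam c hc).mul hU hlam (fun _ _ _ => zero_le_one) hw hf).congr_weight
    fun _ _ _ => one_mul _

theorem neg (hU : IsOpen U) (hlam : ∀ i, ∀ p ∈ U, 0 < lam i p)
    (hw : ∀ i, ∀ p ∈ U, 0 ≤ w i p) (hf : IsSymbol U lam w f) :
    IsSymbol U lam w (fun i p => -f i p) :=
  (hf.const_mul hU hlam hw (fun _ => -1) ⟨1, fun _ => by simp⟩).congr hU
    fun i p _ => by simp

theorem sub (hU : IsOpen U) (hlam : ∀ i, ∀ p ∈ U, 0 < lam i p)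
    (hw : ∀ i, ∀ p ∈ U, 0 ≤ w i p) (hf : IsSymbol U lam w f) (hg : IsSymbol U lam w g) :
    IsSymbol U lam w (fun i p => f i p - g i p) :=
  (hf.add hU (hg.neg hU hlam hw)).congr hU fun _ _ _ => sub_eq_add_neg _ _

theorem sum (hU : IsOpen U) (hlam : ∀ i, ∀ p ∈ U, 0 < lam i p)
    (hw : ∀ i, ∀ p ∈ U, 0 ≤ w i p) {ι : Type*} (s : Finset ι) (F : ι → P → E → ℂ)
    (hF : ∀ j ∈ s, IsSymbol U lam w (F j)) :
    IsSymbol U lam w (fun i p => ∑ j ∈ s, F j i p) := by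
  classical
  induction s using Finset.induction_on with
  | empty => simpa using zero hlam hw
  | insert a s ha ih =>
    refine ((hF a (Finset.mem_insert_self a s)).add hU
      (ih fun j hj => hF j (Finset.mem_insert_of_mem hj))).congr hU fun i p _ => ?_
    rw [Finset.sum_insert ha]

theorem conj (hU : IsOpen U) (hf : IsSymbol U lam w f) :
    IsSymbol U lam w (fun i p => (starRingEnd ℂ) (f i p)) := by
  intro k
  induction k generalizing w f with
  | zero =>
    obtain ⟨C, hC⟩ := hf.bound
    exact ⟨C, fun i p hp => by simpa using hC i p hp⟩
  | succ k ih =>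
    refine ⟨?_, fun i p hp => ?_, fun v => (ih (hf.deriv v)).congr hU fun i p hp => ?_⟩
    · obtain ⟨C, hC⟩ := hf.bound
      exact ⟨C, fun i p hp => by simpa using hC i p hp⟩
    · exact (Complex.conjCLE.toContinuousLinearMap.hasFDerivAt.comp p
        (hf.differentiableAt i hp).hasFDerivAt).differentiableAt
    · have := Complex.conjCLE.toContinuousLinearMap.hasFDerivAt.comp p
        (hf.differentiableAt i hp).hasFDerivAt
      change fderiv ℝ (Complex.conjCLE ∘ f i) p v = _
      rw [show (Complex.conjCLE ∘ f i) = Complex.conjCLE.toContinuousLinearMap ∘ f i from rfl,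
        this.fderiv]
      simp

end IsSymbol

end SymbolCalculus

/-! ### Dilations and compositions as symbols. -/

namespace SymbolCalculus

variable {E : Type*} [NormedAddCommGroup E] [NormedSpace ℝ E] {P : Type*}

theorem contDiffOn_fderiv_apply {F : Type*} [NormedAddCommGroup F] [NormedSpace ℝ F]
    {U : Set E} (hU : IsOpen U) {f : E → F} (hf : ContDiffOn ℝ (⊤ : ℕ∞) f U) (v : E) :
    ContDiffOn ℝ (⊤ : ℕ∞) (fun p => fderiv ℝ f p v) U :=
  (hf.fderiv_of_isOpen hU (by norm_num)).clm_apply contDiffOn_const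

theorem contDiff_fderiv_apply {F : Type*} [NormedAddCommGroup F] [NormedSpace ℝ F]
    {f : E → F} (hf : ContDiff ℝ (⊤ : ℕ∞) f) (v : E) :
    ContDiff ℝ (⊤ : ℕ∞) (fun p => fderiv ℝ f p v) :=
  contDiffOn_univ.mp (contDiffOn_fderiv_apply isOpen_univ hf.contDiffOn v)

theorem contDiff_of_tsupport_subset {F : Type*} [NormedAddCommGroup F] [NormedSpace ℝ F]
    {U : Set E} (hU : IsOpen U) {n : WithTop ℕ∞} {f : E → F} (hf : ContDiffOn ℝ n f U)
    (hs : tsupport f ⊆ U) : ContDiff ℝ n f := by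
  rw [contDiff_iff_contDiffAt]
  intro p
  by_cases hp : p ∈ tsupport f
  · exact hf.contDiffAt (hU.mem_nhds (hs hp))
  · have : f =ᶠ[𝓝 p] fun _ => 0 := notMem_tsupport_iff_eventuallyEq.mp hp
    exact contDiffAt_const.congr_of_eventuallyEq this

section Smooth

variable {U : Set E}

/-- Dilations by factors at most `1` of a test function. -/
theorem IsSymbol.dilation {G : Type*} [NormedAddCommGroup G] [NormedSpace ℝ G] (hU : IsOpen U)
    (c : P → ℝ) (hc : ∀ i, |c i| ≤ 1) (ℓ : E →L[ℝ] G) {χ : G → ℂ}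
    (hχ : ContDiff ℝ (⊤ : ℕ∞) χ) (hχc : HasCompactSupport χ) :
    IsSymbol U (fun _ _ => 1) (fun _ _ => 1) (fun (i : P) p => χ (c i • ℓ p)) := by
  intro k
  have h0 : ∀ {χ : G → ℂ}, ContDiff ℝ (⊤ : ℕ∞) χ → HasCompactSupport χ →
      ∃ C, ∀ i, ∀ p ∈ U, ‖χ (c i • ℓ p)‖ ≤ C * 1 := by
    intro χ hχ hχc
    obtain ⟨C, hC⟩ := hχc.exists_bound_of_continuous hχ.continuous
    exact ⟨C, fun i p _ => by simpa using hC _⟩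
  have hd : ∀ {χ : G → ℂ}, ContDiff ℝ (⊤ : ℕ∞) χ → ∀ i p, HasFDerivAt (fun p => χ (c i • ℓ p))
      ((fderiv ℝ χ (c i • ℓ p)).comp (c i • ℓ)) p := by
    intro χ hχ i p
    exact ((hχ.differentiable (by simp)) _).hasFDerivAt.comp p (c i • ℓ).hasFDerivAt
  induction k generalizing χ with
  | zero => exact h0 hχ hχc
  | succ k ih =>
    refine ⟨h0 hχ hχc, fun i p _ => (hd hχ i p).differentiableAt, fun v => ?_⟩
    have h1 := ih (contDiff_fderiv_apply hχ (ℓ v)) (hχc.fderiv_apply (𝕜 := ℝ) (ℓ v))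
    have h2 := (SymbolBound.const (k := k) (U := U) (lam := fun _ _ => 1)
      (fun _ _ _ => zero_lt_one) (fun i => ((c i : ℝ) : ℂ)) ⟨1, fun i => by simpa using hc i⟩).mul
      hU (fun _ _ _ => zero_lt_one) (fun _ _ _ => zero_le_one) (fun _ _ _ => zero_le_one) h1
    refine (h2.congr_weight fun i p _ => by simp).congr hU fun i p _ => ?_
    rw [(hd hχ i p).fderiv]
    simp

/-- The mean value inequality yields the factor c in the value, and each derivative of a dilation
carries a factor c anyway. This makes the error of the cut-off χ(δη) tend to zero with δ, at the
price of one power of 1 + |η|. -/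
theorem IsSymbol.dilation_sub {G : Type*} [NormedAddCommGroup G] [NormedSpace ℝ G]
    (hU : IsOpen U) (c : P → ℝ) (hc0 : ∀ i, 0 ≤ c i) (hc : ∀ i, c i ≤ 1) (ℓ : E →L[ℝ] G)
    {χ : G → ℂ} (hχ : ContDiff ℝ (⊤ : ℕ∞) χ) (hχc : HasCompactSupport χ) :
    IsSymbol U (fun _ _ => 1) (fun i p => c i * (1 + ‖ℓ p‖))
      (fun (i : P) p => χ (c i • ℓ p) - χ 0) := by
  have hd : ∀ i p, HasFDerivAt (fun p => χ (c i • ℓ p) - χ 0)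
      ((fderiv ℝ χ (c i • ℓ p)).comp (c i • ℓ)) p := fun i p =>
    (((hχ.differentiable (by simp)) _).hasFDerivAt.comp p (c i • ℓ).hasFDerivAt).sub_const _
  refine IsSymbol.of_deriv ?_ (fun i p _ => (hd i p).differentiableAt) fun v => ?_
  · obtain ⟨C, hC⟩ := (hχc.fderiv (𝕜 := ℝ)).exists_bound_of_continuous
      (hχ.continuous_fderiv (by simp))
    refine ⟨C, fun i p _ => ?_⟩
    have h1 := Convex.norm_image_sub_le_of_norm_fderiv_le (𝕜 := ℝ) (f := χ) (s := Set.univ)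
      (x := 0) (y := c i • ℓ p) (fun q _ => (hχ.differentiable (by simp)) q)
      (fun q _ => hC q) convex_univ (Set.mem_univ _) (Set.mem_univ _)
    have hC0 : 0 ≤ C := (norm_nonneg _).trans (hC 0)
    refine h1.trans ?_
    rw [sub_zero, norm_smul, Real.norm_of_nonneg (hc0 i)]
    have := hc0 i
    gcongr
    linarith
  · have h1 := IsSymbol.dilation (P := P) hU c (fun i => by rw [abs_of_nonneg (hc0 i)]; exact hc i) ℓ
      (contDiff_fderiv_apply hχ (ℓ v)) (hχc.fderiv_apply (𝕜 := ℝ) (ℓ v))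
    have h2 := (IsSymbol.const_weight (U := U) (lam := fun _ _ => 1) (fun _ _ _ => zero_lt_one)
      (fun i => ((c i : ℝ) : ℂ)) c ⟨1, fun i => by simp [abs_of_nonneg (hc0 i)]⟩).mul
      hU (fun _ _ _ => zero_lt_one) (fun i _ _ => hc0 i) (fun _ _ _ => zero_le_one) h1
    refine (h2.mono_weight (fun _ _ _ => zero_lt_one) (fun i p _ => by simpa using hc0 i)
      ⟨1, fun i p _ => ?_⟩).congr hU fun i p _ => ?_
    · have := hc0 i
      have := mul_nonneg this (norm_nonneg (ℓ p))
      simp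
      nlinarith
    · rw [(hd i p).fderiv]
      simp

/-- Composition of a smooth function with symbols of order zero. -/
theorem IsSymbol.comp {κ : Type*} [Fintype κ] (hU : IsOpen U) {O L : Set (EuclideanSpace ℝ κ)}
    (hO : IsOpen O) (hL : IsCompact L) (hLO : L ⊆ O) {X : P → E → EuclideanSpace ℝ κ}
    (hX : ∀ j, IsSymbol U (fun _ _ => 1) (fun _ _ => 1) (fun i p => ((X i p j : ℝ) : ℂ)))
    (hXL : ∀ i, ∀ p ∈ U, X i p ∈ L) {F : EuclideanSpace ℝ κ → ℂ}
    (hF : ContDiffOn ℝ (⊤ : ℕ∞) F O) :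
    IsSymbol U (fun _ _ => 1) (fun _ _ => 1) (fun i p => F (X i p)) := by
  classical
  have hXd : ∀ i, ∀ p ∈ U, DifferentiableAt ℝ (X i) p := fun i p hp => by
    rw [differentiableAt_euclidean]
    intro j
    have h1 := Complex.reCLM.hasFDerivAt.comp p ((hX j).differentiableAt i hp).hasFDerivAt
    exact h1.differentiableAt
  have hXj : ∀ i, ∀ p ∈ U, ∀ v j, ((fderiv ℝ (X i) p v j : ℝ) : ℂ) =
      fderiv ℝ (fun p => ((X i p j : ℝ) : ℂ)) p v := fun i p hp v j => by
    have h1 := (Complex.ofRealCLM.comp (EuclideanSpace.proj j : _ →L[ℝ] ℝ)).hasFDerivAt.comp p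
      (hXd i p hp).hasFDerivAt
    have h2 : fderiv ℝ (fun p => ((X i p j : ℝ) : ℂ)) p = _ := h1.fderiv
    rw [h2]
    simp
  intro k
  have h0 : ∀ {F : EuclideanSpace ℝ κ → ℂ}, ContDiffOn ℝ (⊤ : ℕ∞) F O →
      ∃ C, ∀ i, ∀ p ∈ U, ‖F (X i p)‖ ≤ C * 1 := by
    intro F hF
    obtain ⟨C, hC⟩ := hL.exists_bound_of_continuousOn (hF.continuousOn.mono hLO)
    exact ⟨C, fun i p hp => by simpa using hC _ (hXL i p hp)⟩
  have hd : ∀ {F : EuclideanSpace ℝ κ → ℂ}, ContDiffOn ℝ (⊤ : ℕ∞) F O → ∀ i, ∀ p ∈ U,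
      HasFDerivAt (fun p => F (X i p)) ((fderiv ℝ F (X i p)).comp (fderiv ℝ (X i) p)) p := by
    intro F hF i p hp
    exact ((hF.contDiffAt (hO.mem_nhds (hLO (hXL i p hp)))).differentiableAt
      (by simp)).hasFDerivAt.comp p (hXd i p hp).hasFDerivAt
  -- The partial derivatives of F are again smooth on O, so the chain rule and the algebra of
  -- symbols close an induction over all F at once.
  induction k generalizing F with
  | zero => exact h0 hF
  | succ k ih =>
    refine ⟨h0 hF, fun i p hp => (hd hF i p hp).differentiableAt, fun v => ?_⟩
    have one : ∀ (i : P), ∀ p ∈ U, (0 : ℝ) < (fun _ _ => 1 : P → E → ℝ) i p :=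
      fun _ _ _ => zero_lt_one
    have one' : ∀ (i : P), ∀ p ∈ U, (0 : ℝ) ≤ (fun _ _ => 1 : P → E → ℝ) i p :=
      fun _ _ _ => zero_le_one
    have hterm : ∀ j, SymbolBound U (fun _ _ => 1) k (fun _ _ => 1)
        (fun i p => fderiv ℝ F (X i p) (EuclideanSpace.single j 1) *
          fderiv ℝ (fun p => ((X i p j : ℝ) : ℂ)) p v) := fun j => by
      have h1 := (ih (contDiffOn_fderiv_apply hO hF (EuclideanSpace.single j 1))).mul hU one one'
        one' (((hX j).deriv v k).congr_weight (w' := fun _ _ => 1) fun i p _ => by simp)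
      exact h1.congr_weight fun i p _ => by simp
    have hsum : ∀ s : Finset κ, SymbolBound U (fun _ _ => 1) k (fun _ _ => 1)
        (fun i p => ∑ j ∈ s, fderiv ℝ F (X i p) (EuclideanSpace.single j 1) *
          fderiv ℝ (fun p => ((X i p j : ℝ) : ℂ)) p v) := fun s => by
      induction s using Finset.induction_on with
      | empty => simpa using SymbolBound.zero one one'
      | insert a s ha ihs =>
        exact ((hterm a).add hU ihs).congr hU fun i p _ => by rw [Finset.sum_insert ha]
    refine ((hsum Finset.univ).congr_weight fun i p _ => by simp).congr hU fun i p hp => ?_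
    rw [(hd hF i p hp).fderiv, ContinuousLinearMap.comp_apply]
    have h3 : fderiv ℝ (X i) p v =
        ∑ j, (fderiv ℝ (X i) p v j) • (EuclideanSpace.single j (1 : ℝ)) := by
      ext m
      simp [Finset.sum_apply, Pi.single_apply]
    conv_lhs => rw [h3, map_sum]
    refine Finset.sum_congr rfl fun j _ => ?_
    rw [map_smul, ← hXj i p hp, Complex.real_smul, mul_comm]

end Smooth

/-! ### Repeated integration by parts with a first order operator. -/

section Transport

variable {ι : Type*} [Fintype ι] {U : Set E}

/-- The transpose of the first order operator `C₀ + ∑ Cⱼ ∂ⱼ`. -/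
noncomputable def transport (e : ι → E) (C₀ : E → ℂ) (C : ι → E → ℂ) (f : E → ℂ) : E → ℂ :=
  fun p => C₀ p * f p - ∑ j, fderiv ℝ (fun q => C j q * f q) p (e j)

variable {e : ι → E} {C₀ : E → ℂ} {C : ι → E → ℂ} {f : E → ℂ}

theorem transport_eq_zero {p : E} (hp : f =ᶠ[𝓝 p] fun _ => 0) :
    transport e C₀ C f =ᶠ[𝓝 p] fun _ => 0 := by
  filter_upwards [hp.eventuallyEq_nhds] with q hq
  have h1 : ∀ j, (fun q => C j q * f q) =ᶠ[𝓝 q] fun _ => 0 := fun j => by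
    filter_upwards [hq] with r hr
    simp [hr]
  have h2 : ∀ j, fderiv ℝ (fun q => C j q * f q) q (e j) = 0 := fun j => by
    rw [(h1 j).fderiv_eq]
    simp
  simp [transport, Finset.sum_eq_zero fun j _ => h2 j, hq.eq_of_nhds]

theorem transport_iterate_eq_zero (n : ℕ) {p : E} (hp : f =ᶠ[𝓝 p] fun _ => 0) :
    (transport e C₀ C)^[n] f =ᶠ[𝓝 p] fun _ => 0 := by
  induction n generalizing f with
  | zero => exact hp
  | succ n ih => exact ih (transport_eq_zero hp)

theorem tsupport_transport_subset : tsupport (transport e C₀ C f) ⊆ tsupport f := by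
  intro p hp
  by_contra h
  exact (notMem_tsupport_iff_eventuallyEq.mpr
    (transport_eq_zero (notMem_tsupport_iff_eventuallyEq.mp h))) hp

theorem tsupport_transport_iterate_subset (n : ℕ) :
    tsupport ((transport e C₀ C)^[n] f) ⊆ tsupport f := by
  induction n generalizing f with
  | zero => exact subset_rfl
  | succ n ih => exact ih.trans tsupport_transport_subset

theorem contDiffOn_transport (hU : IsOpen U) (hC₀ : ContDiffOn ℝ (⊤ : ℕ∞) C₀ U)
    (hC : ∀ j, ContDiffOn ℝ (⊤ : ℕ∞) (C j) U) (hf : ContDiffOn ℝ (⊤ : ℕ∞) f U) :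
    ContDiffOn ℝ (⊤ : ℕ∞) (transport e C₀ C f) U :=
  (hC₀.mul hf).sub (ContDiffOn.sum fun j _ =>
    contDiffOn_fderiv_apply hU ((hC j).mul hf) (e j))

theorem contDiffOn_transport_iterate (hU : IsOpen U) (hC₀ : ContDiffOn ℝ (⊤ : ℕ∞) C₀ U)
    (hC : ∀ j, ContDiffOn ℝ (⊤ : ℕ∞) (C j) U) (hf : ContDiffOn ℝ (⊤ : ℕ∞) f U) (n : ℕ) :
    ContDiffOn ℝ (⊤ : ℕ∞) ((transport e C₀ C)^[n] f) U := by
  induction n generalizing f with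
  | zero => exact hf
  | succ n ih => exact ih (contDiffOn_transport hU hC₀ hC hf)

theorem transport_congr (hU : IsOpen U) {g : E → ℂ} (hfg : Set.EqOn f g U) :
    Set.EqOn (transport e C₀ C f) (transport e C₀ C g) U := by
  intro p hp
  have h1 : ∀ j, (fun q => C j q * f q) =ᶠ[𝓝 p] fun q => C j q * g q := fun j => by
    filter_upwards [hU.mem_nhds hp] with q hq
    rw [hfg hq]
  simp only [transport, hfg hp]
  rw [Finset.sum_congr rfl fun j _ => by rw [(h1 j).fderiv_eq]]

theorem transport_add (hU : IsOpen U) {g : E → ℂ} (hC : ∀ j, ContDiffOn ℝ (⊤ : ℕ∞) (C j) U)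
    (hf : ContDiffOn ℝ (⊤ : ℕ∞) f U) (hg : ContDiffOn ℝ (⊤ : ℕ∞) g U) {p : E} (hp : p ∈ U) :
    transport e C₀ C (fun q => f q + g q) p =
      transport e C₀ C f p + transport e C₀ C g p := by
  have hd : ∀ {h : E → ℂ}, ContDiffOn ℝ (⊤ : ℕ∞) h U → DifferentiableAt ℝ h p := fun h =>
    (h.contDiffAt (hU.mem_nhds hp)).differentiableAt (by simp)
  have h1 : ∀ j, fderiv ℝ (fun q => C j q * (f q + g q)) p (e j) =
      fderiv ℝ (fun q => C j q * f q) p (e j) + fderiv ℝ (fun q => C j q * g q) p (e j) := by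
    intro j
    simp only [mul_add]
    rw [fderiv_fun_add ((hd (hC j)).fun_mul (hd hf)) ((hd (hC j)).fun_mul (hd hg))]
    rfl
  simp only [transport, h1, Finset.sum_add_distrib]
  ring

/-- A factor annihilated by the vector field commutes with the transport. -/
theorem transport_mul_of_invariant (hU : IsOpen U) {g : E → ℂ}
    (hC : ∀ j, ContDiffOn ℝ (⊤ : ℕ∞) (C j) U)
    (hf : ContDiffOn ℝ (⊤ : ℕ∞) f U) (hg : ContDiffOn ℝ (⊤ : ℕ∞) g U) {p : E} (hp : p ∈ U)
    (hinv : ∑ j, C j p * fderiv ℝ g p (e j) = 0) :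
    transport e C₀ C (fun q => g q * f q) p = g p * transport e C₀ C f p := by
  have hd : ∀ {h : E → ℂ}, ContDiffOn ℝ (⊤ : ℕ∞) h U → DifferentiableAt ℝ h p := fun h =>
    (h.contDiffAt (hU.mem_nhds hp)).differentiableAt (by simp)
  have h1 : ∀ j, fderiv ℝ (fun q => C j q * (g q * f q)) p (e j) =
      g p * fderiv ℝ (fun q => C j q * f q) p (e j) +
        (C j p * fderiv ℝ g p (e j)) * f p := by
    intro j
    have : (fun q => C j q * (g q * f q)) = fun q => g q * (C j q * f q) := by
      ext q; ring
    rw [this, fderiv_fun_mul (hd hg) ((hd (hC j)).fun_mul (hd hf))]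
    simp
    ring
  simp only [transport, h1, Finset.sum_add_distrib, ← Finset.sum_mul, hinv, ← Finset.mul_sum]
  ring

variable [MeasurableSpace E] [BorelSpace E] [FiniteDimensional ℝ E] {μ : Measure E}
  [μ.IsAddHaarMeasure]

theorem integral_fderiv_eq_zero {F : E → ℂ} (hF : ContDiff ℝ 1 F) (hc : HasCompactSupport F)
    (v : E) : ∫ p, fderiv ℝ F p v ∂μ = 0 := by
  have h1 : Integrable (fun p => fderiv ℝ F p v) μ :=
    ((hF.continuous_fderiv (by simp)).clm_apply continuous_const).integrable_of_hasCompactSupport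
      (hc.fderiv_apply (𝕜 := ℝ) v)
  have h2 : Integrable F μ := hF.continuous.integrable_of_hasCompactSupport hc
  have := integral_mul_fderiv_eq_neg_fderiv_mul_of_integrable (μ := μ) (f := fun _ : E => (1 : ℂ))
    (g := F) (v := v) (by simp) (by simpa using h1) (by simpa using h2)
    (fun _ _ => by fun_prop) (fun p _ => hF.differentiable (by simp) p)
  simpa using this

/-- By `hrel` the operator C₀ + ∑ Cⱼ ∂ⱼ fixes W on U. Insert it in front of W and move the
derivatives to f; the divergence terms ∂ⱼ(W Cⱼ f) integrate to zero, since f is compactly supported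
in U. -/
theorem integral_transport (hU : IsOpen U) {W : E → ℂ} (hW : ContDiffOn ℝ 1 W U)
    (hC : ∀ j, ContDiffOn ℝ (⊤ : ℕ∞) (C j) U)
    (hrel : ∀ p ∈ U, C₀ p * W p + ∑ j, C j p * fderiv ℝ W p (e j) = W p)
    (hf : ContDiffOn ℝ (⊤ : ℕ∞) f U) (hfc : HasCompactSupport f) (hfU : tsupport f ⊆ U) :
    ∫ p, W p * f p ∂μ = ∫ p, W p * transport e C₀ C f p ∂μ := by
  set F : ι → E → ℂ := fun j p => W p * (C j p * f p) with hFdef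
  have hsupp : ∀ j, tsupport (F j) ⊆ tsupport f := fun j => by
    refine closure_mono fun p hp => ?_
    simp only [hFdef, Function.mem_support, ne_eq, mul_eq_zero, not_or] at hp ⊢
    exact hp.2.2
  have hF : ∀ j, ContDiff ℝ 1 (F j) := fun j =>
    contDiff_of_tsupport_subset hU (hW.mul ((((hC j).mul hf)).of_le (by simp)))
      ((hsupp j).trans hfU)
  have hFc : ∀ j, HasCompactSupport (F j) := fun j =>
    HasCompactSupport.of_support_subset_isCompact hfc (subset_tsupport _ |>.trans (hsupp j))
  have hpt : ∀ p, W p * transport e C₀ C f p =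
      W p * f p - ∑ j, fderiv ℝ (F j) p (e j) := by
    intro p
    by_cases hp : p ∈ tsupport f
    · have hpU := hfU hp
      have hd : ∀ {h : E → ℂ} {n : WithTop ℕ∞}, n ≠ 0 → ContDiffOn ℝ n h U →
        DifferentiableAt ℝ h p := fun hn h =>
        (h.contDiffAt (hU.mem_nhds hpU)).differentiableAt hn
      have hdC := fun j => (hd (by simp) (hC j)).fun_mul (hd (by simp) hf)
      have h1 : ∀ j, fderiv ℝ (F j) p (e j) =
          W p * fderiv ℝ (fun q => C j q * f q) p (e j) +
            f p * (C j p * fderiv ℝ W p (e j)) := fun j => by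
        simp only [hFdef]
        rw [fderiv_fun_mul (hd (by simp) hW) (hdC j)]
        simp
        ring
      simp only [transport, h1, Finset.sum_add_distrib, ← Finset.mul_sum]
      have := hrel p hpU
      linear_combination f p * this
    · have h0 := notMem_tsupport_iff_eventuallyEq.mp hp
      have h1 : ∀ j, F j =ᶠ[𝓝 p] fun _ => 0 := fun j =>
        notMem_tsupport_iff_eventuallyEq.mp fun h => hp (hsupp j h)
      rw [(transport_eq_zero h0).eq_of_nhds, h0.eq_of_nhds]
      have h2 : ∀ j, fderiv ℝ (F j) p (e j) = 0 := fun j => by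
        rw [(h1 j).fderiv_eq]
        simp
      simp [Finset.sum_eq_zero fun j _ => h2 j]
  have hIF : ∀ j, Integrable (fun p => fderiv ℝ (F j) p (e j)) μ := fun j =>
    (((hF j).continuous_fderiv (by simp)).clm_apply
      continuous_const).integrable_of_hasCompactSupport ((hFc j).fderiv_apply (𝕜 := ℝ) (e j))
  have hIW : Integrable (fun p => W p * f p) μ := by
    have hs : tsupport (fun p => W p * f p) ⊆ tsupport f := closure_mono fun p hp => by
      simp only [Function.mem_support, ne_eq, mul_eq_zero, not_or] at hp ⊢
      exact hp.2
    have hc : ContDiff ℝ 1 (fun p => W p * f p) :=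
      contDiff_of_tsupport_subset hU (hW.mul (hf.of_le (by simp))) (hs.trans hfU)
    exact hc.continuous.integrable_of_hasCompactSupport
      (HasCompactSupport.of_support_subset_isCompact hfc (subset_tsupport _ |>.trans hs))
  simp only [hpt]
  rw [integral_sub hIW (integrable_finsetSum _ fun j _ => hIF j),
    integral_finsetSum _ fun j _ => hIF j]
  simp [fun j => integral_fderiv_eq_zero (μ := μ) (hF j) (hFc j) (e j)]

theorem integral_transport_iterate (hU : IsOpen U) {W : E → ℂ} (hW : ContDiffOn ℝ 1 W U)
    (hC₀ : ContDiffOn ℝ (⊤ : ℕ∞) C₀ U) (hC : ∀ j, ContDiffOn ℝ (⊤ : ℕ∞) (C j) U)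
    (hrel : ∀ p ∈ U, C₀ p * W p + ∑ j, C j p * fderiv ℝ W p (e j) = W p)
    (hf : ContDiffOn ℝ (⊤ : ℕ∞) f U) (hfc : HasCompactSupport f) (hfU : tsupport f ⊆ U) (n : ℕ) :
    ∫ p, W p * f p ∂μ = ∫ p, W p * (transport e C₀ C)^[n] f p ∂μ := by
  induction n generalizing f with
  | zero => rfl
  | succ n ih =>
    rw [integral_transport hU hW hC hrel hf hfc hfU, Function.iterate_succ_apply]
    exact ih (contDiffOn_transport hU hC₀ hC hf)
      (HasCompactSupport.of_support_subset_isCompact hfc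
        ((subset_tsupport _).trans tsupport_transport_subset))
      (tsupport_transport_subset.trans hfU)

end Transport

section TransportSymbol

variable {ι : Type*} [Fintype ι] {U : Set E} {lam w m : P → E → ℝ}

/-- The gain of one integration by parts is m: a coefficient of size m·lam meets a derivative that
costs 1/lam. -/
theorem IsSymbol.transport (hU : IsOpen U) (hlam : ∀ i, ∀ p ∈ U, 0 < lam i p)
    (hw : ∀ i, ∀ p ∈ U, 0 ≤ w i p) (hm : ∀ i, ∀ p ∈ U, 0 ≤ m i p) {e : ι → E}
    {C₀ : P → E → ℂ} {C : P → ι → E → ℂ} {f : P → E → ℂ} (hC₀ : IsSymbol U lam m C₀)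
    (hC : ∀ j, IsSymbol U lam (fun i p => m i p * lam i p) (fun i => C i j))
    (hf : IsSymbol U lam w f) :
    IsSymbol U lam (fun i p => w i p * m i p)
      (fun i => SymbolCalculus.transport e (C₀ i) (C i) (f i)) := by
  have h0 : ∀ i, ∀ p ∈ U, 0 ≤ w i p * m i p := fun i p hp => mul_nonneg (hw i p hp) (hm i p hp)
  refine IsSymbol.sub hU hlam h0 ((hC₀.mul hU hlam hm hw hf).congr_weight
    fun i p _ => mul_comm _ _) (IsSymbol.sum hU hlam h0 _ _ fun j _ => ?_)
  refine (((hC j).mul hU hlam (fun i p hp => mul_nonneg (hm i p hp) (hlam i p hp).le) hw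
    hf).deriv (e j)).congr_weight fun i p hp => ?_
  have := (hlam i p hp).ne'
  field_simp

theorem IsSymbol.transport_iterate (hU : IsOpen U) (hlam : ∀ i, ∀ p ∈ U, 0 < lam i p)
    (hw : ∀ i, ∀ p ∈ U, 0 ≤ w i p) (hm : ∀ i, ∀ p ∈ U, 0 ≤ m i p) {e : ι → E}
    {C₀ : P → E → ℂ} {C : P → ι → E → ℂ} {f : P → E → ℂ} (hC₀ : IsSymbol U lam m C₀)
    (hC : ∀ j, IsSymbol U lam (fun i p => m i p * lam i p) (fun i => C i j))
    (hf : IsSymbol U lam w f) (n : ℕ) :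
    IsSymbol U lam (fun i p => w i p * m i p ^ n)
      (fun i => (SymbolCalculus.transport e (C₀ i) (C i))^[n] (f i)) := by
  induction n generalizing w f with
  | zero => simpa using hf
  | succ n ih =>
    refine (ih (fun i p hp => mul_nonneg (hw i p hp) (hm i p hp))
      (IsSymbol.transport hU hlam hw hm hC₀ hC hf)).congr_weight fun i p _ => ?_
    ring

end TransportSymbol

end SymbolCalculus

/-! ### Vanishing orders and the scale-invariant oscillatory estimate. -/

namespace SymbolCalculus

variable {E : Type*} [NormedAddCommGroup E] [NormedSpace ℝ E] {P : Type*}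

/-- Vanishing to order `r` at the origin. -/
def VanishesToOrder : ℕ → (E → ℂ) → Prop
  | 0, _ => True
  | r + 1, f => f 0 = 0 ∧ ∀ v, VanishesToOrder r (fun p => fderiv ℝ f p v)

namespace VanishesToOrder

variable {f g : E → ℂ} {r s : ℕ}

theorem of_succ (h : VanishesToOrder (r + 1) f) : VanishesToOrder r f := by
  induction r generalizing f with
  | zero => trivial
  | succ r ih => exact ⟨h.1, fun v => ih (h.2 v)⟩

theorem mono (hrs : r ≤ s) (h : VanishesToOrder s f) : VanishesToOrder r f := by
  induction hrs with
  | refl => exact h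
  | step _ ih => exact ih h.of_succ

theorem add (hf : ContDiff ℝ (⊤ : ℕ∞) f) (hg : ContDiff ℝ (⊤ : ℕ∞) g)
    (hrf : VanishesToOrder r f) (hrg : VanishesToOrder r g) :
    VanishesToOrder r (fun p => f p + g p) := by
  induction r generalizing f g with
  | zero => trivial
  | succ r ih =>
    refine ⟨by simp [hrf.1, hrg.1], fun v => ?_⟩
    have := ih (contDiff_fderiv_apply hf v) (contDiff_fderiv_apply hg v) (hrf.2 v) (hrg.2 v)
    convert this using 2 with p
    rw [fderiv_fun_add (hf.differentiable (by simp) p) (hg.differentiable (by simp) p)]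
    rfl

theorem const_mul (hf : ContDiff ℝ (⊤ : ℕ∞) f) (c : ℂ) (hrf : VanishesToOrder r f) :
    VanishesToOrder r (fun p => c * f p) := by
  induction r generalizing f with
  | zero => trivial
  | succ r ih =>
    refine ⟨by simp [hrf.1], fun v => ?_⟩
    have := ih (contDiff_fderiv_apply hf v) (hrf.2 v)
    convert this using 2 with p
    rw [fderiv_const_mul (hf.differentiable (by simp) p)]
    rfl

theorem mul (hf : ContDiff ℝ (⊤ : ℕ∞) f) (hg : ContDiff ℝ (⊤ : ℕ∞) g)
    (hrf : VanishesToOrder r f) (hsg : VanishesToOrder s g) :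
    VanishesToOrder (r + s) (fun p => f p * g p) := by
  obtain ⟨n, hn⟩ : ∃ n, n = r + s := ⟨_, rfl⟩
  rw [← hn]
  induction n generalizing f g r s with
  | zero => trivial
  | succ n ih =>
    refine ⟨?_, fun v => ?_⟩
    · cases r with
      | zero =>
        cases s with
        | zero => omega
        | succ s => simp [hsg.1]
      | succ r => simp [hrf.1]
    · have hd : (fun p => fderiv ℝ (fun q => f q * g q) p v) =
          fun p => f p * fderiv ℝ g p v + fderiv ℝ f p v * g p := by
        ext p
        rw [fderiv_fun_mul (hf.differentiable (by simp) p) (hg.differentiable (by simp) p)]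
        simp [mul_comm]
      rw [hd]
      refine add (hf.mul (contDiff_fderiv_apply hg v)) ((contDiff_fderiv_apply hf v).mul hg) ?_ ?_
      -- If s = 0 nothing is known about g, but then r = n + 1 and f has one order of vanishing to
      -- spare. The other summand is symmetric.
      · cases s with
        | zero =>
          have h1 : VanishesToOrder n f := mono (by omega) hrf
          have h2 : VanishesToOrder 0 (fun p => fderiv ℝ g p v) := trivial
          exact ih hf (contDiff_fderiv_apply hg v) h1 h2 (by omega)
        | succ s => exact ih hf (contDiff_fderiv_apply hg v) hrf (hsg.2 v) (by omega)
      · cases r with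
        | zero =>
          have h1 : VanishesToOrder n g := mono (by omega) hsg
          have h2 : VanishesToOrder 0 (fun p => fderiv ℝ f p v) := trivial
          exact ih (contDiff_fderiv_apply hf v) hg h2 h1 (by omega)
        | succ r => exact ih (contDiff_fderiv_apply hf v) hg (hrf.2 v) hsg (by omega)

theorem contDiff_radial (hf : ContDiff ℝ (⊤ : ℕ∞) f) :
    ContDiff ℝ (⊤ : ℕ∞) (fun p => fderiv ℝ f p p) :=
  (hf.fderiv_right (m := (⊤ : ℕ∞)) (by norm_num)).clm_apply contDiff_id

theorem fderiv_radial (hf : ContDiff ℝ (⊤ : ℕ∞) f) (p v : E) :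
    fderiv ℝ (fun q => fderiv ℝ f q q) p v =
      fderiv ℝ f p v + fderiv ℝ (fun q => fderiv ℝ f q v) p p := by
  have hdd : DifferentiableAt ℝ (fderiv ℝ f) p :=
    (hf.fderiv_right (m := (⊤ : ℕ∞)) (by norm_num)).differentiable (by simp) p
  have h1 : HasFDerivAt (fun q => fderiv ℝ f q q) _ p :=
    hdd.hasFDerivAt.clm_apply (hasFDerivAt_id p)
  have h2 : HasFDerivAt (fun q => fderiv ℝ f q v) _ p :=
    hdd.hasFDerivAt.clm_apply (hasFDerivAt_const v p)
  have hsymm : fderiv ℝ (fderiv ℝ f) p v p = fderiv ℝ (fderiv ℝ f) p p v :=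
    (hf.contDiffAt.isSymmSndFDerivAt
      (by simpa using WithTop.coe_le_coe.2 (le_top : (2 : ℕ∞) ≤ ⊤))).eq v p
  rw [h1.fderiv, h2.fderiv]
  simp [hsymm]

/-- Euler's identity for the leading homogeneous part. -/
theorem sub_radial (hf : ContDiff ℝ (⊤ : ℕ∞) f) (hr : VanishesToOrder (r + 1) f) :
    VanishesToOrder (r + 2) (fun p => f p + (-((r : ℂ) + 1)⁻¹) * fderiv ℝ f p p) := by
  induction r generalizing f with
  | zero =>
    refine ⟨by simp [hr.1], fun v => ⟨?_, fun v' => trivial⟩⟩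
    beta_reduce
    rw [fderiv_fun_add (hf.differentiable (by simp) _)
      (((contDiff_radial hf).differentiable (by simp) _).const_mul _),
      fderiv_const_mul ((contDiff_radial hf).differentiable (by simp) _)]
    simp [fderiv_radial hf]
  | succ r ih =>
    refine ⟨by simp [hr.1], fun v => ?_⟩
    -- The derivative of f − (r+2)⁻¹ p·∇f along v is (r+1)/(r+2) times the expression f_v − (r+1)⁻¹
    -- p·∇f_v of the previous step, because ∂_v (p·∇f) = f_v + p·∇f_v.
    have h1 := (ih (contDiff_fderiv_apply hf v) (hr.2 v)).const_mul
      ((contDiff_fderiv_apply hf v).add (contDiff_const.mul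
        (contDiff_radial (contDiff_fderiv_apply hf v)))) (((r : ℂ) + 1) / ((r : ℂ) + 1 + 1))
    convert h1 using 2 with p
    have e1 : ((r : ℂ) + 1) ≠ 0 := by exact_mod_cast (Nat.succ_ne_zero r)
    have e2 : ((r : ℂ) + 1 + 1) ≠ 0 := by exact_mod_cast (Nat.succ_ne_zero (r + 1))
    rw [fderiv_fun_add (hf.differentiable (by simp) _)
      (((contDiff_radial hf).differentiable (by simp) _).const_mul _),
      fderiv_const_mul ((contDiff_radial hf).differentiable (by simp) _)]
    simp only [_root_.add_apply, _root_.smul_apply, fderiv_radial hf,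
      smul_eq_mul]
    push_cast
    field_simp
    ring

/-- Taylor's estimate by induction: the first derivatives vanish to one order less, and the mean
value inequality on the ball of radius ‖p‖ restores the missing factor ‖p‖. -/
theorem exists_bound [FiniteDimensional ℝ E] (hf : ContDiff ℝ (⊤ : ℕ∞) f)
    (hr : VanishesToOrder r f) (R : ℝ) : ∃ C, ∀ p ∈ Metric.ball (0 : E) R, ‖f p‖ ≤ C * ‖p‖ ^ r := by
  induction r generalizing f with
  | zero =>
    obtain ⟨C, hC⟩ := (isCompact_closedBall (0 : E) R).exists_bound_of_continuousOn
      hf.continuous.continuousOn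
    exact ⟨C, fun p hp => by simpa using hC p (Metric.ball_subset_closedBall hp)⟩
  | succ r ih =>
    let b := Module.finBasis ℝ E
    choose C hC using fun j => ih (contDiff_fderiv_apply hf (b j)) (hr.2 (b j))
    obtain ⟨A, hA0, hA⟩ := b.exists_opNorm_le (F := ℂ)
    refine ⟨A * ∑ j, |C j|, fun p hp => ?_⟩
    have hball : ∀ q ∈ Metric.closedBall (0 : E) ‖p‖,
        ‖fderiv ℝ f q‖ ≤ A * (∑ j, |C j|) * ‖p‖ ^ r := by
      intro q hq
      have hqp : ‖q‖ ≤ ‖p‖ := by simpa using hq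
      have hqR : q ∈ Metric.ball (0 : E) R := by
        rw [mem_ball_zero_iff] at hp ⊢
        exact hqp.trans_lt hp
      rw [mul_assoc]
      refine hA (u := fderiv ℝ f q) (M := (∑ j, |C j|) * ‖p‖ ^ r) (by positivity)
        fun j => (hC j q hqR).trans ?_
      calc C j * ‖q‖ ^ r ≤ |C j| * ‖q‖ ^ r := by gcongr; exact le_abs_self _
        _ ≤ |C j| * ‖p‖ ^ r := by gcongr
        _ ≤ _ := by
          gcongr
          exact Finset.single_le_sum (f := fun j => |C j|) (fun _ _ => abs_nonneg _)
            (Finset.mem_univ j)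
    have := (convex_closedBall (0 : E) ‖p‖).norm_image_sub_le_of_norm_fderiv_le (𝕜 := ℝ)
      (fun q _ => hf.differentiable (by simp) q) hball (x := 0) (y := p) (by simp) (by simp)
    rw [hr.1, sub_zero, sub_zero] at this
    calc _ ≤ _ := this
      _ = _ := by ring

end VanishesToOrder

/-- A function that vanishes to order `r` is a symbol of weight `(h + ‖p‖) ^ r`. -/
theorem VanishesToOrder.isSymbol [FiniteDimensional ℝ E] {f : E → ℂ} {r : ℕ}
    (hf : ContDiff ℝ (⊤ : ℕ∞) f) (hr : VanishesToOrder r f) (R : ℝ) {h : P → ℝ}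
    (h0 : ∀ i, 0 < h i) (h1 : ∀ i, h i ≤ 1) :
    IsSymbol (Metric.ball (0 : E) R) (fun i p => h i + ‖p‖) (fun i p => (h i + ‖p‖) ^ r)
      (fun _ => f) := by
  intro k
  have hpos : ∀ i (p : E), 0 < h i + ‖p‖ := fun i p =>
    add_pos_of_pos_of_nonneg (h0 i) (norm_nonneg p)
  have hb : ∀ {f : E → ℂ} {r : ℕ}, ContDiff ℝ (⊤ : ℕ∞) f → VanishesToOrder r f →
      ∃ C, ∀ i, ∀ p ∈ Metric.ball (0 : E) R, ‖f p‖ ≤ C * (h i + ‖p‖) ^ r := by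
    intro f r hf hr
    obtain ⟨C, hC⟩ := hr.exists_bound hf R
    refine ⟨|C|, fun i p hp => (hC p hp).trans ?_⟩
    calc C * ‖p‖ ^ r ≤ |C| * ‖p‖ ^ r := by gcongr; exact le_abs_self _
      _ ≤ _ := by
        gcongr
        linarith [h0 i]
  induction k generalizing f r with
  | zero => exact hb hf hr
  | succ k ih =>
    refine ⟨hb hf hr, fun i p _ => hf.differentiable (by simp) p, fun v => ?_⟩
    cases r with
    | zero =>
      -- At order zero the derivative is merely bounded, which suffices: h + ‖p‖ is bounded on the
      -- ball, so 1 is at most a multiple of 1/(h + ‖p‖).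
      refine (ih (r := 0) (contDiff_fderiv_apply hf v) trivial).mono_weight
        (fun i p _ => hpos i p) (fun i p _ => by simp) ⟨1 + |R|, fun i p hp => ?_⟩
      rw [mem_ball_zero_iff] at hp
      simp only [pow_zero, ← mul_div_assoc, mul_one]
      rw [le_div_iff₀ (hpos i p)]
      linarith [h1 i, le_abs_self R]
    | succ r =>
      refine (ih (contDiff_fderiv_apply hf v) (hr.2 v)).congr_weight fun i p _ => ?_
      have := (hpos i p).ne'
      field_simp
      ring

section Oscillatory

variable [FiniteDimensional ℝ E] [MeasurableSpace E] [BorelSpace E] {μ : Measure E}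
  [μ.IsAddHaarMeasure]

local notation "d" => Module.finrank ℝ E

/-- Substitute p = hq; the constant is the integral for h = 1, finite because N > d. -/
theorem integral_add_norm_pow (μ : Measure E) [μ.IsAddHaarMeasure] {N : ℕ} (hN : d < N) :
    ∃ C, ∀ h : ℝ, 0 < h → Integrable (fun p : E => ((h + ‖p‖) ^ N)⁻¹) μ ∧
      ∫ p, ((h + ‖p‖) ^ N)⁻¹ ∂μ = C * (h ^ d / h ^ N) := by
  have hI : Integrable (fun p : E => ((1 + ‖p‖) ^ N)⁻¹) μ := by
    have := integrable_one_add_norm (μ := μ) (E := E) (r := N) (by exact_mod_cast hN)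
    refine this.congr (Eventually.of_forall fun p => ?_)
    simp only
    rw [Real.rpow_neg (by positivity), Real.rpow_natCast]
  refine ⟨∫ p, ((1 + ‖p‖) ^ N)⁻¹ ∂μ, fun h hh => ?_⟩
  have he : (fun p : E => ((h + ‖p‖) ^ N)⁻¹) =
      fun p => (h ^ N)⁻¹ * ((1 + ‖h⁻¹ • p‖) ^ N)⁻¹ := by
    ext p
    rw [← mul_inv, ← mul_pow, norm_smul, norm_inv, Real.norm_of_nonneg hh.le, mul_add, mul_one,
      mul_inv_cancel_left₀ hh.ne']
  rw [he]
  refine ⟨((integrable_comp_smul_iff μ (fun p : E => ((1 + ‖p‖) ^ N)⁻¹)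
    (inv_ne_zero hh.ne')).mpr hI).const_mul _, ?_⟩
  rw [integral_const_mul, Measure.integral_comp_inv_smul μ (fun p : E => ((1 + ‖p‖) ^ N)⁻¹) h,
    abs_of_pos (by positivity), smul_eq_mul]
  ring

/-- The scale-invariant estimate for oscillatory integrals near a nondegenerate critical point. -/
theorem norm_integral_le_of_isSymbol {ι : Type*} [Fintype ι] (e : ι → E) {R : ℝ} {h : P → ℝ}
    (h0 : ∀ i, 0 < h i) {Ψ : P → E → ℂ} (hΨ : ∀ i, ContDiff ℝ (⊤ : ℕ∞) (Ψ i))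
    (him : ∀ i, ∀ p ∈ Metric.ball (0 : E) R, 0 ≤ (Ψ i p).im)
    (hG : ∀ j, IsSymbol (Metric.ball (0 : E) R) (fun i p => h i + ‖p‖) (fun i p => h i + ‖p‖)
      (fun i p => fderiv ℝ (Ψ i) p (e j)))
    {c : ℝ} (hc : 0 < c) (hlow : ∀ i, ∀ p ∈ Metric.ball (0 : E) R,
      c * ‖p‖ ^ 2 ≤ ∑ j, ‖fderiv ℝ (Ψ i) p (e j)‖ ^ 2)
    {r : ℕ} {f : P → E → ℂ} (hf : ∀ i, ContDiff ℝ (⊤ : ℕ∞) (f i))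
    (hfc : ∀ i, HasCompactSupport (f i)) (hfU : ∀ i, tsupport (f i) ⊆ Metric.ball (0 : E) R)
    (hfs : IsSymbol (Metric.ball (0 : E) R) (fun i p => h i + ‖p‖)
      (fun i p => (h i + ‖p‖) ^ r) f) :
    ∃ C, ∀ i, ‖∫ p, Complex.exp (Complex.I * Ψ i p / (h i : ℂ) ^ 2) * f i p ∂μ‖ ≤
      C * h i ^ (d + r) := by
  set U := Metric.ball (0 : E) R with hUdef
  have hU : IsOpen U := Metric.isOpen_ball
  set lam : P → E → ℝ := fun i p => h i + ‖p‖ with hlamdef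
  have hpos : ∀ i (p : E), 0 < lam i p := fun i p =>
    add_pos_of_pos_of_nonneg (h0 i) (norm_nonneg p)
  have hlam : ∀ i, ∀ p ∈ U, 0 < lam i p := fun i p _ => hpos i p
  have hlam' : ∀ i, ∀ p ∈ U, 0 ≤ lam i p := fun i p _ => (hpos i p).le
  set G : P → ι → E → ℂ := fun i j p => fderiv ℝ (Ψ i) p (e j) with hGdef
  -- D = h² + |∇Ψ|² is comparable with (h + ‖p‖)². As ∂ⱼW = iGⱼW/h² for W = e^{iΨ/h²}, the operator
  -- (h²/D)(1 − i ∑ conj(Gⱼ) ∂ⱼ) fixes W.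
  set D : P → E → ℂ := fun i p => (h i : ℂ) ^ 2 + ∑ j, (starRingEnd ℂ) (G i j p) * G i j p
    with hDdef
  have hDval : ∀ i p, D i p = ((h i ^ 2 + ∑ j, ‖G i j p‖ ^ 2 : ℝ) : ℂ) := by
    intro i p
    simp only [hDdef]
    push_cast
    congr 1
    refine Finset.sum_congr rfl fun j _ => ?_
    rw [mul_comm, Complex.mul_conj, Complex.normSq_eq_norm_sq]
    push_cast
    rfl
  have hDpos : ∀ i p, 0 < h i ^ 2 + ∑ j, ‖G i j p‖ ^ 2 := fun i p =>
    add_pos_of_pos_of_nonneg (pow_pos (h0 i) 2) (Finset.sum_nonneg fun j _ => by positivity)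
  have hDne : ∀ i p, D i p ≠ 0 := fun i p => by
    rw [hDval]
    exact_mod_cast (hDpos i p).ne'
  have hDlow : ∃ c > 0, ∀ i, ∀ p ∈ U, c * lam i p ^ 2 ≤ ‖D i p‖ := by
    refine ⟨min 1 c / 2, by positivity, fun i p hp => ?_⟩
    rw [hDval, Complex.norm_of_nonneg (hDpos i p).le]
    have h2 := hlow i p hp
    have h3 : lam i p ^ 2 ≤ 2 * (h i ^ 2 + ‖p‖ ^ 2) := by
      simp only [hlamdef]
      nlinarith [sq_nonneg (h i - ‖p‖)]
    calc min 1 c / 2 * lam i p ^ 2 ≤ min 1 c / 2 * (2 * (h i ^ 2 + ‖p‖ ^ 2)) := by gcongr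
      _ = min 1 c * h i ^ 2 + min 1 c * ‖p‖ ^ 2 := by ring
      _ ≤ 1 * h i ^ 2 + c * ‖p‖ ^ 2 := by
        gcongr
        · exact min_le_left _ _
        · exact min_le_right _ _
      _ ≤ _ := by rw [one_mul]; gcongr
  have hh2 : IsSymbol U lam (fun i _ => h i ^ 2) (fun i _ => (h i : ℂ) ^ 2) :=
    IsSymbol.const_weight hlam _ _ ⟨1, fun i => by simp⟩
  have hGc : ∀ j, IsSymbol U lam lam (fun i p => (starRingEnd ℂ) (G i j p)) := fun j =>
    (hG j).conj hU
  have hDs : IsSymbol U lam (fun i p => lam i p ^ 2) D := by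
    refine IsSymbol.add hU (hh2.mono_weight hlam (fun i p _ => by positivity)
      ⟨1, fun i p _ => ?_⟩) (IsSymbol.sum hU hlam (fun i p _ => by positivity) _ _ fun j _ => ?_)
    · rw [one_mul]
      have := h0 i
      simp only [hlamdef]
      gcongr
      linarith [norm_nonneg p]
    · exact ((hGc j).mul hU hlam hlam' hlam' (hG j)).congr_weight fun i p _ => by ring
  have hDi := hDs.inv hU hlam (fun i p hp => pow_pos (hlam i p hp) 2) hDlow
  set C₀ : P → E → ℂ := fun i p => (h i : ℂ) ^ 2 * (D i p)⁻¹ with hC₀def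
  set Cf : P → ι → E → ℂ := fun i j p =>
    (-Complex.I) * ((starRingEnd ℂ) (G i j p) * ((h i : ℂ) ^ 2 * (D i p)⁻¹)) with hCdef
  -- Gain of each integration by parts: the factor (h/(h + ‖p‖))², harmless inside the ball of
  -- radius h and small outside it.
  set m : P → E → ℝ := fun i p => h i ^ 2 * (lam i p ^ 2)⁻¹ with hmdef
  have hm : ∀ i, ∀ p ∈ U, 0 ≤ m i p := fun i p _ => by positivity
  have hC₀s : IsSymbol U lam m C₀ :=
    hh2.mul hU hlam (fun i p _ => by positivity) (fun i p _ => by positivity) hDi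
  have hCs : ∀ j, IsSymbol U lam (fun i p => m i p * lam i p) (fun i => Cf i j) := fun j =>
    (((hGc j).mul hU hlam hlam' hm hC₀s).const_mul hU hlam
      (fun i p hp => mul_nonneg (hlam' i p hp) (hm i p hp)) (fun _ => -Complex.I)
      ⟨1, fun _ => by simp⟩).congr_weight fun i p _ => mul_comm _ _
  have hGd : ∀ i j, ContDiff ℝ (⊤ : ℕ∞) (G i j) := fun i j => contDiff_fderiv_apply (hΨ i) (e j)
  have hGcd : ∀ i j, ContDiff ℝ (⊤ : ℕ∞) (fun p => (starRingEnd ℂ) (G i j p)) := fun i j =>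
    Complex.conjCLE.contDiff.comp (hGd i j)
  have hDd : ∀ i, ContDiff ℝ (⊤ : ℕ∞) (D i) := fun i =>
    contDiff_const.add (ContDiff.sum fun j _ => (hGcd i j).mul (hGd i j))
  have hC₀d : ∀ i, ContDiff ℝ (⊤ : ℕ∞) (C₀ i) := fun i =>
    contDiff_const.mul ((hDd i).inv (hDne i))
  have hCd : ∀ i j, ContDiff ℝ (⊤ : ℕ∞) (Cf i j) := fun i j =>
    contDiff_const.mul ((hGcd i j).mul (hC₀d i))
  set W : P → E → ℂ := fun i p => Complex.exp (Complex.I * Ψ i p / (h i : ℂ) ^ 2) with hWdef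
  have hWd : ∀ i, ContDiff ℝ (⊤ : ℕ∞) (W i) := fun i =>
    ((contDiff_const.mul (hΨ i)).div_const _).cexp
  have hWf : ∀ i p v, fderiv ℝ (W i) p v = W i p * (Complex.I * fderiv ℝ (Ψ i) p v /
      (h i : ℂ) ^ 2) := fun i p v => by
    have h1 := (((hΨ i).differentiable (by simp) p).hasFDerivAt.const_mul Complex.I).mul_const
      (((h i : ℂ) ^ 2)⁻¹)
    have hWe : W i = fun p => Complex.exp (Complex.I * Ψ i p * ((h i : ℂ) ^ 2)⁻¹) := by
      funext p
      simp only [hWdef, div_eq_mul_inv]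
    rw [hWe, h1.cexp.fderiv]
    simp only [_root_.smul_apply, smul_eq_mul, div_eq_mul_inv]
    ring
  have hhne : ∀ i, (h i : ℂ) ≠ 0 := fun i => by exact_mod_cast (h0 i).ne'
  have hrel : ∀ i, ∀ p ∈ U, C₀ i p * W i p + ∑ j, Cf i j p * fderiv ℝ (W i) p (e j) = W i p := by
    intro i p _
    have h1 : ∀ j, Cf i j p * fderiv ℝ (W i) p (e j) =
        (starRingEnd ℂ) (G i j p) * G i j p * ((D i p)⁻¹ * W i p) := fun j => by
      rw [hWf]
      simp only [hCdef, hGdef]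
      have := hhne i
      have h4 : Complex.I * Complex.I = -1 := Complex.I_mul_I
      field_simp
      linear_combination (-((starRingEnd ℂ) (fderiv ℝ (Ψ i) p (e j)) *
        (D i p)⁻¹ * W i p * fderiv ℝ (Ψ i) p (e j))) * h4
    simp only [h1, ← Finset.sum_mul, hC₀def]
    have h2 : ∑ j, (starRingEnd ℂ) (G i j p) * G i j p = D i p - (h i : ℂ) ^ 2 := by
      simp [hDdef]
    rw [h2]
    have := hDne i p
    field_simp
    ring
  -- After n steps the integrand is bounded by h^{2n} (h + ‖p‖)^{−(r+2d+2)}, which is integrable;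
  -- its integral is of order h^{2n + d − (r+2d+2)} = h^{d+r}.
  set n := r + d + 1 with hn
  obtain ⟨A, hA0, hA⟩ := (IsSymbol.transport_iterate (e := e) hU hlam
    (fun i p _ => pow_nonneg (hpos i p).le r) hm hC₀s hCs hfs n).bound_pos
    fun i p hp => mul_nonneg (pow_nonneg (hpos i p).le r) (pow_nonneg (hm i p hp) n)
  obtain ⟨B, hB⟩ := integral_add_norm_pow μ (N := r + 2 * d + 2) (E := E) (by omega)
  refine ⟨A * B, fun i => ?_⟩
  have hint : ∫ p, W i p * f i p ∂μ =
      ∫ p, W i p * (transport e (C₀ i) (Cf i))^[n] (f i) p ∂μ :=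
    integral_transport_iterate hU ((hWd i).of_le (by simp)).contDiffOn (hC₀d i).contDiffOn
      (fun j => (hCd i j).contDiffOn) (hrel i) (hf i).contDiffOn (hfc i) (hfU i) n
  rw [hint]
  obtain ⟨hI, hIv⟩ := hB (h i) (h0 i)
  have hbd : ∀ p, ‖W i p * (transport e (C₀ i) (Cf i))^[n] (f i) p‖ ≤
      A * h i ^ (2 * n) * ((h i + ‖p‖) ^ (r + 2 * d + 2))⁻¹ := by
    intro p
    by_cases hp : p ∈ U
    · have hW1 : ‖W i p‖ ≤ 1 := by
        simp only [hWdef]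
        rw [Complex.norm_exp, Real.exp_le_one_iff]
        have : (Complex.I * Ψ i p / (h i : ℂ) ^ 2).re = -((Ψ i p).im / h i ^ 2) := by
          rw [← Complex.ofReal_pow, Complex.div_ofReal_re]
          simp
          ring
        rw [this, neg_nonpos]
        exact div_nonneg (him i p hp) (by positivity)
      rw [norm_mul]
      calc _ ≤ 1 * (A * (lam i p ^ r * m i p ^ n)) :=
            mul_le_mul hW1 (hA i p hp) (norm_nonneg _) zero_le_one
        _ = _ := by
          have := (hpos i p).ne'
          change _ = A * h i ^ (2 * n) * (lam i p ^ (r + 2 * d + 2))⁻¹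
          have e1 : lam i p ^ (2 * n) = lam i p ^ r * lam i p ^ (r + 2 * d + 2) := by
            rw [hn, ← pow_add]
            congr 1
            ring
          have e2 : lam i p ^ r ≠ 0 := pow_ne_zero _ this
          simp only [hmdef, mul_pow, inv_pow, ← pow_mul]
          rw [e1, mul_inv, one_mul]
          field_simp
    · have h1 : (transport e (C₀ i) (Cf i))^[n] (f i) p = 0 :=
        image_eq_zero_of_notMem_tsupport fun hp' =>
          hp (hfU i (tsupport_transport_iterate_subset n hp'))
      rw [h1, mul_zero, norm_zero]
      have := hpos i p
      have := h0 i
      positivity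
  refine (norm_integral_le_of_norm_le (hI.const_mul _) (Eventually.of_forall hbd)).trans_eq ?_
  rw [integral_const_mul, hIv, hn]
  have := (h0 i).ne'
  field_simp
  ring

end Oscillatory

end SymbolCalculus

/-! ### Phases near a nondegenerate critical point and the gain at odd orders. -/

namespace SymbolCalculus

variable {E : Type*} [NormedAddCommGroup E] [NormedSpace ℝ E]

theorem fderiv_half_quadratic {β : E →L[ℝ] E →L[ℝ] ℂ} (hβ : ∀ p v, β p v = β v p) (p v : E) :
    fderiv ℝ (fun p => (1 / 2 : ℂ) * β p p) p v = β p v := by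
  have h1 : HasFDerivAt (fun p => β p p) _ p :=
    β.hasFDerivAt.clm_apply (hasFDerivAt_id p)
  have h2 := h1.const_mul (1 / 2 : ℂ)
  rw [h2.fderiv]
  simp [hβ v p]
  ring

theorem contDiff_quadratic (β : E →L[ℝ] E →L[ℝ] ℂ) :
    ContDiff ℝ (⊤ : ℕ∞) (fun p => (1 / 2 : ℂ) * β p p) :=
  contDiff_const.mul (β.contDiff.clm_apply contDiff_id)

variable {ι : Type*} [Fintype ι]

/-- `hc` is the form in which nondegeneracy of β is used throughout: the coordinates of p are
recovered from the numbers β(p, b_k), so these numbers cannot all be small compared with ‖p‖. -/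
theorem exists_norm_le_sum_of_span (b : Module.Basis ι ℝ E) {β : E →L[ℝ] E →L[ℝ] ℂ}
    {c : ι → ι → ℂ} (hc : ∀ p j, ((b.repr p j : ℝ) : ℂ) = ∑ k, c j k * β p (b k)) :
    ∃ A > 0, ∀ p, ‖p‖ ≤ A * ∑ k, ‖β p (b k)‖ := by
  refine ⟨1 + ∑ j, ∑ k, ‖c j k‖ * ‖b j‖, by positivity, fun p => ?_⟩
  have h1 : ‖p‖ ≤ ∑ j, |b.repr p j| * ‖b j‖ := by
    conv_lhs => rw [← b.sum_repr p]
    refine (norm_sum_le _ _).trans (Finset.sum_le_sum fun j _ => ?_)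
    rw [norm_smul, Real.norm_eq_abs]
  have h2 : ∀ j, |b.repr p j| * ‖b j‖ ≤ (∑ k, ‖c j k‖ * ‖b j‖) * ∑ k, ‖β p (b k)‖ := fun j => by
    have : |b.repr p j| = ‖((b.repr p j : ℝ) : ℂ)‖ := by simp
    rw [this, hc, ← Finset.sum_mul, mul_right_comm]
    gcongr
    refine (norm_sum_le _ _).trans ?_
    rw [Finset.sum_mul]
    refine Finset.sum_le_sum fun k _ => ?_
    rw [norm_mul]
    gcongr
    exact Finset.single_le_sum (f := fun k => ‖β p (b k)‖) (fun _ _ => norm_nonneg _)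
      (Finset.mem_univ k)
  refine (h1.trans (Finset.sum_le_sum fun j _ => h2 j)).trans ?_
  rw [← Finset.sum_mul]
  gcongr
  linarith

/-- Nondegeneracy of the gradients along the segment from `½ β(p,p)` to `½ β(p,p) + g`. -/
theorem exists_gradient_lower_bound [FiniteDimensional ℝ E] (b : Module.Basis ι ℝ E)
    {β : E →L[ℝ] E →L[ℝ] ℂ}
    {c : ι → ι → ℂ} (hc : ∀ p j, ((b.repr p j : ℝ) : ℂ) = ∑ k, c j k * β p (b k))
    {g : E → ℂ} (hg : ContDiff ℝ (⊤ : ℕ∞) g) (hg3 : VanishesToOrder 3 g) :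
    ∃ R > 0, ∃ a > 0, ∀ s : ℝ, 0 ≤ s → s ≤ 1 → ∀ p ∈ Metric.ball (0 : E) R,
      a * ‖p‖ ^ 2 ≤ ∑ j, ‖β p (b j) + (s : ℂ) * fderiv ℝ g p (b j)‖ ^ 2 := by
  obtain ⟨A, hA0, hA⟩ := exists_norm_le_sum_of_span b hc
  choose B hB using fun j => (hg3.2 (b j)).exists_bound (contDiff_fderiv_apply hg (b j)) 1
  set D := ∑ j, |B j| with hD
  have hD0 : 0 ≤ D := Finset.sum_nonneg fun _ _ => abs_nonneg _
  -- On this ball the gradient of the cubic part, at most D‖p‖², satisfies A·D‖p‖² ≤ ‖p‖/2 and is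
  -- absorbed. The second constant comes from ‖p‖ ≤ 2AS and the Cauchy–Schwarz inequality for S.
  refine ⟨min 1 (1 / (2 * A * D + 1)), by positivity,
    1 / (4 * A ^ 2 * (Fintype.card ι + 1)), by positivity, fun s hs0 hs1 p hp => ?_⟩
  rw [mem_ball_zero_iff, lt_min_iff] at hp
  set S := ∑ j, ‖β p (b j) + (s : ℂ) * fderiv ℝ g p (b j)‖ with hS
  have h1 : ∑ k, ‖β p (b k)‖ ≤ S + D * ‖p‖ ^ 2 := by
    rw [hS, hD, Finset.sum_mul, ← Finset.sum_add_distrib]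
    refine Finset.sum_le_sum fun k _ => ?_
    have h2 : ‖(s : ℂ) * fderiv ℝ g p (b k)‖ ≤ |B k| * ‖p‖ ^ 2 := by
      rw [norm_mul, Complex.norm_of_nonneg hs0]
      calc s * ‖fderiv ℝ g p (b k)‖ ≤ 1 * (B k * ‖p‖ ^ 2) :=
            mul_le_mul hs1 (hB k p (by simpa using hp.1)) (norm_nonneg _) zero_le_one
        _ ≤ _ := by rw [one_mul]; gcongr; exact le_abs_self _
    have h3 := norm_sub_le (β p (b k) + (s : ℂ) * fderiv ℝ g p (b k))
      ((s : ℂ) * fderiv ℝ g p (b k))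
    rw [add_sub_cancel_right] at h3
    linarith
  have h2 : ‖p‖ ≤ 2 * A * S := by
    have h3 := (hA p).trans (mul_le_mul_of_nonneg_left h1 hA0.le)
    have h4 : (2 * A * D + 1) * ‖p‖ < 1 := by
      have := hp.2
      rw [lt_div_iff₀ (by positivity)] at this
      linarith
    have h5 : 2 * A * D * ‖p‖ ≤ 1 := by linarith [norm_nonneg p]
    have h6 := mul_le_mul_of_nonneg_right h5 (norm_nonneg p)
    nlinarith
  have h3 : S ^ 2 ≤ (Fintype.card ι + 1) *
      ∑ j, ‖β p (b j) + (s : ℂ) * fderiv ℝ g p (b j)‖ ^ 2 := by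
    have := sq_sum_le_card_mul_sum_sq (s := Finset.univ)
      (f := fun j => ‖β p (b j) + (s : ℂ) * fderiv ℝ g p (b j)‖)
    rw [Finset.card_univ] at this
    refine this.trans ?_
    gcongr
    linarith
  have h4 : ‖p‖ ^ 2 ≤ (2 * A * S) ^ 2 := by gcongr
  rw [div_mul_eq_mul_div, one_mul, div_le_iff₀ (by positivity)]
  nlinarith [mul_le_mul_of_nonneg_left h3 (sq_nonneg (2 * A))]

/-- The parameters `(h, s)`: the semiclassical parameter and the homotopy parameter. -/
abbrev PhaseParam : Type := {x : ℝ × ℝ // 0 < x.1 ∧ x.1 ≤ 1 ∧ 0 ≤ x.2 ∧ x.2 ≤ 1}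

/-- The oscillating factor `exp (i (½ β(p,p) + s g(p)) / h²)`. -/
noncomputable def oscFactor (β : E →L[ℝ] E →L[ℝ] ℂ) (g : E → ℂ) (h s : ℝ) (p : E) : ℂ :=
  Complex.exp (Complex.I * ((1 / 2 : ℂ) * β p p + (s : ℂ) * g p) / (h : ℂ) ^ 2)

section Phase

variable {β : E →L[ℝ] E →L[ℝ] ℂ} {g : E → ℂ}

theorem contDiff_phase (hg : ContDiff ℝ (⊤ : ℕ∞) g) (s : ℝ) :
    ContDiff ℝ (⊤ : ℕ∞) (fun p => (1 / 2 : ℂ) * β p p + (s : ℂ) * g p) :=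
  (contDiff_quadratic β).add (contDiff_const.mul hg)

theorem contDiff_oscFactor (hg : ContDiff ℝ (⊤ : ℕ∞) g) (h s : ℝ) :
    ContDiff ℝ (⊤ : ℕ∞) (oscFactor β g h s) :=
  ((contDiff_const.mul (contDiff_phase hg s)).div_const _).cexp

theorem fderiv_phase (hβ : ∀ p v, β p v = β v p) (hg : ContDiff ℝ (⊤ : ℕ∞) g) (s : ℝ)
    (p v : E) : fderiv ℝ (fun p => (1 / 2 : ℂ) * β p p + (s : ℂ) * g p) p v =
      β p v + (s : ℂ) * fderiv ℝ g p v := by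
  rw [fderiv_fun_add ((contDiff_quadratic β).differentiable (by simp) p)
    ((hg.differentiable (by simp) p).const_mul _),
    fderiv_const_mul (hg.differentiable (by simp) p)]
  simp only [_root_.add_apply, fderiv_half_quadratic hβ]
  rfl

theorem fderiv_oscFactor (hβ : ∀ p v, β p v = β v p) (hg : ContDiff ℝ (⊤ : ℕ∞) g) (h s : ℝ)
    (p v : E) : fderiv ℝ (oscFactor β g h s) p v =
      oscFactor β g h s p * (Complex.I * (β p v + (s : ℂ) * fderiv ℝ g p v) / (h : ℂ) ^ 2) := by
  have h1 := (((contDiff_phase (β := β) hg s).differentiable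
    (by simp) p).hasFDerivAt.const_mul Complex.I).mul_const (((h : ℂ) ^ 2)⁻¹)
  have hWe : oscFactor β g h s = fun p => Complex.exp (Complex.I *
      ((1 / 2 : ℂ) * β p p + (s : ℂ) * g p) * ((h : ℂ) ^ 2)⁻¹) := by
    funext p
    simp only [oscFactor, div_eq_mul_inv]
  rw [hWe, h1.cexp.fderiv]
  simp only [_root_.smul_apply, smul_eq_mul]
  rw [fderiv_phase hβ hg]
  ring

/-- Test functions supported in the ball of radius `R`. -/
structure IsTestOn (R : ℝ) (f : E → ℂ) : Prop where
  smooth : ContDiff ℝ (⊤ : ℕ∞) f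
  supp : tsupport f ⊆ Metric.ball (0 : E) R

theorem IsTestOn.fderiv_apply {R : ℝ} {f : E → ℂ} (hf : IsTestOn R f) (v : E) :
    IsTestOn R (fun p => fderiv ℝ f p v) :=
  ⟨contDiff_fderiv_apply hf.smooth v, (tsupport_fderiv_apply_subset ℝ v).trans hf.supp⟩

theorem IsTestOn.mul_left {R : ℝ} {f g : E → ℂ} (hf : IsTestOn R f)
    (hg : ContDiff ℝ (⊤ : ℕ∞) g) : IsTestOn R (fun p => g p * f p) :=
  ⟨hg.mul hf.smooth, (tsupport_mul_subset_right (f := g)).trans hf.supp⟩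

theorem IsTestOn.hasCompactSupport [FiniteDimensional ℝ E] {R : ℝ} {f : E → ℂ} (hf : IsTestOn R f) :
    HasCompactSupport f :=
  (isCompact_closedBall (0 : E) R).of_isClosed_subset (isClosed_tsupport f)
    (hf.supp.trans Metric.ball_subset_closedBall)

variable [FiniteDimensional ℝ E] [MeasurableSpace E] [BorelSpace E] {μ : Measure E}
  [μ.IsAddHaarMeasure]

local notation "d" => Module.finrank ℝ E

/-- The properties of a phase near its critical point used throughout. -/
structure IsPhaseOn (b : Module.Basis ι ℝ E) (β : E →L[ℝ] E →L[ℝ] ℂ) (c : ι → ι → ℂ)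
    (g : E → ℂ) (R a : ℝ) : Prop where
  symm : ∀ p v, β p v = β v p
  coords : ∀ p j, ((b.repr p j : ℝ) : ℂ) = ∑ k, c j k * β p (b k)
  smooth : ContDiff ℝ (⊤ : ℕ∞) g
  vanish : VanishesToOrder 3 g
  im_nonneg : ∀ s : ℝ, 0 ≤ s → s ≤ 1 → ∀ p ∈ Metric.ball (0 : E) R,
    0 ≤ ((1 / 2 : ℂ) * β p p + (s : ℂ) * g p).im
  pos : 0 < a
  lower : ∀ s : ℝ, 0 ≤ s → s ≤ 1 → ∀ p ∈ Metric.ball (0 : E) R,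
      a * ‖p‖ ^ 2 ≤ ∑ j, ‖β p (b j) + (s : ℂ) * fderiv ℝ g p (b j)‖ ^ 2

theorem IsTestOn.integrable {R : ℝ} {f g : E → ℂ} (hf : IsTestOn R f)
    (hg : ContDiff ℝ (⊤ : ℕ∞) g) : Integrable (fun p => g p * f p) μ :=
  (hf.mul_left hg).smooth.continuous.integrable_of_hasCompactSupport
    (hf.mul_left hg).hasCompactSupport

variable {b : Module.Basis ι ℝ E} {c : ι → ι → ℂ} {R a : ℝ}

theorem IsPhaseOn.norm_integral_le (H : IsPhaseOn b β c g R a) {r : ℕ} {f : E → ℂ}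
    (hf : IsTestOn R f) (hr : VanishesToOrder r f) :
    ∃ C, ∀ i : PhaseParam, ‖∫ p, oscFactor β g i.1.1 i.1.2 p * f p ∂μ‖ ≤
      C * i.1.1 ^ (d + r) := by
  have hU : IsOpen (Metric.ball (0 : E) R) := Metric.isOpen_ball
  have h0 : ∀ i : PhaseParam, 0 < i.1.1 := fun i => i.2.1
  have h1 : ∀ i : PhaseParam, i.1.1 ≤ 1 := fun i => i.2.2.1
  have hlam : ∀ i : PhaseParam, ∀ p ∈ Metric.ball (0 : E) R, 0 < i.1.1 + ‖p‖ := fun i p _ =>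
    add_pos_of_pos_of_nonneg (h0 i) (norm_nonneg p)
  refine norm_integral_le_of_isSymbol (P := PhaseParam) b h0
    (Ψ := fun i p => (1 / 2 : ℂ) * β p p + (i.1.2 : ℂ) * g p)
    (fun i => contDiff_phase H.smooth _) (fun i => H.im_nonneg _ i.2.2.2.1 i.2.2.2.2)
    (fun j => ?_) H.pos (fun i p hp => ?_) (fun _ => hf.smooth) (fun _ => hf.hasCompactSupport)
    (fun _ => hf.supp) (hr.isSymbol hf.smooth R h0 h1)
  · simp only [fderiv_phase H.symm H.smooth]
    have hb1 : VanishesToOrder 1 (fun p => β p (b j)) := ⟨by simp, fun _ => trivial⟩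
    have s1 := hb1.isSymbol (P := PhaseParam) (h := fun i => i.1.1) (f := fun p => β p (b j))
      (β.contDiff.clm_apply contDiff_const) R h0 h1
    have hg1 : VanishesToOrder 1 (fun p => fderiv ℝ g p (b j)) :=
      (H.vanish.2 (b j)).mono (by norm_num)
    have s2 := hg1.isSymbol (P := PhaseParam) (h := fun i => i.1.1)
      (contDiff_fderiv_apply H.smooth (b j)) R h0 h1
    refine (IsSymbol.add hU s1 (IsSymbol.const_mul hU hlam
      (fun i p hp => pow_nonneg (hlam i p hp).le 1) (fun i => (i.1.2 : ℂ)) ⟨1, fun i => ?_⟩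
      s2)).congr_weight fun i p _ => pow_one _
    rw [Complex.norm_of_nonneg i.2.2.2.1]
    exact i.2.2.2.2
  · simp only [fderiv_phase H.symm H.smooth]
    exact H.lower _ i.2.2.2.1 i.2.2.2.2 p hp

/-- One integration by parts: a factor of the gradient of the phase is worth ih² and a derivative of
the amplitude. -/
theorem IsPhaseOn.integral_gradient_mul (H : IsPhaseOn b β c g R a) {f : E → ℂ}
    (hf : IsTestOn R f) (i : PhaseParam) (v : E) :
    ∫ p, oscFactor β g i.1.1 i.1.2 p * ((β p v + (i.1.2 : ℂ) * fderiv ℝ g p v) * f p) ∂μ =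
      Complex.I * (i.1.1 : ℂ) ^ 2 *
        ∫ p, oscFactor β g i.1.1 i.1.2 p * fderiv ℝ f p v ∂μ := by
  have hW := contDiff_oscFactor (β := β) H.smooth i.1.1 i.1.2
  have hz := integral_fderiv_eq_zero (μ := μ) ((hf.mul_left hW).smooth.of_le (by simp) :
    ContDiff ℝ 1 _) (hf.mul_left hW).hasCompactSupport v
  have hh : (i.1.1 : ℂ) ≠ 0 := by exact_mod_cast i.2.1.ne'
  have hpt : ∀ p, oscFactor β g i.1.1 i.1.2 p * ((β p v + (i.1.2 : ℂ) * fderiv ℝ g p v) * f p) =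
      Complex.I * (i.1.1 : ℂ) ^ 2 * (oscFactor β g i.1.1 i.1.2 p * fderiv ℝ f p v) -
      Complex.I * (i.1.1 : ℂ) ^ 2 *
        fderiv ℝ (fun p => oscFactor β g i.1.1 i.1.2 p * f p) p v := by
    intro p
    rw [fderiv_fun_mul (hW.differentiable (by simp) p) (hf.smooth.differentiable (by simp) p)]
    simp only [_root_.add_apply, _root_.smul_apply, smul_eq_mul,
      fderiv_oscFactor H.symm H.smooth]
    field_simp
    linear_combination (oscFactor β g i.1.1 i.1.2 p * f p *
      (β p v + (i.1.2 : ℂ) * fderiv ℝ g p v)) * Complex.I_mul_I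
  simp only [hpt]
  rw [integral_sub, integral_const_mul, integral_const_mul, hz, mul_zero, sub_zero]
  · exact ((hf.fderiv_apply v).integrable hW).const_mul _
  · exact ((((hf.mul_left hW).fderiv_apply v).integrable
      (contDiff_const (c := (1 : ℂ)))).congr (by simp)).const_mul _

/-- This is one power of h better than `IsPhaseOn.norm_integral_le` for the order 2m + 1. By Euler's
identity f equals (2m+1)⁻¹ p·∇f up to order 2m + 2, which is already good enough. In p·∇f the
coordinates of p are combinations of β(p, b_k), that is, of components of the gradient of the phase
up to terms of second order, which again reach the order 2m + 2. A gradient component is exchanged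
for h² and a second derivative of f; that derivative vanishes to the odd order 2m − 1, or is merely
bounded if m = 0. -/
theorem IsPhaseOn.norm_integral_le_of_odd (H : IsPhaseOn b β c g R a) {m : ℕ} {f : E → ℂ}
    (hf : IsTestOn R f) (hr : VanishesToOrder (2 * m + 1) f) :
    ∃ C, ∀ i : PhaseParam, ‖∫ p, oscFactor β g i.1.1 i.1.2 p * f p ∂μ‖ ≤
      C * i.1.1 ^ (d + 2 * m + 2) := by
  induction m using Nat.strong_induction_on generalizing f with
  | _ m ih =>
  have hW := fun i : PhaseParam => contDiff_oscFactor (β := β) H.smooth i.1.1 i.1.2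
  have hterm : ∀ j k, ∃ C, ∀ i : PhaseParam,
      ‖∫ p, oscFactor β g i.1.1 i.1.2 p * (β p (b k) * fderiv ℝ f p (b j)) ∂μ‖ ≤
        C * i.1.1 ^ (d + 2 * m + 2) := by
    intro j k
    have hu := hf.fderiv_apply (b j)
    have h1 : ∃ C, ∀ i : PhaseParam, ‖∫ p, oscFactor β g i.1.1 i.1.2 p *
        fderiv ℝ (fun p => fderiv ℝ f p (b j)) p (b k) ∂μ‖ ≤ C * i.1.1 ^ (d + 2 * m) := by
      cases m with
      | zero => exact H.norm_integral_le (r := 0) (hu.fderiv_apply (b k)) trivial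
      | succ m => exact ih m (by omega) (hu.fderiv_apply (b k)) ((hr.2 (b j)).2 (b k))
    have hv : VanishesToOrder (2 + 2 * m) (fun p => fderiv ℝ g p (b k) * fderiv ℝ f p (b j)) :=
      VanishesToOrder.mul (contDiff_fderiv_apply H.smooth (b k)) hu.smooth (H.vanish.2 (b k))
        (hr.2 (b j))
    obtain ⟨C₁, hC₁⟩ := h1
    obtain ⟨C₂, hC₂⟩ := H.norm_integral_le (μ := μ)
      (hu.mul_left (contDiff_fderiv_apply H.smooth (b k))) hv
    refine ⟨C₁ + |C₂|, fun i => ?_⟩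
    have hpt : ∀ p, oscFactor β g i.1.1 i.1.2 p * (β p (b k) * fderiv ℝ f p (b j)) =
        oscFactor β g i.1.1 i.1.2 p * ((β p (b k) + (i.1.2 : ℂ) * fderiv ℝ g p (b k)) *
          fderiv ℝ f p (b j)) - (i.1.2 : ℂ) * (oscFactor β g i.1.1 i.1.2 p *
          (fderiv ℝ g p (b k) * fderiv ℝ f p (b j))) := fun p => by ring
    simp only [hpt]
    have hcg : ContDiff ℝ (⊤ : ℕ∞) (fun p => β p (b k) + (i.1.2 : ℂ) * fderiv ℝ g p (b k)) :=
      (β.contDiff.clm_apply contDiff_const).add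
        (contDiff_const.mul (contDiff_fderiv_apply H.smooth (b k)))
    rw [integral_sub ((hu.mul_left hcg).integrable (hW i))
      (((hu.mul_left (contDiff_fderiv_apply H.smooth (b k))).integrable (hW i)).const_mul _),
      H.integral_gradient_mul hu i (b k), integral_const_mul]
    refine (norm_sub_le _ _).trans ?_
    rw [norm_mul, norm_mul, norm_mul, Complex.norm_I, one_mul, norm_pow,
      Complex.norm_of_nonneg i.2.1.le, Complex.norm_of_nonneg i.2.2.2.1, add_mul]
    have hi := i.2.1
    refine add_le_add ?_ ?_
    · calc _ ≤ i.1.1 ^ 2 * (C₁ * i.1.1 ^ (d + 2 * m)) := by gcongr; exact hC₁ i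
        _ = _ := by ring
    · calc _ ≤ 1 * (C₂ * i.1.1 ^ (d + (2 + 2 * m))) :=
            mul_le_mul i.2.2.2.2 (hC₂ i) (norm_nonneg _) zero_le_one
        _ ≤ |C₂| * i.1.1 ^ (d + (2 + 2 * m)) := by
            rw [one_mul]; gcongr; exact le_abs_self _
        _ = _ := by ring
  choose C hC using hterm
  have hf1 : IsTestOn R
      (fun p => f p + (-(((2 * m : ℕ) : ℂ) + 1)⁻¹) * fderiv ℝ f p p) := by
    refine ⟨hf.smooth.add (contDiff_const.mul (VanishesToOrder.contDiff_radial hf.smooth)), ?_⟩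
    refine (closure_minimal (fun p hp => ?_) (isClosed_tsupport f)).trans hf.supp
    by_contra hp'
    have h0 := notMem_tsupport_iff_eventuallyEq.mp hp'
    apply hp
    beta_reduce
    rw [h0.fderiv_eq]
    simp [h0.eq_of_nhds]
  obtain ⟨C₀, hC₀⟩ := H.norm_integral_le (μ := μ) hf1 (hr.sub_radial hf.smooth)
  set q : ℂ := (((2 * m : ℕ) : ℂ) + 1)⁻¹ with hq
  refine ⟨C₀ + ∑ j, ∑ k, ‖q‖ * (‖c j k‖ * C j k), fun i => ?_⟩
  have hexp : ∀ p, oscFactor β g i.1.1 i.1.2 p * f p =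
      oscFactor β g i.1.1 i.1.2 p * (f p + -q * fderiv ℝ f p p) +
      ∑ j, ∑ k, q * (c j k * (oscFactor β g i.1.1 i.1.2 p *
        (β p (b k) * fderiv ℝ f p (b j)))) := by
    intro p
    have h1 : fderiv ℝ f p p = ∑ j, ∑ k, c j k * (β p (b k) * fderiv ℝ f p (b j)) := by
      have h2 : fderiv ℝ f p p = ∑ j, ((b.repr p j : ℝ) : ℂ) * fderiv ℝ f p (b j) := by
        conv_lhs => rw [← b.sum_repr p, map_sum]
        simp [b.sum_repr p]
      rw [h2]
      refine Finset.sum_congr rfl fun j _ => ?_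
      rw [H.coords, Finset.sum_mul]
      exact Finset.sum_congr rfl fun k _ => by ring
    have h3 : ∑ j, ∑ k, q * (c j k * (oscFactor β g i.1.1 i.1.2 p *
        (β p (b k) * fderiv ℝ f p (b j)))) =
        q * oscFactor β g i.1.1 i.1.2 p * fderiv ℝ f p p := by
      rw [h1, Finset.mul_sum]
      refine Finset.sum_congr rfl fun j _ => ?_
      rw [Finset.mul_sum]
      exact Finset.sum_congr rfl fun k _ => by ring
    rw [h3]
    ring
  have hint : ∀ j k, Integrable (fun p => q * (c j k * (oscFactor β g i.1.1 i.1.2 p *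
        (β p (b k) * fderiv ℝ f p (b j))))) μ := fun j k =>
    ((((hf.fderiv_apply (b j)).mul_left (β.contDiff.clm_apply contDiff_const)).integrable
      (hW i)).const_mul _).const_mul _
  simp only [hexp]
  rw [integral_add (hf1.integrable (hW i))
    (integrable_finsetSum _ fun j _ => integrable_finsetSum _ fun k _ => hint j k),
    integral_finsetSum _ fun j _ => integrable_finsetSum _ fun k _ => hint j k, add_mul]
  refine (norm_add_le _ _).trans (add_le_add ?_ ?_)
  · refine (hC₀ i).trans_eq ?_
    ring
  · rw [Finset.sum_mul]
    refine (norm_sum_le _ _).trans (Finset.sum_le_sum fun j _ => ?_)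
    rw [integral_finsetSum _ fun k _ => hint j k, Finset.sum_mul]
    refine (norm_sum_le _ _).trans (Finset.sum_le_sum fun k _ => ?_)
    rw [integral_const_mul, integral_const_mul, norm_mul, norm_mul]
    calc _ ≤ ‖q‖ * (‖c j k‖ * (C j k * i.1.1 ^ (d + 2 * m + 2))) := by
          gcongr
          exact hC j k i
      _ = _ := by ring

end Phase

end SymbolCalculus

/-! ### Stationary phase by comparison with a damped Gaussian. -/

namespace SymbolCalculus

variable {E : Type*} [NormedAddCommGroup E] [NormedSpace ℝ E] {ι : Type*} [Fintype ι]
  {β : E →L[ℝ] E →L[ℝ] ℂ} {g : E → ℂ}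

theorem oscFactor_sub_eq_integral (h : ℝ) (p : E) :
    oscFactor β g h 1 p - oscFactor β g h 0 p =
      ∫ s in (0 : ℝ)..1, oscFactor β g h s p * (Complex.I * g p / (h : ℂ) ^ 2) := by
  have hd : ∀ s : ℝ, HasDerivAt (fun s => oscFactor β g h s p)
      (oscFactor β g h s p * (Complex.I * g p / (h : ℂ) ^ 2)) s := fun s => by
    have h1 : HasDerivAt (fun s : ℝ => (s : ℂ)) 1 s := Complex.ofRealCLM.hasDerivAt
    have h2 := (((((h1.mul_const (g p)).const_add ((1 / 2 : ℂ) * β p p)).const_mul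
      Complex.I).div_const ((h : ℂ) ^ 2))).cexp
    simpa [oscFactor] using h2
  rw [intervalIntegral.integral_eq_sub_of_hasDerivAt (f := fun s => oscFactor β g h s p)
    (fun s _ => hd s)]
  refine Continuous.intervalIntegrable ?_ _ _
  exact (continuous_iff_continuousAt.mpr fun s => (hd s).continuousAt).mul continuous_const

variable [FiniteDimensional ℝ E] [MeasurableSpace E] [BorelSpace E] {μ : Measure E}
  [μ.IsAddHaarMeasure] {b : Module.Basis ι ℝ E} {c : ι → ι → ℂ} {R a : ℝ}

local notation "d" => Module.finrank ℝ E

/-- Differentiation in the homotopy parameter brings down ig/h². The amplitude gf vanishes to third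
order, an odd one, so its integral is O(h^{d+4}), uniformly in s; without the odd gain the result
would only be h^{d+1}. -/
theorem IsPhaseOn.norm_homotopy_le (H : IsPhaseOn b β c g R a) {f : E → ℂ}
    (hf : IsTestOn R f) :
    ∃ C, ∀ h : ℝ, 0 < h → h ≤ 1 → ‖∫ p, oscFactor β g h 1 p * f p ∂μ -
      ∫ p, oscFactor β g h 0 p * f p ∂μ‖ ≤ C * h ^ (d + 2) := by
  have hv : VanishesToOrder (2 * 1 + 1) (fun p => g p * f p) :=
    VanishesToOrder.mul (s := 0) H.smooth hf.smooth H.vanish trivial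
  obtain ⟨C, hC⟩ := H.norm_integral_le_of_odd (μ := μ) (hf.mul_left H.smooth) hv
  refine ⟨C, fun h h0 h1 => ?_⟩
  have hW := fun s => contDiff_oscFactor (β := β) H.smooth h s
  rw [← integral_sub (hf.integrable (hW 1)) (hf.integrable (hW 0))]
  set F : E → ℝ → ℂ := fun p s =>
    oscFactor β g h s p * (Complex.I * g p / (h : ℂ) ^ 2) * f p with hF
  have hpt : ∀ p, oscFactor β g h 1 p * f p - oscFactor β g h 0 p * f p =
      ∫ s in Set.Ioc (0 : ℝ) 1, F p s := fun p => by
    rw [← sub_mul, oscFactor_sub_eq_integral, ← intervalIntegral.integral_mul_const,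
      intervalIntegral.integral_of_le zero_le_one]
  simp only [hpt]
  have hcont : Continuous (Function.uncurry F) := by
    have hg := H.smooth.continuous
    have hf' := hf.smooth.continuous
    have hβc : Continuous (fun x : E × ℝ => β x.1 x.1) := by fun_prop
    simp only [hF, Function.uncurry_def, oscFactor]
    fun_prop
  have hint : Integrable (Function.uncurry F) (μ.prod (volume.restrict (Set.Ioc (0 : ℝ) 1))) := by
    have hK : IsCompact (tsupport f ×ˢ Set.Icc (0 : ℝ) 1) :=
      hf.hasCompactSupport.isCompact.prod isCompact_Icc
    have h1 : IntegrableOn (Function.uncurry F) (tsupport f ×ˢ Set.Icc (0 : ℝ) 1)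
        (μ.prod volume) := hcont.continuousOn.integrableOn_compact hK
    have h2 : IntegrableOn (Function.uncurry F) (Set.univ ×ˢ Set.Ioc (0 : ℝ) 1)
        (μ.prod volume) := by
      refine h1.of_forall_sdiff_eq_zero (MeasurableSet.univ.prod measurableSet_Ioc) ?_
      rintro ⟨p, s⟩ ⟨hp, hp'⟩
      have : p ∉ tsupport f := fun hpf => hp' ⟨hpf, Set.Ioc_subset_Icc_self hp.2⟩
      simp [hF, Function.uncurry, image_eq_zero_of_notMem_tsupport this]
    rw [IntegrableOn, ← Measure.prod_restrict, Measure.restrict_univ] at h2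
    exact h2
  rw [integral_integral_swap hint]
  have hb : ∀ s ∈ Set.Ioc (0 : ℝ) 1, ‖∫ p, F p s ∂μ‖ ≤ C * h ^ (d + 2) := by
    intro s hs
    have h2 : ∀ p, F p s = Complex.I / (h : ℂ) ^ 2 * (oscFactor β g h s p * (g p * f p)) :=
      fun p => by simp only [hF]; ring
    simp only [h2]
    rw [integral_const_mul, norm_mul, norm_div, Complex.norm_I, norm_pow,
      Complex.norm_of_nonneg h0.le]
    have h3 := hC ⟨(h, s), h0, h1, hs.1.le, hs.2⟩
    calc _ ≤ 1 / h ^ 2 * (C * h ^ (d + 2 * 1 + 2)) := by gcongr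
      _ = _ := by field_simp; ring
  refine (norm_setIntegral_le_of_norm_le_const (by simp) hb).trans_eq ?_
  simp

theorem exists_exp_neg_sq_le {k : ℝ} (hk : 0 < k) (n : ℕ) :
    ∃ C, ∀ r : ℝ, 0 ≤ r → Real.exp (-(k * r ^ 2)) ≤ C * ((1 + r) ^ n)⁻¹ := by
  refine ⟨n.factorial * Real.exp (1 + 1 / (4 * k)), fun r hr => ?_⟩
  rw [← div_eq_mul_inv, le_div_iff₀ (by positivity)]
  have h1 : (1 + r) ^ n ≤ n.factorial * Real.exp (1 + r) := by
    have := Real.pow_div_factorial_le_exp (1 + r) (by positivity) n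
    rwa [div_le_iff₀ (by positivity), mul_comm] at this
  calc _ ≤ Real.exp (-(k * r ^ 2)) * (n.factorial * Real.exp (1 + r)) := by gcongr
    _ = n.factorial * Real.exp (-(k * r ^ 2) + (1 + r)) := by
      rw [Real.exp_add (-(k * r ^ 2))]; ring
    _ ≤ _ := by
      refine mul_le_mul_of_nonneg_left (Real.exp_le_exp.mpr ?_) (by positivity)
      have : r - k * r ^ 2 ≤ 1 / (4 * k) := by
        rw [le_div_iff₀ (by positivity)]
        nlinarith [sq_nonneg (2 * k * r - 1)]
      linarith

theorem integrable_exp_neg_of_le {ν : E → ℝ} (hν : Continuous ν) {k : ℝ} (hk : 0 < k)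
    (hle : ∀ p, k * ‖p‖ ^ 2 ≤ ν p) : Integrable (fun p => Real.exp (-(ν p))) μ := by
  obtain ⟨C, hC⟩ := exists_exp_neg_sq_le hk (d + 1)
  obtain ⟨B, hB⟩ := integral_add_norm_pow μ (N := d + 1) (Nat.lt_succ_self _)
  refine ((hB 1 one_pos).1.const_mul C).mono' (by fun_prop) (Eventually.of_forall fun p => ?_)
  rw [Real.norm_of_nonneg (Real.exp_pos _).le]
  exact (Real.exp_le_exp.mpr (neg_le_neg (hle p))).trans (hC _ (norm_nonneg p))

/-- A regularized Gaussian integral is concentrated at the origin. -/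
theorem norm_gaussian_tail_le (μ : Measure E) [μ.IsAddHaarMeasure] (b : Module.Basis ι ℝ E)
    (hβ : ∀ p v, β p v = β v p)
    (hc : ∀ p j, ((b.repr p j : ℝ) : ℂ) = ∑ k, c j k * β p (b k))
    (him : ∀ p, 0 ≤ (β p p).im) {ν : E →L[ℝ] E →L[ℝ] ℝ} (hν : ∀ p v, ν p v = ν v p)
    {k₀ : ℝ} (hk₀ : 0 < k₀) (hνle : ∀ p, k₀ * ‖p‖ ^ 2 ≤ ν p p)
    {κ : E → ℂ} (hκ : ContDiff ℝ (⊤ : ℕ∞) κ) (hκc : HasCompactSupport κ)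
    {r : ℝ} (hr : 0 < r) (hκ1 : ∀ p, ‖p‖ < r → κ p = 1) :
    ∃ C, ∃ h₁ > 0, ∀ h : ℝ, 0 < h → h ≤ h₁ →
      ‖∫ p, Complex.exp (Complex.I * ((1 / 2 : ℂ) * β p p) / (h : ℂ) ^ 2 - ((ν p p : ℝ) : ℂ)) *
        (1 - κ p) ∂μ‖ ≤ C * h ^ (d + 2) := by
  obtain ⟨A, hA0, hA⟩ := exists_norm_le_sum_of_span b hc
  set D := ∑ j, ‖ν‖ * ‖b j‖ with hD
  have hD0 : 0 ≤ D := Finset.sum_nonneg fun _ _ => by positivity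
  -- For h ≤ h₁ the term 2ih²ν in the gradient G is at most half of what the nondegeneracy of β
  -- provides.
  set h₁ : ℝ := min 1 (1 / (4 * A * D + 1)) with hh₁
  have hh₁0 : 0 < h₁ := by positivity
  let P : Type := {x : ℝ × ℝ // 0 < x.1 ∧ x.1 ≤ h₁ ∧ 0 < x.2 ∧ x.2 ≤ 1}
  set U : Set E := {p | r / 2 < ‖p‖} with hUdef
  have hU : IsOpen U := isOpen_lt continuous_const continuous_norm
  have one : ∀ (i : P), ∀ p ∈ U, (0 : ℝ) < (fun _ _ => 1 : P → E → ℝ) i p :=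
    fun _ _ _ => zero_lt_one
  have one' : ∀ (i : P), ∀ p ∈ U, (0 : ℝ) ≤ (fun _ _ => 1 : P → E → ℝ) i p :=
    fun _ _ _ => zero_le_one
  have hUpos : ∀ p ∈ U, 0 < ‖p‖ := fun p hp => (half_pos hr).trans hp
  have hn : ∀ (i : P), ∀ p ∈ U, (0 : ℝ) ≤ (fun _ p => ‖p‖ : P → E → ℝ) i p :=
    fun _ p _ => norm_nonneg p
  have hh1 : ∀ i : P, i.1.1 ≤ 1 := fun i => i.2.2.1.trans (min_le_left _ _)
  -- The derivative of the exponent iβ(p,p)/(2h²) − ν(p,p) along b_j is (i/h²) G_j; the damping is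
  -- treated as part of the phase.
  set G : P → ι → E → ℂ := fun i j p =>
    β p (b j) + (2 * Complex.I * (i.1.1 : ℂ) ^ 2) * ((ν p (b j) : ℝ) : ℂ) with hGdef
  have hlin : ∀ L : E →L[ℝ] ℂ, IsSymbol U (fun (_ : P) _ => 1) (fun _ p => ‖p‖)
      (fun _ p => L p) := fun L => by
    refine IsSymbol.of_deriv ⟨‖L‖, fun i p _ => L.le_opNorm p⟩ (fun _ _ _ => by fun_prop)
      fun v => ?_
    simp only [ContinuousLinearMap.fderiv]
    refine (IsSymbol.const one (fun _ => L v) ⟨‖L v‖, fun _ => le_rfl⟩).mono_weight one one'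
      ⟨2 / r, fun i p hp => ?_⟩
    rw [div_one, div_mul_eq_mul_div, le_div_iff₀ hr]
    have : r / 2 < ‖p‖ := hp
    linarith
  have hG : ∀ j, IsSymbol U (fun (_ : P) _ => 1) (fun _ p => ‖p‖) (fun i p => G i j p) := fun j =>
    (hlin (β.flip (b j))).add hU ((hlin (Complex.ofRealCLM.comp (ν.flip (b j)))).const_mul hU one hn
      (fun i : P => 2 * Complex.I * (i.1.1 : ℂ) ^ 2) ⟨2, fun i => by
        simp only [norm_mul, Complex.norm_I, norm_pow, Complex.norm_of_nonneg i.2.1.le,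
          Complex.norm_ofNat, mul_one]
        have := pow_le_one₀ (n := 2) i.2.1.le (hh1 i)
        linarith⟩)
  set Γ : P → E → ℂ := fun i p => ∑ j, (starRingEnd ℂ) (G i j p) * G i j p with hΓdef
  have hΓval : ∀ i p, Γ i p = ((∑ j, ‖G i j p‖ ^ 2 : ℝ) : ℂ) := by
    intro i p
    simp only [hΓdef]
    push_cast
    refine Finset.sum_congr rfl fun j _ => ?_
    rw [mul_comm, Complex.mul_conj, Complex.normSq_eq_norm_sq]
    push_cast
    rfl
  have hΓlow : ∀ i p, 1 / (4 * A ^ 2 * (Fintype.card ι + 1)) * ‖p‖ ^ 2 ≤ ‖Γ i p‖ := by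
    intro i p
    rw [hΓval, Complex.norm_of_nonneg (Finset.sum_nonneg fun _ _ => by positivity)]
    set S := ∑ j, ‖G i j p‖ with hS
    have h1 : ∑ k, ‖β p (b k)‖ ≤ S + 2 * i.1.1 ^ 2 * (D * ‖p‖) := by
      rw [hS, hD, Finset.sum_mul, Finset.mul_sum, ← Finset.sum_add_distrib]
      refine Finset.sum_le_sum fun k _ => ?_
      have h2 : ‖(2 * Complex.I * (i.1.1 : ℂ) ^ 2) * ((ν p (b k) : ℝ) : ℂ)‖ ≤
          2 * i.1.1 ^ 2 * (‖ν‖ * ‖b k‖ * ‖p‖) := by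
        simp only [norm_mul, Complex.norm_I, norm_pow, Complex.norm_of_nonneg i.2.1.le,
          Complex.norm_ofNat, mul_one, Complex.norm_real]
        have := ν.le_opNorm₂ p (b k)
        gcongr
        linarith
      have h3 := norm_sub_le (G i k p) ((2 * Complex.I * (i.1.1 : ℂ) ^ 2) * ((ν p (b k) : ℝ) : ℂ))
      simp only [hGdef, add_sub_cancel_right] at h3
      simp only [hGdef]
      linarith
    have h2 : ‖p‖ ≤ 2 * A * S := by
      have h3 := (hA p).trans (mul_le_mul_of_nonneg_left h1 hA0.le)
      have h4 : (4 * A * D + 1) * i.1.1 ≤ 1 := by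
        have := i.2.2.1.trans (min_le_right _ _)
        rw [le_div_iff₀ (by positivity)] at this
        linarith
      have h5 : 4 * A * D * i.1.1 ^ 2 ≤ 1 := by
        have := i.2.1
        have h6 : i.1.1 ^ 2 ≤ i.1.1 := by nlinarith [hh1 i]
        have h7 : 4 * A * D * i.1.1 ^ 2 ≤ 4 * A * D * i.1.1 := by gcongr
        linarith
      have h6 := mul_le_mul_of_nonneg_right h5 (norm_nonneg p)
      nlinarith
    have h3 : S ^ 2 ≤ (Fintype.card ι + 1) * ∑ j, ‖G i j p‖ ^ 2 := by
      have := sq_sum_le_card_mul_sum_sq (s := Finset.univ) (f := fun j => ‖G i j p‖)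
      rw [Finset.card_univ] at this
      refine this.trans ?_
      gcongr
      linarith
    have h4 : ‖p‖ ^ 2 ≤ (2 * A * S) ^ 2 := by gcongr
    rw [div_mul_eq_mul_div, one_mul, div_le_iff₀ (by positivity)]
    nlinarith [mul_le_mul_of_nonneg_left h3 (sq_nonneg (2 * A))]
  have hΓne : ∀ i, ∀ p ∈ U, Γ i p ≠ 0 := fun i p hp h0 => by
    have h1 := hΓlow i p
    have h2 := hUpos p hp
    rw [h0, norm_zero] at h1
    have : 0 < 1 / (4 * A ^ 2 * ((Fintype.card ι : ℝ) + 1)) * ‖p‖ ^ 2 := by positivity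
    linarith
  have hΓs : IsSymbol U (fun (_ : P) _ => 1) (fun _ p => ‖p‖ * ‖p‖) Γ :=
    IsSymbol.sum hU one (fun _ p _ => by positivity) _ _ fun j _ =>
      (((hG j).conj hU).mul hU one hn hn (hG j))
  have hΓi := hΓs.inv hU one (fun i p hp => mul_pos (hUpos p hp) (hUpos p hp))
    ⟨1 / (4 * A ^ 2 * (Fintype.card ι + 1)), by positivity, fun i p _ => by
      rw [← pow_two]; exact hΓlow i p⟩
  -- Away from the origin Γ = |G|² is bounded below, so no zeroth order term is needed, and every
  -- integration by parts gains h² uniformly.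
  set Cf : P → ι → E → ℂ := fun i j p =>
    (-Complex.I * (i.1.1 : ℂ) ^ 2) * ((starRingEnd ℂ) (G i j p) * (Γ i p)⁻¹) with hCdef
  have hCs : ∀ j, IsSymbol U (fun (_ : P) _ => 1) (fun i p => i.1.1 ^ 2 * 1)
      (fun i => Cf i j) := fun j => by
    have h1 := (IsSymbol.const_weight (U := U) one (fun i : P => -Complex.I * (i.1.1 : ℂ) ^ 2)
      (fun i => i.1.1 ^ 2) ⟨1, fun i => by simp⟩).mul hU one (fun i _ _ => by positivity)
      (fun i p hp => mul_nonneg (norm_nonneg p) (inv_nonneg.mpr (by positivity)))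
      (((hG j).conj hU).mul hU one hn (fun i p _ => inv_nonneg.mpr (by positivity)) hΓi)
    refine h1.mono_weight one (fun i p _ => by positivity) ⟨2 / r, fun i p hp => ?_⟩
    have h2 : ‖p‖ * (‖p‖ * ‖p‖)⁻¹ = ‖p‖⁻¹ := by
      have := (hUpos p hp).ne'
      field_simp
    rw [h2, mul_one, mul_comm]
    have h3 : ‖p‖⁻¹ ≤ 2 / r := by
      have : (r / 2)⁻¹ = 2 / r := by field_simp
      rw [← this]
      exact inv_anti₀ (half_pos hr) (le_of_lt hp)
    gcongr
  have hGd : ∀ i j, ContDiff ℝ (⊤ : ℕ∞) (G i j) := fun i j =>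
    (β.contDiff.clm_apply contDiff_const).add (contDiff_const.mul
      (Complex.ofRealCLM.contDiff.comp (ν.contDiff.clm_apply contDiff_const)))
  have hGcd : ∀ i j, ContDiff ℝ (⊤ : ℕ∞) (fun p => (starRingEnd ℂ) (G i j p)) := fun i j =>
    Complex.conjCLE.contDiff.comp (hGd i j)
  have hΓd : ∀ i, ContDiff ℝ (⊤ : ℕ∞) (Γ i) := fun i =>
    ContDiff.sum fun j _ => (hGcd i j).mul (hGd i j)
  have hCd : ∀ i j, ContDiffOn ℝ (⊤ : ℕ∞) (Cf i j) U := fun i j =>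
    contDiffOn_const.mul ((hGcd i j).contDiffOn.mul ((hΓd i).contDiffOn.inv (hΓne i)))
  set W : ℝ → E → ℂ := fun h p =>
    Complex.exp (Complex.I * ((1 / 2 : ℂ) * β p p) / (h : ℂ) ^ 2 - ((ν p p : ℝ) : ℂ)) with hWdef
  have hWd : ∀ h, ContDiff ℝ (⊤ : ℕ∞) (W h) := fun h =>
    (((contDiff_const.mul (contDiff_quadratic β)).div_const _).sub
      (Complex.ofRealCLM.contDiff.comp (ν.contDiff.clm_apply contDiff_id))).cexp
  have hWf : ∀ h p v, fderiv ℝ (W h) p v = W h p * (Complex.I * β p v / (h : ℂ) ^ 2 -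
      2 * ((ν p v : ℝ) : ℂ)) := fun h p v => by
    have h1 := (((contDiff_quadratic β).differentiable
      (by simp) p).hasFDerivAt.const_mul Complex.I).mul_const (((h : ℂ) ^ 2)⁻¹)
    have h2 : HasFDerivAt (fun p => ((ν p p : ℝ) : ℂ)) _ p := Complex.ofRealCLM.hasFDerivAt.comp p
      (ν.hasFDerivAt.clm_apply (hasFDerivAt_id p))
    have hWe : W h = fun p => Complex.exp (Complex.I *
        ((1 / 2 : ℂ) * β p p) * ((h : ℂ) ^ 2)⁻¹ - ((ν p p : ℝ) : ℂ)) := by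
      funext p
      simp only [hWdef, div_eq_mul_inv]
    rw [hWe, (h1.fun_sub h2).cexp.fderiv]
    simp only [_root_.smul_apply, _root_.sub_apply, smul_eq_mul, fderiv_half_quadratic hβ]
    simp [hν v p]
    ring
  have hWn : ∀ h : ℝ, 0 < h → ∀ p, ‖W h p‖ ≤ Real.exp (-(ν p p)) := fun h hh p => by
    rw [Complex.norm_exp, Real.exp_le_exp]
    have : (Complex.I * ((1 / 2 : ℂ) * β p p) / (h : ℂ) ^ 2).re =
        -((β p p).im / (2 * h ^ 2)) := by
      rw [← Complex.ofReal_pow, Complex.div_ofReal_re]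
      simp
      field_simp
    rw [Complex.sub_re, this, Complex.ofReal_re]
    have : 0 ≤ (β p p).im / (2 * h ^ 2) := div_nonneg (him p) (by positivity)
    linarith
  -- A compactly supported replacement of 1 − κ that vanishes near the origin. Its derivatives are
  -- bounded uniformly in the dilation, and 1 − κ is recovered by dominated convergence as the
  -- dilation tends to zero.
  set f : P → E → ℂ := fun i p => κ (i.1.2 • p) - κ p with hfdef
  have hfd : ∀ i, ContDiff ℝ (⊤ : ℕ∞) (f i) := fun i =>
    (hκ.comp (contDiff_const_smul _)).sub hκ
  have hfc : ∀ i, HasCompactSupport (f i) := fun i =>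
    (hκc.comp_smul i.2.2.2.1.ne').sub hκc
  have hfU : ∀ i, tsupport (f i) ⊆ U := fun i => by
    have h1 : tsupport (f i) ⊆ {p | r ≤ ‖p‖} := by
      refine closure_minimal (fun p hp => ?_) (isClosed_le continuous_const continuous_norm)
      by_contra hlt
      simp only [Set.mem_ofPred_eq, not_le] at hlt
      apply hp
      have h2 : ‖i.1.2 • p‖ < r := by
        rw [norm_smul, Real.norm_of_nonneg i.2.2.2.1.le]
        exact (mul_le_of_le_one_left (norm_nonneg p) i.2.2.2.2).trans_lt hlt
      simp [hfdef, hκ1 p hlt, hκ1 _ h2]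
    refine h1.trans fun p hp => ?_
    have : r ≤ ‖p‖ := hp
    simp only [hUdef, Set.mem_ofPred_eq]
    linarith
  have hfs : IsSymbol U (fun (_ : P) _ => 1) (fun _ _ => 1) f := by
    have h1 := IsSymbol.dilation (P := P) hU (fun i => i.1.2) (fun i => by
      rw [abs_of_pos i.2.2.2.1]; exact i.2.2.2.2) (ContinuousLinearMap.id ℝ E) hκ hκc
    have h2 := IsSymbol.dilation (P := P) hU (fun _ => 1) (fun i => by simp)
      (ContinuousLinearMap.id ℝ E) hκ hκc
    exact (h1.sub hU one one' h2).congr hU fun i p _ => by simp [hfdef]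
  have hC₀s : IsSymbol U (fun (_ : P) _ => 1) (fun i _ => i.1.1 ^ 2) (fun _ _ => 0) :=
    IsSymbol.zero one fun i p _ => by positivity
  obtain ⟨B, hB0, hB⟩ := (IsSymbol.transport_iterate (e := b) hU one one'
    (fun i p _ => by positivity) hC₀s hCs hfs (d + 2)).bound_pos
    (fun i p _ => by positivity)
  have hIν : Integrable (fun p => Real.exp (-(ν p p))) μ :=
    integrable_exp_neg_of_le (by fun_prop) hk₀ hνle
  refine ⟨B * ∫ p, Real.exp (-(ν p p)) ∂μ, h₁, hh₁0, fun h h0 hh => ?_⟩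
  have hbound : ∀ δ : ℝ, 0 < δ → δ ≤ 1 → ‖∫ p, W h p * (κ (δ • p) - κ p) ∂μ‖ ≤
      (B * ∫ p, Real.exp (-(ν p p)) ∂μ) * h ^ (d + 2) := by
    intro δ hδ0 hδ1
    let i : P := ⟨(h, δ), h0, hh, hδ0, hδ1⟩
    have hhne : (h : ℂ) ≠ 0 := by exact_mod_cast h0.ne'
    have hrel : ∀ p ∈ U, 0 * W h p + ∑ j, Cf i j p * fderiv ℝ (W h) p (b j) = W h p := by
      intro p hp
      have h1 : ∀ j, Cf i j p * fderiv ℝ (W h) p (b j) =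
          (starRingEnd ℂ) (G i j p) * G i j p * ((Γ i p)⁻¹ * W h p) := fun j => by
        rw [hWf]
        have : Complex.I * β p (b j) / (h : ℂ) ^ 2 - 2 * ((ν p (b j) : ℝ) : ℂ) =
            Complex.I / (h : ℂ) ^ 2 * G i j p := by
          simp only [hGdef, i]
          field_simp
          linear_combination (-2 * (h : ℂ) ^ 2 * ((ν p (b j) : ℝ) : ℂ)) * Complex.I_mul_I
        rw [this]
        simp only [hCdef]
        have e1 : ((i.1.1 : ℝ) : ℂ) = (h : ℂ) := rfl
        rw [e1]
        field_simp
        linear_combination (-((starRingEnd ℂ) (G i j p) * G i j p * (Γ i p)⁻¹ * W h p)) *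
          Complex.I_mul_I
      rw [Finset.sum_congr rfl fun j _ => h1 j, ← Finset.sum_mul]
      change 0 * W h p + Γ i p * ((Γ i p)⁻¹ * W h p) = W h p
      rw [mul_inv_cancel_left₀ (hΓne i p hp)]
      ring
    have hint : ∫ p, W h p * f i p ∂μ =
        ∫ p, W h p * (transport b (fun _ => 0) (Cf i))^[d + 2] (f i) p ∂μ :=
      integral_transport_iterate hU ((hWd h).of_le (by simp)).contDiffOn contDiffOn_const
        (hCd i) hrel (hfd i).contDiffOn (hfc i) (hfU i) (d + 2)
    change ‖∫ p, W h p * f i p ∂μ‖ ≤ _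
    rw [hint]
    have hbd : ∀ p, ‖W h p * (transport b (fun _ => 0) (Cf i))^[d + 2] (f i) p‖ ≤
        B * h ^ (d + 2) * Real.exp (-(ν p p)) := by
      intro p
      by_cases hp : p ∈ U
      · rw [norm_mul]
        calc _ ≤ Real.exp (-(ν p p)) * (B * (1 * (h ^ 2) ^ (d + 2))) :=
              mul_le_mul (hWn h h0 p) (hB i p hp) (norm_nonneg _) (Real.exp_pos _).le
          _ ≤ Real.exp (-(ν p p)) * (B * (1 * h ^ (d + 2))) := by
              gcongr
              have := hh1 i
              change h ≤ 1 at this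
              nlinarith
          _ = _ := by ring
      · have h1 : (transport b (fun _ => 0) (Cf i))^[d + 2] (f i) p = 0 :=
          image_eq_zero_of_notMem_tsupport fun hp' =>
            hp (hfU i (tsupport_transport_iterate_subset _ hp'))
        rw [h1, mul_zero, norm_zero]
        positivity
    refine (norm_integral_le_of_norm_le (hIν.const_mul _) (Eventually.of_forall hbd)).trans_eq ?_
    rw [integral_const_mul]
    ring
  have hκ0 : κ 0 = 1 := hκ1 0 (by simpa using hr)
  have hlim : Tendsto (fun n : ℕ => ∫ p, W h p * (κ ((1 / ((n : ℝ) + 1)) • p) - κ p) ∂μ) atTop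
      (𝓝 (∫ p, W h p * (1 - κ p) ∂μ)) := by
    obtain ⟨M, hM⟩ := hκc.exists_bound_of_continuous hκ.continuous
    refine tendsto_integral_of_dominated_convergence
      (fun p => 2 * M * Real.exp (-(ν p p))) (fun n => ?_) (hIν.const_mul _)
      (fun n => Eventually.of_forall fun p => ?_) (Eventually.of_forall fun p => ?_)
    · have h1 := (hWd h).continuous
      have h2 := hκ.continuous
      exact Continuous.aestronglyMeasurable (by fun_prop)
    · rw [norm_mul]
      calc _ ≤ Real.exp (-(ν p p)) * (M + M) :=
            mul_le_mul (hWn h h0 p) ((norm_sub_le _ _).trans (add_le_add (hM _) (hM _)))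
              (norm_nonneg _) (Real.exp_pos _).le
        _ = _ := by ring
    · have h1 : Tendsto (fun n : ℕ => (1 / ((n : ℝ) + 1)) • p) atTop (𝓝 ((0 : ℝ) • p)) :=
        tendsto_one_div_add_atTop_nhds_zero_nat.smul_const p
      rw [zero_smul] at h1
      have h2 := (hκ.continuous.tendsto 0).comp h1
      rw [hκ0] at h2
      exact (h2.sub_const _).const_mul _
  refine le_of_tendsto hlim.norm (Eventually.of_forall fun n => hbound _ (by positivity) ?_)
  rw [div_le_one (by positivity)]
  linarith [n.cast_nonneg (α := ℝ)]

/-- **Stationary phase** at a nondegenerate critical point of a phase with nonnegative imaginary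
part, in comparison with a regularized Gaussian integral. -/
theorem stationary_phase (μ : Measure E) [μ.IsAddHaarMeasure] (b : Module.Basis ι ℝ E)
    (hβ : ∀ p v, β p v = β v p)
    (hc : ∀ p j, ((b.repr p j : ℝ) : ℂ) = ∑ k, c j k * β p (b k))
    (him : ∀ p, 0 ≤ (β p p).im) {ν : E →L[ℝ] E →L[ℝ] ℝ} (hν : ∀ p v, ν p v = ν v p)
    {k₀ : ℝ} (hk₀ : 0 < k₀) (hνle : ∀ p, k₀ * ‖p‖ ^ 2 ≤ ν p p)
    (hg : ContDiff ℝ (⊤ : ℕ∞) g) (hg3 : VanishesToOrder 3 g) {R₀ : ℝ} (hR₀ : 0 < R₀)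
    (himg : ∀ p ∈ Metric.ball (0 : E) R₀, 0 ≤ ((1 / 2 : ℂ) * β p p + g p).im) :
    ∃ R > 0, R ≤ R₀ ∧ ∀ f : E → ℂ, IsTestOn R f → ∃ C, ∃ h₁ > 0, ∀ h : ℝ, 0 < h → h ≤ h₁ →
      ‖∫ p, Complex.exp (Complex.I * ((1 / 2 : ℂ) * β p p + g p) / (h : ℂ) ^ 2) * f p ∂μ -
        f 0 * ∫ p, Complex.exp (Complex.I * ((1 / 2 : ℂ) * β p p) / (h : ℂ) ^ 2 -
          ((ν p p : ℝ) : ℂ)) ∂μ‖ ≤ C * h ^ (d + 2) := by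
  obtain ⟨R₁, hR₁, a, ha, hlow⟩ := exists_gradient_lower_bound b hc hg hg3
  set R := min R₀ R₁ with hRdef
  have hR : 0 < R := lt_min hR₀ hR₁
  have H : IsPhaseOn b β c g R a :=
    { symm := hβ
      coords := hc
      smooth := hg
      vanish := hg3
      -- The imaginary part at s is the convex combination of those at 0 and 1.
      im_nonneg := fun s hs0 hs1 p hp => by
        have h1 := himg p (Metric.ball_subset_ball (min_le_left _ _) hp)
        have h2 := him p
        have h3 : ((1 / 2 : ℂ) * β p p + (s : ℂ) * g p).im =
            (1 - s) * ((β p p).im / 2) + s * ((1 / 2 : ℂ) * β p p + g p).im := by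
          simp
          ring
        rw [h3]
        have := mul_nonneg (sub_nonneg.mpr hs1) (half_pos one_pos).le
        have := mul_nonneg (sub_nonneg.mpr hs1) (div_nonneg h2 two_pos.le)
        have := mul_nonneg hs0 h1
        linarith
      pos := ha
      lower := fun s hs0 hs1 p hp =>
        hlow s hs0 hs1 p (Metric.ball_subset_ball (min_le_right _ _) hp) }
  refine ⟨R, hR, min_le_left _ _, fun f hf => ?_⟩
  let κ₀ : ContDiffBump (0 : E) := ⟨R / 4, R / 2, by positivity, by linarith⟩
  set κ : E → ℂ := fun p => ((κ₀ p : ℝ) : ℂ) with hκdef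
  have hκd : ContDiff ℝ (⊤ : ℕ∞) κ := Complex.ofRealCLM.contDiff.comp κ₀.contDiff
  have hκs : tsupport κ ⊆ tsupport κ₀ :=
    closure_mono fun p hp => by simpa [hκdef] using hp
  have hκT : IsTestOn R κ := ⟨hκd, hκs.trans (by
    rw [κ₀.tsupport_eq]
    exact Metric.closedBall_subset_ball (by simp [κ₀]; linarith))⟩
  have hκ1 : ∀ p, ‖p‖ < R / 4 → κ p = 1 := fun p hp => by
    have : κ₀ p = 1 := κ₀.one_of_mem_closedBall (by simpa [κ₀] using hp.le)
    simp [hκdef, this]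
  have hed : ContDiff ℝ (⊤ : ℕ∞) (fun p => Complex.exp (-((ν p p : ℝ) : ℂ))) :=
    (Complex.ofRealCLM.contDiff.comp (ν.contDiff.clm_apply contDiff_id)).neg.cexp
  have hκT' := hκT.mul_left hed
  -- The amplitude f is compared with f(0) times the damped cut-off. The difference vanishes at the
  -- origin, so the estimate for odd orders with m = 0 gives h^{d+2}.
  have hdiffT : IsTestOn R (fun p => f p + -(f 0) * (Complex.exp (-((ν p p : ℝ) : ℂ)) * κ p)) := by
    refine ⟨hf.smooth.add (contDiff_const.mul hκT'.smooth), ?_⟩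
    refine (tsupport_add f _).trans (Set.union_subset hf.supp ?_)
    exact (tsupport_mul_subset_right).trans hκT'.supp
  have hdiffV : VanishesToOrder (2 * 0 + 1)
      (fun p => f p + -(f 0) * (Complex.exp (-((ν p p : ℝ) : ℂ)) * κ p)) := by
    refine ⟨?_, fun _ => trivial⟩
    have : κ 0 = 1 := hκ1 0 (by simpa using by positivity)
    simp [this]
  obtain ⟨C₁, hC₁⟩ := H.norm_integral_le_of_odd (μ := μ) hdiffT hdiffV
  obtain ⟨C₂, hC₂⟩ := H.norm_homotopy_le (μ := μ) hκT'
  obtain ⟨C₃, h₁, hh₁, hC₃⟩ := norm_gaussian_tail_le μ b hβ hc him hν hk₀ hνle hκd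
    hκT.hasCompactSupport (by positivity : 0 < R / 4) hκ1
  refine ⟨C₁ + ‖f 0‖ * (C₂ + C₃), min 1 h₁, by positivity, fun h h0 hh => ?_⟩
  have hh1 : h ≤ 1 := hh.trans (min_le_left _ _)
  have b1 := hC₁ ⟨(h, 1), h0, hh1, zero_le_one, le_rfl⟩
  have b2 := hC₂ h h0 hh1
  have b3 := hC₃ h h0 (hh.trans (min_le_right _ _))
  have hW := fun s => contDiff_oscFactor (β := β) hg h s
  set W : E → ℂ := fun p => Complex.exp (Complex.I * ((1 / 2 : ℂ) * β p p) / (h : ℂ) ^ 2 -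
    ((ν p p : ℝ) : ℂ)) with hWdef
  have hW0 : ∀ p, W p = oscFactor β g h 0 p * Complex.exp (-((ν p p : ℝ) : ℂ)) := fun p => by
    simp only [hWdef, oscFactor]
    rw [← Complex.exp_add]
    congr 1
    simp [sub_eq_add_neg]
  have hWI : Integrable W μ := by
    have hIν : Integrable (fun p => Real.exp (-(ν p p))) μ :=
      integrable_exp_neg_of_le (by fun_prop) hk₀ hνle
    refine hIν.mono' (Continuous.aestronglyMeasurable ?_) (Eventually.of_forall fun p => ?_)
    · have : W = fun p => oscFactor β g h 0 p * Complex.exp (-((ν p p : ℝ) : ℂ)) := funext hW0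
      rw [this]
      exact (hW 0).continuous.mul hed.continuous
    · rw [hWdef, Complex.norm_exp, Real.exp_le_exp]
      have : (Complex.I * ((1 / 2 : ℂ) * β p p) / (h : ℂ) ^ 2).re =
          -((β p p).im / (2 * h ^ 2)) := by
        rw [← Complex.ofReal_pow, Complex.div_ofReal_re]
        simp
        field_simp
      rw [Complex.sub_re, this, Complex.ofReal_re]
      have : 0 ≤ (β p p).im / (2 * h ^ 2) := div_nonneg (him p) (by positivity)
      linarith
  have e1 : ∫ p, oscFactor β g h 1 p *
      (f p + -(f 0) * (Complex.exp (-((ν p p : ℝ) : ℂ)) * κ p)) ∂μ =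
      ∫ p, oscFactor β g h 1 p * f p ∂μ -
        f 0 * ∫ p, oscFactor β g h 1 p * (Complex.exp (-((ν p p : ℝ) : ℂ)) * κ p) ∂μ := by
    rw [← integral_const_mul, ← integral_sub (hf.integrable (hW 1))
      ((hκT'.integrable (hW 1)).const_mul _)]
    congr 1
    ext p
    ring
  have e2 : ∫ p, W p * (1 - κ p) ∂μ = ∫ p, W p ∂μ -
      ∫ p, oscFactor β g h 0 p * (Complex.exp (-((ν p p : ℝ) : ℂ)) * κ p) ∂μ := by
    rw [← integral_sub hWI (hκT'.integrable (hW 0))]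
    congr 1
    ext p
    rw [hW0]
    ring
  have e3 : ∫ p, Complex.exp (Complex.I * ((1 / 2 : ℂ) * β p p + g p) / (h : ℂ) ^ 2) * f p ∂μ =
      ∫ p, oscFactor β g h 1 p * f p ∂μ := by
    simp [oscFactor]
  rw [e3]
  change ‖∫ p, oscFactor β g h 1 p *
      (f p + -(f 0) * (Complex.exp (-((ν p p : ℝ) : ℂ)) * κ p)) ∂μ‖ ≤ _ at b1
  rw [e1] at b1
  rw [e2] at b3
  set X := ∫ p, oscFactor β g h 1 p * f p ∂μ
  set Y₁ := ∫ p, oscFactor β g h 1 p * (Complex.exp (-((ν p p : ℝ) : ℂ)) * κ p) ∂μ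
  set Y₀ := ∫ p, oscFactor β g h 0 p * (Complex.exp (-((ν p p : ℝ) : ℂ)) * κ p) ∂μ
  set Z := ∫ p, W p ∂μ
  -- Three errors: of the amplitude, of the homotopy to the quadratic phase, and of the Gaussian
  -- tail.
  have e4 : X - f 0 * Z = (X - f 0 * Y₁) + f 0 * ((Y₁ - Y₀) - (Z - Y₀)) := by ring
  rw [e4, add_mul]
  refine (norm_add_le _ _).trans (add_le_add (b1.trans_eq (by ring_nf)) ?_)
  rw [norm_mul, mul_assoc]
  gcongr
  rw [add_mul]
  exact (norm_sub_le _ _).trans (add_le_add b2 b3)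

end SymbolCalculus

/-! ### Smoothness of the flow and the differential of the action. -/

theorem hasFDerivAt_intervalIntegral_of_continuousOn {E : Type*} [NormedAddCommGroup E]
    [NormedSpace ℝ E] [LocallyCompactSpace E] {U : Set E} (hU : IsOpen U) {F : E → ℝ → ℝ}
    {F' : E → ℝ → E →L[ℝ] ℝ} (hF : ContinuousOn (fun z : E × ℝ => F z.1 z.2) (U ×ˢ Set.univ))
    (hF' : ContinuousOn (fun z : E × ℝ => F' z.1 z.2) (U ×ˢ Set.univ))
    (hd : ∀ p ∈ U, ∀ s, HasFDerivAt (fun p => F p s) (F' p s) p) {p : E} (hp : p ∈ U) (a b : ℝ) :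
    HasFDerivAt (fun p => ∫ s in a..b, F p s) (∫ s in a..b, F' p s) p := by
  obtain ⟨K, hK, hKU, hKc⟩ := local_compact_nhds (hU.mem_nhds hp)
  have hsec : ∀ q ∈ U, Continuous (F q) := fun q hq => by
    have : Continuous fun s : ℝ => (q, s) := by fun_prop
    rw [← continuousOn_univ] at this ⊢
    exact hF.comp this fun s _ => ⟨hq, trivial⟩
  have hFm : ∀ q ∈ U, Continuous (F' q) := fun q hq => by
    have : Continuous fun s : ℝ => (q, s) := by fun_prop
    rw [← continuousOn_univ] at this ⊢
    exact hF'.comp this fun s _ => ⟨hq, trivial⟩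
  obtain ⟨C, hC⟩ := (hKc.prod (isCompact_uIcc (a := a) (b := b))).exists_bound_of_continuousOn
    (hF'.mono (Set.prod_mono hKU (Set.subset_univ _)))
  refine intervalIntegral.hasFDerivAt_integral_of_dominated_of_fderiv_le (bound := fun _ => C) hK
    ?_ ((hsec p hp).intervalIntegrable _ _) (hFm p hp).aestronglyMeasurable
    (Eventually.of_forall fun s hs q hq => ?_) (by simp)
    (Eventually.of_forall fun s _ q hq => hd q (hKU hq) s)
  · filter_upwards [hU.mem_nhds hp] with q hq
    exact (hsec q hq).aestronglyMeasurable
  · exact hC (q, s) ⟨hq, Set.uIoc_subset_uIcc hs⟩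

namespace ABOscillator

theorem isOpen_phaseSpace (b : ℝ) : IsOpen (phaseSpace b) := by
  refine (isOpen_ne_fun (by fun_prop) continuous_const).inter
    (isOpen_ne_fun (f := fun p : Plane × Plane => wedge p.1 p.2) ?_ continuous_const)
  unfold wedge
  fun_prop

theorem contDiffOn_potential (b : ℝ) : ContDiffOn ℝ (⊤ : ℕ∞) (potential b) {x | x ≠ 0} := by
  rw [contDiffOn_euclidean]
  have hi : ∀ i : Fin 2, ContDiffOn ℝ (⊤ : ℕ∞) (fun x : Plane => x i) {x | x ≠ 0} := fun i =>
    (EuclideanSpace.proj i : Plane →L[ℝ] ℝ).contDiff.contDiffOn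
  have hn : ContDiffOn ℝ (⊤ : ℕ∞) (fun x : Plane => ‖x‖ ^ 2) {x | x ≠ 0} :=
    (contDiff_norm_sq ℝ).contDiffOn
  have h0 : ∀ x ∈ {x : Plane | x ≠ 0}, ‖x‖ ^ 2 ≠ 0 := fun x hx =>
    pow_ne_zero 2 (norm_ne_zero_iff.mpr hx)
  intro i
  fin_cases i
  · exact (contDiffOn_const.mul (hi 1)).neg.fun_div hn h0
  · exact (contDiffOn_const.mul (hi 0)).fun_div hn h0

theorem contDiffOn_potentialDeriv (b : ℝ) :
    ContDiffOn ℝ (⊤ : ℕ∞) (potentialDeriv b) {x | x ≠ 0} :=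
  ((contDiffOn_potential b).fderiv_of_isOpen isOpen_ne (by simp)).congr fun x hx =>
    (hasFDerivAt_potential b x hx).fderiv.symm

/-- The derivative of `(y, η) ↦ η - A(y)`. -/
noncomputable def momentumDeriv (b : ℝ) (y : Plane) : Plane × Plane →L[ℝ] Plane :=
  ContinuousLinearMap.snd ℝ Plane Plane -
    (potentialDeriv b y).comp (ContinuousLinearMap.fst ℝ Plane Plane)

/-- The derivative of `xᵗ` in `(y, η)`. -/
noncomputable def flowXDeriv (b ω t : ℝ) (y : Plane) : Plane × Plane →L[ℝ] Plane :=
  Real.cos (ω * t) • ContinuousLinearMap.fst ℝ Plane Plane +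
    (Real.sin (ω * t) / ω) • momentumDeriv b y

/-- The derivative of `ẋᵗ` in `(y, η)`. -/
noncomputable def flowVDeriv (b ω t : ℝ) (y : Plane) : Plane × Plane →L[ℝ] Plane :=
  (-(ω * Real.sin (ω * t))) • ContinuousLinearMap.fst ℝ Plane Plane +
    Real.cos (ω * t) • momentumDeriv b y

/-- The derivative of `ξᵗ` in `(y, η)`. -/
noncomputable def flowXiDeriv (b ω t : ℝ) (y η : Plane) : Plane × Plane →L[ℝ] Plane :=
  flowVDeriv b ω t y + (potentialDeriv b (flowX b ω t y η)).comp (flowXDeriv b ω t y)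

theorem momentumDeriv_apply (b : ℝ) (y : Plane) (v : Plane × Plane) :
    momentumDeriv b y v = v.2 - potentialDeriv b y v.1 := rfl

theorem flowXDeriv_apply (b ω t : ℝ) (y : Plane) (v : Plane × Plane) :
    flowXDeriv b ω t y v = Real.cos (ω * t) • v.1 +
      (Real.sin (ω * t) / ω) • (v.2 - potentialDeriv b y v.1) := rfl

theorem flowVDeriv_apply (b ω t : ℝ) (y : Plane) (v : Plane × Plane) :
    flowVDeriv b ω t y v = (-(ω * Real.sin (ω * t))) • v.1 +
      Real.cos (ω * t) • (v.2 - potentialDeriv b y v.1) := rfl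

theorem flowXiDeriv_apply (b ω t : ℝ) (y η : Plane) (v : Plane × Plane) :
    flowXiDeriv b ω t y η v = flowVDeriv b ω t y v +
      potentialDeriv b (flowX b ω t y η) (flowXDeriv b ω t y v) := rfl

theorem hasFDerivAt_momentum (b : ℝ) {p : Plane × Plane} (hp : p.1 ≠ 0) :
    HasFDerivAt (fun p : Plane × Plane => p.2 - potential b p.1) (momentumDeriv b p.1) p :=
  hasFDerivAt_snd.fun_sub ((hasFDerivAt_potential b p.1 hp).comp p hasFDerivAt_fst)

theorem hasFDerivAt_flowX (b ω t : ℝ) {p : Plane × Plane} (hp : p.1 ≠ 0) :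
    HasFDerivAt (fun p : Plane × Plane => flowX b ω t p.1 p.2) (flowXDeriv b ω t p.1) p :=
  (hasFDerivAt_fst.fun_const_smul _).fun_add ((hasFDerivAt_momentum b hp).fun_const_smul _)

theorem hasFDerivAt_flowV (b ω t : ℝ) {p : Plane × Plane} (hp : p.1 ≠ 0) :
    HasFDerivAt (fun p : Plane × Plane => flowV b ω t p.1 p.2) (flowVDeriv b ω t p.1) p :=
  (hasFDerivAt_fst.fun_const_smul _).fun_add ((hasFDerivAt_momentum b hp).fun_const_smul _)

theorem hasFDerivAt_flowXi (b ω t : ℝ) (hω : 0 < ω) {p : Plane × Plane} (hp : p ∈ phaseSpace b) :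
    HasFDerivAt (fun p : Plane × Plane => flowXi b ω t p.1 p.2) (flowXiDeriv b ω t p.1 p.2) p :=
  (hasFDerivAt_flowV b ω t hp.1).fun_add (HasFDerivAt.comp (g := potential b) p
    (hasFDerivAt_potential b _ (flowX_ne_zero b ω t hω p.1 p.2 hp)) (hasFDerivAt_flowX b ω t hp.1))

theorem contDiffOn_momentum (b : ℝ) {n : WithTop ℕ∞} (hn : n ≤ (⊤ : ℕ∞)) :
    ContDiffOn ℝ n (fun p : Plane × Plane => p.2 - potential b p.1) {p | p.1 ≠ 0} :=
  (contDiff_snd.contDiffOn.sub ((contDiffOn_potential b).comp contDiff_fst.contDiffOn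
    fun _ hp => hp)).of_le hn

/-- Time and initial data with `y ≠ 0`: there `xᵗ` and `ẋᵗ` are smooth. -/
theorem contDiffOn_flowX_uncurry (b ω : ℝ) : ContDiffOn ℝ (⊤ : ℕ∞)
    (fun z : (Plane × Plane) × ℝ => flowX b ω z.2 z.1.1 z.1.2) {z | z.1.1 ≠ 0} := by
  have h1 : ContDiff ℝ (⊤ : ℕ∞) (fun z : (Plane × Plane) × ℝ => Real.cos (ω * z.2)) := by fun_prop
  have h2 : ContDiff ℝ (⊤ : ℕ∞) (fun z : (Plane × Plane) × ℝ => Real.sin (ω * z.2) / ω) := by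
    fun_prop
  unfold flowX
  exact (h1.contDiffOn.fun_smul (contDiff_fst.comp contDiff_fst).contDiffOn).add
    (h2.contDiffOn.fun_smul ((contDiffOn_momentum b le_rfl).comp contDiff_fst.contDiffOn
      fun _ hp => hp))

theorem contDiffOn_flowV_uncurry (b ω : ℝ) : ContDiffOn ℝ (⊤ : ℕ∞)
    (fun z : (Plane × Plane) × ℝ => flowV b ω z.2 z.1.1 z.1.2) {z | z.1.1 ≠ 0} := by
  have h1 : ContDiff ℝ (⊤ : ℕ∞) (fun z : (Plane × Plane) × ℝ => Real.cos (ω * z.2)) := by fun_prop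
  have h2 : ContDiff ℝ (⊤ : ℕ∞) (fun z : (Plane × Plane) × ℝ => -(ω * Real.sin (ω * z.2))) := by
    fun_prop
  unfold flowV
  exact (h2.contDiffOn.fun_smul (contDiff_fst.comp contDiff_fst).contDiffOn).add
    (h1.contDiffOn.fun_smul ((contDiffOn_momentum b le_rfl).comp contDiff_fst.contDiffOn
      fun _ hp => hp))

theorem contDiffOn_flowX (b ω t : ℝ) : ContDiffOn ℝ (⊤ : ℕ∞)
    (fun p : Plane × Plane => flowX b ω t p.1 p.2) {p | p.1 ≠ 0} :=
  (contDiffOn_flowX_uncurry b ω).comp (g := fun z : (Plane × Plane) × ℝ => flowX b ω z.2 z.1.1 z.1.2)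
    (f := fun p => (p, t)) (contDiff_id.prodMk contDiff_const).contDiffOn fun _ hp => hp

theorem contDiffOn_flowV (b ω t : ℝ) : ContDiffOn ℝ (⊤ : ℕ∞)
    (fun p : Plane × Plane => flowV b ω t p.1 p.2) {p | p.1 ≠ 0} :=
  (contDiffOn_flowV_uncurry b ω).comp (g := fun z : (Plane × Plane) × ℝ => flowV b ω z.2 z.1.1 z.1.2)
    (f := fun p => (p, t)) (contDiff_id.prodMk contDiff_const).contDiffOn fun _ hp => hp

theorem contDiffOn_flowXi (b ω t : ℝ) (hω : 0 < ω) : ContDiffOn ℝ (⊤ : ℕ∞)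
    (fun p : Plane × Plane => flowXi b ω t p.1 p.2) (phaseSpace b) :=
  ((contDiffOn_flowV b ω t).mono fun _ hp => hp.1).add ((contDiffOn_potential b).comp
    ((contDiffOn_flowX b ω t).mono fun _ hp => hp.1)
    fun p hp => flowX_ne_zero b ω t hω p.1 p.2 hp)

/-- The Lagrangian along the trajectory. -/
theorem action_eq (b ω t : ℝ) (y η : Plane) : action b ω t y η = ∫ s in (0 : ℝ)..t,
    (‖flowV b ω s y η‖ ^ 2 / 2 + inner ℝ (flowV b ω s y η) (potential b (flowX b ω s y η)) -
      ω ^ 2 / 2 * ‖flowX b ω s y η‖ ^ 2) := by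
  unfold action hamiltonian
  congr 1
  ext s
  simp only [flowXi, add_sub_cancel_right, inner_add_right, real_inner_self_eq_norm_sq]
  ring

/-- The derivative of the Lagrangian along the trajectory in the initial data. -/
noncomputable def lagrangianDeriv (b ω s : ℝ) (y η : Plane) : Plane × Plane →L[ℝ] ℝ :=
  (innerSL ℝ (-(ω ^ 2) • flowX b ω s y η +
    potentialDeriv b (flowX b ω s y η) (flowV b ω s y η))).comp (flowXDeriv b ω s y) +
  (innerSL ℝ (flowXi b ω s y η)).comp (flowVDeriv b ω s y)

theorem hasFDerivAt_lagrangian (b ω s : ℝ) (hω : 0 < ω) {p : Plane × Plane}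
    (hp : p ∈ phaseSpace b) :
    HasFDerivAt (fun p : Plane × Plane => ‖flowV b ω s p.1 p.2‖ ^ 2 / 2 +
      inner ℝ (flowV b ω s p.1 p.2) (potential b (flowX b ω s p.1 p.2)) -
      ω ^ 2 / 2 * ‖flowX b ω s p.1 p.2‖ ^ 2) (lagrangianDeriv b ω s p.1 p.2) p := by
  have hX := hasFDerivAt_flowX b ω s hp.1
  have hV := hasFDerivAt_flowV b ω s hp.1
  have hA := (hasFDerivAt_potential b _ (flowX_ne_zero b ω s hω p.1 p.2 hp)).comp p hX
  refine (((hV.norm_sq.mul_const (2⁻¹ : ℝ)).add (hV.inner ℝ hA)).sub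
    (hX.norm_sq.const_mul (ω ^ 2 / 2))).congr_fderiv ?_
  ext v
  all_goals
    simp [lagrangianDeriv, flowXi, ← inner_potentialDeriv, real_inner_comm]
    ring

/-- The Euler–Lagrange equation: along a trajectory the variation of the Lagrangian is the total
time derivative of ξˢ · δxˢ. -/
theorem hasDerivAt_inner_flowXi (b ω s : ℝ) (hω : 0 < ω) {p : Plane × Plane}
    (hp : p ∈ phaseSpace b) (v : Plane × Plane) :
    HasDerivAt (fun s => inner ℝ (flowXi b ω s p.1 p.2) (flowXDeriv b ω s p.1 v))
      (lagrangianDeriv b ω s p.1 p.2 v) s := by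
  have hl : HasDerivAt (fun s : ℝ => ω * s) ω s := by
    simpa using (hasDerivAt_id s).const_mul ω
  have h1 : HasDerivAt (fun s => flowXDeriv b ω s p.1 v) (flowVDeriv b ω s p.1 v) s := by
    have := (hl.cos.smul_const v.1).add ((hl.sin.div_const ω).smul_const (momentumDeriv b p.1 v))
    refine this.congr_deriv ?_
    rw [flowVDeriv_apply, momentumDeriv_apply]
    congr 2
    · ring
    · field_simp
  have h2 := (hasFDerivAt_potential b _ (flowX_ne_zero b ω s hω p.1 p.2 hp)).comp_hasDerivAt s
    (hasDerivAt_flowX b ω s hω p.1 p.2)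
  have h3 := ((hasDerivAt_flowV b ω s hω p.1 p.2).add h2).inner ℝ h1
  refine h3.congr_deriv ?_
  simp [lagrangianDeriv, flowXi, inner_add_left, real_inner_smul_left]
  ring

theorem flowXDeriv_zero (b ω : ℝ) (y : Plane) (v : Plane × Plane) :
    flowXDeriv b ω 0 y v = v.1 := by
  simp [flowXDeriv_apply]

theorem flowXi_zero (b ω : ℝ) (y η : Plane) : flowXi b ω 0 y η = η := by
  simp [flowXi, flowV, flowX]

theorem contDiffOn_momentumDeriv (b : ℝ) :
    ContDiffOn ℝ (⊤ : ℕ∞) (momentumDeriv b) {y | y ≠ 0} := by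
  unfold momentumDeriv
  exact contDiffOn_const.sub ((contDiffOn_potentialDeriv b).clm_comp contDiffOn_const)

theorem contDiffOn_flowXDeriv_uncurry (b ω : ℝ) : ContDiffOn ℝ (⊤ : ℕ∞)
    (fun z : (Plane × Plane) × ℝ => flowXDeriv b ω z.2 z.1.1) {z | z.1.1 ≠ 0} := by
  have h1 : ContDiff ℝ (⊤ : ℕ∞) (fun z : (Plane × Plane) × ℝ => Real.cos (ω * z.2)) := by fun_prop
  have h2 : ContDiff ℝ (⊤ : ℕ∞) (fun z : (Plane × Plane) × ℝ => Real.sin (ω * z.2) / ω) := by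
    fun_prop
  unfold flowXDeriv
  exact (h1.contDiffOn.fun_smul contDiffOn_const).add
    (h2.contDiffOn.fun_smul ((contDiffOn_momentumDeriv b).comp
      (contDiff_fst.comp contDiff_fst).contDiffOn fun _ hz => hz))

theorem contDiffOn_flowVDeriv_uncurry (b ω : ℝ) : ContDiffOn ℝ (⊤ : ℕ∞)
    (fun z : (Plane × Plane) × ℝ => flowVDeriv b ω z.2 z.1.1) {z | z.1.1 ≠ 0} := by
  have h1 : ContDiff ℝ (⊤ : ℕ∞) (fun z : (Plane × Plane) × ℝ => Real.cos (ω * z.2)) := by fun_prop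
  have h2 : ContDiff ℝ (⊤ : ℕ∞) (fun z : (Plane × Plane) × ℝ => -(ω * Real.sin (ω * z.2))) := by
    fun_prop
  unfold flowVDeriv
  exact (h2.contDiffOn.fun_smul contDiffOn_const).add
    (h1.contDiffOn.fun_smul ((contDiffOn_momentumDeriv b).comp
      (contDiff_fst.comp contDiff_fst).contDiffOn fun _ hz => hz))

theorem contDiffOn_flowXDeriv (b ω t : ℝ) : ContDiffOn ℝ (⊤ : ℕ∞) (flowXDeriv b ω t)
    {y | y ≠ 0} := by
  unfold flowXDeriv
  exact contDiffOn_const.add (contDiffOn_const.fun_smul (contDiffOn_momentumDeriv b))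

theorem contDiffOn_flowVDeriv (b ω t : ℝ) : ContDiffOn ℝ (⊤ : ℕ∞) (flowVDeriv b ω t)
    {y | y ≠ 0} := by
  unfold flowVDeriv
  exact contDiffOn_const.add (contDiffOn_const.fun_smul (contDiffOn_momentumDeriv b))

theorem continuousOn_lagrangianDeriv (b ω : ℝ) (hω : 0 < ω) :
    ContinuousOn (fun z : (Plane × Plane) × ℝ => lagrangianDeriv b ω z.2 z.1.1 z.1.2)
      (phaseSpace b ×ˢ Set.univ) := by
  have hX := (contDiffOn_flowX_uncurry b ω).continuousOn.mono
    (fun z hz => hz.1.1 : phaseSpace b ×ˢ Set.univ ⊆ _)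
  have hV := (contDiffOn_flowV_uncurry b ω).continuousOn.mono
    (fun z hz => hz.1.1 : phaseSpace b ×ˢ Set.univ ⊆ _)
  have hne : Set.MapsTo (fun z : (Plane × Plane) × ℝ => flowX b ω z.2 z.1.1 z.1.2)
      (phaseSpace b ×ˢ Set.univ) {x | x ≠ 0} := fun z hz => flowX_ne_zero b ω z.2 hω _ _ hz.1
  have hA := (contDiffOn_potential b).continuousOn.comp hX hne
  have hA' := (contDiffOn_potentialDeriv b).continuousOn.comp hX hne
  have hXD := (contDiffOn_flowXDeriv_uncurry b ω).continuousOn.mono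
    (fun z hz => hz.1.1 : phaseSpace b ×ˢ Set.univ ⊆ _)
  have hVD := (contDiffOn_flowVDeriv_uncurry b ω).continuousOn.mono
    (fun z hz => hz.1.1 : phaseSpace b ×ˢ Set.univ ⊆ _)
  unfold lagrangianDeriv flowXi
  exact ((innerSL ℝ).continuous.comp_continuousOn ((hX.fun_const_smul (-(ω ^ 2))).add
    (hA'.clm_apply hV))).clm_comp hXD |>.add
    (((innerSL ℝ).continuous.comp_continuousOn (hV.add hA)).clm_comp hVD)

theorem continuousOn_lagrangian (b ω : ℝ) (hω : 0 < ω) :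
    ContinuousOn (fun z : (Plane × Plane) × ℝ => ‖flowV b ω z.2 z.1.1 z.1.2‖ ^ 2 / 2 +
      inner ℝ (flowV b ω z.2 z.1.1 z.1.2) (potential b (flowX b ω z.2 z.1.1 z.1.2)) -
      ω ^ 2 / 2 * ‖flowX b ω z.2 z.1.1 z.1.2‖ ^ 2) (phaseSpace b ×ˢ Set.univ) := by
  have hX := (contDiffOn_flowX_uncurry b ω).continuousOn.mono
    (fun z hz => hz.1.1 : phaseSpace b ×ˢ Set.univ ⊆ _)
  have hV := (contDiffOn_flowV_uncurry b ω).continuousOn.mono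
    (fun z hz => hz.1.1 : phaseSpace b ×ˢ Set.univ ⊆ _)
  have hne : Set.MapsTo (fun z : (Plane × Plane) × ℝ => flowX b ω z.2 z.1.1 z.1.2)
      (phaseSpace b ×ˢ Set.univ) {x | x ≠ 0} := fun z hz => flowX_ne_zero b ω z.2 hω _ _ hz.1
  have hA := (contDiffOn_potential b).continuousOn.comp hX hne
  exact (((hV.norm.pow 2).div_const 2).add (hV.inner hA)).sub
    (continuousOn_const.mul (hX.norm.pow 2))

/-- The differential of the action: `dS = ξᵗ · dxᵗ - η · dy`. -/
noncomputable def actionDeriv (b ω t : ℝ) (y η : Plane) : Plane × Plane →L[ℝ] ℝ :=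
  (innerSL ℝ (flowXi b ω t y η)).comp (flowXDeriv b ω t y) -
    (innerSL ℝ η).comp (ContinuousLinearMap.fst ℝ Plane Plane)

/-- After differentiation under the integral the integrand is a total derivative in s by
`hasDerivAt_inner_flowXi`, so only the values of ξˢ · δxˢ at s = t and s = 0 remain. -/
theorem hasFDerivAt_action (b ω t : ℝ) (hω : 0 < ω) {p : Plane × Plane} (hp : p ∈ phaseSpace b) :
    HasFDerivAt (fun p : Plane × Plane => action b ω t p.1 p.2) (actionDeriv b ω t p.1 p.2) p := by
  have h := hasFDerivAt_intervalIntegral_of_continuousOn (isOpen_phaseSpace b)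
    (F := fun p s => ‖flowV b ω s p.1 p.2‖ ^ 2 / 2 +
      inner ℝ (flowV b ω s p.1 p.2) (potential b (flowX b ω s p.1 p.2)) -
      ω ^ 2 / 2 * ‖flowX b ω s p.1 p.2‖ ^ 2) (F' := fun p s => lagrangianDeriv b ω s p.1 p.2)
    (continuousOn_lagrangian b ω hω) (continuousOn_lagrangianDeriv b ω hω)
    (fun q hq s => hasFDerivAt_lagrangian b ω s hω hq) hp 0 t
  refine (h.congr_fderiv ?_).congr_of_eventuallyEq
    (Eventually.of_forall fun q => action_eq b ω t q.1 q.2)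
  have hc : Continuous fun s => lagrangianDeriv b ω s p.1 p.2 := by
    have : Continuous fun s : ℝ => (p, s) := by fun_prop
    rw [← continuousOn_univ] at this ⊢
    exact (continuousOn_lagrangianDeriv b ω hω).comp (f := fun s => (p, s)) this
      fun s _ => ⟨hp, trivial⟩
  refine ContinuousLinearMap.ext fun v => ?_
  rw [ContinuousLinearMap.intervalIntegral_apply (hc.intervalIntegrable _ _),
    intervalIntegral.integral_eq_sub_of_hasDerivAt
      (fun s _ => hasDerivAt_inner_flowXi b ω s hω hp v)
      ((hc.clm_apply continuous_const).intervalIntegrable _ _)]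
  rw [flowXDeriv_zero, flowXi_zero]
  rfl

/-- The differential of the action involves only the flow at time t, which is smooth, so no higher
derivatives have to be taken under the integral. -/
theorem contDiffOn_action (b ω t : ℝ) (hω : 0 < ω) : ContDiffOn ℝ (⊤ : ℕ∞)
    (fun p : Plane × Plane => action b ω t p.1 p.2) (phaseSpace b) := by
  rw [contDiffOn_infty_iff_fderiv_of_isOpen (isOpen_phaseSpace b)]
  refine ⟨fun p hp => (hasFDerivAt_action b ω t hω hp).differentiableAt.differentiableWithinAt, ?_⟩
  have hXD : ContDiffOn ℝ (⊤ : ℕ∞) (fun p : Plane × Plane => flowXDeriv b ω t p.1)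
      (phaseSpace b) := (contDiffOn_flowXDeriv b ω t).comp contDiff_fst.contDiffOn fun p hp => hp.1
  have : ContDiffOn ℝ (⊤ : ℕ∞) (fun p : Plane × Plane => actionDeriv b ω t p.1 p.2)
      (phaseSpace b) := by
    unfold actionDeriv
    exact (((innerSL ℝ).contDiff.comp_contDiffOn (contDiffOn_flowXi b ω t hω)).clm_comp hXD).sub
      (((innerSL ℝ).contDiff.comp_contDiffOn contDiff_snd.contDiffOn).clm_comp contDiffOn_const)
  exact this.congr fun p hp => (hasFDerivAt_action b ω t hω hp).fderiv

end ABOscillator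

/-! ### The phase of the double integral and its Hessian. -/

namespace SymbolCalculus

/-- Beyond its quadratic part at a critical point, a smooth function is a globally defined smooth
function vanishing to third order. -/
theorem exists_cubic_remainder {E : Type*} [NormedAddCommGroup E] [NormedSpace ℝ E]
    [FiniteDimensional ℝ E] {V : Set E} (hV : IsOpen V) {Ψ : E → ℂ}
    (hΨ : ContDiffOn ℝ (⊤ : ℕ∞) Ψ V) {p₀ : E} (hp₀ : p₀ ∈ V) (h1 : fderiv ℝ Ψ p₀ = 0)
    {β : E →L[ℝ] E →L[ℝ] ℂ} (hβ : ∀ p v, β p v = β v p)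
    (h2 : ∀ v w, fderiv ℝ (fun p => fderiv ℝ Ψ p v) p₀ w = β w v) :
    ∃ g : E → ℂ, ContDiff ℝ (⊤ : ℕ∞) g ∧ VanishesToOrder 3 g ∧ ∃ r > 0,
      Metric.ball p₀ r ⊆ V ∧
      ∀ p ∈ Metric.ball (0 : E) r, Ψ (p₀ + p) = Ψ p₀ + ((1 / 2 : ℂ) * β p p + g p) := by
  obtain ⟨r, hr, hrV⟩ := Metric.isOpen_iff.mp hV p₀ hp₀
  let κ₀ : ContDiffBump (0 : E) := ⟨r / 4, r / 2, by positivity, by linarith⟩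
  set κ : E → ℂ := fun p => ((κ₀ p : ℝ) : ℂ) with hκ
  have hκd : ContDiff ℝ (⊤ : ℕ∞) κ := Complex.ofRealCLM.contDiff.comp κ₀.contDiff
  set Rm : E → ℂ := fun p => Ψ (p₀ + p) - Ψ p₀ - (1 / 2 : ℂ) * β p p with hRm
  have hball : Set.MapsTo (fun p => p₀ + p) (Metric.ball (0 : E) r) V := fun p hp =>
    hrV (by simpa using hp)
  have hshift : ContDiff ℝ (⊤ : ℕ∞) (fun p : E => p₀ + p) := contDiff_const.add contDiff_id
  have hRd : ContDiffOn ℝ (⊤ : ℕ∞) Rm (Metric.ball (0 : E) r) :=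
    ((hΨ.comp hshift.contDiffOn hball).sub contDiffOn_const).sub
      (contDiff_quadratic β).contDiffOn
  have hsupp : tsupport (fun p => κ p * Rm p) ⊆ Metric.ball (0 : E) r := by
    refine (tsupport_mul_subset_left (f := κ)).trans ?_
    have : tsupport κ ⊆ tsupport κ₀ := closure_mono fun p hp => by simpa [hκ] using hp
    refine this.trans ?_
    rw [κ₀.tsupport_eq]
    exact Metric.closedBall_subset_ball (by simp [κ₀]; linarith)
  have h1κ : ∀ p ∈ Metric.ball (0 : E) (r / 4), κ p * Rm p = Rm p := fun p hp => by
    have : κ₀ p = 1 := κ₀.one_of_mem_closedBall (Metric.ball_subset_closedBall hp)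
    simp [hκ, this]
  have hsub : Metric.ball (0 : E) (r / 4) ⊆ Metric.ball 0 r :=
    Metric.ball_subset_ball (by linarith)
  have hfd : ∀ v, ∀ p ∈ Metric.ball (0 : E) (r / 4), fderiv ℝ (fun p => κ p * Rm p) p v =
      fderiv ℝ Ψ (p₀ + p) v - β p v := by
    intro v p hp
    have he : (fun p => κ p * Rm p) =ᶠ[𝓝 p] Rm := by
      filter_upwards [Metric.isOpen_ball.mem_nhds hp] with q hq using h1κ q hq
    have hd : DifferentiableAt ℝ Ψ (p₀ + p) :=
      (hΨ.differentiableOn (by simp)).differentiableAt (hV.mem_nhds (hball (hsub hp)))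
    have hd' : DifferentiableAt ℝ (fun p => Ψ (p₀ + p)) p :=
      hd.comp p (hshift.differentiable (by simp) p)
    have hq := (contDiff_quadratic β).differentiable (by simp) p
    rw [he.fderiv_eq, hRm, fderiv_fun_sub (hd'.sub_const _) hq, fderiv_sub_const,
      fderiv_comp_add_left]
    simp only [_root_.sub_apply, fderiv_half_quadratic hβ]
  have h0 : (0 : E) ∈ Metric.ball (0 : E) (r / 4) := Metric.mem_ball_self (by positivity)
  refine ⟨fun p => κ p * Rm p, contDiff_of_tsupport_subset Metric.isOpen_ball
    (hκd.contDiffOn.mul hRd) hsupp, ⟨by simp [hRm], fun v => ⟨?_, fun w => ⟨?_, fun _ => trivial⟩⟩⟩,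
    r / 4, by positivity, (Metric.ball_subset_ball (by linarith)).trans hrV, fun p hp => ?_⟩
  · beta_reduce
    rw [hfd v 0 h0]
    simp [h1]
  · have he : (fun p => fderiv ℝ (fun p => κ p * Rm p) p v) =ᶠ[𝓝 0]
        fun p => fderiv ℝ Ψ (p₀ + p) v - β p v := by
      filter_upwards [Metric.isOpen_ball.mem_nhds h0] with q hq using hfd v q hq
    have hd : DifferentiableAt ℝ (fun p => fderiv ℝ Ψ p v) p₀ :=
      ((contDiffOn_fderiv_apply hV hΨ v).differentiableOn (by simp)).differentiableAt
        (hV.mem_nhds hp₀)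
    have hd' : DifferentiableAt ℝ (fun p => fderiv ℝ Ψ (p₀ + p) v) 0 :=
      DifferentiableAt.comp (g := fun p => fderiv ℝ Ψ p v) 0 (by simpa using hd)
        (hshift.differentiable (by simp) 0)
    have hb : HasFDerivAt (fun p => β p v) (β.flip v) 0 := (β.flip v).hasFDerivAt
    beta_reduce
    rw [he.fderiv_eq, fderiv_fun_sub hd' hb.differentiableAt,
      fderiv_comp_add_left (f := fun p => fderiv ℝ Ψ p v), hb.fderiv]
    simp [h2]
  · beta_reduce
    rw [h1κ p hp, hRm]
    ring

end SymbolCalculus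

namespace ABOscillator

open SymbolCalculus

/-- The phase `φ + y · η₀` of the double integral. -/
noncomputable def totalPhase (b ω B t : ℝ) (x η₀ : Plane) (p : Plane × Plane) : ℂ :=
  phase b ω B t x p.1 p.2 + ((inner ℝ p.1 η₀ : ℝ) : ℂ)

/-- The differential of the total phase. -/
noncomputable def totalPhaseDeriv (b ω B t : ℝ) (x η₀ : Plane) (p : Plane × Plane) :
    Plane × Plane →L[ℝ] ℂ :=
  Complex.ofRealCLM.comp ((innerSL ℝ (x - flowX b ω t p.1 p.2)).comp (flowXiDeriv b ω t p.1 p.2) -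
      (innerSL ℝ (p.2 - η₀)).comp (ContinuousLinearMap.fst ℝ Plane Plane)) -
    (Complex.I * (B : ℂ)) • Complex.ofRealCLM.comp
      ((innerSL ℝ (x - flowX b ω t p.1 p.2)).comp (flowXDeriv b ω t p.1))

theorem totalPhaseDeriv_apply (b ω B t : ℝ) (x η₀ : Plane) (p v : Plane × Plane) :
    totalPhaseDeriv b ω B t x η₀ p v =
      ((inner ℝ (x - flowX b ω t p.1 p.2) (flowXiDeriv b ω t p.1 p.2 v) -
        inner ℝ (p.2 - η₀) v.1 : ℝ) : ℂ) -
      Complex.I * (B : ℂ) *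
        ((inner ℝ (x - flowX b ω t p.1 p.2) (flowXDeriv b ω t p.1 v) : ℝ) : ℂ) := by
  rfl

theorem totalPhase_im (b ω B t : ℝ) (x η₀ : Plane) (p : Plane × Plane) :
    (totalPhase b ω B t x η₀ p).im = B * ‖x - flowX b ω t p.1 p.2‖ ^ 2 / 2 := by
  simp only [totalPhase, phase, Complex.add_im, Complex.ofReal_im, Complex.mul_im, Complex.I_re,
    Complex.I_im, Complex.ofReal_re]
  ring

/-- The term ξᵗ·dxᵗ of dS cancels against the derivative of x − xᵗ in (x − xᵗ)·ξᵗ. Every remaining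
term contains x − xᵗ or η − η₀, which exhibits the stationary points. -/
theorem hasFDerivAt_totalPhase (b ω B t : ℝ) (hω : 0 < ω) (x η₀ : Plane) {p : Plane × Plane}
    (hp : p ∈ phaseSpace b) :
    HasFDerivAt (totalPhase b ω B t x η₀) (totalPhaseDeriv b ω B t x η₀ p) p := by
  have hX := hasFDerivAt_flowX b ω t hp.1
  have hXi := hasFDerivAt_flowXi b ω t hω hp
  have hxX := hX.const_sub x
  have h1 := ((hasFDerivAt_action b ω t hω hp).fun_add (hxX.inner ℝ hXi))
  have h2 := (hxX.norm_sq.const_mul B).mul_const (2⁻¹ : ℝ)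
  have h3 : HasFDerivAt (fun p : Plane × Plane => (inner ℝ p.1 η₀ : ℝ)) _ p :=
    hasFDerivAt_fst.inner ℝ (hasFDerivAt_const η₀ p)
  have h := ((Complex.ofRealCLM.hasFDerivAt.comp p h1).add
    ((Complex.ofRealCLM.hasFDerivAt.comp p h2).const_mul Complex.I)).add
    (Complex.ofRealCLM.hasFDerivAt.comp p h3)
  refine (h.congr_fderiv ?_).congr_of_eventuallyEq (Eventually.of_forall fun q => ?_)
  · refine ContinuousLinearMap.ext fun v => ?_
    rw [totalPhaseDeriv_apply]
    simp only [_root_.add_apply, _root_.smul_apply, ContinuousLinearMap.comp_apply,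
      Complex.ofRealCLM_apply, smul_eq_mul, actionDeriv, _root_.sub_apply, innerSL_apply_apply,
      _root_.neg_apply, fderivInnerCLM_apply, ContinuousLinearMap.prod_apply, _root_.zero_apply,
      inner_neg_right, inner_zero_right, ContinuousLinearMap.coe_fst', inner_sub_left,
      real_inner_comm η₀ v.1, real_inner_comm (flowXi b ω t p.1 p.2)]
    push_cast
    simp
    ring
  · simp [totalPhase, phase, div_eq_mul_inv]

theorem contDiffOn_totalPhase (b ω B t : ℝ) (hω : 0 < ω) (x η₀ : Plane) :
    ContDiffOn ℝ (⊤ : ℕ∞) (totalPhase b ω B t x η₀) (phaseSpace b) := by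
  have hX := (contDiffOn_flowX b ω t).mono fun p (hp : p ∈ phaseSpace b) => hp.1
  have hxX := contDiffOn_const (c := x) |>.sub hX
  unfold totalPhase phase
  refine ((Complex.ofRealCLM.contDiff.comp_contDiffOn ((contDiffOn_action b ω t hω).add
    (hxX.inner ℝ (contDiffOn_flowXi b ω t hω)))).add (contDiffOn_const.mul
      (Complex.ofRealCLM.contDiff.comp_contDiffOn
        ((contDiffOn_const.mul (hxX.norm_sq ℝ)).div_const 2)))).add
    (Complex.ofRealCLM.contDiff.comp_contDiffOn
      ((contDiff_fst.inner ℝ contDiff_const).contDiffOn))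

/-- The Hessian of the total phase at a stationary point. -/
noncomputable def phaseHessian (b ω B t : ℝ) (p₀ : Plane × Plane) :
    Plane × Plane →L[ℝ] Plane × Plane →L[ℝ] ℂ :=
  (ContinuousLinearMap.compL ℝ (Plane × Plane) ℝ ℂ Complex.ofRealCLM).comp
    (-((innerSL ℝ).bilinearComp (flowXDeriv b ω t p₀.1) (flowXiDeriv b ω t p₀.1 p₀.2)) -
      (innerSL ℝ).bilinearComp (ContinuousLinearMap.snd ℝ Plane Plane)
        (ContinuousLinearMap.fst ℝ Plane Plane)) +
  (Complex.I * (B : ℂ)) • (ContinuousLinearMap.compL ℝ (Plane × Plane) ℝ ℂ Complex.ofRealCLM).comp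
    ((innerSL ℝ).bilinearComp (flowXDeriv b ω t p₀.1) (flowXDeriv b ω t p₀.1))

theorem phaseHessian_apply (b ω B t : ℝ) (p₀ p v : Plane × Plane) :
    phaseHessian b ω B t p₀ p v =
      ((-inner ℝ (flowXDeriv b ω t p₀.1 p) (flowXiDeriv b ω t p₀.1 p₀.2 v) -
        inner ℝ p.2 v.1 : ℝ) : ℂ) +
      Complex.I * (B : ℂ) *
        ((inner ℝ (flowXDeriv b ω t p₀.1 p) (flowXDeriv b ω t p₀.1 v) : ℝ) : ℂ) := by
  rfl

/-- The symmetry expresses that the flow is symplectic: `key` is the invariance of the symplectic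
form under the oscillator in the variables position and velocity, and the passage to momenta uses
that A_x is symmetric. -/
theorem phaseHessian_symm (b ω B t : ℝ) (hω : 0 < ω) (p₀ p v : Plane × Plane) :
    phaseHessian b ω B t p₀ p v = phaseHessian b ω B t p₀ v p := by
  have hsc := Real.sin_sq_add_cos_sq (ω * t)
  have hA' := inner_potentialDeriv b (flowX b ω t p₀.1 p₀.2) (flowXDeriv b ω t p₀.1 p)
    (flowXDeriv b ω t p₀.1 v)
  have key : ∀ u₁ m₁ u₂ m₂ : Plane,
      inner ℝ (Real.cos (ω * t) • u₁ + (Real.sin (ω * t) / ω) • m₁)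
        ((-(ω * Real.sin (ω * t))) • u₂ + Real.cos (ω * t) • m₂) + inner ℝ m₁ u₂ =
      inner ℝ (Real.cos (ω * t) • u₂ + (Real.sin (ω * t) / ω) • m₂)
        ((-(ω * Real.sin (ω * t))) • u₁ + Real.cos (ω * t) • m₁) + inner ℝ m₂ u₁ := by
    intro u₁ m₁ u₂ m₂
    simp only [inner_add_left, inner_add_right, real_inner_smul_left, real_inner_smul_right,
      real_inner_comm u₂ u₁, real_inner_comm u₂ m₁, real_inner_comm m₂ u₁, real_inner_comm m₂ m₁]
    field_simp
    linear_combination ω * (inner ℝ m₂ u₁ - inner ℝ u₂ m₁) * hsc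
  have h := key p.1 (p.2 - potentialDeriv b p₀.1 p.1) v.1 (v.2 - potentialDeriv b p₀.1 v.1)
  rw [← flowXDeriv_apply, ← flowXDeriv_apply, ← flowVDeriv_apply, ← flowVDeriv_apply,
    inner_sub_left, inner_sub_left, ← inner_potentialDeriv b p₀.1 p.1 v.1,
    real_inner_comm (potentialDeriv b p₀.1 v.1)] at h
  have h' : inner ℝ (flowXDeriv b ω t p₀.1 p) (flowXiDeriv b ω t p₀.1 p₀.2 v) + inner ℝ p.2 v.1 =
      inner ℝ (flowXDeriv b ω t p₀.1 v) (flowXiDeriv b ω t p₀.1 p₀.2 p) + inner ℝ v.2 p.1 := by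
    rw [flowXiDeriv_apply, flowXiDeriv_apply, inner_add_right, inner_add_right, hA',
      real_inner_comm (flowXDeriv b ω t p₀.1 v)]
    linarith
  rw [phaseHessian_apply, phaseHessian_apply, real_inner_comm (flowXDeriv b ω t p₀.1 p),
    ← neg_add', ← neg_add', h']

theorem phaseHessian_im (b ω B t : ℝ) (p₀ p : Plane × Plane) :
    (phaseHessian b ω B t p₀ p p).im = B * ‖flowXDeriv b ω t p₀.1 p‖ ^ 2 := by
  rw [phaseHessian_apply, real_inner_self_eq_norm_sq (flowXDeriv b ω t p₀.1 p)]
  simp only [Complex.add_im, Complex.ofReal_im, Complex.mul_im, Complex.mul_re, Complex.I_re,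
    Complex.I_im, Complex.ofReal_re]
  ring

/-- At the point x − xᵗ vanishes, so the second derivatives of xᵗ and ξᵗ drop out and only the
derivatives of x − xᵗ and of η − η₀ count. -/
theorem fderiv_totalPhase_apply (b ω B t : ℝ) (hω : 0 < ω) (η₀ : Plane) {p₀ : Plane × Plane}
    (hp₀ : p₀ ∈ phaseSpace b) (v w : Plane × Plane) :
    fderiv ℝ (fun p => fderiv ℝ (totalPhase b ω B t (flowX b ω t p₀.1 p₀.2) η₀) p v) p₀ w =
      phaseHessian b ω B t p₀ w v := by
  set x := flowX b ω t p₀.1 p₀.2 with hx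
  have he : (fun p => fderiv ℝ (totalPhase b ω B t x η₀) p v) =ᶠ[𝓝 p₀]
      fun p => totalPhaseDeriv b ω B t x η₀ p v := by
    filter_upwards [(isOpen_phaseSpace b).mem_nhds hp₀] with p hp
    rw [(hasFDerivAt_totalPhase b ω B t hω x η₀ hp).fderiv]
  have hxX := (hasFDerivAt_flowX b ω t hp₀.1).const_sub x
  have hXD : DifferentiableAt ℝ (fun p : Plane × Plane => flowXDeriv b ω t p.1 v) p₀ := by
    have h1 : DifferentiableAt ℝ (flowXDeriv b ω t) p₀.1 :=
      ((contDiffOn_flowXDeriv b ω t).differentiableOn (by simp)).differentiableAt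
        (isOpen_ne.mem_nhds hp₀.1)
    exact (h1.comp p₀ differentiableAt_fst).clm_apply (differentiableAt_const v)
  have hVD : DifferentiableAt ℝ (fun p : Plane × Plane => flowVDeriv b ω t p.1 v) p₀ := by
    have h1 : DifferentiableAt ℝ (flowVDeriv b ω t) p₀.1 :=
      ((contDiffOn_flowVDeriv b ω t).differentiableOn (by simp)).differentiableAt
        (isOpen_ne.mem_nhds hp₀.1)
    exact (h1.comp p₀ differentiableAt_fst).clm_apply (differentiableAt_const v)
  have hXiD : DifferentiableAt ℝ (fun p : Plane × Plane => flowXiDeriv b ω t p.1 p.2 v) p₀ := by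
    have h1 : DifferentiableAt ℝ (potentialDeriv b) x :=
      ((contDiffOn_potentialDeriv b).differentiableOn (by simp)).differentiableAt
        (isOpen_ne.mem_nhds (flowX_ne_zero b ω t hω p₀.1 p₀.2 hp₀))
    have h2 : DifferentiableAt ℝ (fun p : Plane × Plane => potentialDeriv b (flowX b ω t p.1 p.2))
        p₀ := DifferentiableAt.comp (g := potentialDeriv b) p₀ h1
      (hasFDerivAt_flowX b ω t hp₀.1).differentiableAt
    exact hVD.add (h2.clm_apply hXD)
  have h3 : HasFDerivAt (fun p : Plane × Plane => (inner ℝ (p.2 - η₀) v.1 : ℝ)) _ p₀ :=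
    (hasFDerivAt_snd.sub_const η₀).inner ℝ (hasFDerivAt_const v.1 p₀)
  have h4 := (Complex.ofRealCLM.hasFDerivAt.comp p₀
      ((hxX.inner ℝ hXiD.hasFDerivAt).fun_sub h3)).sub
    ((Complex.ofRealCLM.hasFDerivAt.comp p₀ (hxX.inner ℝ hXD.hasFDerivAt)).const_mul
      (Complex.I * (B : ℂ)))
  have h5 : HasFDerivAt (fun p => totalPhaseDeriv b ω B t x η₀ p v) _ p₀ :=
    h4.congr_of_eventuallyEq (Eventually.of_forall fun p => totalPhaseDeriv_apply b ω B t x η₀ p v)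
  rw [he.fderiv_eq, h5.fderiv, phaseHessian_apply]
  simp [fderivInnerCLM_apply, ← hx]

theorem fderiv_totalPhase_eq_zero (b ω B t : ℝ) (hω : 0 < ω) (η₀ : Plane) {p₀ : Plane × Plane}
    (hp₀ : p₀ ∈ phaseSpace b) (hη : p₀.2 = η₀) :
    fderiv ℝ (totalPhase b ω B t (flowX b ω t p₀.1 p₀.2) η₀) p₀ = 0 := by
  rw [(hasFDerivAt_totalPhase b ω B t hω _ η₀ hp₀).fderiv]
  refine ContinuousLinearMap.ext fun v => ?_
  rw [totalPhaseDeriv_apply]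
  simp [hη]

end ABOscillator

/-! ### The determinants of xᵗ_y and Z, and nondegeneracy of the Hessian. -/

namespace ABOscillator

open SymbolCalculus

theorem norm_sq_plane (x : Plane) : ‖x‖ ^ 2 = x 0 ^ 2 + x 1 ^ 2 := by
  rw [EuclideanSpace.real_norm_sq_eq, Fin.sum_univ_two]

theorem norm_pow_four_plane (x : Plane) : ‖x‖ ^ 4 = (x 0 ^ 2 + x 1 ^ 2) ^ 2 := by
  rw [← norm_sq_plane]; ring

theorem sq_add_sq_ne_zero {x : Plane} (hx : x ≠ 0) : x 0 ^ 2 + x 1 ^ 2 ≠ 0 := by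
  rw [← norm_sq_plane]
  exact pow_ne_zero 2 (norm_ne_zero_iff.mpr hx)

/-- The determinant of `xᵗ_y`. -/
theorem det_flowXy (b ω t : ℝ) {y : Plane} (hy : y ≠ 0) (η : Plane) :
    (flowXy b ω t y η).det = Real.cos (ω * t) ^ 2 -
      b ^ 2 / ω ^ 2 * (‖y‖ ^ 4)⁻¹ * Real.sin (ω * t) ^ 2 := by
  have h := sq_add_sq_ne_zero hy
  rw [flowXy_eq b ω t y η hy, ContinuousLinearMap.det,
    ← LinearMap.det_toMatrix (EuclideanSpace.basisFun (Fin 2) ℝ).toBasis, Matrix.det_fin_two]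
  simp [LinearMap.toMatrix_apply, potentialDeriv_apply, norm_pow_four_plane]
  by_cases hω : ω = 0
  · simp [hω]
  field_simp
  ring

/-- The function `(cos ωt - i B sin ωt / ω)² - (sin ωt / ω)² r²`, which is `det Z` for
`r = |b| / |xᵗ|²`. -/
noncomputable def detZ (ω B r t : ℝ) : ℂ :=
  ((Real.cos (ω * t) : ℂ) - Complex.I * (B * (Real.sin (ω * t) / ω) : ℝ)) ^ 2 -
    ((Real.sin (ω * t) / ω * r : ℝ) : ℂ) ^ 2

theorem jacobian_flowX (b ω t : ℝ) (y η : Plane) :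
    jacobian (flowX b ω t y) η = (Real.sin (ω * t) / ω) • (1 : Matrix (Fin 2) (Fin 2) ℝ) := by
  have h : HasFDerivAt (flowX b ω t y)
      ((Real.sin (ω * t) / ω) • ContinuousLinearMap.id ℝ Plane) η :=
    (((hasFDerivAt_id η).sub_const (potential b y)).fun_const_smul
      (Real.sin (ω * t) / ω)).const_add _
  ext i j
  simp [jacobian, h.fderiv, Matrix.one_apply, PiLp.single_apply]

theorem jacobian_flowXi (b ω t : ℝ) (hω : 0 < ω) {y η : Plane} (hp : (y, η) ∈ phaseSpace b)
    (i j : Fin 2) :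
    jacobian (flowXi b ω t y) η i j = Real.cos (ω * t) * (1 : Matrix (Fin 2) (Fin 2) ℝ) i j +
      Real.sin (ω * t) / ω *
        potentialDeriv b (flowX b ω t y η) (EuclideanSpace.single j 1) i := by
  have h : HasFDerivAt (flowX b ω t y)
      ((Real.sin (ω * t) / ω) • ContinuousLinearMap.id ℝ Plane) η :=
    (((hasFDerivAt_id η).sub_const (potential b y)).fun_const_smul
      (Real.sin (ω * t) / ω)).const_add _
  have hV : HasFDerivAt (flowV b ω t y)
      (Real.cos (ω * t) • ContinuousLinearMap.id ℝ Plane) η :=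
    (((hasFDerivAt_id η).sub_const (potential b y)).fun_const_smul
      (Real.cos (ω * t))).const_add _
  have hA := (hasFDerivAt_potential b _ (flowX_ne_zero b ω t hω y η hp)).comp η h
  have hXi : HasFDerivAt (flowXi b ω t y) _ η := hV.add hA
  simp [jacobian, hXi.fderiv, Matrix.one_apply, PiLp.single_apply]

/-- With σ = sin ωt/ω one has Z = (cos ωt − iBσ) + σ A_x(xᵗ), where A_x(xᵗ) is symmetric and
trace-free with determinant −b²/|xᵗ|⁴. -/
theorem det_matrixZ (b ω B t : ℝ) (hω : 0 < ω) {y η : Plane} (hp : (y, η) ∈ phaseSpace b) :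
    (matrixZ b ω B t y η).det = detZ ω B (|b| / ‖flowX b ω t y η‖ ^ 2) t := by
  have hx := sq_add_sq_ne_zero (flowX_ne_zero b ω t hω y η hp)
  have hx' : (((flowX b ω t y η 0 : ℝ) : ℂ) ^ 2 + ((flowX b ω t y η 1 : ℝ) : ℂ) ^ 2) ≠ 0 := by
    rw [← Complex.ofReal_pow, ← Complex.ofReal_pow, ← Complex.ofReal_add]
    exact Complex.ofReal_ne_zero.mpr hx
  have hω' : (ω : ℂ) ≠ 0 := by exact_mod_cast hω.ne'
  have hb : (((|b| : ℝ) : ℂ)) ^ 2 = (b : ℂ) ^ 2 := by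
    rw [← Complex.ofReal_pow, sq_abs, Complex.ofReal_pow]
  rw [Matrix.det_fin_two, detZ, norm_sq_plane]
  simp only [matrixZ, jacobian_flowX, Matrix.sub_apply, Matrix.map_apply, Matrix.smul_apply,
    jacobian_flowXi b ω t hω hp, potentialDeriv_apply, norm_pow_four_plane]
  simp
  field_simp
  rw [hb]
  ring

/-- A zero would make cos ωt − iBσ equal to the real number ±σr; then σ = 0, and so cos ωt = 0,
which is absurd. -/
theorem detZ_ne_zero {ω B : ℝ} (hω : 0 < ω) (hB : 0 < B) (r t : ℝ) : detZ ω B r t ≠ 0 := by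
  intro h
  rw [detZ, sub_eq_zero, sq_eq_sq_iff_eq_or_eq_neg] at h
  have him : B * (Real.sin (ω * t) / ω) = 0 := by
    rcases h with h | h <;>
    · have := congrArg Complex.im h
      simpa [-Complex.ofReal_mul, -Complex.ofReal_div] using this
  have hs : Real.sin (ω * t) = 0 := by
    rcases mul_eq_zero.mp him with h | h
    · exact absurd h hB.ne'
    · exact (div_eq_zero_iff.mp h).resolve_right hω.ne'
  have hsc := Real.sin_sq_add_cos_sq (ω * t)
  rw [hs] at h hsc
  have hc : Real.cos (ω * t) = 0 := by
    rcases h with h | h <;>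
    · have := congrArg Complex.re h
      simpa [-Complex.ofReal_cos, -Complex.ofReal_mul] using this
  rw [hc] at hsc
  norm_num at hsc

/-- The standard basis of the phase space. -/
noncomputable def phaseBasis : Module.Basis (Fin 2 ⊕ Fin 2) ℝ (Plane × Plane) :=
  (EuclideanSpace.basisFun (Fin 2) ℝ).toBasis.prod (EuclideanSpace.basisFun (Fin 2) ℝ).toBasis

/-- The Hessian at a stationary point is nondegenerate when `xᵗ_y` is. -/
theorem exists_coords_phaseHessian (b ω B t : ℝ) (hω : 0 < ω) (hB : 0 < B) {p₀ : Plane × Plane}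
    (hp₀ : p₀ ∈ phaseSpace b) (hD : (flowXy b ω t p₀.1 p₀.2).det ≠ 0) :
    ∃ c : Fin 2 ⊕ Fin 2 → Fin 2 ⊕ Fin 2 → ℂ, ∀ p j, ((phaseBasis.repr p j : ℝ) : ℂ) =
      ∑ k, c j k * phaseHessian b ω B t p₀ p (phaseBasis k) := by
  set H := phaseHessian b ω B t p₀ with hH
  set x := flowX b ω t p₀.1 p₀.2 with hx
  have hxne : x ≠ 0 := flowX_ne_zero b ω t hω p₀.1 p₀.2 hp₀
  set co := Real.cos (ω * t) with hco
  set σ := Real.sin (ω * t) / ω with hσ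
  set M : Submodule ℂ (Plane × Plane → ℂ) :=
    Submodule.span ℂ (Set.range fun k p => H p (phaseBasis k)) with hM
  -- Inverting the matrix of H amounts to showing that the coordinate functions lie in the complex
  -- span M of the functions H(·, b_k).
  suffices hmem : ∀ j, (fun p => ((phaseBasis.repr p j : ℝ) : ℂ)) ∈ M by
    choose c hc using fun j => (Submodule.mem_span_range_iff_exists_fun ℂ).mp (hmem j)
    refine ⟨c, fun p j => ?_⟩
    have := congrFun (hc j) p
    simp only [Finset.sum_apply, Pi.smul_apply, smul_eq_mul] at this
    exact this.symm
  have hHmem : ∀ v, (fun p => H p v) ∈ M := fun v => by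
    have : (fun p => H p v) = ∑ k, ((phaseBasis.repr v k : ℝ) : ℂ) • fun p => H p (phaseBasis k) := by
      funext p
      conv_lhs => rw [← phaseBasis.sum_repr v, map_sum]
      simp
    rw [this]
    exact M.sum_mem fun k _ => M.smul_mem _ (Submodule.subset_span ⟨k, rfl⟩)
  -- With q = dxᵗ(p), testing with (0, u) gives H(p, (0, u)) = −q·Zu; the adjugate (cos ωt − iBσ) −
  -- σA_x(x) of Z recovers q.
  have hX : ∀ w : Plane, (fun p => ((inner ℝ (flowXDeriv b ω t p₀.1 p) w : ℝ) : ℂ)) ∈ M := by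
    intro w
    have hdet := detZ_ne_zero hω hB (|b| / ‖x‖ ^ 2) t
    have hval : ∀ p u, H p ((0 : Plane), u) =
        -((co : ℂ) - Complex.I * B * σ) * ((inner ℝ (flowXDeriv b ω t p₀.1 p) u : ℝ) : ℂ) -
        σ * ((inner ℝ (flowXDeriv b ω t p₀.1 p) (potentialDeriv b x u) : ℝ) : ℂ) := by
      intro p u
      rw [hH, phaseHessian_apply, flowXiDeriv_apply]
      simp only [flowVDeriv_apply, flowXDeriv_apply b ω t p₀.1 ((0 : Plane), u), map_zero, sub_zero,
        smul_zero, zero_add, map_smul, inner_add_right, inner_zero_right, real_inner_smul_right,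
        ← hx, ← hco, ← hσ]
      push_cast
      ring
    have key : (fun p => ((inner ℝ (flowXDeriv b ω t p₀.1 p) w : ℝ) : ℂ)) =
        (detZ ω B (|b| / ‖x‖ ^ 2) t)⁻¹ • (-((co : ℂ) - Complex.I * B * σ) •
          (fun p => H p ((0 : Plane), w)) + (σ : ℂ) • fun p => H p (0, potentialDeriv b x w)) := by
      funext p
      simp only [Pi.smul_apply, Pi.add_apply, smul_eq_mul, hval, potentialDeriv_sq b x _ hxne,
        real_inner_smul_right]
      rw [eq_inv_mul_iff_mul_eq₀ hdet]
      have hb : (((|b| : ℝ) : ℂ)) ^ 2 = (b : ℂ) ^ 2 := by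
        rw [← Complex.ofReal_pow, sq_abs, Complex.ofReal_pow]
      have hr : (((|b| / ‖x‖ ^ 2 : ℝ)) : ℂ) ^ 2 = ((b ^ 2 / ‖x‖ ^ 4 : ℝ) : ℂ) := by
        push_cast
        rw [div_pow, hb]
        ring
      simp only [detZ, ← hco, ← hσ]
      rw [Complex.ofReal_mul σ, mul_pow (σ : ℂ), hr]
      push_cast
      ring
    rw [key]
    exact M.smul_mem _ (M.add_mem (M.smul_mem _ (hHmem _)) (M.smul_mem _ (hHmem _)))
  -- Once q is known, testing with (w, 0) isolates the second component.
  have h2 : ∀ w : Plane, (fun p : Plane × Plane => ((inner ℝ p.2 w : ℝ) : ℂ)) ∈ M := by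
    intro w
    have key : (fun p : Plane × Plane => ((inner ℝ p.2 w : ℝ) : ℂ)) =
        (-1 : ℂ) • (fun p => H p (w, (0 : Plane))) +
        ((-1 : ℂ) • (fun p => ((inner ℝ (flowXDeriv b ω t p₀.1 p)
          (flowXiDeriv b ω t p₀.1 p₀.2 (w, 0)) : ℝ) : ℂ)) +
        (Complex.I * B) • (fun p => ((inner ℝ (flowXDeriv b ω t p₀.1 p)
          (flowXDeriv b ω t p₀.1 (w, 0)) : ℝ) : ℂ))) := by
      funext p
      simp only [Pi.smul_apply, Pi.add_apply, smul_eq_mul, hH, phaseHessian_apply]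
      push_cast
      ring
    rw [key]
    exact M.add_mem (M.smul_mem _ (hHmem _)) (M.add_mem (M.smul_mem _ (hX _)) (M.smul_mem _ (hX _)))
  -- The first component is obtained from q − σζ = xᵗ_y z with the adjugate cos ωt + σA_x(y₀) of
  -- xᵗ_y; here det xᵗ_y ≠ 0 is needed.
  have h1 : ∀ w : Plane, (fun p : Plane × Plane => ((inner ℝ p.1 w : ℝ) : ℂ)) ∈ M := by
    intro w
    set D := (flowXy b ω t p₀.1 p₀.2).det with hDdef
    have hDe : D = co ^ 2 - σ ^ 2 * (b ^ 2 / ‖p₀.1‖ ^ 4) := by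
      rw [hDdef, det_flowXy b ω t hp₀.1, hσ, ← hco]
      field_simp
    set w' := co • w + σ • potentialDeriv b p₀.1 w with hw'
    have key : (fun p : Plane × Plane => ((inner ℝ p.1 w : ℝ) : ℂ)) =
        (D : ℂ)⁻¹ • ((fun p => ((inner ℝ (flowXDeriv b ω t p₀.1 p) w' : ℝ) : ℂ)) +
          (-σ : ℂ) • fun p : Plane × Plane => ((inner ℝ p.2 w' : ℝ) : ℂ)) := by
      funext p
      have hD' : (D : ℂ) ≠ 0 := by exact_mod_cast hD
      simp only [Pi.smul_apply, Pi.add_apply, smul_eq_mul]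
      rw [eq_inv_mul_iff_mul_eq₀ hD', flowXDeriv_apply, inner_add_left, real_inner_smul_left,
        real_inner_smul_left, inner_sub_left, ← inner_potentialDeriv]
      have hw2 : potentialDeriv b p₀.1 w' =
          co • potentialDeriv b p₀.1 w + (σ * (b ^ 2 / ‖p₀.1‖ ^ 4)) • w := by
        rw [hw', map_add, map_smul, map_smul, potentialDeriv_sq b _ _ hp₀.1, smul_smul]
      rw [hw2, hw', hDe]
      simp only [inner_add_right, real_inner_smul_right, ← hco, ← hσ]
      push_cast
      ring
    rw [key]
    exact M.smul_mem _ (M.add_mem (hX _) (M.smul_mem _ (h2 _)))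
  intro j
  rcases j with j | j
  · convert h1 (EuclideanSpace.single j 1) using 2 with p
    simp [phaseBasis, EuclideanSpace.inner_single_right]
  · convert h2 (EuclideanSpace.single j 1) using 2 with p
    simp [phaseBasis, EuclideanSpace.inner_single_right]

end ABOscillator

/-! ### The continuous square root of det Z. -/

namespace ABOscillator

/-- A function of `B` and `r` close to the square root of `det Z`. -/
noncomputable def sqrtApprox (ω B r t : ℝ) : ℂ :=
  (Real.cos (ω * t) : ℂ) - Complex.I * ((√(B ^ 2 + r ^ 2) * (Real.sin (ω * t) / ω) : ℝ) : ℂ)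

/-- The square root of `det Z` as a function of `r = |b| / |xᵗ|²`. -/
noncomputable def sqrtZ (ω B r t : ℝ) : ℂ :=
  sqrtApprox ω B r t * (detZ ω B r t / sqrtApprox ω B r t ^ 2) ^ (1 / 2 : ℂ)

section

variable {ω B : ℝ} (hω : 0 < ω) (hB : 0 < B)
include hω hB

theorem sqrtApprox_ne_zero (r t : ℝ) : sqrtApprox ω B r t ≠ 0 := by
  intro h
  have hre := congrArg Complex.re h
  have him := congrArg Complex.im h
  simp only [sqrtApprox, Complex.sub_re, Complex.sub_im, Complex.ofReal_re, Complex.ofReal_im,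
    Complex.mul_re, Complex.mul_im, Complex.I_re, Complex.I_im, Complex.zero_re,
    Complex.zero_im] at hre him
  have hγ : 0 < √(B ^ 2 + r ^ 2) := Real.sqrt_pos.mpr (by positivity)
  have hc : Real.cos (ω * t) = 0 := by linarith
  have hs : √(B ^ 2 + r ^ 2) * (Real.sin (ω * t) / ω) = 0 := by linarith
  have hs' : Real.sin (ω * t) = 0 := (div_eq_zero_iff.mp
    ((mul_eq_zero.mp hs).resolve_left hγ.ne')).resolve_right hω.ne'
  have := Real.sin_sq_add_cos_sq (ω * t)
  rw [hc, hs'] at this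
  norm_num at this

/-- With γ² = B² + r² both numbers have the real part c² − γ²σ², and their imaginary parts −2Bcσ and
−2γcσ have the same sign. So the quotient stays in the right half-plane, where the principal root is
smooth, and `sqrtZ` is a global branch. -/
theorem detZ_div_re_pos (r t : ℝ) : 0 < (detZ ω B r t / sqrtApprox ω B r t ^ 2).re := by
  have hne := pow_ne_zero 2 (sqrtApprox_ne_zero hω hB r t)
  have hγ : 0 < √(B ^ 2 + r ^ 2) := Real.sqrt_pos.mpr (by positivity)
  have hγ2 : √(B ^ 2 + r ^ 2) ^ 2 = B ^ 2 + r ^ 2 := Real.sq_sqrt (by positivity)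
  have hsc := Real.sin_sq_add_cos_sq (ω * t)
  have hsσ : Real.sin (ω * t) = ω * (Real.sin (ω * t) / ω) := by field_simp
  rw [Complex.div_re, ← add_div]
  refine div_pos ?_ (Complex.normSq_pos.mpr hne)
  set γ := √(B ^ 2 + r ^ 2)
  set c := Real.cos (ω * t)
  set σ := Real.sin (ω * t) / ω
  have hA : sqrtApprox ω B r t = (c : ℂ) - Complex.I * ((γ * σ : ℝ) : ℂ) := rfl
  have hZ : detZ ω B r t = ((c : ℂ) - Complex.I * (B * σ : ℝ)) ^ 2 - ((σ * r : ℝ) : ℂ) ^ 2 := rfl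
  rw [hsσ] at hsc
  have h1 : (detZ ω B r t).re = c ^ 2 - γ ^ 2 * σ ^ 2 := by
    rw [hγ2]
    simp [hZ, pow_two]
    ring
  have h2 : (detZ ω B r t).im = -(2 * B * c * σ) := by
    simp [hZ, pow_two]
    ring
  have h3 : (sqrtApprox ω B r t ^ 2).re = c ^ 2 - γ ^ 2 * σ ^ 2 := by
    simp [hA, pow_two]
    ring
  have h4 : (sqrtApprox ω B r t ^ 2).im = -(2 * γ * c * σ) := by
    simp [hA, pow_two]
    ring
  rw [h1, h2, h3, h4]
  have h5 : 0 ≤ 4 * B * γ * (c * σ) ^ 2 := by positivity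
  by_contra hle
  have h6 : (c ^ 2 - γ ^ 2 * σ ^ 2) ^ 2 ≤ 0 := by nlinarith
  have h7 : 4 * B * γ * (c * σ) ^ 2 ≤ 0 := by nlinarith [sq_nonneg (c ^ 2 - γ ^ 2 * σ ^ 2)]
  have h8 : c ^ 2 - γ ^ 2 * σ ^ 2 = 0 := by
    exact pow_eq_zero_iff (two_ne_zero) |>.mp (le_antisymm h6 (sq_nonneg _))
  have h9 : c * σ = 0 := by
    have : (c * σ) ^ 2 = 0 := by
      have h10 : 0 < 4 * B * γ := by positivity
      nlinarith [sq_nonneg (c * σ)]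
    exact pow_eq_zero_iff (two_ne_zero) |>.mp this
  rcases mul_eq_zero.mp h9 with h | h
  · rw [h] at h8 hsc
    have : γ ^ 2 * σ ^ 2 = 0 := by linarith
    have hσ : σ ^ 2 = 0 := (mul_eq_zero.mp this).resolve_left (by positivity)
    rw [mul_pow, hσ] at hsc
    norm_num at hsc
  · rw [h] at h8 hsc
    have : c ^ 2 = 0 := by linarith
    rw [this] at hsc
    norm_num at hsc

theorem sqrtZ_sq (r t : ℝ) : sqrtZ ω B r t ^ 2 = detZ ω B r t := by
  have hne := pow_ne_zero 2 (sqrtApprox_ne_zero hω hB r t)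
  rw [sqrtZ, mul_pow, ← Complex.cpow_nat_mul]
  norm_num
  exact mul_div_cancel₀ _ hne

theorem sqrtZ_ne_zero (r t : ℝ) : sqrtZ ω B r t ≠ 0 := fun h => by
  have := sqrtZ_sq hω hB r t
  rw [h] at this
  exact detZ_ne_zero hω hB r t (by simpa using this.symm)

theorem continuousOn_sqrtZ {X : Type*} [TopologicalSpace X] {s : Set X} {r τ : X → ℝ}
    (hr : ContinuousOn r s) (hτ : ContinuousOn τ s) :
    ContinuousOn (fun z => sqrtZ ω B (r z) (τ z)) s := by
  have hA : ContinuousOn (fun z => sqrtApprox ω B (r z) (τ z)) s := by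
    unfold sqrtApprox
    fun_prop
  have hD : ContinuousOn (fun z => detZ ω B (r z) (τ z)) s := by
    unfold detZ
    fun_prop
  unfold sqrtZ
  exact hA.mul ((hD.div (hA.pow 2) fun z _ => pow_ne_zero 2 (sqrtApprox_ne_zero hω hB _ _)).cpow
    continuousOn_const fun z _ => Or.inl (detZ_div_re_pos hω hB _ _))

/-- Two continuous functions on [0, ∞) with the same nonvanishing square and the same initial value
coincide, so the branch chosen in the definition is the explicit one. -/
theorem sqrtDetZ_eq (b : ℝ) {t : ℝ} (ht : 0 ≤ t) {y η : Plane} (hp : (y, η) ∈ phaseSpace b) :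
    sqrtDetZ b ω B t y η = sqrtZ ω B (|b| / ‖flowX b ω t y η‖ ^ 2) t := by
  set R : ℝ → ℂ := fun s => sqrtZ ω B (|b| / ‖flowX b ω s y η‖ ^ 2) s with hR
  have hcX : Continuous fun s => flowX b ω s y η :=
    continuous_iff_continuousAt.mpr fun s => (hasDerivAt_flowX b ω s hω y η).continuousAt
  have hRc : ContinuousOn R (Set.Ici 0) := by
    refine continuousOn_sqrtZ hω hB (ContinuousOn.div continuousOn_const
      (hcX.norm.pow 2).continuousOn fun s _ => ?_) continuousOn_id
    exact pow_ne_zero 2 (norm_ne_zero_iff.mpr (flowX_ne_zero b ω s hω y η hp))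
  have hR0 : R 0 = 1 := by
    simp [hR, sqrtZ, sqrtApprox, detZ]
  have hRsq : ∀ s, R s ^ 2 = (matrixZ b ω B s y η).det := fun s => by
    rw [det_matrixZ b ω B s hω hp]
    exact sqrtZ_sq hω hB _ _
  have hex : ∃ r, IsContinuousSqrt (fun s => (matrixZ b ω B s y η).det) r :=
    ⟨R, hRc, hR0, fun s _ => hRsq s⟩
  rw [sqrtDetZ, dif_pos hex]
  have hch := hex.choose_spec
  refine isPreconnected_Ici.eq_of_sq_eq hch.1 hRc (fun s hs => ?_)
    (fun {s} _ => sqrtZ_ne_zero hω hB _ _) (Set.self_mem_Ici) (by rw [hch.2.1, hR0]) ht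
  simp only [Pi.pow_apply]
  rw [hch.2.2 s hs, hRsq]

theorem contDiffOn_sqrtZ (b t : ℝ) : ContDiffOn ℝ (⊤ : ℕ∞)
    (fun x : Plane => sqrtZ ω B (|b| / ‖x‖ ^ 2) t) {x | x ≠ 0} := by
  have hn : ContDiffOn ℝ (⊤ : ℕ∞) (fun x : Plane => |b| / ‖x‖ ^ 2) {x | x ≠ 0} :=
    contDiffOn_const.fun_div (contDiff_norm_sq ℝ).contDiffOn
      fun x hx => pow_ne_zero 2 (norm_ne_zero_iff.mpr hx)
  have hA : ContDiffOn ℝ (⊤ : ℕ∞) (fun x : Plane => sqrtApprox ω B (|b| / ‖x‖ ^ 2) t)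
      {x | x ≠ 0} := by
    unfold sqrtApprox
    exact contDiffOn_const.sub (contDiffOn_const.mul (Complex.ofRealCLM.contDiff.comp_contDiffOn
      (((contDiffOn_const.add (hn.pow 2)).sqrt fun x _ => by positivity).mul contDiffOn_const)))
  have hD : ContDiffOn ℝ (⊤ : ℕ∞) (fun x : Plane => detZ ω B (|b| / ‖x‖ ^ 2) t) {x | x ≠ 0} := by
    unfold detZ
    exact contDiffOn_const.sub ((Complex.ofRealCLM.contDiff.comp_contDiffOn
      (contDiffOn_const.mul hn)).pow 2)
  unfold sqrtZ
  refine hA.mul ?_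
  have hq : ContDiffOn ℝ (⊤ : ℕ∞) (fun x : Plane => detZ ω B (|b| / ‖x‖ ^ 2) t /
      sqrtApprox ω B (|b| / ‖x‖ ^ 2) t ^ 2) {x | x ≠ 0} :=
    hD.mul ((hA.pow 2).inv fun x _ => pow_ne_zero 2 (sqrtApprox_ne_zero hω hB _ _))
  have hF : ContDiffOn ℝ (⊤ : ℕ∞) (fun z : ℂ => z ^ (1 / 2 : ℂ)) Complex.slitPlane := by
    have : ContDiffOn ℂ (⊤ : ℕ∞) (fun z : ℂ => z ^ (1 / 2 : ℂ)) Complex.slitPlane :=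
      DifferentiableOn.contDiffOn (fun z hz =>
        ((hasStrictDerivAt_id z).cpow_const hz).hasDerivAt.differentiableAt.differentiableWithinAt)
        Complex.isOpen_slitPlane
    exact this.restrict_scalars ℝ
  exact hF.comp hq fun x _ => Or.inl (detZ_div_re_pos hω hB _ _)

/-- Away from the times where `sin ωt` vanishes, `(det Z)^{1/2}` is a product of principal
square roots. -/
theorem sqrtZ_eq_mul (r : ℝ) (hr : 0 ≤ r) {t : ℝ} (ht : Real.sin (ω * t) ≠ 0) :
    sqrtZ ω B r t = -Complex.I * (Real.sin (ω * t) / ω : ℝ) *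
      (((B : ℂ) + Complex.I * (Real.cos (ω * t) / (Real.sin (ω * t) / ω) + r : ℝ)) ^ (1 / 2 : ℂ) *
      ((B : ℂ) + Complex.I * (Real.cos (ω * t) / (Real.sin (ω * t) / ω) - r : ℝ)) ^ (1 / 2 : ℂ)) := by
  set c := Real.cos (ω * t) with hc
  set σ := Real.sin (ω * t) / ω with hσ
  have hσ0 : σ ≠ 0 := div_ne_zero ht hω.ne'
  have hσc : (σ : ℂ) ≠ 0 := by exact_mod_cast hσ0
  have hre : ∀ q : ℝ, 0 < ((B : ℂ) + Complex.I * (q : ℝ)).re := fun q => by simpa using hB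
  have hcont : ∀ f : ℝ → ℝ, Continuous f →
      Continuous (fun r => ((B : ℂ) + Complex.I * (f r : ℝ)) ^ (1 / 2 : ℂ)) := fun f hf =>
    Continuous.cpow (by fun_prop) continuous_const fun r => Or.inl (hre _)
  have hsq : ∀ q : ℝ, (((B : ℂ) + Complex.I * (q : ℝ)) ^ (1 / 2 : ℂ)) ^ 2 =
      (B : ℂ) + Complex.I * (q : ℝ) := fun q => by
    rw [← Complex.cpow_nat_mul]
    norm_num
  have hne : ∀ q : ℝ, ((B : ℂ) + Complex.I * (q : ℝ)) ≠ 0 := fun q h => by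
    have := hre q
    rw [h] at this
    simp at this
  -- The branches are compared by continuity in r at fixed t, because the right-hand side is
  -- singular at the times with sin ωt = 0. At r = 0 the function `sqrtApprox` is an exact root.
  refine isPreconnected_Ici.eq_of_sq_eq (S := Set.Ici 0) (f := fun r => sqrtZ ω B r t)
    (g := fun r => -Complex.I * (σ : ℝ) *
      (((B : ℂ) + Complex.I * (c / σ + r : ℝ)) ^ (1 / 2 : ℂ) *
      ((B : ℂ) + Complex.I * (c / σ - r : ℝ)) ^ (1 / 2 : ℂ)))
    (continuousOn_sqrtZ hω hB continuousOn_id continuousOn_const) ?_ (fun r _ => ?_)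
    (fun {r} _ => ?_) Set.self_mem_Ici ?_ hr
  · exact ((hcont _ (by fun_prop)).mul (hcont _ (by fun_prop))).const_mul _ |>.continuousOn
  · simp only [Pi.pow_apply]
    rw [sqrtZ_sq hω hB, mul_pow, mul_pow, mul_pow, hsq, hsq, detZ, ← hc, ← hσ]
    push_cast
    field_simp
    linear_combination (-2 * c * B * σ * Complex.I +
      ((c : ℂ) ^ 2 - (σ : ℂ) ^ 2 * (r : ℂ) ^ 2) * (1 - Complex.I ^ 2)) * Complex.I_sq
  · have : ∀ q : ℝ, ((B : ℂ) + Complex.I * (q : ℝ)) ^ (1 / 2 : ℂ) ≠ 0 := fun q h => by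
      have h2 := hsq q
      rw [h] at h2
      exact hne q (by simpa using h2.symm)
    exact mul_ne_zero (mul_ne_zero (neg_ne_zero.mpr Complex.I_ne_zero) hσc)
      (mul_ne_zero (this _) (this _))
  · rw [add_zero, sub_zero, ← pow_two, hsq]
    have h1 : sqrtApprox ω B 0 t = (c : ℂ) - Complex.I * (B * σ : ℝ) := by
      simp [sqrtApprox, hc, hσ, Real.sqrt_sq hB.le]
    have h2 : detZ ω B 0 t = sqrtApprox ω B 0 t ^ 2 := by
      rw [h1]
      simp [detZ, hc, hσ]
    rw [sqrtZ, h2, div_self (pow_ne_zero 2 (sqrtApprox_ne_zero hω hB 0 t)), Complex.one_cpow,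
      mul_one, h1]
    push_cast
    field_simp
    linear_combination (c : ℂ) * Complex.I_sq

theorem sqrtZ_eq_cos (r : ℝ) {t : ℝ} (ht : Real.sin (ω * t) = 0) :
    sqrtZ ω B r t = Real.cos (ω * t) := by
  have h1 : sqrtApprox ω B r t = Real.cos (ω * t) := by simp [sqrtApprox, ht]
  have h2 : detZ ω B r t = sqrtApprox ω B r t ^ 2 := by
    rw [h1]
    simp [detZ, ht]
  rw [sqrtZ, h2, div_self (pow_ne_zero 2 (sqrtApprox_ne_zero hω hB r t)), Complex.one_cpow,
    mul_one, h1]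

end

end ABOscillator

/-! ### The Morse index as a count of zeros. -/

namespace ABOscillator

open Classical in
/-- The number of zeros of `cos θ - κ sin θ` between `0` and `kπ + τ`. -/
theorem focal_times_eq_image {ω : ℝ} (hω : 0 < ω) (κ t τ : ℝ) (k : ℕ) (hτ0 : 0 ≤ τ)
    (hτ : τ < Real.pi) (ht : ω * t = k * Real.pi + τ) :
    {s | s ∈ Set.Ioo 0 t ∧ Real.cos (ω * s) - κ * Real.sin (ω * s) = 0} =
      ((Finset.range (k + if Real.cos τ - κ * Real.sin τ < 0 then 1 else 0)).image
        fun n : ℕ => (Real.pi / 2 + n * Real.pi - Real.arctan κ) / ω : Finset ℝ) := by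
  -- With tan a = κ, cos θ − κ sin θ = cos(θ + a)/cos a, so the positive zeros are π/2 + nπ − a with
  -- n ≥ 0.
  set a := Real.arctan κ with ha
  have ha1 := Real.neg_pi_div_two_lt_arctan κ
  have ha2 := Real.arctan_lt_pi_div_two κ
  rw [← ha] at ha1 ha2
  have hca : 0 < Real.cos a := Real.cos_arctan_pos κ
  have hpi := Real.pi_pos
  have hcos : ∀ θ, Real.cos (θ + a) = Real.cos a * (Real.cos θ - κ * Real.sin θ) := fun θ => by
    have h1 : Real.sin a = κ * Real.cos a := by
      have := Real.tan_arctan κ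
      rw [← ha, Real.tan_eq_sin_div_cos, div_eq_iff hca.ne'] at this
      exact this
    rw [Real.cos_add, h1]
    ring
  have hzero : ∀ θ, Real.cos θ - κ * Real.sin θ = 0 ↔ Real.cos (θ + a) = 0 := fun θ => by
    rw [hcos, mul_eq_zero, or_iff_right hca.ne']
  have hneg : Real.cos τ - κ * Real.sin τ < 0 ↔ Real.pi / 2 - a < τ := by
    have h1 : Real.cos τ - κ * Real.sin τ < 0 ↔ Real.cos (τ + a) < 0 := by
      rw [hcos, mul_neg_iff]
      simp [hca, not_lt.mpr hca.le]
    rw [h1]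
    constructor
    · intro h
      by_contra hle
      exact absurd h (not_lt.mpr (Real.cos_nonneg_of_neg_pi_div_two_le_of_le (by linarith)
        (by linarith)))
    · intro h
      exact Real.cos_neg_of_pi_div_two_lt_of_lt (by linarith) (by linarith)
  -- Each complete half-period contains one zero. The incomplete last one contains the zero strictly
  -- before its end exactly when the function has become negative there.
  have hcount : ∀ n : ℕ, n < (k + if Real.cos τ - κ * Real.sin τ < 0 then 1 else 0) ↔
      Real.pi / 2 + n * Real.pi - a < ω * t := by
    intro n
    rw [ht]
    rcases lt_trichotomy n k with h | h | h
    · have h1 : (n : ℝ) + 1 ≤ k := by exact_mod_cast h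
      have h2 := mul_le_mul_of_nonneg_right h1 hpi.le
      exact iff_of_true (by omega) (by linarith)
    · subst h
      by_cases hn : Real.cos τ - κ * Real.sin τ < 0
      · have := hneg.mp hn
        exact iff_of_true (by simp [hn]) (by linarith)
      · have := fun h => hn (hneg.mpr h)
        exact iff_of_false (by simp [hn]) fun h => this (by linarith)
    · have h1 : (k : ℝ) + 1 ≤ n := by exact_mod_cast h
      have h2 := mul_le_mul_of_nonneg_right h1 hpi.le
      refine iff_of_false ?_ (by linarith)
      split_ifs <;> omega
  ext s
  simp only [Set.mem_ofPred_eq, Finset.coe_image, Finset.coe_range, Set.mem_image, Set.mem_Iio]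
  constructor
  · rintro ⟨⟨hs0, hst⟩, hs⟩
    rw [hzero, Real.cos_eq_zero_iff] at hs
    obtain ⟨m, hm⟩ := hs
    have hωs := mul_pos hω hs0
    have hm0 : 0 ≤ m := by
      by_contra hneg
      have : (m : ℝ) ≤ -1 := by exact_mod_cast (by omega : m ≤ -1)
      have := mul_le_mul_of_nonneg_right this hpi.le
      nlinarith
    obtain ⟨n, rfl⟩ := Int.eq_ofNat_of_zero_le hm0
    push_cast at hm
    refine ⟨n, (hcount n).mpr ?_, ?_⟩
    · have := mul_lt_mul_of_pos_left hst hω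
      linarith
    · rw [div_eq_iff hω.ne']
      linarith
  · rintro ⟨n, hn, rfl⟩
    have h1 := (hcount n).mp hn
    have hn0 : 0 ≤ (n : ℝ) * Real.pi := by positivity
    refine ⟨⟨by apply div_pos _ hω; linarith, by rw [div_lt_iff₀ hω]; linarith⟩, ?_⟩
    rw [hzero, Real.cos_eq_zero_iff]
    refine ⟨n, ?_⟩
    rw [mul_div_cancel₀ _ hω.ne']
    push_cast
    ring

open Classical in
theorem finsum_focal_times {ω : ℝ} (hω : 0 < ω) (κ t τ : ℝ) (k : ℕ) (hτ0 : 0 ≤ τ)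
    (hτ : τ < Real.pi) (ht : ω * t = k * Real.pi + τ) :
    (Function.support fun s => if s ∈ Set.Ioo 0 t ∧ Real.cos (ω * s) - κ * Real.sin (ω * s) = 0
      then 1 else 0 : Set ℝ).Finite ∧
    ∑ᶠ s, (if s ∈ Set.Ioo 0 t ∧ Real.cos (ω * s) - κ * Real.sin (ω * s) = 0 then 1 else 0 : ℕ) =
      k + if Real.cos τ - κ * Real.sin τ < 0 then 1 else 0 := by
  have h := focal_times_eq_image hω κ t τ k hτ0 hτ ht
  set F : Finset ℝ := (Finset.range (k + if Real.cos τ - κ * Real.sin τ < 0 then 1 else 0)).image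
        fun n : ℕ => (Real.pi / 2 + n * Real.pi - Real.arctan κ) / ω with hF
  have hsupp : (Function.support fun s => (if s ∈ Set.Ioo 0 t ∧
      Real.cos (ω * s) - κ * Real.sin (ω * s) = 0 then 1 else 0 : ℕ)) = F := by
    rw [← h]
    ext s
    simp [and_assoc]
  refine ⟨hsupp ▸ F.finite_toSet, ?_⟩
  rw [finsum_eq_sum_of_support_subset _ hsupp.subset]
  have h1 : ∀ s ∈ F, (if s ∈ Set.Ioo 0 t ∧ Real.cos (ω * s) - κ * Real.sin (ω * s) = 0
      then 1 else 0 : ℕ) = 1 := fun s hs => by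
    have : s ∈ (F : Set ℝ) := hs
    rw [← h] at this
    exact if_pos this
  rw [Finset.sum_congr rfl h1, Finset.sum_const, smul_eq_mul, mul_one, hF,
    Finset.card_image_of_injective, Finset.card_range]
  intro m n hmn
  have hmn' := (div_left_inj' hω.ne').mp hmn
  have : (m : ℝ) * Real.pi = n * Real.pi := by linarith
  exact_mod_cast mul_right_cancel₀ Real.pi_ne_zero this

/-- An eigenbasis of `A_x(y)`. -/
theorem exists_eigenvectors_potentialDeriv (b : ℝ) {y : Plane} (hy : y ≠ 0) :
    ∃ u : OrthonormalBasis (Fin 2) ℝ Plane,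
      potentialDeriv b y (u 0) = (|b| / ‖y‖ ^ 2) • u 0 ∧
      potentialDeriv b y (u 1) = (-(|b| / ‖y‖ ^ 2)) • u 1 := by
  -- The eigenvectors bisect the radial and the angular direction at y; the sign e of b decides
  -- which of them belongs to +|b|/|y|².
  obtain ⟨e, he, heb⟩ : ∃ e : ℝ, e ^ 2 = 1 ∧ |b| = e * b := by
    rcases le_total 0 b with h | h
    · exact ⟨1, by norm_num, by rw [abs_of_nonneg h]; ring⟩
    · exact ⟨-1, by norm_num, by rw [abs_of_nonpos h]; ring⟩
  have hn := sq_add_sq_ne_zero hy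
  have hn' : 0 < y 0 ^ 2 + y 1 ^ 2 := lt_of_le_of_ne (by positivity) hn.symm
  set q : ℝ := (√(2 * (y 0 ^ 2 + y 1 ^ 2)))⁻¹ with hq
  have hq2 : q ^ 2 * (2 * (y 0 ^ 2 + y 1 ^ 2)) = 1 := by
    rw [hq, inv_pow, Real.sq_sqrt (by positivity)]
    field_simp
  set v : Fin 2 → Plane := ![!₂[q * (y 0 + e * y 1), q * (y 1 - e * y 0)],
    !₂[q * (y 0 - e * y 1), q * (y 1 + e * y 0)]] with hv
  have hon : Orthonormal ℝ v := by
    rw [orthonormal_iff_ite]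
    intro i j
    fin_cases i <;> fin_cases j
    · rw [real_inner_self_eq_norm_sq, norm_sq_plane]
      simp [hv]
      linear_combination hq2 + q ^ 2 * (y 0 ^ 2 + y 1 ^ 2) * he
    · simp [hv, PiLp.inner_apply, Fin.sum_univ_two]
      linear_combination -q ^ 2 * (y 0 ^ 2 + y 1 ^ 2) * he
    · simp [hv, PiLp.inner_apply, Fin.sum_univ_two]
      linear_combination -q ^ 2 * (y 0 ^ 2 + y 1 ^ 2) * he
    · rw [real_inner_self_eq_norm_sq, norm_sq_plane]
      simp [hv]
      linear_combination hq2 + q ^ 2 * (y 0 ^ 2 + y 1 ^ 2) * he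
  have hcard : Fintype.card (Fin 2) = Module.finrank ℝ Plane := by simp
  let B := basisOfOrthonormalOfCardEqFinrank hon hcard
  have hB : ⇑B = v := coe_basisOfOrthonormalOfCardEqFinrank hon hcard
  have hB' : ⇑(B.toOrthonormalBasis (by rw [hB]; exact hon)) = v := by
    rw [Module.Basis.coe_toOrthonormalBasis, hB]
  refine ⟨B.toOrthonormalBasis (by rw [hB]; exact hon), ?_, ?_⟩
  · rw [hB', heb, norm_sq_plane]
    ext i
    fin_cases i
    · simp [hv, potentialDeriv_apply, norm_pow_four_plane]
      field_simp
      linear_combination -(q * b * y 1 * (y 0 ^ 2 + y 1 ^ 2)) * he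
    · simp [hv, potentialDeriv_apply, norm_pow_four_plane]
      field_simp
      linear_combination (q * b * y 0 * (y 0 ^ 2 + y 1 ^ 2)) * he
  · rw [hB', heb, norm_sq_plane]
    ext i
    fin_cases i
    · simp [hv, potentialDeriv_apply, norm_pow_four_plane]
      field_simp
      linear_combination -(q * b * y 1 * (y 0 ^ 2 + y 1 ^ 2)) * he
    · simp [hv, potentialDeriv_apply, norm_pow_four_plane]
      field_simp
      linear_combination (q * b * y 0 * (y 0 ^ 2 + y 1 ^ 2)) * he

-- In the eigenbasis of A_x(y) the map xᵗ_y = cos ωt − σA_x(y) is diagonal with the entries cos ωt ∓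
-- σ|b|/|y|², and the dimension of its kernel is the number of vanishing entries.
open Classical in
theorem finrank_ker_flowXy {b ω t : ℝ} (hω : 0 < ω) {y : Plane} (hy : y ≠ 0) (η : Plane) :
    Module.finrank ℝ (LinearMap.ker (flowXy b ω t y η).toLinearMap) =
      (if Real.cos (ω * t) - |b| / ‖y‖ ^ 2 / ω * Real.sin (ω * t) = 0 then 1 else 0) +
      (if Real.cos (ω * t) - -(|b| / ‖y‖ ^ 2 / ω) * Real.sin (ω * t) = 0 then 1 else 0) := by
  obtain ⟨u, h0, h1⟩ := exists_eigenvectors_potentialDeriv b hy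
  set d : Fin 2 → ℝ := ![Real.cos (ω * t) - |b| / ‖y‖ ^ 2 / ω * Real.sin (ω * t),
    Real.cos (ω * t) - -(|b| / ‖y‖ ^ 2 / ω) * Real.sin (ω * t)] with hd
  have hf : (flowXy b ω t y η).toLinearMap =
      Matrix.toLin u.toBasis u.toBasis (Matrix.diagonal d) := by
    refine u.toBasis.ext fun i => ?_
    rw [Matrix.toLin_self, flowXy_eq b ω t y η hy]
    fin_cases i
    · simp [hd, h0, smul_smul, ← sub_eq_add_neg, ← sub_smul]
      congr 1
      field_simp
    · simp [hd, h1, smul_smul, ← sub_eq_add_neg, ← add_smul]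
      congr 1
      field_simp
  have hr := LinearMap.finrank_range_add_finrank_ker (flowXy b ω t y η).toLinearMap
  have hrk : Module.finrank ℝ (LinearMap.range (flowXy b ω t y η).toLinearMap) =
      Fintype.card {i // d i ≠ 0} := by
    rw [hf, ← Matrix.rank_eq_finrank_range_toLin, Matrix.rank_diagonal]
  have hcard : ∀ d : Fin 2 → ℝ, Fintype.card {i // d i ≠ 0} + ((if d 0 = 0 then 1 else 0) +
      (if d 1 = 0 then 1 else 0)) = 2 := fun d => by
    rw [Fintype.card_subtype, Finset.card_filter, Fin.sum_univ_two]
    by_cases h0 : d 0 = 0 <;> by_cases h1 : d 1 = 0 <;> simp [h0, h1]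
  have hcard := hcard d
  rw [hrk, finrank_euclideanSpace_fin] at hr
  have e0 : d 0 = Real.cos (ω * t) - |b| / ‖y‖ ^ 2 / ω * Real.sin (ω * t) := rfl
  have e1 : d 1 = Real.cos (ω * t) - -(|b| / ‖y‖ ^ 2 / ω) * Real.sin (ω * t) := rfl
  rw [← e0, ← e1]
  omega

-- The index splits into two independent counts, one for each eigenvalue ±|b|/|y|² of A_x(y).
open Classical in
theorem morseIndex_eq {b ω t τ : ℝ} (hω : 0 < ω) {y : Plane} (hy : y ≠ 0) (η : Plane) (k : ℕ)
    (hτ0 : 0 ≤ τ) (hτ : τ < Real.pi) (ht : ω * t = k * Real.pi + τ) :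
    morseIndex b ω t y η =
      (k + if Real.cos τ - |b| / ‖y‖ ^ 2 / ω * Real.sin τ < 0 then 1 else 0) +
      (k + if Real.cos τ - -(|b| / ‖y‖ ^ 2 / ω) * Real.sin τ < 0 then 1 else 0) := by
  obtain ⟨f1, e1⟩ := finsum_focal_times hω (|b| / ‖y‖ ^ 2 / ω) t τ k hτ0 hτ ht
  obtain ⟨f2, e2⟩ := finsum_focal_times hω (-(|b| / ‖y‖ ^ 2 / ω)) t τ k hτ0 hτ ht
  rw [← e1, ← e2, ← finsum_add_distrib f1 f2, morseIndex]
  refine finsum_congr fun s => ?_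
  by_cases hs : s ∈ Set.Ioo 0 t
  · simp [hs, finrank_ker_flowXy hω hy η]
  · simp [hs]

end ABOscillator

/-! ### Explicit Gaussian integrals for the Hessian. -/

namespace ABOscillator

theorem ofReal_mul_cpow {r : ℝ} (hr : 0 < r) {z : ℂ} (hz : z ≠ 0) (a : ℂ) :
    ((r : ℂ) * z) ^ a = (r : ℂ) ^ a * z ^ a := by
  have hr' : (r : ℂ) ≠ 0 := by exact_mod_cast hr.ne'
  rw [Complex.cpow_def_of_ne_zero (mul_ne_zero hr' hz), Complex.cpow_def_of_ne_zero hr',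
    Complex.cpow_def_of_ne_zero hz, Complex.log_ofReal_mul hr hz, ← Complex.exp_add,
    Complex.ofReal_log hr.le]
  ring_nf

theorem ofReal_div_cpow {r : ℝ} (hr : 0 < r) {z : ℂ} (hz : 0 < z.re) (a : ℂ) :
    ((r : ℂ) / z) ^ a = (r : ℂ) ^ a * (z ^ a)⁻¹ := by
  have hz0 : z ≠ 0 := fun h => by simp [h] at hz
  rw [div_eq_mul_inv, ofReal_mul_cpow hr (inv_ne_zero hz0), Complex.inv_cpow]
  exact fun h => absurd (Complex.arg_eq_pi_iff.mp h).1 (not_lt.mpr hz.le)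

theorem cpow_half_sq (z : ℂ) : (z ^ (1 / 2 : ℂ)) ^ 2 = z := by
  rw [← Complex.cpow_nat_mul]
  norm_num

/-- A diagonalized Gaussian integral in the plane. -/
theorem integral_gaussian_orthonormalBasis (u : OrthonormalBasis (Fin 2) ℝ Plane) {a : Fin 2 → ℂ}
    (ha : ∀ i, 0 < (a i).re) :
    ∫ x : Plane, Complex.exp (-∑ i, a i * ((inner ℝ (u i) x : ℝ) : ℂ) ^ 2) =
      ∏ i, (Real.pi / a i) ^ (1 / 2 : ℂ) := by
  have h1 := u.measurePreserving_repr.integral_comp u.repr.toHomeomorph.measurableEmbedding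
    (fun y : EuclideanSpace ℝ (Fin 2) => Complex.exp (-∑ i, a i * ((y i : ℝ) : ℂ) ^ 2))
  have h2 := (PiLp.volume_preserving_toLp (Fin 2)).integral_comp
    (MeasurableEquiv.toLp 2 _).measurableEmbedding
    (fun y : EuclideanSpace ℝ (Fin 2) => Complex.exp (-∑ i, a i * ((y i : ℝ) : ℂ) ^ 2))
  simp only [OrthonormalBasis.repr_apply_apply] at h1
  rw [h1, ← h2]
  have h3 : ∀ x : Fin 2 → ℝ, Complex.exp (-∑ i, a i * ((x i : ℝ) : ℂ) ^ 2) =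
      ∏ i, Complex.exp (-a i * ((x i : ℝ) : ℂ) ^ 2) := fun x => by
    rw [← Complex.exp_sum, ← Finset.sum_neg_distrib]
    simp
  simp only [h3]
  rw [integral_fintype_prod_volume_eq_prod (f := fun i (x : ℝ) =>
    Complex.exp (-a i * (x : ℂ) ^ 2))]
  exact Finset.prod_congr rfl fun i _ => integral_gaussian_complex (ha i)

/-- The same with the quadratic form divided by `2α`. -/
theorem integral_gaussian_scaled (u : OrthonormalBasis (Fin 2) ℝ Plane) {w : Fin 2 → ℂ}
    (hw : ∀ i, 0 < (w i).re) {α : ℝ} (hα : 0 < α) :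
    ∫ x : Plane, Complex.exp (-∑ i, w i / (2 * α) * ((inner ℝ (u i) x : ℝ) : ℂ) ^ 2) =
      2 * Real.pi * α * ∏ i, ((w i) ^ (1 / 2 : ℂ))⁻¹ := by
  have hα' : (α : ℂ) ≠ 0 := by exact_mod_cast hα.ne'
  rw [integral_gaussian_orthonormalBasis u (a := fun i => w i / (2 * α)) fun i => by
    have : w i / (2 * (α : ℂ)) = w i / ((2 * α : ℝ) : ℂ) := by push_cast; rfl
    rw [this, Complex.div_ofReal_re]
    exact div_pos (hw i) (by positivity)]
  have h : ∀ i, ((Real.pi : ℂ) / (w i / (2 * α))) ^ (1 / 2 : ℂ) =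
      ((2 * Real.pi * α : ℝ) : ℂ) ^ (1 / 2 : ℂ) * ((w i) ^ (1 / 2 : ℂ))⁻¹ := fun i => by
    rw [← ofReal_div_cpow (by positivity) (hw i)]
    congr 1
    push_cast
    have : w i ≠ 0 := fun h => by have := hw i; simp [h] at this
    field_simp
  simp only [h]
  rw [Finset.prod_mul_distrib, Finset.prod_const, Finset.card_univ, Fintype.card_fin, cpow_half_sq]
  push_cast
  rfl

/-- The value of the inverse square root of `-iμ`. -/
theorem inv_cpow_half_neg_I_mul {μ : ℝ} (hμ : μ ≠ 0) :
    ((-(Complex.I * μ)) ^ (1 / 2 : ℂ))⁻¹ = ((|μ| ^ (-(1 / 2) : ℝ) : ℝ) : ℂ) *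
      Complex.exp (Real.pi / 4 * Complex.I) * (if μ < 0 then -Complex.I else 1) := by
  have habs := abs_pos.mpr hμ
  have hI : -(Complex.I * (μ : ℂ)) = (|μ| : ℝ) * (if μ < 0 then Complex.I else -Complex.I) := by
    split_ifs with h
    · rw [abs_of_neg h]; push_cast; ring
    · rw [abs_of_nonneg (not_lt.mp h)]; ring
  have hne : (if μ < 0 then Complex.I else -Complex.I) ≠ 0 := by split_ifs <;> simp
  have hr : (((|μ| : ℝ) : ℂ) ^ (1 / 2 : ℂ))⁻¹ = ((|μ| ^ (-(1 / 2) : ℝ) : ℝ) : ℂ) := by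
    rw [Complex.ofReal_cpow habs.le, ← Complex.cpow_neg]
    push_cast
    rfl
  rw [hI, ofReal_mul_cpow habs hne, mul_inv, hr, mul_assoc]
  congr 1
  split_ifs with h
  · rw [Complex.cpow_def_of_ne_zero Complex.I_ne_zero, Complex.log_I, ← Complex.exp_neg]
    have : -Complex.I = Complex.exp (-(Real.pi / 2) * Complex.I) := by
      rw [neg_mul, Complex.exp_neg, Complex.exp_pi_div_two_mul_I, Complex.inv_I]
    rw [this, ← Complex.exp_add]
    congr 1
    ring
  · rw [Complex.cpow_def_of_ne_zero (by simp), Complex.log_neg_I, ← Complex.exp_neg, mul_one]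
    congr 1
    ring

end ABOscillator

namespace SymbolCalculus

/-- The regularized Gaussian integrand is integrable. -/
theorem integrable_regularized_gaussian {E : Type*} [NormedAddCommGroup E] [NormedSpace ℝ E]
    [FiniteDimensional ℝ E] [MeasurableSpace E] [BorelSpace E] {μ : Measure E}
    [μ.IsAddHaarMeasure] {β : E →L[ℝ] E →L[ℝ] ℂ} (him : ∀ p, 0 ≤ (β p p).im)
    {ν : E →L[ℝ] E →L[ℝ] ℝ} {k₀ : ℝ} (hk₀ : 0 < k₀) (hνle : ∀ p, k₀ * ‖p‖ ^ 2 ≤ ν p p)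
    {α : ℝ} (hα : 0 < α) :
    Integrable (fun p => Complex.exp (Complex.I * ((1 / 2 : ℂ) * β p p) / (α : ℂ) -
      ((ν p p : ℝ) : ℂ))) μ := by
  have hIν : Integrable (fun p => Real.exp (-(ν p p))) μ :=
    integrable_exp_neg_of_le (by fun_prop) hk₀ hνle
  have hβc : Continuous fun p => β p p := by fun_prop
  have hνc : Continuous fun p => ν p p := by fun_prop
  refine hIν.mono' (Continuous.aestronglyMeasurable (by fun_prop))
    (Eventually.of_forall fun p => ?_)
  rw [Complex.norm_exp, Real.exp_le_exp, Complex.sub_re, Complex.div_ofReal_re, Complex.ofReal_re]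
  have : (Complex.I * ((1 / 2 : ℂ) * β p p)).re = -((β p p).im / 2) := by
    simp
    ring
  rw [this]
  have : 0 ≤ (β p p).im / 2 / α := div_nonneg (div_nonneg (him p) two_pos.le) hα.le
  rw [neg_div]
  linarith

end SymbolCalculus

namespace ABOscillator

open SymbolCalculus

instance isAddHaarMeasure_plane_prod :
    (volume : Measure (Plane × Plane)).IsAddHaarMeasure :=
  inferInstanceAs ((volume : Measure Plane).prod (volume : Measure Plane)).IsAddHaarMeasure

theorem inner_potentialDeriv_self {b : ℝ} {y : Plane} {u : OrthonormalBasis (Fin 2) ℝ Plane}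
    {l : ℝ} (h0 : potentialDeriv b y (u 0) = l • u 0) (h1 : potentialDeriv b y (u 1) = (-l) • u 1)
    (z : Plane) :
    inner ℝ z (potentialDeriv b y z) = l * inner ℝ (u 0) z ^ 2 - l * inner ℝ (u 1) z ^ 2 := by
  rw [← u.sum_inner_mul_inner, Fin.sum_univ_two, inner_potentialDeriv, inner_potentialDeriv, h0, h1,
    real_inner_smul_left, real_inner_smul_left, real_inner_comm (u 0) z, real_inner_comm (u 1) z]
  ring

theorem norm_sq_eq_inner (u : OrthonormalBasis (Fin 2) ℝ Plane) (z : Plane) :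
    ‖z‖ ^ 2 = inner ℝ (u 0) z ^ 2 + inner ℝ (u 1) z ^ 2 := by
  rw [← real_inner_self_eq_norm_sq, ← u.sum_inner_mul_inner, Fin.sum_univ_two,
    real_inner_comm (u 0) z, real_inner_comm (u 1) z]
  ring

/-- The Hessian as a quadratic form in `z` and `xᵗ_y z + xᵗ_η ζ`. -/
theorem phaseHessian_self {b ω B t : ℝ} (hω : 0 < ω) (hs : Real.sin (ω * t) ≠ 0)
    (p₀ p : Plane × Plane) :
    phaseHessian b ω B t p₀ p p =
      ((Real.cos (ω * t) / (Real.sin (ω * t) / ω) * ‖p.1‖ ^ 2 -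
        inner ℝ p.1 (potentialDeriv b p₀.1 p.1) -
        Real.cos (ω * t) / (Real.sin (ω * t) / ω) * ‖flowXDeriv b ω t p₀.1 p‖ ^ 2 -
        inner ℝ (flowXDeriv b ω t p₀.1 p) (potentialDeriv b (flowX b ω t p₀.1 p₀.2)
          (flowXDeriv b ω t p₀.1 p)) : ℝ) : ℂ) +
      Complex.I * ((B * ‖flowXDeriv b ω t p₀.1 p‖ ^ 2 : ℝ) : ℂ) := by
  rw [phaseHessian_apply, real_inner_self_eq_norm_sq]
  have hsc := Real.sin_sq_add_cos_sq (ω * t)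
  set q := flowXDeriv b ω t p₀.1 p with hq
  -- For sin ωt ≠ 0 the relation q = cos ωt z + σ(ζ − A_x z) is solved for ζ, so that z and q serve
  -- as coordinates; in them the mixed terms of the Hessian cancel.
  have hζ : p.2 = (ω / Real.sin (ω * t)) • (q - Real.cos (ω * t) • p.1) +
      potentialDeriv b p₀.1 p.1 := by
    rw [hq, flowXDeriv_apply, add_sub_cancel_left, smul_smul]
    have : ω / Real.sin (ω * t) * (Real.sin (ω * t) / ω) = 1 := by field_simp
    rw [this, one_smul, sub_add_cancel]
  have hV : flowVDeriv b ω t p₀.1 p = (ω / Real.sin (ω * t)) • (Real.cos (ω * t) • q - p.1) := by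
    rw [hq, flowVDeriv_apply, flowXDeriv_apply]
    generalize p.2 - potentialDeriv b p₀.1 p.1 = m
    ext i
    simp only [PiLp.add_apply, PiLp.smul_apply, PiLp.sub_apply, smul_eq_mul]
    field_simp
    linear_combination (-(ω * p.1 i)) * hsc
  have h : -inner ℝ q (flowXiDeriv b ω t p₀.1 p₀.2 p) - inner ℝ p.2 p.1 =
      Real.cos (ω * t) / (Real.sin (ω * t) / ω) * ‖p.1‖ ^ 2 -
        inner ℝ p.1 (potentialDeriv b p₀.1 p.1) -
        Real.cos (ω * t) / (Real.sin (ω * t) / ω) * ‖q‖ ^ 2 -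
        inner ℝ q (potentialDeriv b (flowX b ω t p₀.1 p₀.2) q) := by
    rw [flowXiDeriv_apply, hV, ← hq, inner_add_right, real_inner_smul_right, inner_sub_right,
      real_inner_smul_right, real_inner_self_eq_norm_sq]
    nth_rewrite 1 [hζ]
    rw [inner_add_left, real_inner_smul_left, inner_sub_left, real_inner_smul_left,
      real_inner_self_eq_norm_sq, real_inner_comm p.1 (potentialDeriv b p₀.1 p.1)]
    field_simp
    ring
  rw [h]
  push_cast
  ring

/-- Fubini and a substitution for a function of `z` and `L z + σ ζ`. -/
theorem integral_shear {f g : Plane → ℂ} {σ : ℝ} (L : Plane → Plane)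
    (h : Integrable (fun p : Plane × Plane => f p.1 * g (L p.1 + σ • p.2))) :
    ∫ p : Plane × Plane, f p.1 * g (L p.1 + σ • p.2) =
      ((σ ^ 2)⁻¹ : ℝ) * ((∫ z, f z) * ∫ q, g q) := by
  rw [Measure.volume_eq_prod] at h ⊢
  rw [integral_prod _ h]
  have h1 : ∀ z, ∫ ζ, f z * g (L z + σ • ζ) = f z * (((σ ^ 2)⁻¹ : ℝ) * ∫ q, g q) := fun z => by
    rw [integral_const_mul, Measure.integral_comp_smul volume (fun q => g (L z + q)) σ,
      integral_add_left_eq_self g (L z), finrank_euclideanSpace_fin, abs_of_nonneg (by positivity)]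
    simp
  simp only [h1]
  rw [integral_mul_const]
  ring

/-- The exact value of the regularized Gaussian integral, up to a constant. -/
theorem integral_regularized_gaussian {b ω B t : ℝ} (hω : 0 < ω) (hB : 0 < B)
    (hs : Real.sin (ω * t) ≠ 0) {p₀ : Plane × Plane} (hp₀ : p₀ ∈ phaseSpace b) :
    ∃ ν : Plane × Plane →L[ℝ] Plane × Plane →L[ℝ] ℝ, (∀ p v, ν p v = ν v p) ∧
      (∃ k₀ > 0, ∀ p, k₀ * ‖p‖ ^ 2 ≤ ν p p) ∧ ∀ α : ℝ, 0 < α →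
      ((((2 * Real.pi * α) ^ 2)⁻¹ : ℝ) : ℂ) *
        ∫ p, Complex.exp (Complex.I * ((1 / 2 : ℂ) * phaseHessian b ω B t p₀ p p) / (α : ℂ) -
          ((ν p p : ℝ) : ℂ)) =
      (((Real.sin (ω * t) / ω) ^ 2)⁻¹ : ℝ) *
        (((2 * α - Complex.I * (Real.cos (ω * t) / (Real.sin (ω * t) / ω) -
            |b| / ‖p₀.1‖ ^ 2 : ℝ)) ^ (1 / 2 : ℂ))⁻¹ *
         ((2 * α - Complex.I * (Real.cos (ω * t) / (Real.sin (ω * t) / ω) +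
            |b| / ‖p₀.1‖ ^ 2 : ℝ)) ^ (1 / 2 : ℂ))⁻¹ *
        (((2 * α + (B + Complex.I * (Real.cos (ω * t) / (Real.sin (ω * t) / ω) +
            |b| / ‖flowX b ω t p₀.1 p₀.2‖ ^ 2 : ℝ))) ^ (1 / 2 : ℂ))⁻¹ *
         ((2 * α + (B + Complex.I * (Real.cos (ω * t) / (Real.sin (ω * t) / ω) -
            |b| / ‖flowX b ω t p₀.1 p₀.2‖ ^ 2 : ℝ))) ^ (1 / 2 : ℂ))⁻¹)) := by
  set x := flowX b ω t p₀.1 p₀.2 with hx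
  have hxne : x ≠ 0 := flowX_ne_zero b ω t hω _ _ hp₀
  set τ := Real.cos (ω * t) / (Real.sin (ω * t) / ω) with hτ
  set σ := Real.sin (ω * t) / ω with hσ
  have hσ0 : σ ≠ 0 := div_ne_zero hs hω.ne'
  obtain ⟨u, hu0, hu1⟩ := exists_eigenvectors_potentialDeriv b hp₀.1
  obtain ⟨v, hv0, hv1⟩ := exists_eigenvectors_potentialDeriv b hxne
  set X := flowXDeriv b ω t p₀.1 with hX
  -- The damping |z|² + |q|² is adapted to the splitting: it only adds 2α to each of the four
  -- diagonal coefficients of the Gaussian, written over 2α.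
  set ν : Plane × Plane →L[ℝ] Plane × Plane →L[ℝ] ℝ :=
    (innerSL ℝ).bilinearComp (ContinuousLinearMap.fst ℝ Plane Plane)
      (ContinuousLinearMap.fst ℝ Plane Plane) + (innerSL ℝ).bilinearComp X X with hν
  have hνa : ∀ p w, ν p w = inner ℝ p.1 w.1 + inner ℝ (X p) (X w) := fun p w => rfl
  have hνself : ∀ p, ν p p = ‖p.1‖ ^ 2 + ‖X p‖ ^ 2 := fun p => by
    rw [hνa, real_inner_self_eq_norm_sq, real_inner_self_eq_norm_sq]
  -- (z, ζ) ↦ (z, q) is injective as σ ≠ 0, which makes ν positive definite on the whole phase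
  -- space.
  have hker : LinearMap.ker (((ContinuousLinearMap.fst ℝ Plane Plane).prod X).toLinearMap) = ⊥ := by
    rw [LinearMap.ker_eq_bot']
    rintro ⟨z, ζ⟩ h
    have h1 : z = 0 := congrArg Prod.fst h
    have h2 : X (z, ζ) = 0 := congrArg Prod.snd h
    rw [hX, flowXDeriv_apply, h1] at h2
    simp only [map_zero, sub_zero, smul_zero, zero_add] at h2
    rw [h1, (smul_eq_zero.mp h2).resolve_left hσ0]
    rfl
  obtain ⟨K, hK0, hK⟩ := LinearMap.exists_antilipschitzWith _ hker
  have hk₀ : ∀ p, ((K : ℝ) ^ 2)⁻¹ * ‖p‖ ^ 2 ≤ ν p p := fun p => by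
    have h1 : ‖p‖ ≤ K * ‖(p.1, X p)‖ := hK.le_mul_norm (map_zero _) p
    have h2 : ‖(p.1, X p)‖ ^ 2 ≤ ν p p := by
      rw [hνself, Prod.norm_def]
      rcases max_cases ‖p.1‖ ‖X p‖ with h | h
      · rw [h.1]; linarith [sq_nonneg ‖X p‖]
      · rw [h.1]; linarith [sq_nonneg ‖p.1‖]
    have hK0' : (0 : ℝ) < K := hK0
    rw [inv_mul_le_iff₀ (by positivity)]
    calc ‖p‖ ^ 2 ≤ (K * ‖(p.1, X p)‖) ^ 2 := by gcongr
      _ = K ^ 2 * ‖(p.1, X p)‖ ^ 2 := by ring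
      _ ≤ _ := by gcongr
  have hK0' : (0 : ℝ) < K := hK0
  refine ⟨ν, fun p w => ?_, ⟨((K : ℝ) ^ 2)⁻¹, by positivity, hk₀⟩, fun α hα => ?_⟩
  · rw [hνa, hνa, real_inner_comm p.1, real_inner_comm (X p)]
  have hα' : (α : ℂ) ≠ 0 := by exact_mod_cast hα.ne'
  set μ : Fin 2 → ℂ := ![2 * α - Complex.I * (τ - |b| / ‖p₀.1‖ ^ 2 : ℝ),
    2 * α - Complex.I * (τ + |b| / ‖p₀.1‖ ^ 2 : ℝ)] with hμ
  set w : Fin 2 → ℂ := ![2 * α + (B + Complex.I * (τ + |b| / ‖x‖ ^ 2 : ℝ)),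
    2 * α + (B + Complex.I * (τ - |b| / ‖x‖ ^ 2 : ℝ))] with hw
  have hre1 : ∀ q : ℝ, 0 < (2 * (α : ℂ) - Complex.I * (q : ℂ)).re := fun q => by simp [hα]
  have hre2 : ∀ q : ℝ, 0 < (2 * (α : ℂ) + (B + Complex.I * (q : ℂ))).re := fun q => by
    simp
    positivity
  have hμre : ∀ i, 0 < (μ i).re := fun i => by
    fin_cases i
    exacts [hre1 _, hre1 _]
  have hwre : ∀ i, 0 < (w i).re := fun i => by
    fin_cases i
    exacts [hre2 _, hre2 _]
  set f : Plane → ℂ := fun z => Complex.exp (-∑ i, μ i / (2 * α) * ((inner ℝ (u i) z : ℝ) : ℂ) ^ 2)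
    with hf
  set g : Plane → ℂ := fun z => Complex.exp (-∑ i, w i / (2 * α) * ((inner ℝ (v i) z : ℝ) : ℂ) ^ 2)
    with hg
  set L : Plane → Plane := fun z => Real.cos (ω * t) • z - σ • potentialDeriv b p₀.1 z with hL
  have hXL : ∀ p : Plane × Plane, L p.1 + σ • p.2 = X p := fun p => by
    rw [hX, flowXDeriv_apply, hL]
    simp only [smul_sub]
    abel
  have hexp : ∀ p, Complex.exp (Complex.I * ((1 / 2 : ℂ) * phaseHessian b ω B t p₀ p p) / (α : ℂ) -
      ((ν p p : ℝ) : ℂ)) = f p.1 * g (L p.1 + σ • p.2) := fun p => by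
    rw [hXL, hf, hg]
    simp only
    rw [← Complex.exp_add, phaseHessian_self hω hs, hνself, ← hX, ← hx, ← hτ,
      inner_potentialDeriv_self hu0 hu1, inner_potentialDeriv_self hv0 hv1,
      norm_sq_eq_inner u p.1, norm_sq_eq_inner v (X p)]
    congr 1
    simp only [Fin.sum_univ_two, hμ, hw, Matrix.cons_val_zero, Matrix.cons_val_one]
    push_cast
    field_simp
    ring_nf
    rw [Complex.I_sq]
    ring
  have hint := integrable_regularized_gaussian (μ := (volume : Measure (Plane × Plane)))
    (β := phaseHessian b ω B t p₀) (fun p => by rw [phaseHessian_im]; positivity)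
    (by positivity : 0 < ((K : ℝ) ^ 2)⁻¹) hk₀ hα
  simp only [hexp] at hint ⊢
  rw [integral_shear L hint, integral_gaussian_scaled u hμre hα, integral_gaussian_scaled v hwre hα]
  simp only [Fin.prod_univ_two, hμ, hw, Matrix.cons_val_zero, Matrix.cons_val_one]
  have hpi : (Real.pi : ℂ) ≠ 0 := by exact_mod_cast Real.pi_ne_zero
  push_cast
  field_simp

end ABOscillator

/-! ### The limit of the Gaussian integral and the Maslov phase. -/

namespace ABOscillator

open SymbolCalculus

/-- The damping turns the factor w^{−1/2} into (2α + w)^{−1/2}; differentiability at α = 0 shows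
that this costs O(α). -/
theorem differentiableAt_inv_cpow_half {w : ℂ} (hw : w ∈ Complex.slitPlane) :
    DifferentiableAt ℝ (fun α : ℝ => ((2 * (α : ℂ) + w) ^ (1 / 2 : ℂ))⁻¹) 0 := by
  have h1 : HasDerivAt (fun α : ℝ => 2 * (α : ℂ) + w) (2 * 1) 0 :=
    ((hasDerivAt_id (0 : ℝ)).ofReal_comp.const_mul (2 : ℂ)).add_const w
  have hne : w ≠ 0 := Complex.slitPlane_ne_zero hw
  have h2 : DifferentiableAt ℝ (fun α : ℝ => (2 * (α : ℂ) + w) ^ (1 / 2 : ℂ)) 0 := by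
    have h3 : HasDerivAt (fun z : ℂ => z ^ (1 / 2 : ℂ)) _ (2 * ((0 : ℝ) : ℂ) + w) :=
      (hasDerivAt_id _).cpow_const (c := (1 / 2 : ℂ)) (by simpa using hw)
    exact (h3.comp (0 : ℝ) h1).differentiableAt
  refine h2.inv ?_
  simp [hne]

theorem slitPlane_of_re_pos_add {B : ℝ} (hB : 0 < B) (q : ℝ) :
    (B : ℂ) + Complex.I * (q : ℂ) ∈ Complex.slitPlane :=
  Or.inl (by simpa using hB)

theorem neg_I_mul_mem_slitPlane {q : ℝ} (hq : q ≠ 0) :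
    -(Complex.I * (q : ℂ)) ∈ Complex.slitPlane :=
  Or.inr (by simpa using hq)

theorem exp_neg_I_pi_mul_div_two (m : ℕ) :
    Complex.exp (-(Complex.I * (Real.pi : ℂ) * (m : ℂ) / 2)) = (-Complex.I) ^ m := by
  have : -Complex.I = Complex.exp (-(Real.pi / 2) * Complex.I) := by
    rw [neg_mul, Complex.exp_neg, Complex.exp_pi_div_two_mul_I, Complex.inv_I]
  rw [this, ← Complex.exp_nat_mul]
  congr 1
  ring

/-- The value at `α = 0` of the normalized Gaussian integral. -/
theorem gaussian_value_of_sin_ne_zero {b ω t : ℝ} (hω : 0 < ω) (ht : 0 ≤ t)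
    (hs : Real.sin (ω * t) ≠ 0) {y : Plane} (hy : y ≠ 0) (η : Plane)
    (hD : (flowXy b ω t y η).det ≠ 0) :
    Real.cos (ω * t) / (Real.sin (ω * t) / ω) - |b| / ‖y‖ ^ 2 ≠ 0 ∧
    Real.cos (ω * t) / (Real.sin (ω * t) / ω) + |b| / ‖y‖ ^ 2 ≠ 0 ∧
    -Complex.I * ((Real.sin (ω * t) / ω : ℝ) : ℂ)⁻¹ *
      (((-(Complex.I * (Real.cos (ω * t) / (Real.sin (ω * t) / ω) - |b| / ‖y‖ ^ 2 : ℝ))) ^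
          (1 / 2 : ℂ))⁻¹ *
        ((-(Complex.I * (Real.cos (ω * t) / (Real.sin (ω * t) / ω) + |b| / ‖y‖ ^ 2 : ℝ))) ^
          (1 / 2 : ℂ))⁻¹) =
      Complex.exp (-(Complex.I * (Real.pi : ℂ) * (morseIndex b ω t y η : ℂ) / 2)) *
        ((|Real.cos (ω * t) ^ 2 - b ^ 2 / ω ^ 2 * (‖y‖ ^ 4)⁻¹ * Real.sin (ω * t) ^ 2| ^
          (-(1 / 2) : ℝ) : ℝ) : ℂ) := by
  have hn : ‖y‖ ≠ 0 := norm_ne_zero_iff.mpr hy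
  -- The k complete half-periods contribute 2k to the Morse index; the rest depends on τ only,
  -- through the signs of μ₁ and μ₂.
  obtain ⟨k, τ, hτ0, hτ, hk⟩ : ∃ (k : ℕ) (τ : ℝ), 0 ≤ τ ∧ τ < Real.pi ∧
      ω * t = k * Real.pi + τ := by
    refine ⟨⌊ω * t / Real.pi⌋₊, ω * t - ⌊ω * t / Real.pi⌋₊ * Real.pi, ?_, ?_, by ring⟩
    · have := Nat.floor_le (a := ω * t / Real.pi) (by positivity)
      rw [le_div_iff₀ Real.pi_pos] at this
      linarith
    · have := Nat.lt_floor_add_one (ω * t / Real.pi)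
      rw [div_lt_iff₀ Real.pi_pos] at this
      linarith
  have hsin : Real.sin (ω * t) = (-1) ^ k * Real.sin τ := by
    rw [hk, add_comm, Real.sin_add_nat_mul_pi]
  have hcos : Real.cos (ω * t) = (-1) ^ k * Real.cos τ := by
    rw [hk, add_comm, Real.cos_add_nat_mul_pi]
  have hsτ : 0 < Real.sin τ := by
    refine lt_of_le_of_ne (Real.sin_nonneg_of_nonneg_of_le_pi hτ0 hτ.le) fun h => hs ?_
    rw [hsin, ← h, mul_zero]
  have hk1 : ((-1 : ℝ) ^ k) ≠ 0 := pow_ne_zero _ (by norm_num)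
  have hτe : Real.cos (ω * t) / (Real.sin (ω * t) / ω) = ω * Real.cos τ / Real.sin τ := by
    rw [hsin, hcos]
    field_simp
  rw [det_flowXy b ω t hy η] at hD
  rw [morseIndex_eq hω hy η k hτ0 hτ hk, hτe]
  set r := |b| / ‖y‖ ^ 2 with hr
  set σ := Real.sin (ω * t) / ω with hσ
  have hσ0 : σ ≠ 0 := div_ne_zero hs hω.ne'
  set μ₁ := ω * Real.cos τ / Real.sin τ - r with hμ₁
  set μ₂ := ω * Real.cos τ / Real.sin τ + r with hμ₂
  have hDe : Real.cos (ω * t) ^ 2 - b ^ 2 / ω ^ 2 * (‖y‖ ^ 4)⁻¹ * Real.sin (ω * t) ^ 2 =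
      σ ^ 2 * (μ₁ * μ₂) := by
    have h1 : μ₁ * μ₂ = (Real.cos (ω * t) / σ) ^ 2 - b ^ 2 / ‖y‖ ^ 4 := by
      rw [hμ₁, hμ₂, ← hτe, hr, ← sq_abs b]
      field_simp
      ring
    rw [h1, hσ]
    field_simp
  rw [hDe] at hD ⊢
  have hμ₁0 : μ₁ ≠ 0 := fun h => hD (by rw [h]; ring)
  have hμ₂0 : μ₂ ≠ 0 := fun h => hD (by rw [h]; ring)
  refine ⟨hμ₁0, hμ₂0, ?_⟩
  have hiff₁ : Real.cos τ - r / ω * Real.sin τ < 0 ↔ μ₁ < 0 := by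
    have : Real.cos τ - r / ω * Real.sin τ = Real.sin τ / ω * μ₁ := by
      rw [hμ₁]; field_simp
    rw [this]
    exact smul_neg_iff_of_pos_left (div_pos hsτ hω)
  have hiff₂ : Real.cos τ - -(r / ω) * Real.sin τ < 0 ↔ μ₂ < 0 := by
    have : Real.cos τ - -(r / ω) * Real.sin τ = Real.sin τ / ω * μ₂ := by
      rw [hμ₂]; field_simp; ring
    rw [this]
    exact smul_neg_iff_of_pos_left (div_pos hsτ hω)
  simp only [hiff₁, hiff₂]
  rw [inv_cpow_half_neg_I_mul hμ₁0, inv_cpow_half_neg_I_mul hμ₂0, exp_neg_I_pi_mul_div_two, abs_mul,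
    abs_mul, Real.mul_rpow (abs_nonneg _) (by positivity), Real.mul_rpow (abs_nonneg _)
    (abs_nonneg _), abs_of_nonneg (sq_nonneg σ)]
  have hσs : σ = (-1) ^ k * (Real.sin τ / ω) := by rw [hσ, hsin, mul_div_assoc]
  have hσr : (σ ^ 2) ^ (-(1 / 2) : ℝ) = (Real.sin τ / ω)⁻¹ := by
    have : σ ^ 2 = (Real.sin τ / ω) ^ 2 := by
      rw [hσs, mul_pow, ← pow_mul, mul_comm k 2, pow_mul]
      norm_num
    rw [this, ← Real.rpow_natCast, ← Real.rpow_mul (by positivity)]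
    norm_num
    rw [Real.rpow_neg_one, inv_div]
  -- The two factors e^{iπ/4} cancel the −i that stands in front.
  have hexp : Complex.exp (Real.pi / 4 * Complex.I) * Complex.exp (Real.pi / 4 * Complex.I) =
      Complex.I := by
    rw [← Complex.exp_add, ← add_mul,
      show (Real.pi : ℂ) / 4 + Real.pi / 4 = Real.pi / 2 by ring, Complex.exp_pi_div_two_mul_I]
  rw [hσr, hσs]
  -- The part 2k of the index is accounted for by the sign (−1)^k of sin ωt in the prefactor.
  have hIk : (-Complex.I) ^ (k + k) = (-1) ^ k := by
    rw [← two_mul, pow_mul]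
    simp
  have hkk : ((-1 : ℂ) ^ k)⁻¹ = (-1) ^ k := by
    rw [← inv_pow]
    norm_num
  have hpow : ∀ (P : Prop) [Decidable P], (-Complex.I) ^ (if P then 1 else 0) =
      if P then -Complex.I else 1 := fun P _ => by split_ifs <;> simp
  have hm : (-Complex.I) ^ ((k + if μ₁ < 0 then 1 else 0) + (k + if μ₂ < 0 then 1 else 0)) =
      (-1) ^ k * ((if μ₁ < 0 then -Complex.I else 1) * (if μ₂ < 0 then -Complex.I else 1)) := by
    rw [← hpow, ← hpow, ← hIk, ← pow_add, ← pow_add]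
    congr 1
    ring
  rw [hm]
  push_cast
  rw [mul_inv, hkk]
  generalize (if μ₁ < 0 then -Complex.I else 1) = a₁
  generalize (if μ₂ < 0 then -Complex.I else 1) = a₂
  generalize ((|μ₁| ^ (-(1 / 2) : ℝ) : ℝ) : ℂ) = m₁
  generalize ((|μ₂| ^ (-(1 / 2) : ℝ) : ℝ) : ℂ) = m₂
  linear_combination (-Complex.I * (-1) ^ k * ((Complex.sin τ : ℂ) / ω)⁻¹ * m₁ * m₂ * a₁ * a₂) * hexp
    - ((-1) ^ k * ((Complex.sin τ : ℂ) / ω)⁻¹ * m₁ * m₂ * a₁ * a₂) * Complex.I_sq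

/-- A_x is invariant under y ↦ −y. It is applied with c = cos ωt = ±1 when sin ωt = 0: then xᵗ = cy,
and the contributions of A_x at y and at xᵗ cancel in the Hessian. -/
theorem potentialDeriv_smul_of_sq_eq_one (b : ℝ) {c : ℝ} (hc : c ^ 2 = 1) (y : Plane) :
    potentialDeriv b (c • y) = potentialDeriv b y := by
  have h4 : ‖c • y‖ ^ 4 = ‖y‖ ^ 4 := by
    rw [norm_smul, mul_pow, Real.norm_eq_abs, show |c| ^ 4 = (|c| ^ 2) ^ 2 by ring, sq_abs, hc]
    ring
  ext w i
  rw [potentialDeriv_apply, potentialDeriv_apply, h4]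
  have e1 : ∀ i j, (c • y) i * (c • y) j = y i * y j := fun i j => by
    simp only [PiLp.smul_apply, smul_eq_mul]
    linear_combination (y i * y j) * hc
  have e2 : ∀ i, (c • y) i ^ 2 = y i ^ 2 := fun i => by rw [sq, e1, sq]
  simp only [mul_assoc, e1, e2]

/-- The regularized Gaussian integral when `sin (ωt) = 0`. -/
theorem integral_regularized_gaussian_of_sin_eq_zero {b ω B t : ℝ} (hB : 0 < B)
    (hs : Real.sin (ω * t) = 0) (p₀ : Plane × Plane) :
    ∃ ν : Plane × Plane →L[ℝ] Plane × Plane →L[ℝ] ℝ, (∀ p v, ν p v = ν v p) ∧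
      (∃ k₀ > 0, ∀ p, k₀ * ‖p‖ ^ 2 ≤ ν p p) ∧ ∀ α : ℝ, 0 < α →
      ((((2 * Real.pi * α) ^ 2)⁻¹ : ℝ) : ℂ) *
        ∫ p, Complex.exp (Complex.I * ((1 / 2 : ℂ) * phaseHessian b ω B t p₀ p p) / (α : ℂ) -
          ((ν p p : ℝ) : ℂ)) = ((1 + 2 * B * α + 4 * α ^ 2 : ℝ)⁻¹ : ℝ) := by
  have hc : Real.cos (ω * t) ^ 2 = 1 := by
    have := Real.sin_sq_add_cos_sq (ω * t)
    rw [hs] at this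
    linarith
  have hX : ∀ p, flowXDeriv b ω t p₀.1 p = Real.cos (ω * t) • p.1 := fun p => by
    simp [flowXDeriv_apply, hs]
  have hx : flowX b ω t p₀.1 p₀.2 = Real.cos (ω * t) • p₀.1 := by simp [flowX, hs]
  set ν : Plane × Plane →L[ℝ] Plane × Plane →L[ℝ] ℝ :=
    (innerSL ℝ).bilinearComp (ContinuousLinearMap.fst ℝ Plane Plane)
      (ContinuousLinearMap.fst ℝ Plane Plane) +
    (innerSL ℝ).bilinearComp (ContinuousLinearMap.snd ℝ Plane Plane)
      (ContinuousLinearMap.snd ℝ Plane Plane) with hν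
  have hνa : ∀ p w, ν p w = inner ℝ p.1 w.1 + inner ℝ p.2 w.2 := fun p w => rfl
  have hνself : ∀ p, ν p p = ‖p.1‖ ^ 2 + ‖p.2‖ ^ 2 := fun p => by
    rw [hνa, real_inner_self_eq_norm_sq, real_inner_self_eq_norm_sq]
  have hk₀ : ∀ p, 1 * ‖p‖ ^ 2 ≤ ν p p := fun p => by
    rw [hνself, Prod.norm_def, one_mul]
    rcases max_cases ‖p.1‖ ‖p.2‖ with h | h
    · rw [h.1]; linarith [sq_nonneg ‖p.2‖]
    · rw [h.1]; linarith [sq_nonneg ‖p.1‖]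
  refine ⟨ν, fun p w => ?_, ⟨1, one_pos, hk₀⟩, fun α hα => ?_⟩
  · rw [hνa, hνa, real_inner_comm p.1, real_inner_comm p.2]
  have hα' : (α : ℂ) ≠ 0 := by exact_mod_cast hα.ne'
  -- With sin ωt = 0 the Hessian is −2z·ζ + iB|z|², without any trace of the magnetic potential.
  have hβ : ∀ p, phaseHessian b ω B t p₀ p p =
      ((-2 * inner ℝ p.1 p.2 : ℝ) : ℂ) + Complex.I * ((B * ‖p.1‖ ^ 2 : ℝ) : ℂ) := fun p => by
    have h1 : -inner ℝ (flowXDeriv b ω t p₀.1 p) (flowXiDeriv b ω t p₀.1 p₀.2 p) -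
        inner ℝ p.2 p.1 = -2 * inner ℝ p.1 p.2 := by
      rw [flowXiDeriv_apply, hX, hx, potentialDeriv_smul_of_sq_eq_one b hc, flowVDeriv_apply, hs,
        mul_zero, neg_zero, zero_smul, zero_add, map_smul, ← smul_add, sub_add_cancel,
        real_inner_smul_left, real_inner_smul_right, ← mul_assoc, ← sq, hc,
        real_inner_comm p.1 p.2]
      ring
    have h2 : inner ℝ (flowXDeriv b ω t p₀.1 p) (flowXDeriv b ω t p₀.1 p) = ‖p.1‖ ^ 2 := by
      rw [real_inner_self_eq_norm_sq, hX, norm_smul, mul_pow, Real.norm_eq_abs, sq_abs, hc, one_mul]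
    rw [phaseHessian_apply, h1, h2]
    push_cast
    ring
  have hint := integrable_regularized_gaussian (μ := (volume : Measure (Plane × Plane)))
    (β := phaseHessian b ω B t p₀) (fun p => by rw [phaseHessian_im]; positivity)
    one_pos hk₀ hα
  rw [Measure.volume_eq_prod] at hint ⊢
  rw [integral_prod _ hint]
  have h1 : ∀ z : Plane, ∫ ζ : Plane, Complex.exp (Complex.I * ((1 / 2 : ℂ) *
      phaseHessian b ω B t p₀ (z, ζ) (z, ζ)) / (α : ℂ) - ((ν (z, ζ) (z, ζ) : ℝ) : ℂ)) =
      Real.pi * Complex.exp (-((1 + B / (2 * α) + 1 / (4 * α ^ 2) : ℝ) : ℂ) * ‖z‖ ^ 2) := fun z => by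
    have h2 : ∀ ζ : Plane, Complex.exp (Complex.I * ((1 / 2 : ℂ) *
        phaseHessian b ω B t p₀ (z, ζ) (z, ζ)) / (α : ℂ) - ((ν (z, ζ) (z, ζ) : ℝ) : ℂ)) =
        Complex.exp (-((1 + B / (2 * α) : ℝ) : ℂ) * ‖z‖ ^ 2) *
        Complex.exp (-1 * ‖ζ‖ ^ 2 + (-(Complex.I / α)) * ((inner ℝ z ζ : ℝ) : ℂ)) := fun ζ => by
      rw [hβ, hνself, ← Complex.exp_add]
      congr 1
      push_cast
      field_simp
      ring_nf
      rw [Complex.I_sq]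
      ring
    simp only [h2]
    rw [integral_const_mul, GaussianFourier.integral_cexp_neg_mul_sq_norm_add (by simp),
      finrank_euclideanSpace_fin]
    have h3 : ((Real.pi : ℂ) / 1) ^ (((2 : ℕ) : ℂ) / 2) = Real.pi := by
      rw [div_one, Nat.cast_ofNat, div_self two_ne_zero, Complex.cpow_one]
    rw [h3, mul_left_comm, ← Complex.exp_add]
    congr 2
    push_cast
    field_simp
    rw [Complex.I_sq]
    ring
  simp only [h1]
  rw [integral_const_mul, GaussianFourier.integral_cexp_neg_mul_sq_norm (by
    rw [Complex.ofReal_re]; positivity), finrank_euclideanSpace_fin]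
  have hpi : (Real.pi : ℂ) ≠ 0 := by exact_mod_cast Real.pi_ne_zero
  rw [Nat.cast_ofNat, div_self two_ne_zero, Complex.cpow_one, ← Complex.ofReal_div,
    ← Complex.ofReal_mul, ← Complex.ofReal_mul]
  congr 1
  field_simp
  ring

/-- The regularized Gaussian integral of the Hessian of the phase, up to `O(α)`. -/
theorem exists_regularized_gaussian {b ω B t : ℝ} (hω : 0 < ω) (hB : 0 < B) (ht : 0 ≤ t)
    {p₀ : Plane × Plane} (hp₀ : p₀ ∈ phaseSpace b) (hD : (flowXy b ω t p₀.1 p₀.2).det ≠ 0) :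
    ∃ ν : Plane × Plane →L[ℝ] Plane × Plane →L[ℝ] ℝ, (∀ p v, ν p v = ν v p) ∧
      (∃ k₀ > 0, ∀ p, k₀ * ‖p‖ ^ 2 ≤ ν p p) ∧
      (fun α : ℝ => sqrtDetZ b ω B t p₀.1 p₀.2 * (((((2 * Real.pi * α) ^ 2)⁻¹ : ℝ) : ℂ) *
        ∫ p, Complex.exp (Complex.I * ((1 / 2 : ℂ) * phaseHessian b ω B t p₀ p p) / (α : ℂ) -
          ((ν p p : ℝ) : ℂ))) -
        Complex.exp (-(Complex.I * (Real.pi : ℂ) * (morseIndex b ω t p₀.1 p₀.2 : ℂ) / 2)) *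
          ((|Real.cos (ω * t) ^ 2 - b ^ 2 / ω ^ 2 * (‖p₀.1‖ ^ 4)⁻¹ * Real.sin (ω * t) ^ 2| ^
            (-(1 / 2) : ℝ) : ℝ) : ℂ)) =O[𝓝[>] 0] (fun α : ℝ => α) := by
  -- The damped integral is known exactly for α > 0, as a function that extends differentiably to α
  -- = 0, so the error O(α) is a first order Taylor remainder.
  have of_diff : ∀ (F : ℝ → ℂ) (G : ℝ → ℂ) (c : ℂ), DifferentiableAt ℝ F 0 → F 0 = c →
      (∀ α, 0 < α → G α = F α) → (fun α => G α - c) =O[𝓝[>] 0] (fun α : ℝ => α) := by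
    intro F G c hF h0 hFG
    have h1 := hF.isBigO_sub
    simp only [sub_zero, h0] at h1
    refine (h1.mono nhdsWithin_le_nhds).congr' ?_ EventuallyEq.rfl
    filter_upwards [self_mem_nhdsWithin] with α hα
    rw [hFG α hα]
  have hsq : sqrtDetZ b ω B t p₀.1 p₀.2 = sqrtZ ω B (|b| / ‖flowX b ω t p₀.1 p₀.2‖ ^ 2) t :=
    sqrtDetZ_eq hω hB b ht hp₀
  by_cases hs : Real.sin (ω * t) = 0
  · obtain ⟨ν, hν, hk, hG⟩ := integral_regularized_gaussian_of_sin_eq_zero (b := b) hB hs p₀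
    refine ⟨ν, hν, hk, of_diff (fun α => Real.cos (ω * t) *
      ((1 + 2 * B * α + 4 * α ^ 2 : ℝ)⁻¹ : ℝ)) _ _ ?_ ?_ fun α hα => ?_⟩
    · have h1 : DifferentiableAt ℝ (fun α : ℝ => (1 + 2 * B * α + 4 * α ^ 2)⁻¹) 0 :=
        DifferentiableAt.fun_inv (by fun_prop) (by norm_num)
      exact (differentiableAt_const _).mul
        (Complex.ofRealCLM.differentiableAt.comp (0 : ℝ) h1)
    -- For ωt = nπ each eigenvalue contributes n zeros, so the index is 2n, and e^{−iπn} = (−1)^n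
    -- equals (det Z)^{1/2} = cos ωt.
    · obtain ⟨n, hn⟩ := Real.sin_eq_zero_iff.mp hs
      have hn0 : 0 ≤ n := by
        have h1 : 0 ≤ (n : ℝ) * Real.pi := by rw [hn]; positivity
        exact_mod_cast nonneg_of_mul_nonneg_left h1 Real.pi_pos
      lift n to ℕ using hn0
      rw [morseIndex_eq hω hp₀.1 p₀.2 n le_rfl Real.pi_pos (by rw [← hn]; simp),
        exp_neg_I_pi_mul_div_two, hs]
      have hc : Real.cos (ω * t) = (-1) ^ n := by
        rw [← hn]
        simp [Real.cos_nat_mul_pi]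
      rw [hc]
      simp only [Real.cos_zero, Real.sin_zero, mul_zero, sub_zero, not_lt.mpr zero_le_one, if_false,
        add_zero, zero_pow two_ne_zero]
      have h1 : ((-1 : ℝ) ^ n) ^ 2 = 1 := by rw [← pow_mul, mul_comm, pow_mul]; norm_num
      rw [← two_mul, pow_mul, h1]
      simp
    · rw [hsq, sqrtZ_eq_cos hω hB _ hs, hG α hα]
  · obtain ⟨ν, hν, hk, hG⟩ := integral_regularized_gaussian hω hB hs hp₀
    obtain ⟨h1, h2, h3⟩ := gaussian_value_of_sin_ne_zero (b := b) hω ht hs hp₀.1 p₀.2 hD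
    rw [← h3]
    set r := |b| / ‖flowX b ω t p₀.1 p₀.2‖ ^ 2 with hr
    set r' := |b| / ‖p₀.1‖ ^ 2 with hr'
    set σ := Real.sin (ω * t) / ω with hσ
    set τ := Real.cos (ω * t) / σ with hτ
    have hσ0 : (σ : ℂ) ≠ 0 := by exact_mod_cast div_ne_zero hs hω.ne'
    have hne : ∀ q : ℝ, ((B : ℂ) + Complex.I * (q : ℂ)) ^ (1 / 2 : ℂ) ≠ 0 := fun q => by
      simp [Complex.slitPlane_ne_zero (slitPlane_of_re_pos_add hB q)]
    refine ⟨ν, hν, hk, of_diff (fun α : ℝ => -Complex.I * (σ : ℂ)⁻¹ *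
      (((B : ℂ) + Complex.I * (τ + r : ℝ)) ^ (1 / 2 : ℂ) *
        ((B : ℂ) + Complex.I * (τ - r : ℝ)) ^ (1 / 2 : ℂ)) *
      (((2 * (α : ℂ) + -(Complex.I * (τ - r' : ℝ))) ^ (1 / 2 : ℂ))⁻¹ *
        ((2 * (α : ℂ) + -(Complex.I * (τ + r' : ℝ))) ^ (1 / 2 : ℂ))⁻¹ *
        (((2 * (α : ℂ) + (B + Complex.I * (τ + r : ℝ))) ^ (1 / 2 : ℂ))⁻¹ *
          ((2 * (α : ℂ) + (B + Complex.I * (τ - r : ℝ))) ^ (1 / 2 : ℂ))⁻¹))) _ _ ?_ ?_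
          fun α hα => ?_⟩
    · exact (differentiableAt_const _).mul
        (((differentiableAt_inv_cpow_half (neg_I_mul_mem_slitPlane h1)).mul
          (differentiableAt_inv_cpow_half (neg_I_mul_mem_slitPlane h2))).mul
        ((differentiableAt_inv_cpow_half (slitPlane_of_re_pos_add hB _)).mul
          (differentiableAt_inv_cpow_half (slitPlane_of_re_pos_add hB _))))
    -- At α = 0 the two roots in the factorization of (det Z)^{1/2} cancel the Gaussian factors in
    -- q.
    · have e1 := hne (τ + r)
      have e2 := hne (τ - r)
      simp only [Complex.ofReal_zero, mul_zero, zero_add]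
      field_simp
    · have e : sqrtZ ω B r t = -Complex.I * (σ : ℂ) *
          (((B : ℂ) + Complex.I * (τ + r : ℝ)) ^ (1 / 2 : ℂ) *
            ((B : ℂ) + Complex.I * (τ - r : ℝ)) ^ (1 / 2 : ℂ)) := by
        have := sqrtZ_eq_mul hω hB r (by positivity) hs
        push_cast at this ⊢
        rw [this]
        push_cast [hτ, hσ]
        rfl
      rw [hsq, e, hG α hα]
      simp only [← sub_eq_add_neg]
      rw [Complex.ofReal_inv, Complex.ofReal_pow]
      field_simp

end ABOscillator

/-! ### Symbol estimates along the flow and a field tangent to the level sets of y ∧ η. -/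

namespace SymbolCalculus

variable {E : Type*} [NormedAddCommGroup E] [NormedSpace ℝ E] {P : Type*} {U : Set E}

theorem IsSymbol.clm {w : P → E → ℝ} (ℓ : E →L[ℝ] ℂ) (h0 : ∃ C, ∀ i, ∀ p ∈ U, ‖ℓ p‖ ≤ C * w i p)
    (h1 : ∃ A, ∀ i, ∀ p ∈ U, 1 ≤ A * w i p) : IsSymbol U (fun _ _ => 1) w (fun _ p => ℓ p) := by
  refine of_deriv h0 (fun _ _ _ => by fun_prop) fun v => ?_
  simp only [ContinuousLinearMap.fderiv]
  refine (const (lam := fun _ _ => 1) (fun _ _ _ => one_pos) (fun _ => ℓ v)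
    ⟨_, fun _ => le_rfl⟩).mono_weight (fun _ _ _ => one_pos) (fun _ _ _ => zero_le_one) ?_
  simpa using h1

end SymbolCalculus

namespace ABOscillator

open SymbolCalculus

/-- An open set of initial data on which `y` and `xᵗ` stay in compact sets away from the origin. -/
structure IsRegion (b ω t : ℝ) (K L : Set Plane) (U : Set (Plane × Plane)) : Prop where
  isOpen : IsOpen U
  isCompact_fst : IsCompact K
  ne_zero_fst : K ⊆ {0}ᶜ
  fst_mem : ∀ p ∈ U, p.1 ∈ K
  isCompact_flow : IsCompact L
  ne_zero_flow : L ⊆ {0}ᶜ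
  flow_mem : ∀ p ∈ U, flowX b ω t p.1 p.2 ∈ L

namespace IsRegion

variable {b ω t : ℝ} {K L : Set Plane} {U : Set (Plane × Plane)} {P : Type*}

theorem comp_fst (hU : IsRegion b ω t K L U) {F : Plane → ℂ}
    (hF : ContDiffOn ℝ (⊤ : ℕ∞) F {0}ᶜ) :
    IsSymbol U (fun (_ : P) _ => 1) (fun _ _ => 1) (fun _ p => F p.1) := by
  refine IsSymbol.comp hU.isOpen isOpen_compl_singleton hU.isCompact_fst hU.ne_zero_fst
    (X := fun _ p => p.1) (fun j => ?_) (fun _ p hp => hU.fst_mem p hp) hF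
  obtain ⟨C, hC⟩ := hU.isCompact_fst.exists_bound_of_continuousOn
    (f := fun y : Plane => ((y j : ℝ) : ℂ)) (by fun_prop)
  exact IsSymbol.clm (Complex.ofRealCLM.comp
    ((EuclideanSpace.proj j : Plane →L[ℝ] ℝ).comp (ContinuousLinearMap.fst ℝ Plane Plane)))
    ⟨C, fun _ p hp => by simpa using hC _ (hU.fst_mem p hp)⟩ ⟨1, by simp⟩

theorem ofReal_comp_fst (hU : IsRegion b ω t K L U) {F : Plane → Plane}
    (hF : ContDiffOn ℝ (⊤ : ℕ∞) F {0}ᶜ) (j : Fin 2) :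
    IsSymbol U (fun (_ : P) _ => 1) (fun _ _ => 1) (fun _ p => ((F p.1 j : ℝ) : ℂ)) :=
  hU.comp_fst (F := fun y => ((F y j : ℝ) : ℂ))
    (Complex.ofRealCLM.contDiff.comp_contDiffOn (contDiffOn_euclidean.mp hF j))

/-- xᵗ is affine in η with coefficients depending on y, and its first derivatives are functions of y
alone. So although η is unbounded, all derivatives are bounded on a region, and xᵗ itself is bounded
there by assumption. -/
theorem flowX_apply (hU : IsRegion b ω t K L U) (j : Fin 2) :
    IsSymbol U (fun (_ : P) _ => 1) (fun _ _ => 1)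
      (fun _ p => ((flowX b ω t p.1 p.2 j : ℝ) : ℂ)) := by
  have hd : ∀ p ∈ U, HasFDerivAt (fun p : Plane × Plane => ((flowX b ω t p.1 p.2 j : ℝ) : ℂ))
      (Complex.ofRealCLM.comp ((EuclideanSpace.proj j : Plane →L[ℝ] ℝ).comp
        (flowXDeriv b ω t p.1))) p := fun p hp =>
    Complex.ofRealCLM.hasFDerivAt.comp p ((EuclideanSpace.proj j : Plane →L[ℝ] ℝ).hasFDerivAt.comp p
      (hasFDerivAt_flowX b ω t (hU.ne_zero_fst (hU.fst_mem p hp))))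
  refine IsSymbol.of_deriv ?_ (fun _ p hp => (hd p hp).differentiableAt) fun v => ?_
  · obtain ⟨C, hC⟩ := hU.isCompact_flow.exists_bound_of_continuousOn
      (f := fun y : Plane => ((y j : ℝ) : ℂ)) (by fun_prop)
    exact ⟨C, fun _ p hp => by simpa using hC _ (hU.flow_mem p hp)⟩
  · have h1 : ContDiffOn ℝ (⊤ : ℕ∞) (fun y => flowXDeriv b ω t y v) {0}ᶜ :=
      (contDiffOn_flowXDeriv b ω t).clm_apply contDiffOn_const
    refine ((hU.ofReal_comp_fst h1 j).congr hU.isOpen fun _ p hp => ?_).congr_weight (by simp)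
    rw [(hd p hp).fderiv]
    rfl

theorem comp_flowX (hU : IsRegion b ω t K L U) {F : Plane → ℂ}
    (hF : ContDiffOn ℝ (⊤ : ℕ∞) F {0}ᶜ) :
    IsSymbol U (fun (_ : P) _ => 1) (fun _ _ => 1) (fun _ p => F (flowX b ω t p.1 p.2)) :=
  IsSymbol.comp hU.isOpen isOpen_compl_singleton hU.isCompact_flow hU.ne_zero_flow
    (X := fun _ p => flowX b ω t p.1 p.2) hU.flowX_apply (fun _ p hp => hU.flow_mem p hp) hF

theorem comp_snd (hU : IsRegion b ω t K L U) {F : Plane → ℂ} (hF : ContDiff ℝ (⊤ : ℕ∞) F)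
    (hc : HasCompactSupport F) :
    IsSymbol U (fun (_ : P) _ => 1) (fun _ _ => 1) (fun _ p => F p.2) := by
  simpa using IsSymbol.dilation hU.isOpen (fun _ : P => 1) (by simp)
    (ContinuousLinearMap.snd ℝ Plane Plane) hF hc

theorem snd_sub_apply (hU : IsRegion b ω t K L U) (η₀ : Plane) (j : Fin 2) :
    IsSymbol U (fun (_ : P) _ => 1) (fun _ p => 1 + ‖p.2‖)
      (fun _ p => (((p.2 - η₀) j : ℝ) : ℂ)) := by
  have h1 : IsSymbol U (fun (_ : P) _ => 1) (fun _ p => 1 + ‖p.2‖)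
      (fun _ p => ((p.2 j : ℝ) : ℂ)) :=
    IsSymbol.clm (Complex.ofRealCLM.comp
      ((EuclideanSpace.proj j : Plane →L[ℝ] ℝ).comp (ContinuousLinearMap.snd ℝ Plane Plane)))
      ⟨1, fun _ p _ => by
        have := PiLp.norm_apply_le p.2 j
        simp at this ⊢
        linarith⟩ ⟨1, fun _ p _ => by simp⟩
  have h2 : IsSymbol U (fun (_ : P) _ => 1) (fun _ (p : Plane × Plane) => 1 + ‖p.2‖)
      (fun _ _ => ((-η₀ j : ℝ) : ℂ)) :=
    (IsSymbol.const (fun _ _ _ => one_pos) (fun _ => ((-η₀ j : ℝ) : ℂ))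
      ⟨_, fun _ => le_rfl⟩).mono_weight (fun _ _ _ => one_pos) (fun _ _ _ => zero_le_one)
      ⟨1, fun _ p _ => by simp⟩
  refine (h1.add hU.isOpen h2).congr hU.isOpen fun _ p _ => ?_
  rw [← Complex.ofReal_add]
  rfl

theorem mono_one (_hU : IsRegion b ω t K L U) {f : P → Plane × Plane → ℂ}
    (hf : IsSymbol U (fun (_ : P) _ => 1) (fun _ _ => 1) f) :
    IsSymbol U (fun (_ : P) _ => 1) (fun _ p => 1 + ‖p.2‖) f :=
  hf.mono_weight (fun _ _ _ => one_pos) (fun _ _ _ => zero_le_one)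
    ⟨1, fun _ p _ => by simp⟩

theorem mul_one_one (hU : IsRegion b ω t K L U) {f g : P → Plane × Plane → ℂ}
    (hf : IsSymbol U (fun (_ : P) _ => 1) (fun _ _ => 1) f)
    (hg : IsSymbol U (fun (_ : P) _ => 1) (fun _ _ => 1) g) :
    IsSymbol U (fun (_ : P) _ => 1) (fun _ _ => 1) (fun i p => f i p * g i p) :=
  (hf.mul hU.isOpen (fun _ _ _ => one_pos) (fun _ _ _ => zero_le_one) (fun _ _ _ => zero_le_one)
    hg).congr_weight (by simp)

theorem mul_one_left (hU : IsRegion b ω t K L U) {f g : P → Plane × Plane → ℂ}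
    {w : P → Plane × Plane → ℝ} (hw : ∀ i, ∀ p ∈ U, 0 ≤ w i p)
    (hf : IsSymbol U (fun (_ : P) _ => 1) (fun _ _ => 1) f)
    (hg : IsSymbol U (fun (_ : P) _ => 1) w g) :
    IsSymbol U (fun (_ : P) _ => 1) w (fun i p => f i p * g i p) :=
  (hf.mul hU.isOpen (fun _ _ _ => one_pos) (fun _ _ _ => zero_le_one) hw
    hg).congr_weight (by simp)

theorem sub_flowX_apply (hU : IsRegion b ω t K L U) (x : Plane) (j : Fin 2) :
    IsSymbol U (fun (_ : P) _ => 1) (fun _ _ => 1)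
      (fun _ p => (((x - flowX b ω t p.1 p.2) j : ℝ) : ℂ)) :=
  hU.comp_flowX (F := fun z => (((x - z) j : ℝ) : ℂ)) (ContDiff.contDiffOn
    (Complex.ofRealCLM.contDiff.comp ((EuclideanSpace.proj j : Plane →L[ℝ] ℝ).contDiff.comp
      (contDiff_const.sub contDiff_id))))

theorem flowXiDeriv_apply (hU : IsRegion b ω t K L U) (v : Plane × Plane) (j : Fin 2) :
    IsSymbol U (fun (_ : P) _ => 1) (fun _ _ => 1)
      (fun _ p => ((flowXiDeriv b ω t p.1 p.2 v j : ℝ) : ℂ)) := by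
  have h1 : ContDiffOn ℝ (⊤ : ℕ∞) (fun y => flowVDeriv b ω t y v) {0}ᶜ :=
    (contDiffOn_flowVDeriv b ω t).clm_apply contDiffOn_const
  have h2 : ContDiffOn ℝ (⊤ : ℕ∞) (fun y => flowXDeriv b ω t y v) {0}ᶜ :=
    (contDiffOn_flowXDeriv b ω t).clm_apply contDiffOn_const
  have h3 : ∀ l : Fin 2, IsSymbol U (fun (_ : P) _ => 1) (fun _ _ => 1) (fun _ p =>
      ((potentialDeriv b (flowX b ω t p.1 p.2) (EuclideanSpace.single l 1) j : ℝ) : ℂ)) := fun l =>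
    hU.comp_flowX (F := fun z => ((potentialDeriv b z (EuclideanSpace.single l 1) j : ℝ) : ℂ))
      (Complex.ofRealCLM.contDiff.comp_contDiffOn (contDiffOn_euclidean.mp
        ((contDiffOn_potentialDeriv b).clm_apply contDiffOn_const) j))
  refine ((hU.ofReal_comp_fst h1 j).add hU.isOpen
    ((hU.mul_one_one (hU.ofReal_comp_fst h2 0) (h3 0)).add hU.isOpen
      (hU.mul_one_one (hU.ofReal_comp_fst h2 1) (h3 1)))).congr hU.isOpen fun _ p _ => ?_
  rw [ABOscillator.flowXiDeriv_apply]
  generalize flowXDeriv b ω t p.1 v = w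
  have hw : w = w 0 • EuclideanSpace.single 0 (1 : ℝ) + w 1 • EuclideanSpace.single 1 (1 : ℝ) := by
    ext i
    fin_cases i <;> simp
  conv_lhs => rw [hw]
  simp only [map_add, map_smul, PiLp.add_apply, PiLp.smul_apply, smul_eq_mul]
  push_cast
  ring

/-- On a region x − xᵗ, dxᵗ and dξᵗ are bounded; the only growth comes from (η − η₀)·dy. -/
theorem totalPhaseDeriv_apply (hU : IsRegion b ω t K L U) (B : ℝ) (x η₀ : Plane)
    (v : Plane × Plane) :
    IsSymbol U (fun (_ : P) _ => 1) (fun _ p => 1 + ‖p.2‖)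
      (fun _ p => totalPhaseDeriv b ω B t x η₀ p v) := by
  have h2 : ContDiffOn ℝ (⊤ : ℕ∞) (fun y => flowXDeriv b ω t y v) {0}ᶜ :=
    (contDiffOn_flowXDeriv b ω t).clm_apply contDiffOn_const
  have hpos : ∀ (_ : P), ∀ p ∈ U, (0 : ℝ) ≤ 1 + ‖p.2‖ := fun _ p _ => by positivity
  have hc : ∀ z : ℂ, IsSymbol U (fun (_ : P) _ => 1) (fun _ _ => 1)
      (fun _ (_ : Plane × Plane) => z) := fun z =>
    IsSymbol.const (fun _ _ _ => one_pos) (fun _ => z) ⟨_, fun _ => le_rfl⟩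
  have hX := fun j => hU.sub_flowX_apply (P := P) x j
  have t1 := fun j => hU.mono_one (hU.mul_one_one (hX j) (hU.flowXiDeriv_apply v j))
  have t2 := fun j => hU.mul_one_left hpos (hc (-(v.1 j : ℝ))) (hU.snd_sub_apply η₀ j)
  have t3 := fun j => hU.mono_one (hU.mul_one_one (hc (-(Complex.I * B)))
    (hU.mul_one_one (hX j) (hU.ofReal_comp_fst h2 j)))
  refine ((((t1 0).add hU.isOpen (t1 1)).add hU.isOpen ((t2 0).add hU.isOpen (t2 1))).add hU.isOpen
    ((t3 0).add hU.isOpen (t3 1))).congr hU.isOpen fun _ p _ => ?_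
  rw [ABOscillator.totalPhaseDeriv_apply]
  simp only [PiLp.inner_apply, Fin.sum_univ_two, RCLike.inner_apply, conj_trivial]
  push_cast
  ring

end IsRegion

/-- A vector field along which `y ∧ η` is constant and which decreases the phase. -/
noncomputable def tangentField (η₀ : Plane) (p : Plane × Plane) : Plane × Plane :=
  (p.2 - η₀, (wedge η₀ p.2 / ‖p.1‖ ^ 2) • !₂[-p.1 1, p.1 0])

theorem abs_wedge_le (y η : Plane) : |wedge y η| ≤ ‖y‖ * ‖η‖ := by
  refine abs_le_of_sq_le_sq ?_ (by positivity)
  rw [mul_pow, norm_sq_plane, norm_sq_plane, wedge]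
  nlinarith [sq_nonneg (y 0 * η 0 + y 1 * η 1)]

theorem norm_tangentField_snd_le (η₀ : Plane) {p : Plane × Plane} (hp : p.1 ≠ 0) :
    ‖(tangentField η₀ p).2‖ ≤ ‖η₀‖ / ‖p.1‖ * ‖p.2 - η₀‖ := by
  have h1 : ‖(!₂[-p.1 1, p.1 0] : Plane)‖ = ‖p.1‖ := by
    rw [← sq_eq_sq₀ (norm_nonneg _) (norm_nonneg _), norm_sq_plane, norm_sq_plane]
    simp
    ring
  have h2 : wedge η₀ p.2 = wedge η₀ (p.2 - η₀) := by
    simp [wedge]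
    ring
  have hn : 0 < ‖p.1‖ := norm_pos_iff.mpr hp
  change ‖(wedge η₀ p.2 / ‖p.1‖ ^ 2) • (!₂[-p.1 1, p.1 0] : Plane)‖ ≤ _
  rw [norm_smul, h1, Real.norm_eq_abs, abs_div, abs_of_nonneg (sq_nonneg ‖p.1‖), h2]
  calc |wedge η₀ (p.2 - η₀)| / ‖p.1‖ ^ 2 * ‖p.1‖ = |wedge η₀ (p.2 - η₀)| / ‖p.1‖ := by field_simp
    _ ≤ ‖η₀‖ * ‖p.2 - η₀‖ / ‖p.1‖ := by gcongr; exact abs_wedge_le _ _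
    _ = _ := by ring

/-- The vector field is tangent to the level sets of `y ∧ η`. -/
theorem wedge_tangentField (η₀ : Plane) {p : Plane × Plane} (hp : p.1 ≠ 0) :
    wedge (tangentField η₀ p).1 p.2 + wedge p.1 (tangentField η₀ p).2 = 0 := by
  have h := sq_add_sq_ne_zero hp
  simp [tangentField, wedge, norm_sq_plane]
  field_simp
  ring

theorem hasFDerivAt_wedge (p : Plane × Plane) : ∃ D : Plane × Plane →L[ℝ] ℝ,
    HasFDerivAt (fun p : Plane × Plane => wedge p.1 p.2) D p ∧
      ∀ v, D v = wedge v.1 p.2 + wedge p.1 v.2 := by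
  have h1 : ∀ i : Fin 2, HasFDerivAt (fun p : Plane × Plane => p.1 i)
      ((EuclideanSpace.proj i : Plane →L[ℝ] ℝ).comp (ContinuousLinearMap.fst ℝ Plane Plane)) p :=
    fun i => (EuclideanSpace.proj i : Plane →L[ℝ] ℝ).hasFDerivAt.comp p hasFDerivAt_fst
  have h2 : ∀ i : Fin 2, HasFDerivAt (fun p : Plane × Plane => p.2 i)
      ((EuclideanSpace.proj i : Plane →L[ℝ] ℝ).comp (ContinuousLinearMap.snd ℝ Plane Plane)) p :=
    fun i => (EuclideanSpace.proj i : Plane →L[ℝ] ℝ).hasFDerivAt.comp p hasFDerivAt_snd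
  refine ⟨_, ((h1 0).mul (h2 1)).sub ((h1 1).mul (h2 0)), fun v => ?_⟩
  simp [wedge]
  ring

theorem IsRegion.tangentField_coord {b ω t : ℝ} {K L : Set Plane} {U : Set (Plane × Plane)}
    {P : Type*} (hU : IsRegion b ω t K L U) (η₀ : Plane) (j : Fin 2 ⊕ Fin 2) :
    IsSymbol U (fun (_ : P) _ => 1) (fun _ p => 1 + ‖p.2‖)
      (fun _ p => ((phaseBasis.repr (tangentField η₀ p) j : ℝ) : ℂ)) := by
  rcases j with j | j
  · refine (hU.snd_sub_apply η₀ j).congr hU.isOpen fun _ p _ => ?_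
    simp [phaseBasis, tangentField]
  · have hperp : ContDiff ℝ (⊤ : ℕ∞) (fun y : Plane => (!₂[-y 1, y 0] : Plane) j) := by
      have h : ∀ i : Fin 2, ContDiff ℝ (⊤ : ℕ∞) (fun y : Plane => y i) := fun i =>
        (EuclideanSpace.proj i : Plane →L[ℝ] ℝ).contDiff
      fin_cases j
      · exact (h 1).neg
      · exact h 0
    have hF : ContDiffOn ℝ (⊤ : ℕ∞)
        (fun y : Plane => (((!₂[-y 1, y 0] : Plane) j / ‖y‖ ^ 2 : ℝ) : ℂ)) {0}ᶜ :=
      Complex.ofRealCLM.contDiff.comp_contDiffOn (hperp.contDiffOn.fun_div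
        (contDiff_norm_sq ℝ).contDiffOn fun x hx => pow_ne_zero 2 (norm_ne_zero_iff.mpr hx))
    have hpos : ∀ (_ : P), ∀ p ∈ U, (0 : ℝ) ≤ 1 + ‖p.2‖ := fun _ p _ => by positivity
    have hc : ∀ z : ℂ, IsSymbol U (fun (_ : P) _ => 1) (fun _ _ => 1)
        (fun _ (_ : Plane × Plane) => z) := fun z =>
      IsSymbol.const (fun _ _ _ => one_pos) (fun _ => z) ⟨_, fun _ => le_rfl⟩
    have h0 := hU.snd_sub_apply (P := P) η₀
    refine (hU.mul_one_left hpos (hU.comp_fst hF)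
      ((hU.mul_one_left hpos (hc (η₀ 0 : ℝ)) (h0 1)).add hU.isOpen
      (hU.mul_one_left hpos (hc (-(η₀ 1 : ℝ))) (h0 0)))).congr hU.isOpen fun _ p _ => ?_
    simp only [phaseBasis, tangentField, wedge, Module.Basis.prod_repr_inr,
      OrthonormalBasis.coe_toBasis_repr_apply, EuclideanSpace.basisFun_repr, PiLp.smul_apply,
      smul_eq_mul, PiLp.sub_apply]
    push_cast
    ring

/-- Along `tangentField` the phase decreases at the rate `|η - η₀|²`, up to an error controlled by
`|x - xᵗ|`. -/
theorem exists_totalPhaseDeriv_tangentField (b ω B t : ℝ) (x η₀ : Plane) {K L : Set Plane}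
    (hK : IsCompact K) (hK0 : K ⊆ {0}ᶜ) (hL : IsCompact L) (hL0 : L ⊆ {0}ᶜ) :
    ∃ C, 0 ≤ C ∧ ∀ p : Plane × Plane, p.1 ∈ K → flowX b ω t p.1 p.2 ∈ L →
      ‖totalPhaseDeriv b ω B t x η₀ p (tangentField η₀ p) + ((‖p.2 - η₀‖ ^ 2 : ℝ) : ℂ)‖ ≤
        C * ‖x - flowX b ω t p.1 p.2‖ * ‖p.2 - η₀‖ := by
  obtain ⟨C₁, hC₁⟩ := hK.exists_bound_of_continuousOn
    ((contDiffOn_flowXDeriv b ω t).continuousOn.mono hK0)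
  obtain ⟨C₂, hC₂⟩ := hK.exists_bound_of_continuousOn
    ((contDiffOn_flowVDeriv b ω t).continuousOn.mono hK0)
  obtain ⟨C₃, hC₃⟩ := hL.exists_bound_of_continuousOn
    ((contDiffOn_potentialDeriv b).continuousOn.mono hL0)
  obtain ⟨C₄, hC₄⟩ := hK.exists_bound_of_continuousOn (f := fun y : Plane => ‖η₀‖ / ‖y‖)
    (continuousOn_const.div continuous_norm.continuousOn
      fun y hy => norm_ne_zero_iff.mpr (hK0 hy))
  set M := 1 + |C₄| with hM
  refine ⟨(|C₂| + |C₃| * |C₁| + |B| * |C₁|) * M, by positivity, fun p hp hX => ?_⟩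
  have hV : ‖tangentField η₀ p‖ ≤ M * ‖p.2 - η₀‖ := by
    rw [Prod.norm_def, max_le_iff]
    constructor
    · change ‖p.2 - η₀‖ ≤ _
      have : 0 ≤ |C₄| * ‖p.2 - η₀‖ := by positivity
      rw [hM]
      linarith
    · refine (norm_tangentField_snd_le η₀ (hK0 hp)).trans ?_
      gcongr
      have := hC₄ p.1 hp
      rw [Real.norm_of_nonneg (by positivity)] at this
      linarith [le_abs_self C₄]
  have h1 : ‖flowXDeriv b ω t p.1 (tangentField η₀ p)‖ ≤ |C₁| * ‖tangentField η₀ p‖ :=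
    (ContinuousLinearMap.le_opNorm _ _).trans (by
      gcongr; exact (hC₁ _ hp).trans (le_abs_self _))
  have h2 : ‖flowXiDeriv b ω t p.1 p.2 (tangentField η₀ p)‖ ≤
      (|C₂| + |C₃| * |C₁|) * ‖tangentField η₀ p‖ := by
    rw [flowXiDeriv_apply, add_mul, mul_assoc]
    refine (norm_add_le _ _).trans (add_le_add ?_ ?_)
    · exact (ContinuousLinearMap.le_opNorm _ _).trans (by
        gcongr; exact (hC₂ _ hp).trans (le_abs_self _))
    · refine (ContinuousLinearMap.le_opNorm _ _).trans ?_
      gcongr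
      exact (hC₃ _ hX).trans (le_abs_self _)
  -- The first component of the field is η − η₀, so the term −(η − η₀)·dy of the differential
  -- contributes exactly −|η − η₀|²; all the rest has a factor x − xᵗ.
  have h3 : totalPhaseDeriv b ω B t x η₀ p (tangentField η₀ p) + ((‖p.2 - η₀‖ ^ 2 : ℝ) : ℂ) =
      ((inner ℝ (x - flowX b ω t p.1 p.2) (flowXiDeriv b ω t p.1 p.2 (tangentField η₀ p)) : ℝ) : ℂ)
        - Complex.I * ((B * inner ℝ (x - flowX b ω t p.1 p.2)
          (flowXDeriv b ω t p.1 (tangentField η₀ p)) : ℝ) : ℂ) := by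
    rw [totalPhaseDeriv_apply, show (tangentField η₀ p).1 = p.2 - η₀ from rfl,
      real_inner_self_eq_norm_sq]
    push_cast
    ring
  rw [h3]
  refine (norm_sub_le _ _).trans ?_
  rw [norm_mul, Complex.norm_I, one_mul, Complex.norm_real, Complex.norm_real, norm_mul,
    Real.norm_eq_abs B]
  set q := ‖x - flowX b ω t p.1 p.2‖ with hq
  calc _ ≤ q * ((|C₂| + |C₃| * |C₁|) * ‖tangentField η₀ p‖) +
        |B| * (q * (|C₁| * ‖tangentField η₀ p‖)) := by
        gcongr
        · exact (norm_inner_le_norm _ _).trans (by gcongr)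
        · exact (norm_inner_le_norm _ _).trans (by gcongr)
    _ = (|C₂| + |C₃| * |C₁| + |B| * |C₁|) * q * ‖tangentField η₀ p‖ := by ring
    _ ≤ (|C₂| + |C₃| * |C₁| + |B| * |C₁|) * q * (M * ‖p.2 - η₀‖) := by gcongr
    _ = _ := by ring

end ABOscillator

/-! ### Nonstationary integrals with jumps across y ∧ η = b. -/

namespace SymbolCalculus

variable {E : Type*} [NormedAddCommGroup E] [NormedSpace ℝ E] {ι : Type*} [Fintype ι] {U : Set E}
  {e : ι → E} {C₀ : E → ℂ} {C : ι → E → ℂ}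

theorem transport_iterate_congr (hU : IsOpen U) {f g : E → ℂ} (hfg : Set.EqOn f g U) (n : ℕ) :
    Set.EqOn ((transport e C₀ C)^[n] f) ((transport e C₀ C)^[n] g) U := by
  induction n generalizing f g with
  | zero => exact hfg
  | succ n ih => exact ih (transport_congr hU hfg)

theorem transport_iterate_add (hU : IsOpen U) (hC₀ : ContDiffOn ℝ (⊤ : ℕ∞) C₀ U)
    (hC : ∀ j, ContDiffOn ℝ (⊤ : ℕ∞) (C j) U) {f g : E → ℂ}
    (hf : ContDiffOn ℝ (⊤ : ℕ∞) f U) (hg : ContDiffOn ℝ (⊤ : ℕ∞) g U) (n : ℕ) :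
    Set.EqOn ((transport e C₀ C)^[n] fun q => f q + g q)
      (fun p => (transport e C₀ C)^[n] f p + (transport e C₀ C)^[n] g p) U := by
  induction n generalizing f g with
  | zero => exact fun _ _ => rfl
  | succ n ih =>
    exact (transport_iterate_congr hU (fun p hp => transport_add hU hC hf hg hp) n).trans
      (ih (contDiffOn_transport hU hC₀ hC hf) (contDiffOn_transport hU hC₀ hC hg))

theorem transport_iterate_mul_of_invariant (hU : IsOpen U) (hC₀ : ContDiffOn ℝ (⊤ : ℕ∞) C₀ U)
    (hC : ∀ j, ContDiffOn ℝ (⊤ : ℕ∞) (C j) U) {f g : E → ℂ}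
    (hf : ContDiffOn ℝ (⊤ : ℕ∞) f U) (hg : ContDiffOn ℝ (⊤ : ℕ∞) g U)
    (hinv : ∀ p ∈ U, ∑ j, C j p * fderiv ℝ g p (e j) = 0) (n : ℕ) :
    Set.EqOn ((transport e C₀ C)^[n] fun q => g q * f q)
      (fun p => g p * (transport e C₀ C)^[n] f p) U := by
  induction n generalizing f with
  | zero => exact fun _ _ => rfl
  | succ n ih =>
    exact (transport_iterate_congr hU
      (fun p hp => transport_mul_of_invariant hU hC hf hg hp (hinv p hp)) n).trans
      (ih (contDiffOn_transport hU hC₀ hC hf))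

end SymbolCalculus

namespace ABOscillator

open SymbolCalculus

theorem continuous_wedge : Continuous fun p : Plane × Plane => wedge p.1 p.2 := by
  unfold wedge
  fun_prop

theorem contDiff_wedge : ContDiff ℝ (⊤ : ℕ∞) fun p : Plane × Plane => wedge p.1 p.2 := by
  have h1 : ∀ i : Fin 2, ContDiff ℝ (⊤ : ℕ∞) (fun p : Plane × Plane => p.1 i) := fun i =>
    (EuclideanSpace.proj i : Plane →L[ℝ] ℝ).contDiff.comp contDiff_fst
  have h2 : ∀ i : Fin 2, ContDiff ℝ (⊤ : ℕ∞) (fun p : Plane × Plane => p.2 i) := fun i =>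
    (EuclideanSpace.proj i : Plane →L[ℝ] ℝ).contDiff.comp contDiff_snd
  exact ((h1 0).mul (h2 1)).sub ((h1 1).mul (h2 0))

theorem volume_wedge_eq_right (b : ℝ) {y : Plane} (hy : y ≠ 0) :
    volume {η : Plane | wedge y η = b} = 0 := by
  have hn := sq_add_sq_ne_zero hy
  set ℓ : Plane →ₗ[ℝ] ℝ :=
    { toFun := wedge y
      map_add' := fun u v => by simp [wedge]; ring
      map_smul' := fun c u => by simp [wedge]; ring } with hℓ
  set η₁ : Plane := (b / (y 0 ^ 2 + y 1 ^ 2)) • !₂[-y 1, y 0] with hη₁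
  have h1 : wedge y η₁ = b := by
    simp [wedge, hη₁]
    field_simp
  refine measure_mono_null (fun η (hη : wedge y η = b) => ?_)
    (Measure.addHaar_affineSubspace volume (AffineSubspace.mk' η₁ (LinearMap.ker ℓ)) fun h => ?_)
  · refine AffineSubspace.mem_mk'.mpr ?_
    rw [vsub_eq_sub, LinearMap.mem_ker, map_sub]
    exact sub_eq_zero.mpr (hη.trans h1.symm)
  · have h2 : LinearMap.ker ℓ = ⊤ := by
      rw [← AffineSubspace.direction_mk' η₁ (LinearMap.ker ℓ), h, AffineSubspace.direction_top]
    have h3 : ℓ !₂[-y 1, y 0] = 0 := by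
      rw [← LinearMap.mem_ker, h2]
      trivial
    apply hn
    have h4 : wedge y !₂[-y 1, y 0] = 0 := h3
    simp [wedge] at h4
    linarith

theorem ae_wedge_ne (b : ℝ) : ∀ᵐ p : Plane × Plane, wedge p.1 p.2 ≠ b := by
  have hm : MeasurableSet {p : Plane × Plane | wedge p.1 p.2 = b} :=
    (isClosed_eq continuous_wedge continuous_const).measurableSet
  have h : (volume : Measure (Plane × Plane)) {p | wedge p.1 p.2 = b} = 0 := by
    rw [Measure.volume_eq_prod, Measure.measure_prod_null hm]
    have h0 : ∀ᵐ y : Plane, y ≠ 0 := by simp [ae_iff]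
    filter_upwards [h0] with y hy
    exact volume_wedge_eq_right b hy
  rw [ae_iff]
  simpa using h

/-- The function `(1 + |η|)⁻³`, restricted to `y ∈ K`. -/
noncomputable def majorant (K : Set Plane) (p : Plane × Plane) : ℝ :=
  K.indicator (fun _ => 1) p.1 * ((1 + ‖p.2‖) ^ 3)⁻¹

theorem majorant_nonneg (K : Set Plane) (p : Plane × Plane) : 0 ≤ majorant K p :=
  mul_nonneg (Set.indicator_nonneg (fun _ _ => zero_le_one) _) (by positivity)

theorem majorant_of_mem {K : Set Plane} {p : Plane × Plane} (hp : p.1 ∈ K) :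
    majorant K p = ((1 + ‖p.2‖) ^ 3)⁻¹ := by
  simp [majorant, hp]

theorem integrable_majorant {K : Set Plane} (hK : IsCompact K) :
    Integrable (majorant K) := by
  have h1 : Integrable (K.indicator fun _ => (1 : ℝ)) :=
    (integrable_indicator_iff hK.measurableSet).mpr (integrableOn_const hK.measure_lt_top.ne)
  have h2 : Integrable (fun η : Plane => ((1 + ‖η‖) ^ 3)⁻¹) := by
    refine (integrable_one_add_norm (E := Plane) (r := 3) (by
      rw [finrank_euclideanSpace_fin]; norm_num)).congr (Eventually.of_forall fun η => ?_)
    simp only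
    rw [Real.rpow_neg (by positivity)]
    norm_cast
  exact h1.mul_prod h2

/-- Integrability and a bound for the integral of a function that is continuous on `U` and
vanishes outside of `S`. -/
theorem integrable_of_le_majorant {b : ℝ} {K : Set Plane} (hK : IsCompact K)
    {U S : Set (Plane × Plane)} (hU : IsOpen U) (hSU : ∀ p ∈ S, wedge p.1 p.2 ≠ b → p ∈ U)
    {g : Plane × Plane → ℂ} (hg : ContinuousOn g U) (hg0 : ∀ p ∉ S, g p = 0)
    {c : ℝ} (hc : 0 ≤ c) (hle : ∀ p ∈ S, p ∈ U → ‖g p‖ ≤ c * majorant K p) :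
    Integrable g ∧ ‖∫ p, g p‖ ≤ c * ∫ p, majorant K p := by
  have hint : Integrable (fun p => c * majorant K p) := (integrable_majorant hK).const_mul c
  -- Off U the function g vanishes except possibly on the null set y ∧ η = b, so continuity on U is
  -- enough for measurability.
  have hm : AEStronglyMeasurable g volume := by
    have h1 := (aestronglyMeasurable_indicator_iff hU.measurableSet).mpr
      (hg.aestronglyMeasurable hU.measurableSet (μ := volume))
    refine h1.congr ?_
    filter_upwards [ae_wedge_ne b] with p hp
    by_cases hpU : p ∈ U
    · rw [Set.indicator_of_mem hpU]
    · rw [Set.indicator_of_notMem hpU, hg0 p fun h => hpU (hSU p h hp)]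
  have hb : ∀ᵐ p : Plane × Plane, ‖g p‖ ≤ c * majorant K p := by
    filter_upwards [ae_wedge_ne b] with p hp
    by_cases hpS : p ∈ S
    · exact hle p hpS (hSU p hpS hp)
    · rw [hg0 p hpS, norm_zero]
      exact mul_nonneg hc (majorant_nonneg K p)
  refine ⟨hint.mono' hm hb, (norm_integral_le_of_norm_le hint hb).trans_eq ?_⟩
  rw [integral_const_mul]

/-- The oscillating exponential. -/
noncomputable def wave (b ω B t : ℝ) (x η₀ : Plane) (α : ℝ) (p : Plane × Plane) : ℂ :=
  Complex.exp (Complex.I * totalPhase b ω B t x η₀ p / (α : ℂ))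

theorem norm_wave (b ω B t : ℝ) (x η₀ : Plane) (α : ℝ) (p : Plane × Plane) :
    ‖wave b ω B t x η₀ α p‖ = Real.exp (-(B * ‖x - flowX b ω t p.1 p.2‖ ^ 2 / 2 / α)) := by
  rw [wave, Complex.norm_exp, Complex.div_ofReal_re]
  congr 1
  have : (Complex.I * totalPhase b ω B t x η₀ p).re = -(totalPhase b ω B t x η₀ p).im := by simp
  rw [this, totalPhase_im, neg_div]

theorem norm_wave_le_one (b ω t : ℝ) {B : ℝ} (hB : 0 < B) (x η₀ : Plane) {α : ℝ} (hα : 0 < α)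
    (p : Plane × Plane) : ‖wave b ω B t x η₀ α p‖ ≤ 1 := by
  rw [norm_wave, Real.exp_le_one_iff]
  have : 0 ≤ B * ‖x - flowX b ω t p.1 p.2‖ ^ 2 / 2 / α := by positivity
  linarith

theorem contDiffOn_wave (b ω B t : ℝ) (hω : 0 < ω) (x η₀ : Plane) (α : ℝ) :
    ContDiffOn ℝ (⊤ : ℕ∞) (wave b ω B t x η₀ α) (phaseSpace b) := by
  unfold wave
  simp only [div_eq_mul_inv]
  exact ((contDiffOn_const.mul (contDiffOn_totalPhase b ω B t hω x η₀)).mul contDiffOn_const).cexp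

theorem hasFDerivAt_wave (b ω B t : ℝ) (hω : 0 < ω) (x η₀ : Plane) (α : ℝ) {p : Plane × Plane}
    (hp : p ∈ phaseSpace b) (v : Plane × Plane) :
    fderiv ℝ (wave b ω B t x η₀ α) p v =
      Complex.I / α * totalPhaseDeriv b ω B t x η₀ p v * wave b ω B t x η₀ α p := by
  have h := (((hasFDerivAt_totalPhase b ω B t hω x η₀ hp).const_mul Complex.I).mul_const
    ((α : ℂ)⁻¹)).cexp
  have h2 : HasFDerivAt (wave b ω B t x η₀ α) _ p := h
  rw [h2.fderiv]
  simp only [wave, div_eq_mul_inv, _root_.smul_apply, smul_eq_mul]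
  ring

/-- The coefficients of the vector field `(α/i) V / Vψ`, with `V` the field `tangentField`. -/
noncomputable def transportCoeff (b ω B t : ℝ) (x η₀ : Plane) (α : ℝ) (j : Fin 2 ⊕ Fin 2)
    (p : Plane × Plane) : ℂ :=
  (α : ℂ) * (-Complex.I * (((phaseBasis.repr (tangentField η₀ p) j : ℝ) : ℂ) *
    (totalPhaseDeriv b ω B t x η₀ p (tangentField η₀ p))⁻¹))

theorem totalPhaseDeriv_tangentField_eq_sum (b ω B t : ℝ) (x η₀ : Plane) (p : Plane × Plane) :
    totalPhaseDeriv b ω B t x η₀ p (tangentField η₀ p) =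
      ∑ j, ((phaseBasis.repr (tangentField η₀ p) j : ℝ) : ℂ) *
        totalPhaseDeriv b ω B t x η₀ p (phaseBasis j) := by
  conv_lhs => rw [← phaseBasis.sum_repr (tangentField η₀ p), map_sum]
  simp

/-- An open set on which the phase is not stationary along `tangentField`. -/
structure IsNonstationary (b ω B t : ℝ) (x η₀ : Plane) (K L : Set Plane)
    (U : Set (Plane × Plane)) : Prop extends IsRegion b ω t K L U where
  subset : U ⊆ phaseSpace b
  lower : ∃ c > 0, ∀ p ∈ U,
    c * (1 + ‖p.2‖) ^ 2 ≤ ‖totalPhaseDeriv b ω B t x η₀ p (tangentField η₀ p)‖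

namespace IsNonstationary

variable {b ω B t : ℝ} {x η₀ : Plane} {K L : Set Plane} {U : Set (Plane × Plane)} {P : Type*}

theorem ne_zero (hU : IsNonstationary b ω B t x η₀ K L U) {p : Plane × Plane} (hp : p ∈ U) :
    totalPhaseDeriv b ω B t x η₀ p (tangentField η₀ p) ≠ 0 := by
  obtain ⟨c, hc, h⟩ := hU.lower
  have h1 := h p hp
  intro h0
  rw [h0, norm_zero] at h1
  have : 0 < c * (1 + ‖p.2‖) ^ 2 := by positivity
  linarith

/-- The field V has size 1 + |η| and Vψ is of order (1 + |η|)², hence each integration by parts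
gains α/(1 + |η|): smallness in α and decay in η at once. -/
theorem isSymbol_transportCoeff (hU : IsNonstationary b ω B t x η₀ K L U) (α : P → ℝ)
    (hα : ∀ i, 0 ≤ α i) (j : Fin 2 ⊕ Fin 2) :
    IsSymbol U (fun _ _ => 1) (fun i p => α i * (1 + ‖p.2‖)⁻¹ * 1)
      (fun i => transportCoeff b ω B t x η₀ (α i) j) := by
  have h1 : ∀ (_ : P), ∀ p ∈ U, (0 : ℝ) < 1 + ‖p.2‖ := fun _ p _ => by positivity
  have hr := hU.toIsRegion
  have hlam : ∀ (_ : P), ∀ p ∈ U, (0 : ℝ) < (fun _ _ => 1 : P → Plane × Plane → ℝ) ‹_› p :=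
    fun _ _ _ => one_pos
  have hD : IsSymbol U (fun (_ : P) _ => 1) (fun _ p => (1 + ‖p.2‖) * (1 + ‖p.2‖))
      (fun _ p => totalPhaseDeriv b ω B t x η₀ p (tangentField η₀ p)) := by
    simp only [totalPhaseDeriv_tangentField_eq_sum]
    refine IsSymbol.sum hU.isOpen (fun _ _ _ => one_pos) (fun _ p _ => by positivity)
      Finset.univ (fun j (_ : P) p => ((phaseBasis.repr (tangentField η₀ p) j : ℝ) : ℂ) *
        totalPhaseDeriv b ω B t x η₀ p (phaseBasis j)) fun j _ => ?_
    exact (hr.tangentField_coord η₀ j).mul hU.isOpen (fun _ _ _ => one_pos)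
      (fun i p hp => (h1 i p hp).le) (fun i p hp => (h1 i p hp).le)
      (hr.totalPhaseDeriv_apply B x η₀ _)
  obtain ⟨c, hc0, hc⟩ := hU.lower
  have hDi := hD.inv hU.isOpen (fun _ _ _ => one_pos) (fun _ p _ => by positivity)
    ⟨c, hc0, fun _ p hp => by simpa [sq] using hc p hp⟩
  have h2 := (hr.tangentField_coord (P := P) η₀ j).mul hU.isOpen (fun _ _ _ => one_pos)
    (fun i p hp => (h1 i p hp).le) (fun i p _ => by positivity) hDi
  have h3 := h2.const_mul hU.isOpen (fun _ _ _ => one_pos) (fun i p _ => by positivity)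
    (fun _ => -Complex.I) ⟨1, by simp⟩
  refine ((IsSymbol.const_weight (fun _ _ _ => one_pos) (fun i => (α i : ℂ)) α
    ⟨1, fun i => by simp [abs_of_nonneg (hα i)]⟩).mul hU.isOpen (fun _ _ _ => one_pos)
      (fun i _ _ => hα i) (fun i p _ => by positivity) h3).congr_weight fun i p hp => ?_
  have := (h1 i p hp).ne'
  field_simp

theorem contDiffOn_tangentField_coord (η₀ : Plane) (j : Fin 2 ⊕ Fin 2) :
    ContDiffOn ℝ (⊤ : ℕ∞)
      (fun p : Plane × Plane => ((phaseBasis.repr (tangentField η₀ p) j : ℝ) : ℂ))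
      {p | p.1 ≠ 0} := by
  have h1 : ∀ i : Fin 2, ContDiff ℝ (⊤ : ℕ∞) (fun p : Plane × Plane => p.1 i) := fun i =>
    (EuclideanSpace.proj i : Plane →L[ℝ] ℝ).contDiff.comp contDiff_fst
  have h2 : ∀ i : Fin 2, ContDiff ℝ (⊤ : ℕ∞) (fun p : Plane × Plane => p.2 i) := fun i =>
    (EuclideanSpace.proj i : Plane →L[ℝ] ℝ).contDiff.comp contDiff_snd
  suffices h : ContDiffOn ℝ (⊤ : ℕ∞)
      (fun p : Plane × Plane => phaseBasis.repr (tangentField η₀ p) j) {p | p.1 ≠ 0} from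
    Complex.ofRealCLM.contDiff.comp_contDiffOn h
  rcases j with j | j
  · have h3 : ContDiff ℝ (⊤ : ℕ∞) (fun p : Plane × Plane => p.2 j - η₀ j) :=
      (h2 j).sub contDiff_const
    refine h3.contDiffOn.congr fun p _ => ?_
    simp [phaseBasis, tangentField]
  · have hn : ContDiffOn ℝ (⊤ : ℕ∞) (fun p : Plane × Plane => ‖p.1‖ ^ 2) {p | p.1 ≠ 0} :=
      ((contDiff_norm_sq ℝ).comp contDiff_fst).contDiffOn
    have hw : ContDiff ℝ (⊤ : ℕ∞) (fun p : Plane × Plane => wedge η₀ p.2) :=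
      (contDiff_const.mul (h2 1)).sub (contDiff_const.mul (h2 0))
    have hq : ContDiffOn ℝ (⊤ : ℕ∞) (fun p : Plane × Plane => wedge η₀ p.2 / ‖p.1‖ ^ 2)
        {p | p.1 ≠ 0} :=
      hw.contDiffOn.fun_div hn fun p hp => pow_ne_zero 2 (norm_ne_zero_iff.mpr hp)
    fin_cases j
    · refine (hq.mul (h1 1).neg.contDiffOn).congr fun p _ => ?_
      simp [phaseBasis, tangentField]
    · refine (hq.mul (h1 0).contDiffOn).congr fun p _ => ?_
      simp [phaseBasis, tangentField]

theorem contDiffOn_transportCoeff (hω : 0 < ω) (hU : IsNonstationary b ω B t x η₀ K L U) (α : ℝ)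
    (j : Fin 2 ⊕ Fin 2) : ContDiffOn ℝ (⊤ : ℕ∞) (transportCoeff b ω B t x η₀ α j) U := by
  have hV : ∀ j, ContDiffOn ℝ (⊤ : ℕ∞)
      (fun p : Plane × Plane => ((phaseBasis.repr (tangentField η₀ p) j : ℝ) : ℂ)) U := fun j =>
    (contDiffOn_tangentField_coord η₀ j).mono fun p hp => (hU.subset hp).1
  have hψ : ∀ v, ContDiffOn ℝ (⊤ : ℕ∞) (fun p => totalPhaseDeriv b ω B t x η₀ p v) U := fun v =>
    (contDiffOn_fderiv_apply hU.isOpen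
      ((contDiffOn_totalPhase b ω B t hω x η₀).mono hU.subset) v).congr fun p hp => by
      rw [(hasFDerivAt_totalPhase b ω B t hω x η₀ (hU.subset hp)).fderiv]
  have hD : ContDiffOn ℝ (⊤ : ℕ∞)
      (fun p => totalPhaseDeriv b ω B t x η₀ p (tangentField η₀ p)) U := by
    simp only [totalPhaseDeriv_tangentField_eq_sum]
    exact ContDiffOn.sum fun j _ => (hV j).mul (hψ _)
  exact contDiffOn_const.mul (contDiffOn_const.mul ((hV j).mul
    (hD.fun_inv fun p hp => hU.ne_zero hp)))

theorem sum_transportCoeff_wave (hω : 0 < ω) (hU : IsNonstationary b ω B t x η₀ K L U) {α : ℝ}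
    (hα : 0 < α) {p : Plane × Plane} (hp : p ∈ U) :
    (0 : ℂ) * wave b ω B t x η₀ α p + ∑ j, transportCoeff b ω B t x η₀ α j p *
      fderiv ℝ (wave b ω B t x η₀ α) p (phaseBasis j) = wave b ω B t x η₀ α p := by
  have hα' : (α : ℂ) ≠ 0 := by exact_mod_cast hα.ne'
  have hne := hU.ne_zero hp
  have h1 : ∀ j, transportCoeff b ω B t x η₀ α j p *
      fderiv ℝ (wave b ω B t x η₀ α) p (phaseBasis j) =
      (((phaseBasis.repr (tangentField η₀ p) j : ℝ) : ℂ) *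
        totalPhaseDeriv b ω B t x η₀ p (phaseBasis j)) *
      ((totalPhaseDeriv b ω B t x η₀ p (tangentField η₀ p))⁻¹ * wave b ω B t x η₀ α p) := by
    intro j
    rw [hasFDerivAt_wave b ω B t hω x η₀ α (hU.subset hp), transportCoeff]
    field_simp
    rw [Complex.I_sq]
    ring
  simp only [h1]
  rw [← Finset.sum_mul, ← totalPhaseDeriv_tangentField_eq_sum, zero_mul, zero_add, ← mul_assoc,
    mul_inv_cancel₀ hne, one_mul]

/-- The vector field annihilates functions of `y ∧ η`. -/
theorem sum_transportCoeff_wedge (hU : IsNonstationary b ω B t x η₀ K L U) (α : ℝ)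
    {k : ℝ → ℂ} (hk : ContDiff ℝ (⊤ : ℕ∞) k) {p : Plane × Plane} (hp : p ∈ U) :
    ∑ j, transportCoeff b ω B t x η₀ α j p *
      fderiv ℝ (fun p : Plane × Plane => k (wedge p.1 p.2)) p (phaseBasis j) = 0 := by
  obtain ⟨D, hD, hDv⟩ := hasFDerivAt_wedge p
  have hkd : HasFDerivAt k (fderiv ℝ k (wedge p.1 p.2)) (wedge p.1 p.2) :=
    ((hk.differentiable (by simp)) _).hasFDerivAt
  have h1 : ∀ v, fderiv ℝ (fun p : Plane × Plane => k (wedge p.1 p.2)) p v =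
      ((D v : ℝ) : ℂ) * deriv k (wedge p.1 p.2) := fun v => by
    have h2 : HasFDerivAt (fun p : Plane × Plane => k (wedge p.1 p.2)) _ p :=
      HasFDerivAt.comp (g := k) p hkd hD
    rw [h2.fderiv, ContinuousLinearMap.comp_apply]
    have : D v = D v • (1 : ℝ) := by simp
    rw [this, map_smul, Complex.real_smul, fderiv_apply_one_eq_deriv]
    simp
  have h3 : ∑ j, ((phaseBasis.repr (tangentField η₀ p) j : ℝ) : ℂ) * ((D (phaseBasis j) : ℝ) : ℂ)
      = 0 := by
    have h4 : D (tangentField η₀ p) = 0 := by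
      rw [hDv]
      exact wedge_tangentField η₀ (hU.subset hp).1
    rw [← phaseBasis.sum_repr (tangentField η₀ p), map_sum] at h4
    simp only [map_smul, smul_eq_mul] at h4
    exact_mod_cast h4
  simp only [h1, transportCoeff]
  calc _ = (∑ j, ((phaseBasis.repr (tangentField η₀ p) j : ℝ) : ℂ) *
        ((D (phaseBasis j) : ℝ) : ℂ)) * ((α : ℂ) * (-Complex.I *
        ((totalPhaseDeriv b ω B t x η₀ p (tangentField η₀ p))⁻¹)) * deriv k (wedge p.1 p.2)) := by
        rw [Finset.sum_mul]
        exact Finset.sum_congr rfl fun j _ => by ring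
    _ = 0 := by rw [h3, zero_mul]

end IsNonstationary

-- Existence and smallness of the nonstationary oscillatory integrals.

end ABOscillator

namespace ABOscillator

open SymbolCalculus

/-- The transpose of the vector field `(α/i) V / Vψ`. -/
noncomputable def waveTransport (b ω B t : ℝ) (x η₀ : Plane) (α : ℝ) :
    (Plane × Plane → ℂ) → Plane × Plane → ℂ :=
  transport phaseBasis (fun _ => 0) (transportCoeff b ω B t x η₀ α)

namespace IsNonstationary

variable {b ω B t : ℝ} {x η₀ : Plane} {K L : Set Plane} {U : Set (Plane × Plane)} {P : Type*}

theorem waveTransport_iterate_eq_zero {S : Set (Plane × Plane)} (hS : IsClosed S)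
    {f : Plane × Plane → ℂ} (hf : ∀ p ∉ S, f p = 0) (α : ℝ) (n : ℕ) {p : Plane × Plane}
    (hp : p ∉ S) : (waveTransport b ω B t x η₀ α)^[n] f p = 0 := by
  have h : f =ᶠ[𝓝 p] fun _ => 0 := by
    filter_upwards [hS.isOpen_compl.mem_nhds hp] with q hq
    exact hf q hq
  exact (transport_iterate_eq_zero n h).self_of_nhds

theorem contDiffOn_waveTransport_iterate (hω : 0 < ω) (hU : IsNonstationary b ω B t x η₀ K L U)
    (α : ℝ) {f : Plane × Plane → ℂ} (hf : ContDiffOn ℝ (⊤ : ℕ∞) f U) (n : ℕ) :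
    ContDiffOn ℝ (⊤ : ℕ∞) ((waveTransport b ω B t x η₀ α)^[n] f) U :=
  contDiffOn_transport_iterate hU.isOpen contDiffOn_const
    (fun j => hU.contDiffOn_transportCoeff hω α j) hf n

/-- Integration by parts, for functions that may jump where `y ∧ η = b`. -/
theorem integral_wave_mul (hω : 0 < ω) (hB : 0 < B) (hU : IsNonstationary b ω B t x η₀ K L U)
    {α : ℝ} (hα : 0 < α) {f : Plane × Plane → ℂ} (hf : ContDiffOn ℝ (⊤ : ℕ∞) f U)
    {S : Set (Plane × Plane)} (hS : IsCompact S) (hSU : ∀ p ∈ S, wedge p.1 p.2 ≠ b → p ∈ U)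
    (hf0 : ∀ p ∉ S, f p = 0) {n : ℕ} {c : ℝ} (hc : ∀ p ∈ S, p ∈ U → ‖f p‖ ≤ c)
    (hcn : ∀ p ∈ S, p ∈ U → ‖(waveTransport b ω B t x η₀ α)^[n] f p‖ ≤ c) :
    ∫ p, wave b ω B t x η₀ α p * f p =
      ∫ p, wave b ω B t x η₀ α p * (waveTransport b ω B t x η₀ α)^[n] f p := by
  let k₀ : ContDiffBump (0 : ℝ) := ⟨1, 2, one_pos, one_lt_two⟩
  -- k(m(y ∧ η − b)) removes a neighbourhood of width of order 1/m of the hypersurface. It is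
  -- constant along V, so it passes through every integration by parts without being differentiated,
  -- and no powers of m appear.
  set k : ℝ → ℂ := fun s => ((1 - k₀ s : ℝ) : ℂ) with hk
  have hkd : ContDiff ℝ (⊤ : ℕ∞) k := Complex.ofRealCLM.contDiff.comp
    (contDiff_const.sub k₀.contDiff)
  have hk0 : ∀ s, |s| ≤ 1 → k s = 0 := fun s hs => by
    rw [hk]
    simp only
    rw [k₀.one_of_mem_closedBall (by simpa [k₀] using hs)]
    simp
  have hk1 : ∀ s, 2 ≤ |s| → k s = 1 := fun s hs => by
    rw [hk]
    simp only
    rw [k₀.zero_of_le_dist (by simpa [k₀] using hs)]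
    simp
  have hkn : ∀ s, ‖k s‖ ≤ 1 := fun s => by
    rw [hk]
    simp only [Complex.norm_real]
    rw [Real.norm_of_nonneg (by linarith [k₀.le_one (x := s)])]
    linarith [k₀.nonneg (x := s)]
  set T := waveTransport b ω B t x η₀ α with hT
  set W := wave b ω B t x η₀ α with hW
  have hkm : ∀ m : ℕ, ContDiff ℝ (⊤ : ℕ∞) fun s : ℝ => k (m * (s - b)) := fun m =>
    hkd.comp (contDiff_const.mul (contDiff_id.sub contDiff_const))
  set g : ℕ → Plane × Plane → ℂ := fun m p => k (m * (wedge p.1 p.2 - b)) with hg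
  have hgd : ∀ m, ContDiff ℝ (⊤ : ℕ∞) (g m) := fun m => (hkm m).comp contDiff_wedge
  have hWd : ContDiffOn ℝ (⊤ : ℕ∞) W U := (contDiffOn_wave b ω B t hω x η₀ α).mono hU.subset
  have hTf := hU.contDiffOn_waveTransport_iterate hω α hf n
  have hcls : ∀ m : ℕ, IsClosed {p : Plane × Plane | 1 ≤ |(m : ℝ) * (wedge p.1 p.2 - b)|} :=
    fun m => isClosed_le continuous_const
      (continuous_abs.comp (continuous_const.mul (continuous_wedge.sub continuous_const)))
  have hSm : ∀ m : ℕ, ∀ p ∈ S ∩ {p : Plane × Plane | 1 ≤ |(m : ℝ) * (wedge p.1 p.2 - b)|},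
      p ∈ U := fun m p hp => hSU p hp.1 fun h => by
    have := hp.2
    simp [h] at this
    linarith
  have hsupp : ∀ (m : ℕ) (u : Plane × Plane → ℂ), (∀ p ∉ S, u p = 0) →
      ∀ p ∉ S ∩ {p : Plane × Plane | 1 ≤ |(m : ℝ) * (wedge p.1 p.2 - b)|}, g m p * u p = 0 := by
    intro m u hu p hp
    by_cases hpS : p ∈ S
    · have : ¬ 1 ≤ |(m : ℝ) * (wedge p.1 p.2 - b)| := fun h => hp ⟨hpS, h⟩
      rw [hg]
      simp only
      rw [hk0 _ (not_le.mp this).le, zero_mul]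
    · rw [hu p hpS, mul_zero]
  have hts : ∀ (m : ℕ) (u : Plane × Plane → ℂ), (∀ p ∉ S, u p = 0) →
      tsupport (fun p => g m p * u p) ⊆
        S ∩ {p : Plane × Plane | 1 ≤ |(m : ℝ) * (wedge p.1 p.2 - b)|} := fun m u hu =>
    closure_minimal (fun p hp => by
      by_contra h
      exact hp (hsupp m u hu p h)) (hS.isClosed.inter (hcls m))
  have hcomp : ∀ (m : ℕ) (u : Plane × Plane → ℂ), (∀ p ∉ S, u p = 0) →
      HasCompactSupport (fun p => g m p * u p) := fun m u hu =>
    (hS.inter_right (hcls m)).of_isClosed_subset (isClosed_tsupport _) (hts m u hu)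
  have hTf0 : ∀ p ∉ S, T^[n] f p = 0 := fun p hp =>
    waveTransport_iterate_eq_zero hS.isClosed hf0 α n hp
  have hibp : ∀ m, ∫ p, W p * (g m p * f p) = ∫ p, W p * (g m p * T^[n] f p) := fun m => by
    rw [integral_transport_iterate (e := phaseBasis) (C₀ := fun _ => 0)
      (C := transportCoeff b ω B t x η₀ α) hU.isOpen
      (hWd.of_le (by exact_mod_cast le_top)) contDiffOn_const
      (fun j => hU.contDiffOn_transportCoeff hω α j)
      (fun p hp => hU.sum_transportCoeff_wave hω hα hp) ((hgd m).contDiffOn.mul hf)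
      (hcomp m f hf0) ((hts m f hf0).trans (hSm m)) n]
    congr 1
    ext p
    by_cases hp : p ∈ U
    · rw [transport_iterate_mul_of_invariant hU.isOpen contDiffOn_const
        (fun j => hU.contDiffOn_transportCoeff hω α j) hf (hgd m).contDiffOn
        (fun q hq => hU.sum_transportCoeff_wedge α (hkm m) hq) n hp]
      rfl
    · have hp' : p ∉ S ∩ {p : Plane × Plane | 1 ≤ |(m : ℝ) * (wedge p.1 p.2 - b)|} := fun h =>
        hp (hSm m p h)
      rw [hsupp m _ hTf0 p hp']
      congr 1
      exact waveTransport_iterate_eq_zero (hS.isClosed.inter (hcls m)) (hsupp m f hf0) α n hp'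
  -- As m → ∞ the cut-off tends to 1 off the null set y ∧ η = b, and the integrands are bounded on
  -- the compact set S.
  have hlim : ∀ u : Plane × Plane → ℂ, ContDiffOn ℝ (⊤ : ℕ∞) u U → (∀ p ∉ S, u p = 0) →
      (∀ p ∈ S, p ∈ U → ‖u p‖ ≤ c) →
      Tendsto (fun m => ∫ p, W p * (g m p * u p)) atTop (𝓝 (∫ p, W p * u p)) := by
    intro u hu hu0 huc
    refine tendsto_integral_of_dominated_convergence (S.indicator fun _ => |c|) (fun m => ?_)
      ((integrable_indicator_iff hS.measurableSet).mpr (integrableOn_const hS.measure_lt_top.ne))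
      (fun m => ?_) ?_
    · have h1 : ContDiff ℝ (⊤ : ℕ∞) fun p => g m p * u p :=
        contDiff_of_tsupport_subset hU.isOpen ((hgd m).contDiffOn.mul hu)
          ((hts m u hu0).trans (hSm m))
      have h2 : ContDiff ℝ (⊤ : ℕ∞) fun p => W p * (g m p * u p) :=
        contDiff_of_tsupport_subset hU.isOpen (hWd.mul h1.contDiffOn)
          ((tsupport_mul_subset_right (f := W)).trans ((hts m u hu0).trans (hSm m)))
      exact h2.continuous.aestronglyMeasurable
    · filter_upwards [ae_wedge_ne b] with p hp
      by_cases hpS : p ∈ S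
      · rw [Set.indicator_of_mem hpS, norm_mul, norm_mul]
        calc _ ≤ 1 * (1 * |c|) := by
              gcongr
              · exact norm_wave_le_one b ω t hB x η₀ hα p
              · exact hkn _
              · exact (huc p hpS (hSU p hpS hp)).trans (le_abs_self c)
          _ = |c| := by ring
      · rw [hu0 p hpS, Set.indicator_of_notMem hpS]
        simp
    · filter_upwards [ae_wedge_ne b] with p hp
      refine tendsto_const_nhds.congr' ?_
      have hpos : 0 < |wedge p.1 p.2 - b| := abs_pos.mpr (sub_ne_zero.mpr hp)
      obtain ⟨M, hM⟩ := exists_nat_gt (2 / |wedge p.1 p.2 - b|)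
      filter_upwards [eventually_ge_atTop M] with m hm
      have h1 : g m p = 1 := hk1 _ (by
        rw [abs_mul, Nat.abs_cast]
        have h2 : 2 / |wedge p.1 p.2 - b| ≤ (m : ℝ) :=
          hM.le.trans (by exact_mod_cast hm)
        rwa [div_le_iff₀ hpos] at h2)
      rw [h1, one_mul]
  have h1 := hlim f hf hf0 hc
  have h2 := hlim _ hTf hTf0 hcn
  simp only [hibp] at h1
  exact tendsto_nhds_unique h1 h2

/-- A nonstationary oscillatory integral exists and is small. -/
theorem exists_oscillatory (hω : 0 < ω) (hB : 0 < B) (hU : IsNonstationary b ω B t x η₀ K L U)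
    {f : Plane × Plane → ℂ} (hf : ContDiffOn ℝ (⊤ : ℕ∞) f U) {M : ℕ}
    (hfM : IsSymbol U (fun (_ : Unit) _ => 1) (fun _ p => (1 + ‖p.2‖) ^ M) (fun _ => f))
    {S : Set (Plane × Plane)} (hS : IsClosed S) (hSU : ∀ p ∈ S, wedge p.1 p.2 ≠ b → p ∈ U)
    (hSK : ∀ p ∈ S, p.1 ∈ K) (hf0 : ∀ p ∉ S, f p = 0) :
    ∃ J : ℝ → ℂ, (∃ C, ∀ α, 0 < α → α ≤ 1 → ‖J α‖ ≤ C * α ^ 3) ∧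
      ∀ α, 0 < α → ∀ χ : Plane → ℂ, ContDiff ℝ (⊤ : ℕ∞) χ → HasCompactSupport χ → χ 0 = 1 →
        Tendsto (fun δ : ℝ => ∫ p, wave b ω B t x η₀ α p * (χ (δ • p.2) * f p)) (𝓝[>] 0)
          (𝓝 (J α)) := by
  -- After n steps the growth (1 + |η|)^M has become the decay (1 + |η|)⁻⁴. One power is reserved
  -- for the error of the cut-off, and the exponent −3 is integrable in the plane.
  set n := M + 4 with hn
  have hpow : ∀ p : Plane × Plane, ∀ α : ℝ, (1 + ‖p.2‖) ^ M * (α * (1 + ‖p.2‖)⁻¹) ^ n =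
      α ^ n * ((1 + ‖p.2‖) ^ 4)⁻¹ := fun p α => by
    have : (1 + ‖p.2‖) ≠ 0 := by positivity
    rw [mul_pow, inv_pow, show (1 + ‖p.2‖) ^ n = (1 + ‖p.2‖) ^ M * (1 + ‖p.2‖) ^ 4 from
      pow_add _ _ _]
    field_simp
  have h4 : ∀ p : Plane × Plane, ((1 + ‖p.2‖) ^ 4)⁻¹ ≤ ((1 + ‖p.2‖) ^ 3)⁻¹ := fun p => by
    gcongr
    · linarith [norm_nonneg p.2]
    · norm_num
  have hwpos : ∀ (_ : Unit), ∀ p ∈ U, (0 : ℝ) ≤ (1 + ‖p.2‖) ^ M := fun _ p _ => by positivity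
  have hI : 0 ≤ ∫ p, majorant K p := integral_nonneg (majorant_nonneg K)
  obtain ⟨C₁, hC₁0, hC₁⟩ := IsSymbol.bound_pos (P := Set.Ioi (0 : ℝ)) (IsSymbol.transport_iterate
    (e := phaseBasis) (C₀ := fun _ _ => 0)
    (C := fun (i : Set.Ioi (0 : ℝ)) => transportCoeff b ω B t x η₀ i.1)
    (m := fun i p => i.1 * (1 + ‖p.2‖)⁻¹) hU.isOpen (fun _ _ _ => one_pos)
    (fun i p hp => hwpos () p hp) (fun i p _ => mul_nonneg i.2.le (by positivity))
    (IsSymbol.zero (fun _ _ _ => one_pos) (fun i p _ => mul_nonneg i.2.le (by positivity)))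
    (fun j => hU.isSymbol_transportCoeff (fun i : Set.Ioi (0 : ℝ) => i.1) (fun i => i.2.le) j)
    (hfM.comp_param fun _ => ()) n)
    (fun i p _ => mul_nonneg (by positivity) (pow_nonneg (mul_nonneg i.2.le (by positivity)) _))
  have hTbound : ∀ α, 0 < α → ∀ p ∈ U,
      ‖(waveTransport b ω B t x η₀ α)^[n] f p‖ ≤ C₁ * α ^ n * ((1 + ‖p.2‖) ^ 4)⁻¹ :=
    fun α hα p hp => (hC₁ ⟨α, hα⟩ p hp).trans_eq (by
      simp only
      rw [hpow, mul_assoc])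
  have hWd : ∀ α, ContinuousOn (wave b ω B t x η₀ α) U := fun α =>
    ((contDiffOn_wave b ω B t hω x η₀ α).mono hU.subset).continuousOn
  have hTd := fun α => (hU.contDiffOn_waveTransport_iterate hω α hf n).continuousOn
  have hT0 : ∀ α, ∀ p ∉ S, (waveTransport b ω B t x η₀ α)^[n] f p = 0 := fun α p hp =>
    waveTransport_iterate_eq_zero hS hf0 α n hp
  have hJ : ∀ α, 0 < α → Integrable (fun p => wave b ω B t x η₀ α p *
      (waveTransport b ω B t x η₀ α)^[n] f p) ∧
      ‖∫ p, wave b ω B t x η₀ α p * (waveTransport b ω B t x η₀ α)^[n] f p‖ ≤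
        C₁ * α ^ n * ∫ p, majorant K p := fun α hα =>
    integrable_of_le_majorant (b := b) (hU.isCompact_fst) hU.isOpen hSU ((hWd α).fun_mul (hTd α))
      (fun p hp => by rw [hT0 α p hp, mul_zero]) (by positivity) fun p hpS hp => by
        rw [norm_mul, majorant_of_mem (hSK p hpS)]
        calc _ ≤ 1 * (C₁ * α ^ n * ((1 + ‖p.2‖) ^ 4)⁻¹) := by
              gcongr
              · exact norm_wave_le_one b ω t hB x η₀ hα p
              · exact hTbound α hα p hp
          _ ≤ _ := by
              rw [one_mul]
              gcongr ?_ * ?_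
              exact h4 p
  refine ⟨fun α => ∫ p, wave b ω B t x η₀ α p * (waveTransport b ω B t x η₀ α)^[n] f p,
    ⟨C₁ * ∫ p, majorant K p, fun α hα hα1 => (hJ α hα).2.trans ?_⟩, fun α hα χ hχ hχc hχ0 => ?_⟩
  · have : α ^ n ≤ α ^ 3 := pow_le_pow_of_le_one hα.le hα1 (by omega)
    calc C₁ * α ^ n * ∫ p, majorant K p ≤ C₁ * α ^ 3 * ∫ p, majorant K p := by gcongr
      _ = _ := by ring
  have hχd : ∀ δ : ℝ, ContDiff ℝ (⊤ : ℕ∞) fun p : Plane × Plane => χ (δ • p.2) := fun δ =>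
    hχ.comp (contDiff_const.fun_smul contDiff_snd)
  have hdil := IsSymbol.dilation_sub (P := Set.Icc (0 : ℝ) 1) hU.isOpen (fun i => i.1)
    (fun i => i.2.1) (fun i => i.2.2) (ContinuousLinearMap.snd ℝ Plane Plane) hχ hχc
  have hprod := hdil.mul hU.isOpen (fun _ _ _ => one_pos)
    (fun i p _ => mul_nonneg i.2.1 (by positivity)) (fun i p hp => hwpos () p hp)
    (hfM.comp_param fun _ => ())
  obtain ⟨C₂, hC₂0, hC₂⟩ := IsSymbol.bound_pos (IsSymbol.transport_iterate
    (e := phaseBasis) (C₀ := fun _ _ => 0)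
    (C := fun (_ : Set.Icc (0 : ℝ) 1) => transportCoeff b ω B t x η₀ α)
    (m := fun i p => α * (1 + ‖p.2‖)⁻¹) hU.isOpen (fun _ _ _ => one_pos)
    (fun i p hp => mul_nonneg (mul_nonneg i.2.1 (by positivity)) (hwpos () p hp))
    (fun i p _ => by positivity)
    (IsSymbol.zero (fun _ _ _ => one_pos) (fun i p _ => by positivity))
    (fun j => hU.isSymbol_transportCoeff (fun _ => α) (fun i => hα.le) j)
    hprod n)
    (fun i p _ => mul_nonneg (mul_nonneg (mul_nonneg i.2.1 (by positivity)) (by positivity))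
      (by positivity))
  -- The difference between the integrand with and without cut-off; after the transport it is O(δ(1
  -- + |η|)⁻³), so the limit is the absolutely convergent transported integral, whatever χ is.
  set g : ℝ → Plane × Plane → ℂ := fun δ p => (χ (δ • p.2) - χ 0) * f p with hg
  have hgd : ∀ δ, ContDiffOn ℝ (⊤ : ℕ∞) (g δ) U := fun δ =>
    ((hχd δ).sub contDiff_const).contDiffOn.mul hf
  have hg0 : ∀ δ, ∀ p ∉ S, g δ p = 0 := fun δ p hp => by
    rw [hg]
    simp only
    rw [hf0 p hp, mul_zero]
  have hgbound : ∀ δ, 0 ≤ δ → δ ≤ 1 → ∀ p ∈ U,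
      ‖(waveTransport b ω B t x η₀ α)^[n] (g δ) p‖ ≤ C₂ * α ^ n * δ * ((1 + ‖p.2‖) ^ 3)⁻¹ :=
    fun δ h0 h1 p hp => (hC₂ ⟨δ, h0, h1⟩ p hp).trans_eq (by
      simp only [ContinuousLinearMap.coe_snd']
      rw [mul_assoc (δ * (1 + ‖p.2‖)), hpow]
      have : (1 + ‖p.2‖) ≠ 0 := by positivity
      field_simp)
  have hR : ∀ δ, 0 ≤ δ → δ ≤ 1 → Integrable (fun p => wave b ω B t x η₀ α p *
      (waveTransport b ω B t x η₀ α)^[n] (g δ) p) ∧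
      ‖∫ p, wave b ω B t x η₀ α p * (waveTransport b ω B t x η₀ α)^[n] (g δ) p‖ ≤
        C₂ * α ^ n * δ * ∫ p, majorant K p := fun δ h0 h1 =>
    integrable_of_le_majorant (b := b) (hU.isCompact_fst) hU.isOpen hSU ((hWd α).fun_mul
      (hU.contDiffOn_waveTransport_iterate hω α (hgd δ) n).continuousOn)
      (fun p hp => by rw [waveTransport_iterate_eq_zero hS (hg0 δ) α n hp, mul_zero])
      (by positivity) fun p hpS hp => by
        rw [norm_mul, majorant_of_mem (hSK p hpS)]
        calc _ ≤ 1 * (C₂ * α ^ n * δ * ((1 + ‖p.2‖) ^ 3)⁻¹) := by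
              gcongr
              · exact norm_wave_le_one b ω t hB x η₀ hα p
              · exact hgbound δ h0 h1 p hp
          _ = _ := one_mul _
  have hsplit : ∀ δ, Set.EqOn ((waveTransport b ω B t x η₀ α)^[n] fun p => χ (δ • p.2) * f p)
      (fun p => (waveTransport b ω B t x η₀ α)^[n] f p +
        (waveTransport b ω B t x η₀ α)^[n] (g δ) p) U := fun δ => by
    have h1 : (fun p : Plane × Plane => χ (δ • p.2) * f p) = fun p => f p + g δ p := by
      ext p
      simp only [hg, hχ0]
      ring
    rw [h1]
    exact transport_iterate_add hU.isOpen contDiffOn_const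
      (fun j => hU.contDiffOn_transportCoeff hω α j) hf (hgd δ) n
  have hkey : ∀ δ, 0 < δ → δ ≤ 1 → ∫ p, wave b ω B t x η₀ α p * (χ (δ • p.2) * f p) =
      (∫ p, wave b ω B t x η₀ α p * (waveTransport b ω B t x η₀ α)^[n] f p) +
        ∫ p, wave b ω B t x η₀ α p * (waveTransport b ω B t x η₀ α)^[n] (g δ) p := by
    intro δ hδ hδ1
    obtain ⟨r, hr⟩ := hχc.isCompact.isBounded.subset_closedBall (0 : Plane)
    have hχr : ∀ p : Plane × Plane, r / δ < ‖p.2‖ → χ (δ • p.2) = 0 := fun p hp => by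
      refine image_eq_zero_of_notMem_tsupport fun h => ?_
      have h1 := hr h
      rw [mem_closedBall_zero_iff, norm_smul, Real.norm_of_nonneg hδ.le] at h1
      rw [div_lt_iff₀ hδ, mul_comm] at hp
      linarith
    -- For fixed δ the cut-off confines η to a ball, and the integration by parts over a compact
    -- support applies.
    set S' : Set (Plane × Plane) := S ∩ (K ×ˢ Metric.closedBall (0 : Plane) (r / δ)) with hS'
    have hS'c : IsCompact S' := (hU.isCompact_fst.prod (isCompact_closedBall _ _)).inter_left hS
    have hf0' : ∀ p ∉ S', χ (δ • p.2) * f p = 0 := fun p hp => by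
      by_cases hpS : p ∈ S
      · have : r / δ < ‖p.2‖ := by
          by_contra h
          exact hp ⟨hpS, hSK p hpS, mem_closedBall_zero_iff.mpr (not_lt.mp h)⟩
        rw [hχr p this, zero_mul]
      · rw [hf0 p hpS, mul_zero]
    obtain ⟨c₁, hc₁⟩ : ∃ c₁, ∀ z, ‖χ z‖ ≤ c₁ := hχ.continuous.bounded_above_of_compact_support hχc
    obtain ⟨c₂, hc₂0, hc₂⟩ := hfM.bound_pos hwpos
    have hc₁0 : 0 ≤ c₁ := (norm_nonneg _).trans (hc₁ 0)
    have hJr : ∀ p ∈ S', ‖p.2‖ ≤ |r / δ| := fun p hp =>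
      (mem_closedBall_zero_iff.mp hp.2.2).trans (le_abs_self _)
    have hinv1 : ∀ (p : Plane × Plane) (k : ℕ), ((1 + ‖p.2‖) ^ k)⁻¹ ≤ 1 := fun p k =>
      inv_le_one_of_one_le₀ (one_le_pow₀ (by linarith [norm_nonneg p.2]))
    rw [hU.integral_wave_mul hω hB hα (n := n) ((hχd δ).contDiffOn.mul hf) hS'c
      (fun p hp => hSU p hp.1) hf0'
      (c := c₁ * (c₂ * (1 + |r / δ|) ^ M) + (C₁ * α ^ n + C₂ * α ^ n * δ)) ?_ ?_,
      ← integral_add (hJ α hα).1 (hR δ hδ.le hδ1).1]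
    · refine integral_congr_ae ?_
      filter_upwards [ae_wedge_ne b] with p hp
      by_cases hpS : p ∈ S
      · rw [hsplit δ (hSU p hpS hp)]
        ring
      · rw [hT0 α p hpS, waveTransport_iterate_eq_zero hS (hg0 δ) α n hpS,
          waveTransport_iterate_eq_zero hS (fun q hq => by rw [hf0 q hq, mul_zero]) α n hpS]
        ring
    · intro p hpS hp
      have h1 : ‖χ (δ • p.2) * f p‖ ≤ c₁ * (c₂ * (1 + |r / δ|) ^ M) := by
        rw [norm_mul]
        gcongr
        · exact hc₁ _
        · refine (hc₂ () p hp).trans ?_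
          gcongr
          exact hJr p hpS
      have h2 : 0 ≤ C₁ * α ^ n + C₂ * α ^ n * δ := by positivity
      linarith
    · intro p hpS hp
      rw [hsplit δ hp]
      have h1 : 0 ≤ c₁ * (c₂ * (1 + |r / δ|) ^ M) := by positivity
      have h2 : C₁ * α ^ n * ((1 + ‖p.2‖) ^ 4)⁻¹ ≤ C₁ * α ^ n :=
        mul_le_of_le_one_right (by positivity) (hinv1 p 4)
      have h3 : C₂ * α ^ n * δ * ((1 + ‖p.2‖) ^ 3)⁻¹ ≤ C₂ * α ^ n * δ :=
        mul_le_of_le_one_right (by positivity) (hinv1 p 3)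
      have h4 := (norm_add_le _ _).trans
        (add_le_add (hTbound α hα p hp) (hgbound δ hδ.le hδ1 p hp))
      linarith
  have hzero : Tendsto (fun δ : ℝ =>
      ∫ p, wave b ω B t x η₀ α p * (waveTransport b ω B t x η₀ α)^[n] (g δ) p) (𝓝[>] 0) (𝓝 0) := by
    refine squeeze_zero_norm' (a := fun δ : ℝ => C₂ * α ^ n * δ * ∫ p, majorant K p) ?_ ?_
    · filter_upwards [Ioc_mem_nhdsGT one_pos] with δ hδ
      exact (hR δ hδ.1.le hδ.2).2
    · have : Tendsto (fun δ : ℝ => C₂ * α ^ n * δ * ∫ p, majorant K p) (𝓝 0)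
          (𝓝 (C₂ * α ^ n * 0 * ∫ p, majorant K p)) :=
        Continuous.tendsto (by fun_prop) 0
      simp only [mul_zero, zero_mul] at this
      exact this.mono_left nhdsWithin_le_nhds
  have hsum := (tendsto_const_nhds (x := ∫ p, wave b ω B t x η₀ α p *
    (waveTransport b ω B t x η₀ α)^[n] f p)).add hzero
  rw [add_zero] at hsum
  refine hsum.congr' ?_
  filter_upwards [Ioc_mem_nhdsGT one_pos] with δ hδ
  exact (hkey δ hδ.1 hδ.2).symm

end IsNonstationary

end ABOscillator

/-! ### Amplitudes of polynomial growth and decay in x − xᵗ. -/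

namespace ABOscillator

open SymbolCalculus

theorem mem_phaseSpace_of_fst_mem {b : ℝ} {K : Set Plane} (hK0 : K ⊆ {0}ᶜ) {p : Plane × Plane}
    (hp : p.1 ∈ K) (hw : wedge p.1 p.2 ≠ b) : p ∈ phaseSpace b :=
  ⟨hK0 hp, hw⟩

/-- When `sin (ωt) ≠ 0`, the momentum is controlled by the position at time `t`. -/
theorem exists_norm_snd_le_of_sin_ne_zero {b ω t : ℝ} (hω : 0 < ω) (hs : Real.sin (ω * t) ≠ 0)
    (x : Plane) {K : Set Plane} (hK : IsCompact K) (hK0 : K ⊆ {0}ᶜ) :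
    ∃ C, ∀ p : Plane × Plane, p.1 ∈ K → 1 + ‖p.2‖ ≤ C * (1 + ‖x - flowX b ω t p.1 p.2‖) := by
  obtain ⟨C₁, hC₁⟩ := hK.exists_bound_of_continuousOn (f := fun y : Plane =>
    potential b y - (ω / Real.sin (ω * t)) • (Real.cos (ω * t) • y - x))
    (((contDiffOn_potential b).continuousOn.mono hK0).sub (by fun_prop))
  refine ⟨1 + |C₁| + |ω / Real.sin (ω * t)|, fun p hp => ?_⟩
  have h1 : p.2 = (potential b p.1 - (ω / Real.sin (ω * t)) • (Real.cos (ω * t) • p.1 - x)) -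
      (ω / Real.sin (ω * t)) • (x - flowX b ω t p.1 p.2) := by
    rw [flowX]
    ext i
    simp only [PiLp.sub_apply, PiLp.smul_apply, PiLp.add_apply, smul_eq_mul]
    field_simp
    ring
  have h2 : ‖p.2‖ ≤ |C₁| + |ω / Real.sin (ω * t)| * ‖x - flowX b ω t p.1 p.2‖ := by
    conv_lhs => rw [h1]
    refine (norm_sub_le _ _).trans (add_le_add ((hC₁ _ hp).trans (le_abs_self _)) ?_)
    rw [norm_smul, Real.norm_eq_abs]
  have h3 : 0 ≤ ‖x - flowX b ω t p.1 p.2‖ := norm_nonneg _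
  have h4 : 0 ≤ |C₁| := abs_nonneg _
  have h5 : 0 ≤ |ω / Real.sin (ω * t)| := abs_nonneg _
  nlinarith [mul_nonneg h4 h3]

/-- Functions that are continuous on the phase space, of polynomial growth in `η`, and vanish
outside of `S`. -/
structure IsModerate (b : ℝ) (K : Set Plane) (S : Set (Plane × Plane)) (f : Plane × Plane → ℂ) :
    Prop where
  isCompact : IsCompact K
  ne_zero : K ⊆ {0}ᶜ
  fst_mem : ∀ p ∈ S, p.1 ∈ K
  continuousOn : ContinuousOn f (phaseSpace b)
  eq_zero : ∀ p ∉ S, f p = 0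
  bound : ∃ c, 0 ≤ c ∧ ∃ M : ℕ, ∀ p ∈ S, p ∈ phaseSpace b → ‖f p‖ ≤ c * (1 + ‖p.2‖) ^ M

namespace IsModerate

variable {b ω B t : ℝ} {x η₀ : Plane} {K : Set Plane} {S : Set (Plane × Plane)}
  {f : Plane × Plane → ℂ}

theorem mem_phaseSpace (hf : IsModerate b K S f) {p : Plane × Plane} (hp : p ∈ S)
    (hw : wedge p.1 p.2 ≠ b) : p ∈ phaseSpace b :=
  mem_phaseSpace_of_fst_mem hf.ne_zero (hf.fst_mem p hp) hw

theorem mul_bounded (hf : IsModerate b K S f) {g : Plane × Plane → ℂ}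
    (hg : ContinuousOn g (phaseSpace b)) {C : ℝ} (hgC : ∀ p, ‖g p‖ ≤ C) :
    IsModerate b K S (fun p => g p * f p) := by
  obtain ⟨c, hc, M, hM⟩ := hf.bound
  have hC : 0 ≤ C := (norm_nonneg _).trans (hgC 0)
  refine ⟨hf.isCompact, hf.ne_zero, hf.fst_mem, hg.fun_mul hf.continuousOn,
    fun p hp => by rw [hf.eq_zero p hp, mul_zero], C * c, by positivity, M, fun p hpS hp => ?_⟩
  rw [norm_mul, mul_assoc]
  exact mul_le_mul (hgC p) (hM p hpS hp) (norm_nonneg _) hC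

theorem of_subset (hf : IsModerate b K S f) {S' : Set (Plane × Plane)} (hS : S' ⊆ S)
    (h0 : ∀ p ∉ S', f p = 0) : IsModerate b K S' f := by
  obtain ⟨c, hc, M, hM⟩ := hf.bound
  exact ⟨hf.isCompact, hf.ne_zero, fun p hp => hf.fst_mem p (hS hp), hf.continuousOn, h0,
    c, hc, M, fun p hp => hM p (hS hp)⟩

/-- A cut-off in `η` makes the integral converge. -/
theorem integrable_cutoff (hω : 0 < ω) (hB : 0 < B) (hf : IsModerate b K S f) {α : ℝ} (hα : 0 < α)
    {χ : Plane → ℂ} (hχ : Continuous χ) (hχc : HasCompactSupport χ) {δ : ℝ} (hδ : 0 < δ) :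
    Integrable fun p => wave b ω B t x η₀ α p * (χ (δ • p.2) * f p) := by
  obtain ⟨c, hc, M, hM⟩ := hf.bound
  obtain ⟨c₁, hc₁⟩ : ∃ c₁, ∀ z, ‖χ z‖ ≤ c₁ := hχ.bounded_above_of_compact_support hχc
  have hc₁0 : 0 ≤ c₁ := (norm_nonneg _).trans (hc₁ 0)
  obtain ⟨r, hr⟩ := hχc.isCompact.isBounded.subset_closedBall (0 : Plane)
  have hχr : ∀ p : Plane × Plane, χ (δ • p.2) ≠ 0 → ‖p.2‖ ≤ |r / δ| := fun p hp => by
    have h1 := hr (subset_tsupport χ hp)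
    rw [mem_closedBall_zero_iff, norm_smul, Real.norm_of_nonneg hδ.le, mul_comm,
      ← le_div_iff₀ hδ] at h1
    exact h1.trans (le_abs_self _)
  have hχδ : Continuous fun p : Plane × Plane => χ (δ • p.2) := by fun_prop
  refine (integrable_of_le_majorant (c := c₁ * (c * (1 + |r / δ|) ^ (M + 3))) hf.isCompact
    (isOpen_phaseSpace b) (fun p hp hw => hf.mem_phaseSpace hp hw)
    (((contDiffOn_wave b ω B t hω x η₀ α).continuousOn).fun_mul
      (hχδ.continuousOn.fun_mul hf.continuousOn))
    (fun p hp => by rw [hf.eq_zero p hp, mul_zero, mul_zero]) (by positivity)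
    fun p hpS hp => ?_).1
  by_cases h0 : χ (δ • p.2) = 0
  · rw [h0, zero_mul, mul_zero, norm_zero]
    exact mul_nonneg (by positivity) (majorant_nonneg K p)
  rw [majorant_of_mem (hf.fst_mem p hpS), norm_mul, norm_mul, ← div_eq_mul_inv,
    le_div_iff₀ (by positivity)]
  have h1 := hχr p h0
  calc _ ≤ 1 * (c₁ * (c * (1 + ‖p.2‖) ^ M)) * (1 + ‖p.2‖) ^ 3 := by
        gcongr
        · exact norm_wave_le_one b ω t hB x η₀ hα p
        · exact hc₁ _
        · exact hM p hpS hp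
    _ = c₁ * (c * (1 + ‖p.2‖) ^ (M + 3)) := by ring
    _ ≤ _ := by gcongr

/-- The exponential is dominated by a Gaussian when `η` is controlled by `x - xᵗ`. -/
theorem exists_exp_mul_le (hf : IsModerate b K S f)
    (hS : ∃ C, ∀ p ∈ S, 1 + ‖p.2‖ ≤ C * (1 + ‖x - flowX b ω t p.1 p.2‖)) {k : ℝ} (hk : 0 < k) :
    ∃ C, 0 ≤ C ∧ ∀ p ∈ S, p ∈ phaseSpace b →
      Real.exp (-(k * ‖x - flowX b ω t p.1 p.2‖ ^ 2)) * ‖f p‖ ≤ C * majorant K p := by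
  obtain ⟨C₁, hC₁⟩ := hS
  obtain ⟨c, hc, M, hM⟩ := hf.bound
  obtain ⟨C₂, hC₂⟩ := exists_exp_neg_sq_le hk (M + 3)
  have hC₂0 : 0 ≤ C₂ := by
    have := hC₂ 0 le_rfl
    simp at this
    linarith
  refine ⟨C₂ * (c * |C₁| ^ (M + 3)), by positivity, fun p hpS hp => ?_⟩
  set q := ‖x - flowX b ω t p.1 p.2‖ with hq
  have hq0 : 0 ≤ q := norm_nonneg _
  have h1 : 1 + ‖p.2‖ ≤ |C₁| * (1 + q) := (hC₁ p hpS).trans (by gcongr; exact le_abs_self _)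
  rw [majorant_of_mem (hf.fst_mem p hpS), ← div_eq_mul_inv _ ((1 + ‖p.2‖) ^ 3),
    le_div_iff₀ (by positivity)]
  calc _ ≤ C₂ * ((1 + q) ^ (M + 3))⁻¹ * (c * (1 + ‖p.2‖) ^ M) * (1 + ‖p.2‖) ^ 3 := by
        gcongr
        · exact hC₂ q hq0
        · exact hM p hpS hp
    _ = C₂ * ((1 + q) ^ (M + 3))⁻¹ * (c * (1 + ‖p.2‖) ^ (M + 3)) := by ring
    _ ≤ C₂ * ((1 + q) ^ (M + 3))⁻¹ * (c * (|C₁| * (1 + q)) ^ (M + 3)) := by gcongr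
    _ = _ := by
        rw [mul_pow]
        field_simp

theorem integrable_wave (hω : 0 < ω) (hB : 0 < B) (hf : IsModerate b K S f)
    (hS : ∃ C, ∀ p ∈ S, 1 + ‖p.2‖ ≤ C * (1 + ‖x - flowX b ω t p.1 p.2‖)) {α : ℝ} (hα : 0 < α) :
    Integrable fun p => wave b ω B t x η₀ α p * f p := by
  obtain ⟨C, hC0, hC⟩ := hf.exists_exp_mul_le hS (k := B / 2 / α) (by positivity)
  refine (integrable_of_le_majorant (c := C) hf.isCompact
    (isOpen_phaseSpace b) (fun p hp hw => hf.mem_phaseSpace hp hw)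
    (((contDiffOn_wave b ω B t hω x η₀ α).continuousOn).fun_mul hf.continuousOn)
    (fun p hp => by rw [hf.eq_zero p hp, mul_zero]) hC0 fun p hpS hp => ?_).1
  rw [norm_mul, norm_wave]
  convert! hC p hpS hp using 3
  field_simp

/-- The decaying exponent B|x − xᵗ|²/(2α) is halved. One half is at least Bz²/(4α) on the support
and beats every power of α; the other half, at α ≤ 1, dominates the growth in η. -/
theorem norm_integral_wave_le (hω : 0 < ω) (hB : 0 < B) (hf : IsModerate b K S f)
    (hS : ∃ C, ∀ p ∈ S, 1 + ‖p.2‖ ≤ C * (1 + ‖x - flowX b ω t p.1 p.2‖)) {z : ℝ} (hz : 0 < z)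
    (hfz : ∀ p, f p ≠ 0 → z ≤ ‖x - flowX b ω t p.1 p.2‖) :
    ∃ C, ∀ α, 0 < α → α ≤ 1 → ‖∫ p, wave b ω B t x η₀ α p * f p‖ ≤ C * α ^ 3 := by
  obtain ⟨C, hC0, hC⟩ := hf.exists_exp_mul_le hS (k := B / 4) (by positivity)
  set k := B * z ^ 2 / 4 with hk
  have hk0 : 0 < k := by positivity
  have hexp : ∀ α, 0 < α → Real.exp (-(k / α)) ≤ 6 * k⁻¹ ^ 3 * α ^ 3 := fun α hα => by
    have h1 := Real.pow_div_factorial_le_exp (k / α) (by positivity) 3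
    rw [Real.exp_neg, inv_le_comm₀ (Real.exp_pos _) (by positivity)]
    refine le_trans (le_of_eq ?_) h1
    simp only [Nat.factorial]
    push_cast
    field_simp
  refine ⟨6 * k⁻¹ ^ 3 * C * ∫ p, majorant K p, fun α hα hα1 => ?_⟩
  have h := (integrable_of_le_majorant (c := 6 * k⁻¹ ^ 3 * α ^ 3 * C) hf.isCompact
    (isOpen_phaseSpace b) (fun p hp hw => hf.mem_phaseSpace hp hw)
    (((contDiffOn_wave b ω B t hω x η₀ α).continuousOn).fun_mul hf.continuousOn)
    (fun p hp => by rw [hf.eq_zero p hp, mul_zero]) (by positivity) fun p hpS hp => ?_).2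
  · exact h.trans_eq (by ring)
  by_cases h0 : f p = 0
  · rw [h0, mul_zero, norm_zero]
    exact mul_nonneg (by positivity) (majorant_nonneg K p)
  have hq := hfz p h0
  rw [norm_mul, norm_wave, mul_assoc _ C]
  set q := ‖x - flowX b ω t p.1 p.2‖ with hqd
  have h1 : Real.exp (-(B * q ^ 2 / 2 / α)) ≤
      Real.exp (-(k / α)) * Real.exp (-(B / 4 * q ^ 2)) := by
    rw [← Real.exp_add, Real.exp_le_exp]
    have h2 : k / α ≤ B * q ^ 2 / 4 / α := by
      rw [hk]
      gcongr
    have h3 : B / 4 * q ^ 2 ≤ B * q ^ 2 / 4 / α := by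
      rw [le_div_iff₀ hα]
      have : 0 ≤ B / 4 * q ^ 2 := by positivity
      nlinarith
    have h4 : B * q ^ 2 / 2 / α = B * q ^ 2 / 4 / α + B * q ^ 2 / 4 / α := by ring
    linarith
  calc _ ≤ Real.exp (-(k / α)) * Real.exp (-(B / 4 * q ^ 2)) * ‖f p‖ := by gcongr
    _ = Real.exp (-(k / α)) * (Real.exp (-(B / 4 * q ^ 2)) * ‖f p‖) := by ring
    _ ≤ 6 * k⁻¹ ^ 3 * α ^ 3 * (C * majorant K p) := by
        exact mul_le_mul (hexp α hα) (hC p hpS hp) (by positivity) (by positivity)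

end IsModerate

/-- For an integrable function, the oscillatory integral is the ordinary one. -/
theorem tendsto_integral_cutoff {W f : Plane × Plane → ℂ} (h : Integrable fun p => W p * f p)
    {χ : Plane → ℂ} (hχ : Continuous χ) (hχc : HasCompactSupport χ) (hχ0 : χ 0 = 1) :
    Tendsto (fun δ : ℝ => ∫ p, W p * (χ (δ • p.2) * f p)) (𝓝[>] 0) (𝓝 (∫ p, W p * f p)) := by
  obtain ⟨c₁, hc₁⟩ : ∃ c₁, ∀ z, ‖χ z‖ ≤ c₁ := hχ.bounded_above_of_compact_support hχc
  have he : ∀ δ : ℝ, (fun p : Plane × Plane => W p * (χ (δ • p.2) * f p)) =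
      fun p => χ (δ • p.2) * (W p * f p) := fun δ => by
    ext p
    ring
  simp only [he]
  refine tendsto_integral_filter_of_dominated_convergence (fun p => c₁ * ‖W p * f p‖)
    (Eventually.of_forall fun δ => ?_) (Eventually.of_forall fun δ => Eventually.of_forall
      fun p => ?_) (h.norm.const_mul c₁) (Eventually.of_forall fun p => ?_)
  · have hχδ : Continuous fun p : Plane × Plane => χ (δ • p.2) := by fun_prop
    exact hχδ.aestronglyMeasurable.mul h.aestronglyMeasurable
  · rw [norm_mul]
    gcongr
    exact hc₁ _
  · have h1 : Tendsto (fun δ : ℝ => χ (δ • p.2) * (W p * f p)) (𝓝 0)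
        (𝓝 (χ ((0 : ℝ) • p.2) * (W p * f p))) :=
      Continuous.tendsto (f := fun δ : ℝ => χ (δ • p.2) * (W p * f p)) (by fun_prop) 0
    rw [zero_smul, hχ0, one_mul] at h1
    exact h1.mono_left nhdsWithin_le_nhds

end ABOscillator

/-! ### Symbol estimates for the amplitudes. -/

namespace SymbolCalculus

variable {E : Type*} [NormedAddCommGroup E] [NormedSpace ℝ E] {P : Type*} {U : Set E}

/-- Bounds for the iterated derivatives give symbol estimates. -/
theorem IsSymbol.of_iteratedFDeriv (hU : IsOpen U) {w : E → ℝ} {f : E → ℂ}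
    (hf : ContDiffOn ℝ (⊤ : ℕ∞) f U)
    (h : ∀ n : ℕ, ∃ C, ∀ p ∈ U, ‖iteratedFDeriv ℝ n f p‖ ≤ C * w p) :
    IsSymbol U (fun (_ : P) _ => 1) (fun _ p => w p) (fun _ => f) := by
  intro k
  have h0 : ∀ {f : E → ℂ}, (∀ n : ℕ, ∃ C, ∀ p ∈ U, ‖iteratedFDeriv ℝ n f p‖ ≤ C * w p) →
      ∃ C, ∀ _ : P, ∀ p ∈ U, ‖f p‖ ≤ C * w p := fun h => by
    obtain ⟨C, hC⟩ := h 0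
    exact ⟨C, fun _ p hp => by simpa using hC p hp⟩
  induction k generalizing f with
  | zero => exact h0 h
  | succ k ih =>
    refine ⟨h0 h, fun _ p hp => (hf.contDiffAt (hU.mem_nhds hp)).differentiableAt (by simp),
      fun v => ?_⟩
    simp only [div_one]
    refine ih (contDiffOn_fderiv_apply hU hf v) fun n => ?_
    obtain ⟨C, hC⟩ := h (n + 1)
    refine ⟨‖v‖ * C, fun p hp => ?_⟩
    have h1 : ContDiffAt ℝ (n : ℕ∞) (fderiv ℝ f) p :=
      ((hf.fderiv_of_isOpen hU (m := (n : ℕ∞)) (by exact_mod_cast le_top)).contDiffAt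
        (hU.mem_nhds hp))
    refine (norm_iteratedFDeriv_clm_apply_const h1 (by simp)).trans ?_
    rw [norm_iteratedFDeriv_fderiv, mul_assoc]
    gcongr
    exact hC p hp

end SymbolCalculus

namespace ABOscillator

open SymbolCalculus

/-- Amplitudes for which the symbol estimates hold where `y` and `xᵗ` are in compact sets. -/
structure IsLocalAmplitude (b ω t : ℝ) (a : Plane × Plane → ℂ) : Prop where
  smooth : ContDiffOn ℝ (⊤ : ℕ∞) a (phaseSpace b)
  bound : ∀ K : Set Plane, IsCompact K → K ⊆ {0}ᶜ → ∃ c, 0 ≤ c ∧ ∃ M : ℕ, ∀ p ∈ phaseSpace b,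
    p.1 ∈ K → ‖a p‖ ≤ c * (1 + ‖p.2‖) ^ M
  symbol : ∀ (K L : Set Plane) (U : Set (Plane × Plane)), IsRegion b ω t K L U →
    U ⊆ phaseSpace b → ∃ M : ℕ,
      IsSymbol U (fun (_ : Unit) _ => 1) (fun _ p => (1 + ‖p.2‖) ^ M) (fun _ => a)

theorem IsAmplitude.isLocalAmplitude {b : ℝ} {a : Plane → Plane → ℂ} (ha : IsAmplitude b a)
    (ω t : ℝ) : IsLocalAmplitude b ω t (fun p => a p.1 p.2) := by
  refine ⟨ha.smooth, fun K hK hK0 => ?_, fun K L U hU hUp => ?_⟩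
  · obtain ⟨M, hM⟩ := ha.bound K hK fun h => hK0 h rfl
    obtain ⟨C, hC⟩ := hM 0
    refine ⟨|C|, abs_nonneg C, M, fun p hp hpK => ?_⟩
    have := hC p.1 hpK p.2 hp.2
    rw [norm_iteratedFDeriv_zero] at this
    exact this.trans (by gcongr; exact le_abs_self C)
  · obtain ⟨M, hM⟩ := ha.bound K hU.isCompact_fst fun h => hU.ne_zero_fst h rfl
    refine ⟨M, IsSymbol.of_iteratedFDeriv hU.isOpen (ha.smooth.mono hUp) fun n => ?_⟩
    obtain ⟨C, hC⟩ := hM n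
    exact ⟨C, fun p hp => hC p.1 (hU.fst_mem p hp) p.2 (hUp hp).2⟩

theorem contDiff_scaledCutoff {θ : Plane → ℝ} (hθ : IsCutoff θ) (ε : ℝ) :
    ContDiff ℝ (⊤ : ℕ∞) (scaledCutoff θ ε) :=
  hθ.smooth.comp (contDiff_const_smul ε⁻¹)

theorem exists_scaledCutoff_le {θ : Plane → ℝ} (hθ : IsCutoff θ) (ε : ℝ) :
    ∃ C, 0 ≤ C ∧ ∀ x, |scaledCutoff θ ε x| ≤ C := by
  obtain ⟨C, hC⟩ := (isCompact_closedBall (0 : Plane) 2).exists_bound_of_continuousOn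
    hθ.smooth.continuous.continuousOn
  refine ⟨max |C| 1, by positivity, fun x => ?_⟩
  by_cases h : ‖ε⁻¹ • x‖ ≤ 2
  · exact ((hC _ (mem_closedBall_zero_iff.mpr h)).trans (le_abs_self C)).trans (le_max_left _ _)
  · rw [scaledCutoff, hθ.eq_one _ (not_le.mp h), abs_one]
    exact le_max_right _ _

/-- The factor of the leading amplitude that depends on `xᵗ` only. -/
noncomputable def flowFactor (b ω B ε : ℝ) (θ : Plane → ℝ) (t : ℝ) (z : Plane) : ℂ :=
  (scaledCutoff θ ε z : ℂ) * sqrtZ ω B (|b| / ‖z‖ ^ 2) t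

/-- |b|/|z|² is unbounded only near z = 0, where the cut-off vanishes; for |z| ≥ ε the square of the
root is det Z, which is bounded. -/
theorem exists_flowFactor_le {b ω B ε t : ℝ} (hω : 0 < ω) (hB : 0 < B) (hε : 0 < ε)
    {θ : Plane → ℝ} (hθ : IsCutoff θ) : ∃ C, 0 ≤ C ∧ ∀ z, ‖flowFactor b ω B ε θ t z‖ ≤ C := by
  obtain ⟨C, hC0, hC⟩ := exists_scaledCutoff_le hθ ε
  set s := |Real.sin (ω * t) / ω| with hs
  set D := (1 + B * s) ^ 2 + (s * (|b| / ε ^ 2)) ^ 2 with hD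
  refine ⟨C * (1 + D), by positivity, fun z => ?_⟩
  by_cases hz : ‖z‖ < ε
  · have h0 : scaledCutoff θ ε z = 0 := hθ.eq_zero _ (by
      rw [norm_smul, norm_inv, Real.norm_of_nonneg hε.le, inv_mul_lt_iff₀ hε, mul_one]
      exact hz)
    rw [flowFactor, h0, Complex.ofReal_zero, zero_mul, norm_zero]
    positivity
  have hz' : ε ≤ ‖z‖ := not_lt.mp hz
  have hr : |b| / ‖z‖ ^ 2 ≤ |b| / ε ^ 2 := by gcongr
  have hr0 : 0 ≤ |b| / ‖z‖ ^ 2 := by positivity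
  have hdet : ‖detZ ω B (|b| / ‖z‖ ^ 2) t‖ ≤ D := by
    rw [detZ]
    refine (norm_sub_le _ _).trans ?_
    rw [norm_pow, norm_pow]
    have h1 : ‖(Real.cos (ω * t) : ℂ) - Complex.I * (B * (Real.sin (ω * t) / ω) : ℝ)‖ ≤
        1 + B * s := by
      refine (norm_sub_le _ _).trans (add_le_add ?_ ?_)
      · rw [Complex.norm_real]
        exact Real.abs_cos_le_one _
      · rw [norm_mul, Complex.norm_I, one_mul, Complex.norm_real, Real.norm_eq_abs, abs_mul,
          abs_of_pos hB]
    have h2 : ‖((Real.sin (ω * t) / ω * (|b| / ‖z‖ ^ 2) : ℝ) : ℂ)‖ ≤ s * (|b| / ε ^ 2) := by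
      rw [Complex.norm_real, Real.norm_eq_abs, abs_mul, abs_of_nonneg hr0]
      gcongr
    rw [hD]
    gcongr
  have hsq : ‖sqrtZ ω B (|b| / ‖z‖ ^ 2) t‖ ≤ 1 + D := by
    have h1 : ‖sqrtZ ω B (|b| / ‖z‖ ^ 2) t‖ ^ 2 ≤ D := by
      rw [← norm_pow, sqrtZ_sq hω hB]
      exact hdet
    nlinarith [norm_nonneg (sqrtZ ω B (|b| / ‖z‖ ^ 2) t)]
  rw [flowFactor, norm_mul, Complex.norm_real]
  gcongr
  exact hC z

theorem contDiffOn_flowFactor {b ω B ε t : ℝ} (hω : 0 < ω) (hB : 0 < B)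
    {θ : Plane → ℝ} (hθ : IsCutoff θ) :
    ContDiffOn ℝ (⊤ : ℕ∞) (flowFactor b ω B ε θ t) {0}ᶜ :=
  (Complex.ofRealCLM.contDiff.comp (contDiff_scaledCutoff hθ ε)).contDiffOn.mul
    (contDiffOn_sqrtZ hω hB b t)

theorem leadingAmplitude_eq {b ω B ε t : ℝ} (hω : 0 < ω) (hB : 0 < B) (ht : 0 ≤ t)
    (θ : Plane → ℝ) {p : Plane × Plane} (hp : p ∈ phaseSpace b) :
    leadingAmplitude b ω B ε θ t p.1 p.2 =
      flowFactor b ω B ε θ t (flowX b ω t p.1 p.2) * (scaledCutoff θ ε p.1 : ℂ) := by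
  rw [leadingAmplitude, flowFactor, sqrtDetZ_eq hω hB b ht hp]
  ring

/-- Derivative bounds are required only where xᵗ stays in a compact set away from the origin. There
the amplitude is a product of smooth functions of y and of xᵗ, so no behaviour of the derivatives at
infinity has to be examined. -/
theorem isLocalAmplitude_leadingAmplitude {b ω B ε t : ℝ} (hω : 0 < ω) (hB : 0 < B) (hε : 0 < ε)
    (ht : 0 ≤ t) {θ : Plane → ℝ} (hθ : IsCutoff θ) :
    IsLocalAmplitude b ω t (fun p => leadingAmplitude b ω B ε θ t p.1 p.2) := by
  have hθc : ContDiff ℝ (⊤ : ℕ∞) fun y : Plane => ((scaledCutoff θ ε y : ℝ) : ℂ) :=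
    Complex.ofRealCLM.contDiff.comp (contDiff_scaledCutoff hθ ε)
  refine ⟨?_, fun K hK hK0 => ?_, fun K L U hU hUp => ⟨0, ?_⟩⟩
  · have h1 : ContDiffOn ℝ (⊤ : ℕ∞)
        (fun p : Plane × Plane => flowFactor b ω B ε θ t (flowX b ω t p.1 p.2)) (phaseSpace b) :=
      (contDiffOn_flowFactor hω hB hθ).comp
        ((contDiffOn_flowX b ω t).mono fun p hp => hp.1)
        fun p hp => flowX_ne_zero b ω t hω p.1 p.2 hp
    exact (h1.mul (hθc.comp contDiff_fst).contDiffOn).congr fun p hp =>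
      leadingAmplitude_eq hω hB ht θ hp
  · obtain ⟨C, hC0, hC⟩ := exists_flowFactor_le (b := b) (t := t) hω hB hε hθ
    obtain ⟨C', hC'0, hC'⟩ := exists_scaledCutoff_le hθ ε
    refine ⟨C * C', by positivity, 0, fun p hp _ => ?_⟩
    rw [leadingAmplitude_eq hω hB ht θ hp, norm_mul, pow_zero, mul_one, Complex.norm_real]
    exact mul_le_mul (hC _) (hC' _) (norm_nonneg _) hC0
  · simp only [pow_zero]
    exact (hU.mul_one_one (hU.comp_flowX (contDiffOn_flowFactor (ε := ε) hω hB hθ))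
      (hU.comp_fst hθc.contDiffOn)).congr hU.isOpen fun _ p hp =>
      leadingAmplitude_eq hω hB ht θ (hUp hp)

end ABOscillator

/-! ### Localization at the stationary point. -/

namespace ABOscillator

open SymbolCalculus

/-- The contribution of a neighbourhood of the stationary point. -/
theorem exists_stationary_ball {b ω B t : ℝ} (hω : 0 < ω) (hB : 0 < B) {p₀ : Plane × Plane}
    (hp₀ : p₀ ∈ phaseSpace b) (hD : (flowXy b ω t p₀.1 p₀.2).det ≠ 0)
    {ν : Plane × Plane →L[ℝ] Plane × Plane →L[ℝ] ℝ} (hν : ∀ p v, ν p v = ν v p)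
    (hk : ∃ k₀ > 0, ∀ p, k₀ * ‖p‖ ^ 2 ≤ ν p p) :
    ∃ R > 0, Metric.ball p₀ R ⊆ phaseSpace b ∧ ∀ f : Plane × Plane → ℂ,
      ContDiffOn ℝ (⊤ : ℕ∞) f (phaseSpace b) → ∀ S : Set (Plane × Plane), IsClosed S →
      S ⊆ Metric.ball p₀ R → (∀ p ∉ S, f p = 0) →
      (∀ α, 0 < α → Integrable fun p =>
        wave b ω B t (flowX b ω t p₀.1 p₀.2) p₀.2 α p * f p) ∧
      ∃ C, ∃ α₁ > 0, ∀ α : ℝ, 0 < α → α ≤ α₁ →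
        ‖(∫ p, wave b ω B t (flowX b ω t p₀.1 p₀.2) p₀.2 α p * f p) -
          wave b ω B t (flowX b ω t p₀.1 p₀.2) p₀.2 α p₀ * (f p₀ *
            ∫ p, Complex.exp (Complex.I * ((1 / 2 : ℂ) * phaseHessian b ω B t p₀ p p) / (α : ℂ) -
              ((ν p p : ℝ) : ℂ)))‖ ≤ C * α ^ 3 := by
  set x := flowX b ω t p₀.1 p₀.2 with hx
  set Ψ := totalPhase b ω B t x p₀.2 with hΨ
  obtain ⟨g, hg, hg3, r, hr, hrV, hΨe⟩ := exists_cubic_remainder (isOpen_phaseSpace b)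
    (contDiffOn_totalPhase b ω B t hω x p₀.2) hp₀
    (fderiv_totalPhase_eq_zero b ω B t hω p₀.2 hp₀ rfl)
    (phaseHessian_symm b ω B t hω p₀) (fderiv_totalPhase_apply b ω B t hω p₀.2 hp₀)
  obtain ⟨c, hc⟩ := exists_coords_phaseHessian b ω B t hω hB hp₀ hD
  obtain ⟨k₀, hk₀, hνle⟩ := hk
  have him0 : (totalPhase b ω B t x p₀.2 p₀).im = 0 := by
    rw [totalPhase_im, hx]
    simp
  obtain ⟨R, hR, hRr, hstat⟩ := stationary_phase (volume : Measure (Plane × Plane)) phaseBasis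
    (phaseHessian_symm b ω B t hω p₀) hc (fun p => by rw [phaseHessian_im]; positivity) hν hk₀ hνle
    hg hg3 hr fun p hp => by
      have h1 := congrArg Complex.im (hΨe p hp)
      rw [Complex.add_im, him0, zero_add, totalPhase_im] at h1
      rw [← h1]
      positivity
  refine ⟨R, hR, (Metric.ball_subset_ball hRr).trans hrV, fun f hf S hS hSR hf0 => ?_⟩
  have hSV : S ⊆ phaseSpace b := hSR.trans ((Metric.ball_subset_ball hRr).trans hrV)
  have hts : tsupport f ⊆ S := closure_minimal (fun p hp => by
    by_contra h
    exact hp (hf0 p h)) hS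
  have hfd : ContDiff ℝ (⊤ : ℕ∞) f :=
    contDiff_of_tsupport_subset (isOpen_phaseSpace b) hf (hts.trans hSV)
  have hfc : HasCompactSupport f := (isCompact_closedBall p₀ R).of_isClosed_subset
    (isClosed_tsupport f) ((hts.trans hSR).trans Metric.ball_subset_closedBall)
  refine ⟨fun α hα => ?_, ?_⟩
  · have h1 : ContDiff ℝ (⊤ : ℕ∞) fun p => wave b ω B t x p₀.2 α p * f p :=
      contDiff_of_tsupport_subset (isOpen_phaseSpace b)
        ((contDiffOn_wave b ω B t hω x p₀.2 α).mul hf)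
        ((tsupport_mul_subset_right (f := wave b ω B t x p₀.2 α)).trans (hts.trans hSV))
    exact h1.continuous.integrable_of_hasCompactSupport hfc.mul_left
  have hsub : ∀ p, p₀ + p ∈ S → p ∈ Metric.ball (0 : Plane × Plane) R := fun p hp => by
    have := hSR hp
    rw [mem_ball_iff_norm, add_sub_cancel_left] at this
    exact mem_ball_zero_iff.mpr this
  have htest : IsTestOn R fun p => f (p₀ + p) := by
    refine ⟨hfd.comp (contDiff_const.add contDiff_id), ?_⟩
    refine (closure_minimal (t := (fun p => p₀ + p) ⁻¹' S) (fun p hp => ?_)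
      (hS.preimage (by fun_prop))).trans fun p hp => hsub p hp
    by_contra h
    exact hp (hf0 _ h)
  obtain ⟨C, h₁, hh₁, hC⟩ := hstat _ htest
  refine ⟨C, h₁ ^ 2, by positivity, fun α hα hα1 => ?_⟩
  -- The semiclassical parameter is h = √α, and in dimension four the error h^{4+2} is α³.
  have h2 := hC (Real.sqrt α) (Real.sqrt_pos.mpr hα) (Real.sqrt_le_iff.mpr ⟨hh₁.le, hα1⟩)
  have hsq : ((Real.sqrt α : ℝ) : ℂ) ^ 2 = (α : ℂ) := by
    rw [← Complex.ofReal_pow, Real.sq_sqrt hα.le]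
  have hfin : Module.finrank ℝ (Plane × Plane) = 4 := by
    rw [Module.finrank_prod, finrank_euclideanSpace_fin]
  have hpow : Real.sqrt α ^ (4 + 2) = α ^ 3 := by
    rw [show 4 + 2 = 2 * 3 by norm_num, pow_mul, Real.sq_sqrt hα.le]
  rw [hfin, hpow] at h2
  simp only [hsq, add_zero] at h2
  have h3 : ∫ p, wave b ω B t x p₀.2 α p * f p = wave b ω B t x p₀.2 α p₀ *
      ∫ p, Complex.exp (Complex.I * ((1 / 2 : ℂ) * phaseHessian b ω B t p₀ p p + g p) / (α : ℂ)) *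
        f (p₀ + p) := by
    rw [← integral_add_left_eq_self (fun p => wave b ω B t x p₀.2 α p * f p) p₀,
      ← integral_const_mul]
    congr 1
    ext p
    by_cases hp : p₀ + p ∈ S
    · rw [← mul_assoc]
      congr 1
      rw [wave, wave, hΨe p (Metric.ball_subset_ball hRr (hsub p hp)), ← Complex.exp_add]
      congr 1
      ring
    · rw [hf0 _ hp, mul_zero, mul_zero, mul_zero]
  rw [h3, ← mul_sub, norm_mul]
  calc _ ≤ 1 * (C * α ^ 3) := mul_le_mul (norm_wave_le_one b ω t hB x p₀.2 hα p₀) h2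
        (norm_nonneg _) zero_le_one
    _ = _ := one_mul _

/-- A compact set that contains the positions at time `t` of interest. -/
theorem exists_compact_flow {b ω t : ℝ} {x : Plane} (hx : x ≠ 0) {K : Set Plane}
    (hK : IsCompact K) (hK0 : K ⊆ {0}ᶜ) :
    ∃ L, IsCompact L ∧ L ⊆ {0}ᶜ ∧ ∀ p : Plane × Plane, p.1 ∈ K →
      (‖x - flowX b ω t p.1 p.2‖ ≤ ‖x‖ / 2 ∨ Real.sin (ω * t) = 0) → flowX b ω t p.1 p.2 ∈ L := by
  have hball : Metric.closedBall x (‖x‖ / 2) ⊆ {0}ᶜ := fun z hz h => by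
    rw [Set.mem_singleton_iff.mp h, mem_closedBall_iff_norm, zero_sub, norm_neg] at hz
    linarith [norm_pos_iff.mpr hx]
  by_cases hs : Real.sin (ω * t) = 0
  · have hc : Real.cos (ω * t) ≠ 0 := fun h => by
      have := Real.sin_sq_add_cos_sq (ω * t)
      rw [hs, h] at this
      norm_num at this
    refine ⟨(fun y => Real.cos (ω * t) • y) '' K, hK.image (by fun_prop), ?_, fun p hp _ =>
      ⟨p.1, hp, by simp [flowX, hs]⟩⟩
    rintro _ ⟨y, hy, rfl⟩ h
    exact (smul_ne_zero hc (hK0 hy)) h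
  · refine ⟨Metric.closedBall x (‖x‖ / 2), isCompact_closedBall _ _, hball, fun p _ h => ?_⟩
    rw [mem_closedBall_iff_norm, norm_sub_rev]
    exact h.resolve_right hs

theorem continuousOn_norm_sub_flowX (b ω t : ℝ) (x : Plane) :
    ContinuousOn (fun p : Plane × Plane => ‖x - flowX b ω t p.1 p.2‖) {p | p.1 ≠ 0} :=
  (continuousOn_const.sub (contDiffOn_flowX b ω t).continuousOn).norm

/-- Smallness of `η - η₀` and `x - xᵗ` forces `(y, η)` to be near the stationary point. -/
theorem exists_localization {b ω t : ℝ} {p₀ : Plane × Plane} {K : Set Plane} (hK : IsCompact K)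
    (hK0 : K ⊆ {0}ᶜ)
    (huniq : ∀ y ∈ K, flowX b ω t p₀.1 p₀.2 = flowX b ω t y p₀.2 → y = p₀.1) {R : ℝ} (hR : 0 < R) :
    ∃ δ > 0, ∀ p : Plane × Plane, p.1 ∈ K → ‖p.2 - p₀.2‖ ≤ δ →
      ‖flowX b ω t p₀.1 p₀.2 - flowX b ω t p.1 p.2‖ ≤ δ → p ∈ Metric.ball p₀ R := by
  set x := flowX b ω t p₀.1 p₀.2 with hx
  set T : Set (Plane × Plane) := (K ×ˢ Metric.closedBall p₀.2 1) \ Metric.ball p₀ R with hT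
  have hTc : IsCompact T := (hK.prod (isCompact_closedBall _ _)).diff Metric.isOpen_ball
  set m : Plane × Plane → ℝ := fun p => ‖p.2 - p₀.2‖ + ‖x - flowX b ω t p.1 p.2‖ with hm
  have hmc : ContinuousOn m T := ContinuousOn.add (by fun_prop)
    ((continuousOn_norm_sub_flowX b ω t x).mono fun p hp => hK0 hp.1.1)
  rcases T.eq_empty_or_nonempty with hE | hE
  · refine ⟨1, one_pos, fun p hp h1 _ => ?_⟩
    by_contra h
    have : p ∈ T := ⟨⟨hp, mem_closedBall_iff_norm.mpr h1⟩, h⟩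
    rw [hE] at this
    exact this
  -- By compactness the minimum is attained on the part outside the ball. It is positive, since a
  -- zero would be a solution of x = xᵗ(y, η₀) in K, and hence the excluded stationary point.
  · obtain ⟨q, hq, hmin⟩ := hTc.exists_isMinOn hE hmc
    have hpos : 0 < m q := by
      refine lt_of_le_of_ne (by positivity) fun h => ?_
      have h1 : ‖q.2 - p₀.2‖ = 0 := by
        have := norm_nonneg (q.2 - p₀.2)
        have := norm_nonneg (x - flowX b ω t q.1 q.2)
        simp only [hm] at h
        linarith
      have h2 : ‖x - flowX b ω t q.1 q.2‖ = 0 := by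
        simp only [hm] at h
        linarith
      have h3 : q.2 = p₀.2 := sub_eq_zero.mp (norm_eq_zero.mp h1)
      have h4 := sub_eq_zero.mp (norm_eq_zero.mp h2)
      rw [h3] at h4
      have h5 : q = p₀ := Prod.ext (huniq q.1 hq.1.1 h4) h3
      exact hq.2 (by rw [h5]; exact Metric.mem_ball_self hR)
    -- Two terms of at most a third of the minimum cannot add up to it.
    refine ⟨min 1 (m q / 3), by positivity, fun p hp h1 h2 => ?_⟩
    by_contra h
    have hpT : p ∈ T :=
      ⟨⟨hp, mem_closedBall_iff_norm.mpr (h1.trans (min_le_left _ _))⟩, h⟩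
    have h3 : m q ≤ m p := hmin hpT
    have h4 := h1.trans (min_le_right _ _)
    have h5 := h2.trans (min_le_right _ _)
    simp only [hm] at h3 hpos h4 h5
    linarith

end ABOscillator

/-! ### The partition of the double integral. -/

namespace ABOscillator

open SymbolCalculus

/-- The set where the part of the integrand treated by integration by parts is supported. -/
def farRegion (b ω t : ℝ) (x η₀ : Plane) (O : Set Plane) (z δ R : ℝ) : Set (Plane × Plane) :=
  {p | p.1 ∈ O ∧ δ < ‖p.2 - η₀‖} ∩
    ((phaseSpace b ∩ (fun p => ‖x - flowX b ω t p.1 p.2‖) ⁻¹' Set.Iio z) ∪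
      (phaseSpace b ∩ {p | Real.sin (ω * t) = 0 ∧ R < ‖p.2 - η₀‖}))

theorem isOpen_farRegion (b ω t : ℝ) (x η₀ : Plane) {O : Set Plane} (hO : IsOpen O) (z δ R : ℝ) :
    IsOpen (farRegion b ω t x η₀ O z δ R) := by
  have h : IsOpen {p : Plane × Plane | δ < ‖p.2 - η₀‖} := isOpen_lt continuous_const (by fun_prop)
  refine ((hO.preimage continuous_fst).inter h).inter
    (((((continuousOn_norm_sub_flowX b ω t x).mono fun p hp => hp.1).isOpen_inter_preimage
      (isOpen_phaseSpace b) isOpen_Iio)).union ((isOpen_phaseSpace b).inter ?_))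
  by_cases hs : Real.sin (ω * t) = 0
  · simp only [hs, true_and]
    exact isOpen_lt continuous_const (by fun_prop)
  · simp [hs]

/-- Along the field the derivative of ψ is −|η − η₀|² with an error C|x − xᵗ||η − η₀|. The error is
at most half of the main term if xᵗ is within z of x, as Cz ≤ δ/2 < |η − η₀|/2. If sin ωt = 0, then
|x − xᵗ| ≤ Q, and |η − η₀| > R ≥ 2CQ serves the same purpose. -/
theorem isNonstationary_farRegion {b ω B t : ℝ} (x η₀ : Plane) {K L : Set Plane}
    (hK : IsCompact K) (hK0 : K ⊆ {0}ᶜ) (hL : IsCompact L) (hL0 : L ⊆ {0}ᶜ)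
    (hKL : ∀ p : Plane × Plane, p.1 ∈ K →
      (‖x - flowX b ω t p.1 p.2‖ ≤ ‖x‖ / 2 ∨ Real.sin (ω * t) = 0) → flowX b ω t p.1 p.2 ∈ L)
    {C : ℝ} (hC0 : 0 ≤ C) (hC : ∀ p : Plane × Plane, p.1 ∈ K → flowX b ω t p.1 p.2 ∈ L →
      ‖totalPhaseDeriv b ω B t x η₀ p (tangentField η₀ p) + ((‖p.2 - η₀‖ ^ 2 : ℝ) : ℂ)‖ ≤
        C * ‖x - flowX b ω t p.1 p.2‖ * ‖p.2 - η₀‖)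
    {Q : ℝ} (hQ : ∀ p : Plane × Plane, p.1 ∈ K → Real.sin (ω * t) = 0 →
      ‖x - flowX b ω t p.1 p.2‖ ≤ Q)
    {z δ R : ℝ} (hδ : 0 < δ) (hz : z ≤ ‖x‖ / 2) (hzδ : C * z ≤ δ / 2) (hR : C * Q ≤ R / 2) :
    IsNonstationary b ω B t x η₀ K L (farRegion b ω t x η₀ (interior K) z δ R) := by
  have hpK : ∀ p ∈ farRegion b ω t x η₀ (interior K) z δ R, p.1 ∈ K := fun p hp =>
    interior_subset hp.1.1
  have hpL : ∀ p ∈ farRegion b ω t x η₀ (interior K) z δ R, flowX b ω t p.1 p.2 ∈ L := by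
    intro p hp
    refine hKL p (hpK p hp) ?_
    rcases hp.2 with h | h
    · exact Or.inl ((le_of_lt h.2).trans hz)
    · exact Or.inr h.2.1
  refine ⟨⟨isOpen_farRegion b ω t x η₀ isOpen_interior z δ R, hK, hK0, hpK, hL, hL0, hpL⟩,
    fun p hp => hp.2.elim (fun h => h.1) (fun h => h.1), ?_⟩
  -- Chosen so that 1 + |η| ≤ A|η − η₀| whenever |η − η₀| > δ.
  set A := (1 + ‖η₀‖) / δ + 1 with hA
  have hA0 : 0 < A := by positivity
  refine ⟨1 / (2 * A ^ 2), by positivity, fun p hp => ?_⟩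
  set ζ := ‖p.2 - η₀‖ with hζ
  have hζδ : δ < ζ := hp.1.2
  have hζ0 : 0 < ζ := hδ.trans hζδ
  have h1 := hC p (hpK p hp) (hpL p hp)
  have h2 : C * ‖x - flowX b ω t p.1 p.2‖ ≤ ζ / 2 := by
    rcases hp.2 with h | h
    · have : C * ‖x - flowX b ω t p.1 p.2‖ ≤ C * z := by
        gcongr
        exact le_of_lt h.2
      linarith
    · have h3 : C * ‖x - flowX b ω t p.1 p.2‖ ≤ C * Q := by
        gcongr
        exact hQ p (hpK p hp) h.2.1
      have h4 : R < ζ := h.2.2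
      linarith
  have h3 : ζ ^ 2 / 2 ≤ ‖totalPhaseDeriv b ω B t x η₀ p (tangentField η₀ p)‖ := by
    have h4 : ‖((ζ ^ 2 : ℝ) : ℂ)‖ ≤ ‖totalPhaseDeriv b ω B t x η₀ p (tangentField η₀ p) +
        ((ζ ^ 2 : ℝ) : ℂ)‖ + ‖totalPhaseDeriv b ω B t x η₀ p (tangentField η₀ p)‖ := by
      refine le_trans (le_of_eq ?_) (norm_sub_le _ _)
      rw [add_sub_cancel_left]
    rw [Complex.norm_real, Real.norm_of_nonneg (sq_nonneg ζ)] at h4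
    have h5 : C * ‖x - flowX b ω t p.1 p.2‖ * ζ ≤ ζ / 2 * ζ := by gcongr
    nlinarith
  have h4 : 1 + ‖p.2‖ ≤ A * ζ := by
    have h5 : ‖p.2‖ ≤ ζ + ‖η₀‖ := by
      have := norm_add_le (p.2 - η₀) η₀
      rwa [sub_add_cancel] at this
    have h6 : 1 + ‖η₀‖ ≤ (1 + ‖η₀‖) / δ * ζ := by
      rw [div_mul_eq_mul_div, le_div_iff₀ hδ]
      gcongr
    rw [hA, add_mul]
    linarith
  calc 1 / (2 * A ^ 2) * (1 + ‖p.2‖) ^ 2 ≤ 1 / (2 * A ^ 2) * (A * ζ) ^ 2 := by gcongr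
    _ = ζ ^ 2 / 2 := by field_simp
    _ ≤ _ := h3

theorem IsLocalAmplitude.isModerate {b ω t : ℝ} {a : Plane × Plane → ℂ}
    (ha : IsLocalAmplitude b ω t a) {ρ : Plane → ℂ} (hρ : ContDiff ℝ (⊤ : ℕ∞) ρ)
    (hρc : HasCompactSupport ρ) (hρ0 : tsupport ρ ⊆ {0}ᶜ) :
    IsModerate b (tsupport ρ) {p | p.1 ∈ tsupport ρ} (fun p => a p * ρ p.1) := by
  obtain ⟨c, hc, M, hM⟩ := ha.bound (tsupport ρ) hρc hρ0
  obtain ⟨c', hc'⟩ := hρ.continuous.bounded_above_of_compact_support hρc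
  have hc'0 : 0 ≤ c' := (norm_nonneg _).trans (hc' 0)
  refine ⟨hρc, hρ0, fun p hp => hp,
    (ha.smooth.mul (hρ.comp contDiff_fst).contDiffOn).continuousOn, fun p hp => ?_,
    c * c', by positivity, M, fun p hpK hp => ?_⟩
  · rw [image_eq_zero_of_notMem_tsupport hp, mul_zero]
  · rw [norm_mul]
    calc _ ≤ c * (1 + ‖p.2‖) ^ M * c' :=
          mul_le_mul (hM p hp hpK) (hc' _) (norm_nonneg _) (by positivity)
      _ = _ := by ring

set_option maxHeartbeats 1000000 in
/-- The expansion of the oscillatory integral with a fixed amplitude. -/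
theorem exists_amplitude_expansion {b ω B t : ℝ} (hω : 0 < ω) (hB : 0 < B) {p₀ : Plane × Plane}
    (hp₀ : p₀ ∈ phaseSpace b) (hD : (flowXy b ω t p₀.1 p₀.2).det ≠ 0)
    {ν : Plane × Plane →L[ℝ] Plane × Plane →L[ℝ] ℝ} (hν : ∀ p v, ν p v = ν v p)
    (hk : ∃ k₀ > 0, ∀ p, k₀ * ‖p‖ ^ 2 ≤ ν p p)
    {a : Plane × Plane → ℂ} (ha : IsLocalAmplitude b ω t a)
    {ρ : Plane → ℂ} (hρ : ContDiff ℝ (⊤ : ℕ∞) ρ) (hρc : HasCompactSupport ρ)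
    (hρ0 : tsupport ρ ⊆ {0}ᶜ)
    (huniq : ∀ y ∈ tsupport ρ, flowX b ω t p₀.1 p₀.2 = flowX b ω t y p₀.2 → y = p₀.1) :
    ∃ J : ℝ → ℂ, (∃ C, ∃ α₁ > 0, ∀ α : ℝ, 0 < α → α ≤ α₁ →
      ‖J α - wave b ω B t (flowX b ω t p₀.1 p₀.2) p₀.2 α p₀ * (a p₀ * ρ p₀.1 *
        ∫ p, Complex.exp (Complex.I * ((1 / 2 : ℂ) * phaseHessian b ω B t p₀ p p) / (α : ℂ) -
          ((ν p p : ℝ) : ℂ)))‖ ≤ C * α ^ 3) ∧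
      ∀ α, 0 < α → ∀ χ : Plane → ℂ, ContDiff ℝ (⊤ : ℕ∞) χ → HasCompactSupport χ → χ 0 = 1 →
        Tendsto (fun δ : ℝ => ∫ p, wave b ω B t (flowX b ω t p₀.1 p₀.2) p₀.2 α p *
          (χ (δ • p.2) * (a p * ρ p.1))) (𝓝[>] 0) (𝓝 (J α)) := by
  set x := flowX b ω t p₀.1 p₀.2 with hx
  set η₀ := p₀.2 with hη₀
  set K := tsupport ρ with hKdef
  have hxne : x ≠ 0 := flowX_ne_zero b ω t hω _ _ hp₀
  have hKc : IsCompact K := hρc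
  -- Integration by parts needs an open set around the support of ρ; it is the interior of K', and
  -- K' is still compact and away from the origin.
  obtain ⟨K', hK'c, hKK', hK'0⟩ := exists_compact_between hKc isOpen_compl_singleton hρ0
  obtain ⟨L, hLc, hL0, hKL⟩ := exists_compact_flow (b := b) (ω := ω) (t := t) hxne hK'c hK'0
  obtain ⟨C, hC0, hC⟩ := exists_totalPhaseDeriv_tangentField b ω B t x η₀ hK'c hK'0 hLc hL0
  obtain ⟨Q, hQ⟩ : ∃ Q, ∀ p : Plane × Plane, p.1 ∈ K' → Real.sin (ω * t) = 0 →
      ‖x - flowX b ω t p.1 p.2‖ ≤ Q := by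
    obtain ⟨Q, hQ⟩ := hK'c.exists_bound_of_continuousOn
      (f := fun y => x - Real.cos (ω * t) • y) (by fun_prop)
    exact ⟨Q, fun p hp hs => by simpa [flowX, hs] using hQ p.1 hp⟩
  obtain ⟨r, hr, hrV, hstat⟩ := exists_stationary_ball hω hB hp₀ hD hν hk
  obtain ⟨δ, hδ, hloc⟩ := exists_localization hKc hρ0 huniq hr
  set z := min δ (min (‖x‖ / 4) (δ / (16 * (C + 1)))) with hzdef
  have hz : 0 < z := by
    have := norm_pos_iff.mpr hxne
    positivity
  have hzx : 2 * z ≤ ‖x‖ / 2 := by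
    have : z ≤ ‖x‖ / 4 := (min_le_right _ _).trans (min_le_left _ _)
    linarith
  have hzδ : z ≤ δ := min_le_left _ _
  have hzC : C * (2 * z) ≤ δ / 4 / 2 := by
    have h1 : z ≤ δ / (16 * (C + 1)) := (min_le_right _ _).trans (min_le_right _ _)
    rw [le_div_iff₀ (by positivity)] at h1
    nlinarith
  set R := 2 * (C * |Q|) + δ with hRdef
  have hRδ : δ ≤ R := by
    have : 0 ≤ C * |Q| := by positivity
    linarith
  have hR0 : 0 < R := hδ.trans_le hRδ
  have hRQ : C * Q ≤ R / 2 := by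
    have : C * Q ≤ C * |Q| := by gcongr; exact le_abs_self Q
    linarith
  -- The thresholds are weaker than those of the closed support `SB` below (z, δ/2 and 2R), so that
  -- U is an open neighbourhood of it up to the hypersurface y ∧ η = b.
  set U := farRegion b ω t x η₀ (interior K') (2 * z) (δ / 4) R with hU
  have hUn : IsNonstationary b ω B t x η₀ K' L U := isNonstationary_farRegion x η₀ hK'c hK'0 hLc
    hL0 hKL hC0 hC hQ (by positivity) hzx hzC hRQ
  let κ₁ : ContDiffBump (0 : Plane) := ⟨z / 2, z, by positivity, by linarith⟩
  let κ₂ : ContDiffBump η₀ := ⟨δ / 2, δ, by positivity, by linarith⟩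
  let κ₃ : ContDiffBump η₀ := ⟨2 * R, 3 * R, by positivity, by linarith⟩
  -- If sin ωt = 0, then x − xᵗ does not control η. In that case, and only then, the part with xᵗ
  -- away from x and large η is handed over to integration by parts.
  set e : ℂ := if Real.sin (ω * t) = 0 then 1 else 0 with he
  set k₁ : Plane → ℂ := fun y => ((κ₁ (x - y) : ℝ) : ℂ) with hk₁
  set k₂ : Plane → ℂ := fun η => ((κ₂ η : ℝ) : ℂ) with hk₂
  set k₃ : Plane → ℂ := fun η => ((κ₃ η : ℝ) : ℂ) with hk₃
  have hk₁d : ContDiff ℝ (⊤ : ℕ∞) k₁ := Complex.ofRealCLM.contDiff.comp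
    (κ₁.contDiff.comp (contDiff_const.sub contDiff_id))
  have hk₂d : ContDiff ℝ (⊤ : ℕ∞) k₂ := Complex.ofRealCLM.contDiff.comp κ₂.contDiff
  have hk₃d : ContDiff ℝ (⊤ : ℕ∞) k₃ := Complex.ofRealCLM.contDiff.comp κ₃.contDiff
  have hk₂c : HasCompactSupport k₂ := κ₂.hasCompactSupport.comp_left Complex.ofReal_zero
  have hk₃c : HasCompactSupport k₃ := κ₃.hasCompactSupport.comp_left Complex.ofReal_zero
  have hb : ∀ s : ℝ, 0 ≤ s → s ≤ 1 → ‖((s : ℝ) : ℂ)‖ ≤ 1 ∧ ‖1 - ((s : ℝ) : ℂ)‖ ≤ 1 := by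
    intro s h0 h1
    constructor
    · rw [Complex.norm_real, Real.norm_of_nonneg h0]
      exact h1
    · rw [← Complex.ofReal_one, ← Complex.ofReal_sub, Complex.norm_real,
        Real.norm_of_nonneg (by linarith)]
      linarith
  have hb₁ := fun y => hb (κ₁ (x - y)) κ₁.nonneg κ₁.le_one
  have hb₂ := fun η => hb (κ₂ η) κ₂.nonneg κ₂.le_one
  have hb₃ := fun η => hb (κ₃ η) κ₃.nonneg κ₃.le_one
  have hen : ‖e‖ ≤ 1 := by
    rw [he]
    split_ifs <;> simp
  have hk₁0 : ∀ y, z ≤ ‖x - y‖ → k₁ y = 0 := fun y hy => by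
    rw [hk₁]
    simp only
    rw [κ₁.zero_of_le_dist (by rwa [dist_zero_right]), Complex.ofReal_zero]
  have hk₁1 : ∀ y, ‖x - y‖ ≤ z / 2 → k₁ y = 1 := fun y hy => by
    rw [hk₁]
    simp only
    rw [κ₁.one_of_mem_closedBall (mem_closedBall_zero_iff.mpr hy), Complex.ofReal_one]
  have hk₂0 : ∀ η, δ ≤ ‖η - η₀‖ → k₂ η = 0 := fun η hη => by
    rw [hk₂]
    simp only
    rw [κ₂.zero_of_le_dist (by rwa [dist_eq_norm]), Complex.ofReal_zero]
  have hk₂1 : ∀ η, ‖η - η₀‖ ≤ δ / 2 → k₂ η = 1 := fun η hη => by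
    rw [hk₂]
    simp only
    rw [κ₂.one_of_mem_closedBall (mem_closedBall_iff_norm.mpr hη), Complex.ofReal_one]
  have hk₃0 : ∀ η, 3 * R ≤ ‖η - η₀‖ → k₃ η = 0 := fun η hη => by
    rw [hk₃]
    simp only
    rw [κ₃.zero_of_le_dist (by rwa [dist_eq_norm]), Complex.ofReal_zero]
  have hk₃1 : ∀ η, ‖η - η₀‖ ≤ 2 * R → k₃ η = 1 := fun η hη => by
    rw [hk₃]
    simp only
    rw [κ₃.one_of_mem_closedBall (mem_closedBall_iff_norm.mpr hη), Complex.ofReal_one]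
  set X : Plane × Plane → Plane := fun p => flowX b ω t p.1 p.2 with hX
  set w : Plane × Plane → ℂ := fun p => a p * ρ p.1 with hw
  -- gA + gB + gC = 1. Here k₁ localizes xᵗ near x, k₂ localizes η near η₀, and k₃ is a wide cut-off
  -- in η.
  set gA : Plane × Plane → ℂ := fun p => k₁ (X p) * k₂ p.2 with hgA
  set gB : Plane × Plane → ℂ := fun p => k₁ (X p) * (1 - k₂ p.2) +
    e * ((1 - k₁ (X p)) * (1 - k₃ p.2)) with hgB
  set gC : Plane × Plane → ℂ := fun p => (1 - k₁ (X p)) * (1 - e * (1 - k₃ p.2)) with hgC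
  have hXd : ContDiffOn ℝ (⊤ : ℕ∞) X (phaseSpace b) :=
    (contDiffOn_flowX b ω t).mono fun p hp => hp.1
  have hd₁ : ContDiffOn ℝ (⊤ : ℕ∞) (fun p => k₁ (X p)) (phaseSpace b) := hk₁d.comp_contDiffOn hXd
  have hd₂ : ContDiffOn ℝ (⊤ : ℕ∞) (fun p : Plane × Plane => k₂ p.2) (phaseSpace b) :=
    (hk₂d.comp contDiff_snd).contDiffOn
  have hd₃ : ContDiffOn ℝ (⊤ : ℕ∞) (fun p : Plane × Plane => k₃ p.2) (phaseSpace b) :=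
    (hk₃d.comp contDiff_snd).contDiffOn
  have hgAd : ContDiffOn ℝ (⊤ : ℕ∞) gA (phaseSpace b) := hd₁.mul hd₂
  have hgBd : ContDiffOn ℝ (⊤ : ℕ∞) gB (phaseSpace b) :=
    (hd₁.mul (contDiffOn_const.sub hd₂)).add (contDiffOn_const.mul
      ((contDiffOn_const.sub hd₁).mul (contDiffOn_const.sub hd₃)))
  have hgCd : ContDiffOn ℝ (⊤ : ℕ∞) gC (phaseSpace b) :=
    (contDiffOn_const.sub hd₁).mul (contDiffOn_const.sub (contDiffOn_const.mul
      (contDiffOn_const.sub hd₃)))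
  have hwd : ContDiffOn ℝ (⊤ : ℕ∞) w (phaseSpace b) :=
    ha.smooth.mul (hρ.comp contDiff_fst).contDiffOn
  have hgAn : ∀ p, ‖gA p‖ ≤ 1 := fun p => by
    rw [hgA, norm_mul]
    exact mul_le_one₀ (hb₁ _).1 (norm_nonneg _) (hb₂ _).1
  have hgBn : ∀ p, ‖gB p‖ ≤ 2 := fun p => by
    rw [hgB]
    refine (norm_add_le _ _).trans ?_
    rw [norm_mul, norm_mul, norm_mul]
    have h1 := mul_le_one₀ (hb₁ (X p)).1 (norm_nonneg _) (hb₂ p.2).2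
    have h2 := mul_le_one₀ hen (by positivity)
      (mul_le_one₀ (hb₁ (X p)).2 (norm_nonneg _) (hb₃ p.2).2)
    linarith
  have hgCn : ∀ p, ‖gC p‖ ≤ 2 := fun p => by
    rw [hgC, norm_mul]
    have h1 : ‖1 - e * (1 - k₃ p.2)‖ ≤ 1 + 1 := by
      refine (norm_sub_le _ _).trans (add_le_add (by simp) ?_)
      rw [norm_mul]
      exact mul_le_one₀ hen (norm_nonneg _) (hb₃ p.2).2
    calc _ ≤ 1 * (1 + 1) := mul_le_mul (hb₁ _).2 h1 (norm_nonneg _) zero_le_one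
      _ = 2 := by norm_num
  have hw0 : ∀ p, p.1 ∉ K → w p = 0 := fun p hp => by
    rw [hw]
    simp only
    rw [image_eq_zero_of_notMem_tsupport hp, mul_zero]
  have hwm : IsModerate b K {p | p.1 ∈ K} w := ha.isModerate hρ hρc hρ0
  have hmA : IsModerate b K {p | p.1 ∈ K} (fun p => gA p * w p) :=
    hwm.mul_bounded hgAd.continuousOn hgAn
  have hmB : IsModerate b K {p | p.1 ∈ K} (fun p => gB p * w p) :=
    hwm.mul_bounded hgBd.continuousOn hgBn
  have hmC : IsModerate b K {p | p.1 ∈ K} (fun p => gC p * w p) :=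
    hwm.mul_bounded hgCd.continuousOn hgCn
  have hclosed : ∀ T : Set ℝ, IsClosed T →
      IsClosed ({p : Plane × Plane | p.1 ∈ K} ∩ (fun p => ‖x - X p‖) ⁻¹' T) := fun T hT =>
    ((continuousOn_norm_sub_flowX b ω t x).mono
      fun p (hp : p.1 ∈ K) => hρ0 hp).preimage_isClosed_of_isClosed
      (hKc.isClosed.preimage continuous_fst) hT
  -- the part near the stationary point
  set SA : Set (Plane × Plane) := ({p : Plane × Plane | p.1 ∈ K} ∩
    (fun p => ‖x - X p‖) ⁻¹' Set.Iic z) ∩ {p | ‖p.2 - η₀‖ ≤ δ} with hSA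
  obtain ⟨hAint, CA, αA, hαA, hCA⟩ := hstat (fun p => gA p * w p) (hgAd.mul hwd) SA
    ((hclosed _ isClosed_Iic).inter (isClosed_le (by fun_prop) continuous_const))
    (fun p hp => hloc p hp.1.1 hp.2 (le_trans hp.1.2 hzδ)) (fun p hp => by
      by_cases h1 : p.1 ∈ K
      · by_cases h2 : ‖x - X p‖ ≤ z
        · have h3 : ¬ ‖p.2 - η₀‖ ≤ δ := fun h => hp ⟨⟨h1, h2⟩, h⟩
          simp only [hgA]
          rw [hk₂0 _ (not_le.mp h3).le, mul_zero, zero_mul]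
        · simp only [hgA]
          rw [hk₁0 _ (not_le.mp h2).le, zero_mul, zero_mul]
      · rw [hw0 p h1, mul_zero])
  have hA0 : gA p₀ * w p₀ = a p₀ * ρ p₀.1 := by
    have h1 : k₁ (X p₀) = 1 := hk₁1 _ (by
      change ‖x - x‖ ≤ z / 2
      rw [sub_self, norm_zero]
      positivity)
    have h2 : k₂ p₀.2 = 1 := hk₂1 _ (by
      rw [sub_self, norm_zero]
      positivity)
    rw [hgA]
    simp only
    rw [h1, h2, one_mul, one_mul]
  rw [hA0] at hCA
  -- the part away from the stationary trajectory
  set SC : Set (Plane × Plane) :=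
    {p | p.1 ∈ K ∧ (Real.sin (ω * t) = 0 → ‖p.2 - η₀‖ ≤ 3 * R)} with hSC
  have hmC' : IsModerate b K SC (fun p => gC p * w p) := hmC.of_subset (fun p hp => hp.1)
    fun p hp => by
      by_cases h1 : p.1 ∈ K
      · have h2 : Real.sin (ω * t) = 0 ∧ ¬ ‖p.2 - η₀‖ ≤ 3 * R := by
          by_contra h
          refine hp ⟨h1, fun hs => ?_⟩
          by_contra h'
          exact h ⟨hs, h'⟩
        simp only [hgC, he]
        rw [if_pos h2.1, hk₃0 _ (not_le.mp h2.2).le]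
        ring
      · rw [hw0 p h1, mul_zero]
  have hSCη : ∃ C, ∀ p ∈ SC, 1 + ‖p.2‖ ≤ C * (1 + ‖x - flowX b ω t p.1 p.2‖) := by
    by_cases hs : Real.sin (ω * t) = 0
    · refine ⟨1 + ‖η₀‖ + 3 * R, fun p hp => ?_⟩
      have h1 := hp.2 hs
      have h2 : ‖p.2‖ ≤ ‖p.2 - η₀‖ + ‖η₀‖ := by
        have := norm_add_le (p.2 - η₀) η₀
        rwa [sub_add_cancel] at this
      have h3 : 0 ≤ (1 + ‖η₀‖ + 3 * R) * ‖x - flowX b ω t p.1 p.2‖ := by positivity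
      linarith
    · obtain ⟨C', hC'⟩ := exists_norm_snd_le_of_sin_ne_zero (b := b) hω hs x hKc hρ0
      exact ⟨C', fun p hp => hC' p hp.1⟩
  obtain ⟨CC, hCC⟩ := hmC'.norm_integral_wave_le (B := B) (η₀ := η₀) hω hB hSCη (half_pos hz)
    fun p hp => by
      by_contra h
      apply hp
      simp only [hgC]
      rw [hk₁1 _ (not_le.mp h).le, sub_self, zero_mul, zero_mul]
  have hCint := fun α (hα : 0 < α) => hmC'.integrable_wave (B := B) (η₀ := η₀) hω hB hSCη hα
  -- the part where integration by parts applies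
  set SB : Set (Plane × Plane) := {p | δ / 2 ≤ ‖p.2 - η₀‖} ∩
    (({p : Plane × Plane | p.1 ∈ K} ∩ (fun p => ‖x - X p‖) ⁻¹' Set.Iic z) ∪
      {p | p.1 ∈ K ∧ Real.sin (ω * t) = 0 ∧ 2 * R ≤ ‖p.2 - η₀‖}) with hSB
  have hSBc : IsClosed SB := by
    refine (isClosed_le continuous_const (by fun_prop)).inter ((hclosed _ isClosed_Iic).union ?_)
    have h : IsClosed {p : Plane × Plane | Real.sin (ω * t) = 0 ∧ 2 * R ≤ ‖p.2 - η₀‖} := by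
      by_cases hs : Real.sin (ω * t) = 0
      · simp only [hs, true_and]
        exact isClosed_le continuous_const (by fun_prop)
      · simp [hs]
    exact (hKc.isClosed.preimage continuous_fst).inter h
  have hSBK : ∀ p ∈ SB, p.1 ∈ K := fun p hp => hp.2.elim (fun h => h.1) (fun h => h.1)
  have hSBU : ∀ p ∈ SB, wedge p.1 p.2 ≠ b → p ∈ U := fun p hp hpw => by
    have hps : p ∈ phaseSpace b := mem_phaseSpace_of_fst_mem hρ0 (hSBK p hp) hpw
    have h1 : δ / 2 ≤ ‖p.2 - η₀‖ := hp.1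
    refine ⟨⟨hKK' (hSBK p hp), by linarith⟩, ?_⟩
    rcases hp.2 with h | h
    · refine Or.inl ⟨hps, ?_⟩
      have h2 : ‖x - X p‖ ≤ z := h.2
      have h3 : ‖x - flowX b ω t p.1 p.2‖ < 2 * z := lt_of_le_of_lt h2 (by linarith)
      exact h3
    · exact Or.inr ⟨hps, h.2.1, lt_of_lt_of_le (by linarith) h.2.2⟩
  have hSB0 : ∀ p ∉ SB, gB p * w p = 0 := fun p hp => by
    by_cases h1 : p.1 ∈ K
    · have hg0 : gB p = 0 := by
        simp only [hgB]
        by_cases h2 : δ / 2 ≤ ‖p.2 - η₀‖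
        · have h3 : ¬ ‖x - X p‖ ≤ z := fun h => hp ⟨h2, Or.inl ⟨h1, h⟩⟩
          rw [hk₁0 _ (not_le.mp h3).le, zero_mul, zero_add]
          by_cases hs : Real.sin (ω * t) = 0
          · have h4 : ¬ 2 * R ≤ ‖p.2 - η₀‖ := fun h => hp ⟨h2, Or.inr ⟨h1, hs, h⟩⟩
            rw [hk₃1 _ (not_le.mp h4).le, sub_self, mul_zero, mul_zero]
          · rw [he, if_neg hs, zero_mul]
        · have h3 : ‖p.2 - η₀‖ ≤ δ / 2 := (not_le.mp h2).le
          rw [hk₂1 _ h3, hk₃1 _ (by linarith)]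
          ring
      rw [hg0, zero_mul]
    · rw [hw0 p h1, mul_zero]
  obtain ⟨M, hM⟩ := ha.symbol K' L U hUn.toIsRegion hUn.subset
  have hreg := hUn.toIsRegion
  have hc : ∀ z : ℂ, IsSymbol U (fun (_ : Unit) _ => 1) (fun _ _ => 1)
      (fun _ (_ : Plane × Plane) => z) := fun z =>
    IsSymbol.const (fun _ _ _ => one_pos) (fun _ => z) ⟨_, fun _ => le_rfl⟩
  have hsub : ∀ {f g : Unit → Plane × Plane → ℂ},
      IsSymbol U (fun (_ : Unit) _ => 1) (fun _ _ => 1) f →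
      IsSymbol U (fun (_ : Unit) _ => 1) (fun _ _ => 1) g →
      IsSymbol U (fun (_ : Unit) _ => 1) (fun _ _ => 1) (fun i p => f i p - g i p) :=
    fun hf hg => hf.sub hUn.isOpen (fun _ _ _ => one_pos) (fun _ _ _ => zero_le_one) hg
  have hs₁ := hreg.comp_flowX (P := Unit) (F := k₁) hk₁d.contDiffOn
  have hs₂ := hreg.comp_snd (P := Unit) hk₂d hk₂c
  have hs₃ := hreg.comp_snd (P := Unit) hk₃d hk₃c
  have hsB : IsSymbol U (fun (_ : Unit) _ => 1) (fun _ _ => 1) (fun _ => gB) :=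
    (hreg.mul_one_one hs₁ (hsub (hc 1) hs₂)).add hUn.isOpen
      (hreg.mul_one_one (hc e) (hreg.mul_one_one (hsub (hc 1) hs₁) (hsub (hc 1) hs₃)))
  have hsBw : IsSymbol U (fun (_ : Unit) _ => 1) (fun _ p => (1 + ‖p.2‖) ^ M)
      (fun _ p => gB p * w p) := by
    have hpos : ∀ (_ : Unit), ∀ p ∈ U, (0 : ℝ) ≤ (1 + ‖p.2‖) ^ M := fun _ p _ => by positivity
    have h1 := hreg.mul_one_left hpos (hreg.comp_fst (P := Unit) (F := ρ) hρ.contDiffOn) hM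
    refine (hreg.mul_one_left hpos hsB h1).congr hUn.isOpen fun _ p _ => ?_
    simp only [hw]
    ring
  obtain ⟨JB, ⟨CB, hCB⟩, hJB⟩ := hUn.exists_oscillatory hω hB
    ((hgBd.mul hwd).mono hUn.subset) hsBw hSBc hSBU
    (fun p hp => interior_subset (hKK' (hSBK p hp))) hSB0
  refine ⟨fun α => (∫ p, wave b ω B t x η₀ α p * (gA p * w p)) + JB α +
    ∫ p, wave b ω B t x η₀ α p * (gC p * w p), ⟨CA + CB + CC, min αA 1, by positivity,
      fun α hα hα1 => ?_⟩, fun α hα χ hχ hχc hχ0 => ?_⟩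
  · have h1 := hCA α hα (hα1.trans (min_le_left _ _))
    have h2 := hCB α hα (hα1.trans (min_le_right _ _))
    have h3 := hCC α hα (hα1.trans (min_le_right _ _))
    rw [add_sub_right_comm, add_sub_right_comm]
    refine (norm_add_le _ _).trans ((add_le_add ((norm_add_le _ _).trans (add_le_add h1 h2))
      h3).trans_eq ?_)
    ring
  · have hTA := tendsto_integral_cutoff (hAint α hα) hχ.continuous hχc hχ0
    have hTB := hJB α hα χ hχ hχc hχ0
    have hTC := tendsto_integral_cutoff (hCint α hα) hχ.continuous hχc hχ0
    refine ((hTA.add hTB).add hTC).congr' ?_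
    filter_upwards [self_mem_nhdsWithin] with δ' hδ'
    have hδ'0 : 0 < δ' := hδ'
    have iA := hmA.integrable_cutoff (ω := ω) (t := t) (x := x) (η₀ := η₀) hω hB hα hχ.continuous
      hχc hδ'0
    have iB := hmB.integrable_cutoff (ω := ω) (t := t) (x := x) (η₀ := η₀) hω hB hα hχ.continuous
      hχc hδ'0
    have iC := hmC.integrable_cutoff (ω := ω) (t := t) (x := x) (η₀ := η₀) hω hB hα hχ.continuous
      hχc hδ'0
    rw [← integral_add iA iB, ← integral_add (iA.fun_add iB) iC]
    congr 1
    ext p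
    simp only [hgA, hgB, hgC, hw]
    ring

end ABOscillator

/-! ### Summation over the powers of α and the conclusion. -/

namespace ABOscillator

/-- The coefficient of `αᵏ` in the full amplitude. -/
noncomputable def amplitudeTerm (b ω B ε : ℝ) (θ : Plane → ℝ) (u : ℕ → ℝ → Plane → Plane → ℂ)
    (t : ℝ) (k : ℕ) (p : Plane × Plane) : ℂ :=
  if k = 0 then leadingAmplitude b ω B ε θ t p.1 p.2 else u k t p.1 p.2

theorem sum_amplitudeTerm (b ω B ε : ℝ) (θ : Plane → ℝ) (N : ℕ)
    (u : ℕ → ℝ → Plane → Plane → ℂ) (α t : ℝ) (p : Plane × Plane) :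
    amplitude b ω B ε θ N u α t p.1 p.2 =
      ∑ k ∈ Finset.range (N + 1), (α : ℂ) ^ k * amplitudeTerm b ω B ε θ u t k p := by
  rw [Finset.range_eq_Ico, Finset.sum_eq_sum_Ico_succ_bot (Nat.succ_pos N), amplitude]
  congr 1
  · simp [amplitudeTerm]
  · refine Finset.sum_congr ?_ fun k hk => ?_
    · ext k
      simp only [Finset.mem_Icc, Finset.mem_Ico]
      lia
    · rw [amplitudeTerm, if_neg]
      have := (Finset.mem_Icc.mp hk).1
      lia

theorem isLocalAmplitude_amplitudeTerm {b ω B ε t : ℝ} (hω : 0 < ω) (hB : 0 < B) (hε : 0 < ε)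
    (ht : 0 ≤ t) {θ : Plane → ℝ} (hθ : IsCutoff θ) {N : ℕ} {u : ℕ → ℝ → Plane → Plane → ℂ}
    (hu : ∀ k ∈ Finset.Icc 1 N, IsAmplitude b (u k t)) {k : ℕ} (hk : k ∈ Finset.range (N + 1)) :
    IsLocalAmplitude b ω t (amplitudeTerm b ω B ε θ u t k) := by
  rcases Nat.eq_zero_or_pos k with h | h
  · subst h
    exact isLocalAmplitude_leadingAmplitude hω hB hε ht hθ
  · have h1 := (hu k (Finset.mem_Icc.mpr ⟨h, Nat.lt_succ_iff.mp (Finset.mem_range.mp hk)⟩))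
    have h2 : amplitudeTerm b ω B ε θ u t k = fun p => u k t p.1 p.2 := by
      ext p
      rw [amplitudeTerm, if_neg h.ne']
    rw [h2]
    exact h1.isLocalAmplitude ω t

theorem kernelIntegrand_mul_oscillatingData (b ω B ε : ℝ) (θ : Plane → ℝ) (N : ℕ)
    (u : ℕ → ℝ → Plane → Plane → ℂ) (α t : ℝ) (x η₀ : Plane) (ρ : Plane → ℂ) (p : Plane × Plane) :
    kernelIntegrand b ω B ε θ N u α t x p.1 p.2 * oscillatingData ρ η₀ α p.1 =
      ∑ k ∈ Finset.range (N + 1), ((((2 * Real.pi * α) ^ 2)⁻¹ : ℝ) : ℂ) * (α : ℂ) ^ k *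
        (wave b ω B t x η₀ α p * (amplitudeTerm b ω B ε θ u t k p * ρ p.1)) := by
  have hW : wave b ω B t x η₀ α p =
      Complex.exp (Complex.I * phase b ω B t x p.1 p.2 / (α : ℂ)) *
        Complex.exp (Complex.I * ((inner ℝ p.1 η₀ / α : ℝ) : ℂ)) := by
    rw [wave, totalPhase, ← Complex.exp_add]
    push_cast
    congr 1
    ring
  rw [kernelIntegrand, oscillatingData, sum_amplitudeTerm, hW, Finset.mul_sum, Finset.sum_mul]
  refine Finset.sum_congr rfl fun k _ => ?_
  ring

theorem wave_self (b ω B t : ℝ) (α : ℝ) (p : Plane × Plane) :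
    wave b ω B t (flowX b ω t p.1 p.2) p.2 α p =
      Complex.exp (Complex.I * (((inner ℝ p.1 p.2 + action b ω t p.1 p.2) / α : ℝ) : ℂ)) := by
  rw [wave, totalPhase, phase, sub_self]
  simp only [inner_zero_left, norm_zero]
  push_cast
  congr 1
  ring

theorem exists_test_function :
    ∃ χ : Plane → ℂ, ContDiff ℝ (⊤ : ℕ∞) χ ∧ HasCompactSupport χ ∧ χ 0 = 1 := by
  let κ : ContDiffBump (0 : Plane) := ⟨1, 2, one_pos, one_lt_two⟩
  refine ⟨fun η => ((κ η : ℝ) : ℂ), Complex.ofRealCLM.contDiff.comp κ.contDiff,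
    κ.hasCompactSupport.comp_left Complex.ofReal_zero, ?_⟩
  change ((κ 0 : ℝ) : ℂ) = 1
  rw [κ.one_of_mem_closedBall (Metric.mem_closedBall_self zero_le_one), Complex.ofReal_one]

/-- The iterated integral with a cut-off as a sum of double integrals. -/
theorem integral_integral_cutoff {ι : Type*} (s : Finset ι) {F : Plane → Plane → ℂ}
    {f : ι → Plane × Plane → ℂ} {c : ι → ℂ} {W : Plane × Plane → ℂ}
    (hF : ∀ p, F p.1 p.2 = ∑ k ∈ s, c k * (W p * f k p)) {κ : Plane → ℂ}
    (hf : ∀ k ∈ s, Integrable fun p => W p * (κ p.2 * f k p)) :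
    Integrable (fun p : Plane × Plane => κ p.2 * F p.1 p.2) ∧
      ∫ y, ∫ η, κ η * F y η = ∑ k ∈ s, c k * ∫ p, W p * (κ p.2 * f k p) := by
  have he : (fun p : Plane × Plane => κ p.2 * F p.1 p.2) =
      fun p => ∑ k ∈ s, c k * (W p * (κ p.2 * f k p)) := by
    ext p
    rw [hF, Finset.mul_sum]
    refine Finset.sum_congr rfl fun k _ => ?_
    ring
  have hi : Integrable (fun p : Plane × Plane => κ p.2 * F p.1 p.2) := by
    rw [he]
    exact integrable_finsetSum s fun k hk => (hf k hk).const_mul (c k)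
  refine ⟨hi, ?_⟩
  rw [Measure.volume_eq_prod] at hi
  rw [← integral_prod _ hi, ← Measure.volume_eq_prod, he,
    integral_finsetSum s fun k hk => (hf k hk).const_mul (c k)]
  exact Finset.sum_congr rfl fun k _ => integral_const_mul _ _

/-- The leading term of a finite sum of expansions. -/
theorem isBigO_sum_expansion {N : ℕ} {J : ℕ → ℝ → ℂ} {a : ℕ → ℂ} {r s E : ℂ} {W G : ℝ → ℂ}
    (hJ : ∀ k ∈ Finset.range (N + 1), ∃ C, ∃ α₁ > 0, ∀ α : ℝ, 0 < α → α ≤ α₁ →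
      ‖J k α - W α * (a k * r * G α)‖ ≤ C * α ^ 3)
    (hW : ∀ α, 0 < α → ‖W α‖ ≤ 1) (hs : s ≠ 0) (ha : a 0 = s)
    (hG : (fun α : ℝ => s * (((((2 * Real.pi * α) ^ 2)⁻¹ : ℝ) : ℂ) * G α) - E)
      =O[𝓝[>] 0] (fun α : ℝ => α)) :
    (fun α : ℝ => (∑ k ∈ Finset.range (N + 1),
      ((((2 * Real.pi * α) ^ 2)⁻¹ : ℝ) : ℂ) * (α : ℂ) ^ k * J k α) - r * W α * E)
      =O[𝓝[>] 0] (fun α : ℝ => α) := by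
  set c : ℝ → ℂ := fun α => ((((2 * Real.pi * α) ^ 2)⁻¹ : ℝ) : ℂ) with hc
  have hsmall : ∀ δ : ℝ, 0 < δ → ∀ᶠ α in 𝓝[>] (0 : ℝ), 0 < α ∧ α ≤ δ := fun δ hδ =>
    Ioc_mem_nhdsGT hδ
  have hid : (fun α : ℝ => α) =O[𝓝[>] 0] (fun _ : ℝ => (1 : ℝ)) := by
    refine IsBigO.of_bound 1 ?_
    filter_upwards [hsmall 1 one_pos] with α hα
    rw [Real.norm_of_nonneg hα.1.le, norm_one]
    linarith [hα.2]
  have hW1 : W =O[𝓝[>] 0] (fun _ : ℝ => (1 : ℝ)) := by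
    refine IsBigO.of_bound 1 ?_
    filter_upwards [self_mem_nhdsWithin] with α hα
    rw [norm_one, mul_one]
    exact hW α hα
  have hpow : ∀ k : ℕ, (fun α : ℝ => (α : ℂ) ^ k) =O[𝓝[>] 0] (fun _ : ℝ => (1 : ℝ)) := fun k => by
    refine IsBigO.of_bound 1 ?_
    filter_upwards [hsmall 1 one_pos] with α hα
    rw [norm_pow, Complex.norm_real, Real.norm_of_nonneg hα.1.le, norm_one, mul_one]
    exact pow_le_one₀ hα.1.le hα.2
  -- The normalized Gaussian is bounded, since s times it converges and s ≠ 0; hence the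
  -- coefficients with k ≥ 1 contribute only O(αᵏ).
  have hcG : (fun α => c α * G α) =O[𝓝[>] 0] (fun _ : ℝ => (1 : ℝ)) := by
    have h1 := ((hG.trans hid).add (isBigO_const_const E one_ne_zero (𝓝[>] (0 : ℝ)))).const_mul_left
      s⁻¹
    refine h1.congr_left fun α => ?_
    simp only [hc]
    field_simp
    ring
  have hrem : ∀ k ∈ Finset.range (N + 1),
      (fun α => c α * (α : ℂ) ^ k * (J k α - W α * (a k * r * G α))) =O[𝓝[>] 0]
        (fun α : ℝ => α) := by
    intro k hk
    obtain ⟨C, α₁, hα₁, hC⟩ := hJ k hk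
    -- The error O(α³) of the expansion, divided by (2πα)², leaves O(α).
    have h1 : (fun α => c α * (J k α - W α * (a k * r * G α))) =O[𝓝[>] 0]
        (fun α : ℝ => α) := by
      refine IsBigO.of_bound (((2 * Real.pi) ^ 2)⁻¹ * C) ?_
      filter_upwards [hsmall α₁ hα₁] with α hα
      have hα0 := hα.1
      rw [norm_mul, hc, Complex.norm_real, Real.norm_of_nonneg (by positivity),
        Real.norm_of_nonneg hα0.le]
      calc _ ≤ ((2 * Real.pi * α) ^ 2)⁻¹ * (C * α ^ 3) := by
            gcongr
            exact hC α hα0 hα.2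
        _ = _ := by field_simp
    refine (((hpow k).mul h1).congr_left fun α => ?_).congr_right fun α => one_mul _
    ring
  have hmain : (fun α => W α * r * (s * (c α * G α) - E)) =O[𝓝[>] 0] (fun α : ℝ => α) :=
    ((hW1.mul (isBigO_const_const r one_ne_zero _)).mul hG).congr_right fun α => by ring
  have hhigh : ∀ k : ℕ, (fun α : ℝ => (α : ℂ) ^ (k + 1) * (W α * (a (k + 1) * r)) * (c α * G α))
      =O[𝓝[>] 0] (fun α : ℝ => α) := by
    intro k
    have h1 : (fun α : ℝ => (α : ℂ)) =O[𝓝[>] 0] (fun α : ℝ => α) :=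
      IsBigO.of_bound 1 (Eventually.of_forall fun α => by simp)
    have h2 := ((h1.mul (hpow k)).mul (hW1.mul (isBigO_const_const (a (k + 1) * r) one_ne_zero
      (𝓝[>] (0 : ℝ))))).mul hcG
    refine (h2.congr_left fun α => ?_).congr_right fun α => ?_
    · ring
    · ring
  have htot := ((IsBigO.sum hrem).add hmain).add
    (IsBigO.sum (s := Finset.range N) fun k _ => hhigh k)
  refine htot.congr_left fun α => ?_
  simp only [Finset.sum_apply, mul_sub]
  rw [Finset.sum_sub_distrib, Finset.sum_range_succ' (fun k => c α * (α : ℂ) ^ k *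
      (W α * (a k * r * G α)))]
  have h3 : ∑ k ∈ Finset.range N, c α * (α : ℂ) ^ (k + 1) * (W α * (a (k + 1) * r * G α)) =
      ∑ k ∈ Finset.range N, (α : ℂ) ^ (k + 1) * (W α * (a (k + 1) * r)) * (c α * G α) :=
    Finset.sum_congr rfl fun k _ => by ring
  rw [h3, ha]
  ring

end ABOscillator

open ABOscillator in
theorem mainTheorem3
    (b ω B ε t : ℝ) (hω : 0 < ω) (hB : 0 < B) (hε : 0 < ε) (ht : 0 ≤ t)
    (θ : Plane → ℝ) (hθ : IsCutoff θ)
    (N : ℕ) (u : ℕ → ℝ → Plane → Plane → ℂ)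
    (hu : ∀ k ∈ Finset.Icc 1 N, IsAmplitude b (u k t))
    (x y₀ η₀ : Plane) (hy₀ : (y₀, η₀) ∈ phaseSpace b)
    (hx : x = flowX b ω t y₀ η₀)
    (hdet : (flowXy b ω t y₀ η₀).det ≠ 0)
    (hεx : scaledCutoff θ ε x = 1) (hεy : scaledCutoff θ ε y₀ = 1)
    (ρ : Plane → ℂ) (hρ : ContDiff ℝ (⊤ : ℕ∞) ρ) (hρc : HasCompactSupport ρ)
    (hρs : tsupport ρ ⊆ ({0} ∪ {y : Plane | wedge y η₀ = b})ᶜ)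
    (huniq : ∀ y ∈ tsupport ρ, x = flowX b ω t y η₀ → y = y₀) :
    ∃ J : ℝ → ℂ,
      (∀ α : ℝ, 0 < α →
        IsOscillatoryIntegral
          (fun y η => kernelIntegrand b ω B ε θ N u α t x y η * oscillatingData ρ η₀ α y)
          (J α)) ∧
      (Real.sin (ω * t) ≠ 0 → ∀ α : ℝ, 0 < α →
        Integrable (fun p : Plane × Plane =>
          kernelIntegrand b ω B ε θ N u α t x p.1 p.2 * oscillatingData ρ η₀ α p.1) ∧
        J α = ∫ y, kernel b ω B ε θ N u α t x y * oscillatingData ρ η₀ α y) ∧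
      (fun α : ℝ => J α -
          ρ y₀ * Complex.exp (Complex.I * (((inner ℝ y₀ η₀ + action b ω t y₀ η₀) / α : ℝ) : ℂ)) *
            Complex.exp (-(Complex.I * (Real.pi : ℂ) * (morseIndex b ω t y₀ η₀ : ℂ) / 2)) *
            ((|Real.cos (ω * t) ^ 2 - b ^ 2 / ω ^ 2 * (‖y₀‖ ^ 4)⁻¹ * Real.sin (ω * t) ^ 2| ^
              (-(1 / 2) : ℝ) : ℝ) : ℂ))
        =O[𝓝[>] 0] (fun α : ℝ => α) := by
  have hρ0 : tsupport ρ ⊆ {0}ᶜ := fun y hy h => hρs hy (Or.inl h)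
  obtain ⟨ν, hν, hk, hG⟩ := exists_regularized_gaussian hω hB ht hy₀ hdet
  have ha : ∀ k ∈ Finset.range (N + 1),
      IsLocalAmplitude b ω t (amplitudeTerm b ω B ε θ u t k) := fun k hk =>
    isLocalAmplitude_amplitudeTerm hω hB hε ht hθ hu hk
  have hm := fun k hk => (ha k hk).isModerate hρ hρc hρ0
  choose! J hJ hJlim using fun k (hk' : k ∈ Finset.range (N + 1)) =>
    -- The same damping ν serves all coefficients, so a single Gaussian integral appears in every
    -- expansion.
    exists_amplitude_expansion hω hB hy₀ hdet hν hk (ha k hk') hρ hρc hρ0 (hx ▸ huniq)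
  rw [← hx] at hJ hJlim
  have hF := fun α => kernelIntegrand_mul_oscillatingData b ω B ε θ N u α t x η₀ ρ
  refine ⟨fun α => ∑ k ∈ Finset.range (N + 1),
    ((((2 * Real.pi * α) ^ 2)⁻¹ : ℝ) : ℂ) * (α : ℂ) ^ k * J k α, fun α hα => ?_,
    fun hs α hα => ?_, ?_⟩
  · intro χ hχ hχc hχ0
    refine (tendsto_finsetSum _ fun k hk' =>
      (hJlim k hk' α hα χ hχ hχc hχ0).const_mul _).congr' ?_
    filter_upwards [self_mem_nhdsWithin] with δ hδ
    exact (integral_integral_cutoff (κ := fun η => χ (δ • η)) _ (hF α) fun k hk' =>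
      (hm k hk').integrable_cutoff hω hB hα hχ.continuous hχc hδ).2.symm
  · obtain ⟨C, hC⟩ := exists_norm_snd_le_of_sin_ne_zero (b := b) hω hs x hρc hρ0
    have hint : ∀ k ∈ Finset.range (N + 1), Integrable fun p : Plane × Plane =>
        wave b ω B t x η₀ α p * (amplitudeTerm b ω B ε θ u t k p * ρ p.1) := fun k hk' =>
      (hm k hk').integrable_wave hω hB ⟨C, fun p hp => hC p hp⟩ hα
    have hJeq : ∀ k ∈ Finset.range (N + 1), J k α = ∫ p : Plane × Plane,
        wave b ω B t x η₀ α p * (amplitudeTerm b ω B ε θ u t k p * ρ p.1) := by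
      intro k hk'
      -- Any single test function identifies the oscillatory value with the ordinary integral, by
      -- uniqueness of limits.
      obtain ⟨χ, hχ, hχc, hχ0⟩ := exists_test_function
      exact tendsto_nhds_unique (hJlim k hk' α hα χ hχ hχc hχ0)
        (tendsto_integral_cutoff (hint k hk') hχ.continuous hχc hχ0)
    have h := integral_integral_cutoff (κ := fun _ => 1)
      (F := fun y η => kernelIntegrand b ω B ε θ N u α t x y η * oscillatingData ρ η₀ α y)
      (c := fun k => ((((2 * Real.pi * α) ^ 2)⁻¹ : ℝ) : ℂ) * (α : ℂ) ^ k)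
      (Finset.range (N + 1)) (hF α)
      fun k hk' => by simpa only [one_mul] using hint k hk'
    simp only [one_mul] at h
    refine ⟨h.1, ?_⟩
    refine (Finset.sum_congr rfl fun k hk' => congrArg _ (hJeq k hk')).trans (h.2.symm.trans ?_)
    exact integral_congr_ae (Eventually.of_forall fun y => integral_mul_const _ _)
  · have hs0 : sqrtDetZ b ω B t y₀ η₀ ≠ 0 := by
      rw [sqrtDetZ_eq hω hB b ht hy₀]
      exact sqrtZ_ne_zero hω hB _ _
    have ha0 : amplitudeTerm b ω B ε θ u t 0 (y₀, η₀) = sqrtDetZ b ω B t y₀ η₀ := by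
      rw [amplitudeTerm, if_pos rfl, leadingAmplitude, ← hx, hεx, hεy]
      simp
    have h := isBigO_sum_expansion hJ
      (fun α hα => norm_wave_le_one b ω t hB x η₀ hα (y₀, η₀)) hs0 ha0 hG
    refine h.congr_left fun α => ?_
    rw [hx, wave_self b ω B t α (y₀, η₀)]
    ring
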